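/- **Conventions.** Let $\mathbb K$ be a field. Everything is graded by $\mathbb Z$ or by $\mathbb Z/2$ (more generally by a commutative ring of degrees on which the signs $(-1)^e$ make sense), and all signs follow the Koszul rule. $A_\infty$-algebras are strictly unital over $\mathbb K$; $\mathcal B A=\bigoplus_{n\ge 0}(sA)^{\otimes n}$ is the bar coalgebra with its differential and its length filtration. A *labelled set* $\mathfrak s=(S^+,S^-,\kappa)$ is a finite set $S^+\sqcup S^-$ together with an $A_\infty$-algebra $\kappa(x)$ for every element $x$ (and an enumeration of the set, used only to order tensor factors); $\mathfrak s^*=(S^-,S^+,\kappa)$; morphisms are injections preserving signs and labels. Put $\mathcal B A_{\mathfrak s}=\bigotimes_{x}\mathcal B\kappa(x)$. An *$\mathfrak s$-polymodule* is a graded vector space $P$ with a degree one map $\mu_P:\mathcal B A_{\mathfrak s}\otimes P\to P$ (factors in $S^+$ acting from the left, those in $S^-$ from the right) such that the induced differential on the bar construction $\mathcal B A_{\mathfrak s}\otimes P$ squares to zero and such that the units act strictly: $\mu_P(e;p)=p$ on the left, $\mu_P(p;e)=-(-1)^{|p|}p$ on the right, and $\mu_P$ vanishes on every word of total length $\ne1$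 that contains a unit. A morphism $P\to P'$ of degree $k$ in $\mathfrak s\text{-}\mathrm{Mod}_\infty$ is any linear map $\varphi:\mathcal B A_{\mathfrak s}\otimes P\to P'$ of degree $k$, composed as a comodule map of bar constructions, with differential $\varphi\mapsto b'\varphi-(-1)^k\varphi b$; it is *strict* if it vanishes on all words of positive length. **Tensor product and internal Hom.** For morphisms $i_1:\mathfrak s_0\to\mathfrak s_1^*$ and $i_2:\mathfrak s_0\to\mathfrak s_2$, the tensor product $P_1\otimes_{\mathfrak s_0}P_2=P_1\otimes\mathcal B A_{\mathfrak s_0}\otimes P_2$ (with the twisted differential) has labels $\mathfrak s_1\sharp_{\mathfrak s_0}\mathfrak s_2=(\mathfrak s_1-\mathfrak s_0)\sqcup(\mathfrak s_2-\mathfrak s_0)$. For morphisms $i_1:\mathfrak s_0\to\mathfrak s_1$ and $i_2:\mathfrak s_0\to\mathfrak s_2$, the internal Hom $\mathcal Hom_{\mathfrak s_0}(P_1,P_2)$ is the graded vector space of maps $\mathcal B A_{\mathfrak s_0}\otimes P_1\to P_2$ (finite sums of homogeneous ones), with labels $(\mathfrak s_1-\mathfrak s_0)^*\sqcup(\mathfrak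 s_2-\mathfrak s_0)$. Its structure map is postcomposition with $\mu_{P_2}$ minus (Koszul signed) precomposition with $\mu_{P_1}$ and with the differential of $\mathcal BA_{\mathfrak s_0}$. Both constructions are functorial, in each variable, with respect to all homogeneous morphisms. **Filtrations.** $F_\gamma(P_1\otimes_{\mathfrak s_0}P_2)$, $\gamma\in\mathbb Z^{\mathfrak s_0}$, is spanned by the $p_1\otimes w\otimes p_2$ where for each $x$ the component $w_x$ has length at most $\gamma_x$. In general, $\mathcal Hom(P_1,P_2)$ is filtered by the lengths of words, by a filtration $F$ of $P_1$ and by a filtration $G$ of $P_2$: the piece $(\beta,\gamma,\delta)$ consists of those $\varphi$ that map $w\otimes p$ into $G_\delta$ whenever $p\in F_{-\gamma}$ and each component $w_x$ has length at most $-\beta_x$ (an unfiltered $P_1$ is replaced by $F=P_1$, an unfiltered $P_2$ by $G=0$). **Gluing cycles.** A *gluing cycle* $\mathfrak r$ consists of labelled sets $\mathfrak s_1,\mathfrak s_2,\mathfrak s_3,\mathfrak s_{12},\mathfrak s_{23},\mathfrak s_{31}$ and morphisms $$\mathfrak s_{12}\to\mathfrak s_1^*,\quad \mathfrak s_{12}\to\mathfrak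 s_2,\quad \mathfrak s_{23}\to\mathfrak s_2,\quad \mathfrak s_{23}\to\mathfrak s_3,\quad \mathfrak s_{31}\to\mathfrak s_3^*,\quad \mathfrak s_{31}\to\mathfrak s_1^*$$ such that the two images in each of $\mathfrak s_1,\mathfrak s_2,\mathfrak s_3$ are disjoint. Let $\mathfrak q_i\subseteq\mathfrak s_i$ be the complement of these images and $\mathfrak s_{\mathfrak r}=(\mathfrak q_1\sqcup\mathfrak q_2)^*\sqcup\mathfrak q_3$. **Theorem.** Let $\mathfrak r$ be a gluing cycle. For all $\mathfrak s_i$-polymodules $P_i$ $(i=1,2,3)$ the objects $P_1\otimes_{\mathfrak s_{12}}P_2$, $\mathcal Hom_{\mathfrak s_{23}}(P_2,P_3)$, $\mathcal Hom_{\mathfrak s_{31}^*}(P_1,P_3)$ and $$L=\mathcal Hom_{\mathfrak s_{31}^*\sqcup\mathfrak s_{23}}(P_1\otimes_{\mathfrak s_{12}}P_2,\;P_3),\quad R=\mathcal Hom_{\mathfrak s_{31}^*\sqcup\mathfrak s_{12}^*}(P_1,\;\mathcal Hom_{\mathfrak s_{23}}(P_2,P_3)),\quad R^l=\mathcal Hom_{\mathfrak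 s_{12}\sqcup\mathfrak s_{23}}(P_2,\;\mathcal Hom_{\mathfrak s_{31}^*}(P_1,P_3))$$ are polymodules, the last three over $\mathfrak s_{\mathfrak r}$. The filtrations above are increasing lattice filtrations of them by graded subspaces stable under the structure maps, those of $L$, $R$, $R^l$ being indexed by $\mathbb Z^{\mathfrak s_{12}\sqcup\mathfrak s_{23}\sqcup\mathfrak s_{31}}$. Moreover there are isomorphisms of lattice filtered $\mathfrak s_{\mathfrak r}$-polymodules $$\Phi:\;L\;\longrightarrow\;R,\qquad\qquad \Phi^l:\;L\;\longrightarrow\;R^l,$$ i.e. closed strict morphisms of degree $0$ with closed strict two-sided inverses, carrying each step of the filtration of $L$ onto the step of $R$, resp. $R^l$, with the same index. Both are natural in each of $P_1,P_2,P_3$ with respect to all homogeneous morphisms of $\mathrm{Mod}_\infty$, of any degree and not necessarily closed. In particular (the case $\mathfrak s_{\mathfrak r}=\emptyset$ with $\mathfrak s_{12}$, $\mathfrak s_{23}$, $\mathfrak s_{31}$ one-point sets) for $A_\infty$-bimodules both $-\otimes P_2$ and $P_1\otimes-$ have right adjoints, as functors enriched in lattice filtered complexes; this is the sense in which $A_\infty$-algebras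 and bimodules are biclosed. -/

import Mathlib

open scoped Classical TensorProduct

universe u

namespace PolyMod

noncomputable section

set_option linter.unusedSectionVars false
set_option linter.unusedSimpArgs false

variable {K : Type u} {ι : Type} [Field K] [CommRing ι] [Module ι (Additive ℤˣ)]

/-- The Koszul sign `(-1)^e`. The group of degrees `ι` is `ℤ`, `ℤ/2`, or any other commutative ring
of degrees for which `(-1)^e` makes sense. -/
def sgn (e : ι) : ℤˣ := (-1 : ℤˣ) ^ e

theorem sgn_smul_mem {M : Type*} [AddCommGroup M] [Module K M] (p : Submodule K M) (e : ι) {x : M}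
    (hx : x ∈ p) : sgn e • x ∈ p := by
  rcases Int.units_eq_one_or (sgn e) with h | h
  · simpa [h] using hx
  · simpa [h] using hx

/-! ### Graded vector spaces -/

/-- A graded vector space: a vector space that is the internal direct sum of its pieces. -/
structure GrMod (K : Type u) (ι : Type) [Field K] where
  carrier : Type u
  [addCommGroup : AddCommGroup carrier]
  [module : Module K carrier]
  piece : ι → Submodule K carrier
  indep : iSupIndep piece
  span : ⨆ i, piece i = ⊤

attribute [instance] GrMod.addCommGroup GrMod.module

instance : CoeSort (GrMod K ι) (Type u) := ⟨GrMod.carrier⟩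

theorem GrMod.isInternal (P : GrMod K ι) : DirectSum.IsInternal P.piece :=
  (DirectSum.isInternal_submodule_iff_iSupIndep_and_iSup_eq_top _).2 ⟨P.indep, P.span⟩

/-- The decomposition of a graded vector space into its pieces. -/
def GrMod.decomp (P : GrMod K ι) : P ≃ₗ[K] DirectSum ι fun i => P.piece i :=
  (LinearEquiv.ofBijective (DirectSum.coeLinearMap P.piece) P.isInternal).symm

theorem GrMod.decomp_of_mem (P : GrMod K ι) {i : ι} {p : P} (hp : p ∈ P.piece i) :
    P.decomp p = DirectSum.lof K ι (fun i => P.piece i) i ⟨p, hp⟩ := by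
  rw [GrMod.decomp, LinearEquiv.symm_apply_eq]
  exact (DirectSum.coeLinearMap_lof P.piece i ⟨p, hp⟩).symm

/-- The operator `p ↦ (-1)^{d |p|} p`. -/
def GrMod.twist (P : GrMod K ι) (d : ι) : P →ₗ[K] P :=
  (DirectSum.toModule K ι P fun i => sgn (d * i) • (P.piece i).subtype) ∘ₗ
    (P.decomp : P →ₗ[K] DirectSum ι fun i => P.piece i)

theorem GrMod.twist_of_mem (P : GrMod K ι) (d : ι) {i : ι} {p : P} (hp : p ∈ P.piece i) :
    P.twist d p = sgn (d * i) • p := by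
  simp [GrMod.twist, P.decomp_of_mem hp]

theorem GrMod.twist_mem (P : GrMod K ι) (d : ι) {i : ι} {p : P} (hp : p ∈ P.piece i) :
    P.twist d p ∈ P.piece i := by
  rw [P.twist_of_mem d hp]; exact sgn_smul_mem _ _ hp

theorem GrMod.le_of_pieces (P : GrMod K ι) {M : Type*} [AddCommGroup M] [Module K M]
    (L : P →ₗ[K] M) (N : Submodule K M) (h : ∀ i, ∀ p ∈ P.piece i, L p ∈ N) (p : P) : L p ∈ N := by
  have : (⊤ : Submodule K P) ≤ N.comap L := by
    rw [← P.span]; exact iSup_le fun i p hp => h i p hp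
  exact this (Submodule.mem_top : p ∈ ⊤)

/-- A graded vector space from homogeneous spanning sets, given a linear map that recovers the
components. -/
def GrMod.ofSpan (M : Type u) [AddCommGroup M] [Module K M] (G : ι → Set M)
    (hspan : ⨆ i, Submodule.span K (G i) = ⊤) (D : M →ₗ[K] (ι → M))
    (hD : ∀ i, ∀ g ∈ G i, D g = LinearMap.single K (fun _ => M) i g) : GrMod K ι where
  carrier := M
  piece i := Submodule.span K (G i)
  span := hspan
  indep := by
    have key : ∀ i, ∀ x ∈ Submodule.span K (G i), D x = LinearMap.single K (fun _ => M) i x := by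
      intro i x hx
      have : Submodule.span K (G i) ≤ LinearMap.eqLocus D (LinearMap.single K (fun _ => M) i) :=
        Submodule.span_le.2 fun g hg => hD i g hg
      exact this hx
    rw [iSupIndep_def]
    intro i
    rw [Submodule.disjoint_def]
    intro x hx hx'
    have h0 : ∀ y ∈ ⨆ (j) (_ : j ≠ i), Submodule.span K (G j), D y i = 0 := by
      intro y hy
      have : (⨆ (j) (_ : j ≠ i), Submodule.span K (G j)) ≤
          LinearMap.ker (LinearMap.proj i ∘ₗ D) := by
        refine iSup_le fun j => iSup_le fun hj z hz => ?_
        rw [LinearMap.mem_ker, LinearMap.comp_apply, key j z hz]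
        exact Pi.single_eq_of_ne hj.symm _
      exact this hy
    have := h0 x hx'
    rw [key i x hx] at this
    exact (Pi.single_eq_same (M := fun _ => M) i x).symm.trans this

/-! ### Strictly unital A∞-algebras -/

/-- A homogeneous element of `A`. -/
abbrev Letter (A : GrMod K ι) := Σ i : ι, A.piece i

/-- The degree of `[a₁|…|aₙ]` in the tensor coalgebra of `sA`, where `(sA)ⁿ = Aⁿ⁺¹`. -/
def wt {A : GrMod K ι} (l : List (Letter A)) : ι := (l.map fun a => a.1 - 1).sum

/-- A strictly unital A∞-algebra. `m [a₁,…,aₙ]` is the value of the structure map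
`μⁿ : (sA)^{⊗n} → sA`, of degree `1`, on homogeneous elements. -/
structure AInfAlg (K : Type u) (ι : Type) [Field K] [CommRing ι] [Module ι (Additive ℤˣ)]
    extends GrMod K ι where
  m : List (Letter toGrMod) → carrier
  m_nil : m [] = 0
  m_mem : ∀ l, m l ∈ piece (wt l + 2)
  m_lin : ∀ u v i, IsLinearMap K fun a : piece i => m (u ++ ⟨i, a⟩ :: v)
  m_rel : ∀ l : List (Letter toGrMod),
    ∑ j ∈ Finset.range l.length, ∑ k ∈ Finset.range (l.length - j),
      sgn (wt (l.take j)) •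
        m (l.take j ++ ⟨wt ((l.drop j).take (k + 1)) + 2, m ((l.drop j).take (k + 1)), m_mem _⟩ ::
          l.drop (j + k + 1)) = 0
  one : piece 0
  one_m : ∀ a : Letter toGrMod, m [⟨0, one⟩, a] = a.2
  m_one : ∀ a : Letter toGrMod, m [a, ⟨0, one⟩] = sgn a.1 • (a.2 : carrier)
  m_unit : ∀ l, (⟨0, one⟩ : Letter toGrMod) ∈ l → l.length ≠ 2 → m l = 0

/-- The value of a structure map, as a homogeneous element. -/
def AInfAlg.mLetter (A : AInfAlg K ι) (l : List (Letter A.toGrMod)) : Letter A.toGrMod :=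
  ⟨wt l + 2, A.m l, A.m_mem l⟩

/-! ### Labelled sets -/

/-- A labelled set: `{x | side x = true}` is `S⁺`, `{x | side x = false}` is `S⁻`. The relation `lt`
is an enumeration of the finite sets, used to write down tensor products over them. -/
structure LSet (K : Type u) (ι : Type) [Field K] [CommRing ι] [Module ι (Additive ℤˣ)] where
  I : Type
  [fintype : Fintype I]
  side : I → Bool
  κ : I → AInfAlg K ι
  lt : I → I → Prop
  [total : IsStrictTotalOrder I lt]

attribute [instance] LSet.fintype LSet.total

/-- `s* = (S⁻, S⁺, κ)`. -/
abbrev LSet.dual (s : LSet K ι) : LSet K ι := { s with side := fun x => !s.side x }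

/-- The disjoint union of labelled sets. -/
abbrev LSet.sum (s t : LSet K ι) : LSet K ι :=
  letI : IsStrictTotalOrder (s.I ⊕ t.I) (Sum.Lex s.lt t.lt) := {}
  { I := s.I ⊕ t.I
    side := Sum.elim s.side t.side
    κ := Sum.elim s.κ t.κ
    lt := Sum.Lex s.lt t.lt }

/-- The complement of a subset of a labelled set. -/
abbrev LSet.minus (s : LSet K ι) (A : Set s.I) : LSet K ι :=
  letI : IsStrictTotalOrder {x // x ∉ A} (Subrel s.lt (· ∉ A)) := {}
  { I := {x // x ∉ A}
    side := fun x => s.side x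
    κ := fun x => s.κ x
    lt := Subrel s.lt (· ∉ A) }

/-- Morphisms of labelled sets: injections respecting the signs and the labels. -/
structure LSet.Hom (s t : LSet K ι) where
  f : s.I → t.I
  inj : Function.Injective f
  side_eq : ∀ x, t.side (f x) = s.side x
  κ_eq : ∀ x, t.κ (f x) = s.κ x

/-- A morphism `s → t*` is the same as a morphism `s* → t`. -/
def LSet.Hom.flip {s t : LSet K ι} (i : LSet.Hom s t.dual) : LSet.Hom s.dual t where
  f := i.f
  inj := i.inj
  side_eq x := by
    have := i.side_eq x
    simp only [LSet.dual] at this ⊢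
    rw [← this, Bool.not_not]
  κ_eq := i.κ_eq

/-! ### Words: the decomposable elements of the bar coalgebras -/

/-- A word over `s`: an element `⊗ₓ [a₁|…|aₙ]ₓ` of `⊗ₓ 𝓑 κ(x)`. -/
abbrev Word (s : LSet K ι) := ∀ x : s.I, List (Letter (s.κ x).toGrMod)

section words

variable {s t : LSet K ι}

def emptyWord (s : LSet K ι) : Word s := fun _ => []

/-- Replace the component `x` of a word. -/
def upd (w : Word s) (x : s.I) (l : List (Letter (s.κ x).toGrMod)) : Word s :=
  @Function.update _ _ (Classical.decEq _) w x l

@[simp] theorem upd_self (w : Word s) (x : s.I) (l : List (Letter (s.κ x).toGrMod)) :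
    upd w x l x = l := @Function.update_self _ _ (Classical.decEq _) _ _ _

@[simp] theorem upd_of_ne {w : Word s} {x y : s.I} (h : y ≠ x)
    {l : List (Letter (s.κ x).toGrMod)} : upd w x l y = w y :=
  @Function.update_of_ne _ _ (Classical.decEq _) _ _ h _ _

@[simp] theorem upd_idem (w : Word s) (x : s.I) (l l' : List (Letter (s.κ x).toGrMod)) :
    upd (upd w x l) x l' = upd w x l' := by
  unfold upd; exact Function.update_idem _ _ _

@[simp] theorem upd_eq_self (w : Word s) (x : s.I) : upd w x (w x) = w :=
  @Function.update_eq_self _ _ (Classical.decEq _) _ _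

theorem upd_comm {x y : s.I} (h : x ≠ y) (l : List (Letter (s.κ x).toGrMod))
    (l' : List (Letter (s.κ y).toGrMod)) (w : Word s) :
    upd (upd w x l) y l' = upd (upd w y l') x l :=
  by unfold upd; exact Function.update_comm h _ _ _

/-- Total degree of a word. -/
def deg (w : Word s) : ι := ∑ x, wt (w x)

/-- Degree of the part of a word in the `S⁺` factors. -/
def degL (w : Word s) : ι := ∑ x, if s.side x then wt (w x) else 0

/-- Degree of the part of a word in the `S⁻` factors. -/
def degR (w : Word s) : ι := ∑ x, if s.side x then 0 else wt (w x)

/-- Indices for the terms of the comultiplication: a cut of every component of the word. -/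
def cuts (w : Word s) : Finset (s.I → ℕ) :=
  Fintype.piFinset fun x => Finset.range ((w x).length + 1)

/-- After a cut, the part of the word away from the module (first half on the left, second half on
the right of the module). -/
def outer (w : Word s) (k : s.I → ℕ) : Word s := fun x =>
  if s.side x then (w x).take (k x) else (w x).drop (k x)

/-- After a cut, the part of the word next to the module. -/
def inner (w : Word s) (k : s.I → ℕ) : Word s := fun x =>
  if s.side x then (w x).drop (k x) else (w x).take (k x)

/-- Exponent of the Koszul sign that is needed to bring `⊗ₓ oₓ nₓ` (for `x ∈ S⁺`) into the order
`(⊗ₓ oₓ)(⊗ₓ nₓ)` and `⊗ₓ nₓ oₓ` (for `x ∈ S⁻`) into the order `(⊗ₓ nₓ)(⊗ₓ oₓ)`. -/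
def shuffle (o n : Word s) : ι :=
  ∑ x, ∑ y, if s.lt x y ∧ s.side x = s.side y then
    (if s.side x then wt (n x) * wt (o y) else wt (o x) * wt (n y)) else 0

/-- Total degree of the components that precede `x`, in the order `S⁺` before `S⁻`. -/
def before (w : Word s) (x : s.I) : ι :=
  ∑ y, if (s.side y ∧ ¬ s.side x) ∨ (s.side y = s.side x ∧ s.lt y x) then wt (w y) else 0

/-- Apply a structure map of the algebra `κ x` to the letters `j, …, j + k` of the component `x`. -/
def contract (w : Word s) (x : s.I) (j k : ℕ) : Word s :=
  upd w x ((w x).take j ++ (s.κ x).mLetter (((w x).drop j).take (k + 1)) ::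
    (w x).drop (j + k + 1))

/-- The sum of `F x w'` over the terms `w'` of the bar differential of `w`, where `x` is the
component of `w` that changes. -/
def barSum {M : Type*} [AddCommGroup M] (w : Word s) (F : s.I → Word s → M) : M :=
  ∑ x, ∑ j ∈ Finset.range (w x).length, ∑ k ∈ Finset.range ((w x).length - j),
    sgn (before w x + wt ((w x).take j)) • F x (contract w x j k)

/-- The word over a disjoint union with given components. -/
def pair (v : Word s) (w : Word t) : Word (s.sum t) := fun x =>
  match x with
  | Sum.inl x => v x
  | Sum.inr y => w y

def fstW (w : Word (s.sum t)) : Word s := fun x => w (Sum.inl x)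

def sndW (w : Word (s.sum t)) : Word t := fun y => w (Sum.inr y)

def castL {A B : AInfAlg K ι} (h : A = B) (l : List (Letter A.toGrMod)) :
    List (Letter B.toGrMod) := h ▸ l

/-- Extend a word along a morphism of labelled sets by empty components. -/
def push (i : LSet.Hom s t) (w : Word s) : Word t := fun y =>
  if h : ∃ x, i.f x = y then
    castL ((i.κ_eq h.choose).symm.trans (congrArg t.κ h.choose_spec)) (w h.choose) else []

/-- Exponent of the Koszul sign of the reordering of tensor factors caused by `i`. -/
def reorder (i : LSet.Hom s t) (w : Word s) : ι :=
  ∑ x, ∑ y, if s.side x = s.side y ∧ s.lt x y ∧ t.lt (i.f y) (i.f x) then wt (w x) * wt (w y) else 0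

end words

/-! ### Multilinear functions of words -/

section multilinear

variable {s t : LSet K ι} {M N : Type*} [AddCommGroup M] [Module K M] [AddCommGroup N] [Module K N]

/-- `f` is multilinear in the letters, i.e. `f` is a linear map on `⊗ₓ 𝓑 κ(x)`. -/
def Multilin (f : Word s → M) : Prop :=
  ∀ (w : Word s) (x : s.I) (u v : List (Letter (s.κ x).toGrMod)) (i : ι),
    IsLinearMap K fun a : (s.κ x).piece i => f (upd w x (u ++ ⟨i, a⟩ :: v))

/-- `W` varies in one letter only, and linearly. -/
def IsLine {V : Type*} [AddCommGroup V] [Module K V] (W : V → Word s) : Prop :=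
  ∃ (w : Word s) (x : s.I) (u v : List (Letter (s.κ x).toGrMod)) (i : ι)
    (ℓ : V →ₗ[K] (s.κ x).piece i), ∀ a, W a = upd w x (u ++ ⟨i, ℓ a⟩ :: v)

def SameDeg (w w' : Word s) : Prop := ∀ x, wt (w x) = wt (w' x)

section
variable {V : Type*} [AddCommGroup V] [Module K V] {W : V → Word s}

theorem isLine_std (w : Word s) (x : s.I) (u v : List (Letter (s.κ x).toGrMod)) (i : ι) :
    IsLine (K := K) fun a : (s.κ x).piece i => upd w x (u ++ ⟨i, a⟩ :: v) :=
  ⟨w, x, u, v, i, LinearMap.id, fun _ => rfl⟩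

theorem Multilin.line {f : Word s → M} (hf : Multilin (K := K) f) (hW : IsLine (K := K) W) :
    IsLinearMap K fun a => f (W a) := by
  obtain ⟨w, x, u, v, i, ℓ, h⟩ := hW
  have := hf w x u v i
  refine ⟨fun a b => ?_, fun c a => ?_⟩
  · simp only [h, map_add, this.map_add]
  · simp only [h, map_smul, this.map_smul]

theorem multilin_of_line {f : Word s → M}
    (h : ∀ (x : s.I) (i : ι) (W : (s.κ x).piece i → Word s), IsLine (K := K) W →
      IsLinearMap K fun a => f (W a)) : Multilin (K := K) f :=
  fun w x u v i => h x i _ (isLine_std w x u v i)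

theorem wt_append {A : GrMod K ι} (u v : List (Letter A)) : wt (u ++ v) = wt u + wt v := by
  simp [wt]

theorem wt_cons {A : GrMod K ι} (a : Letter A) (v : List (Letter A)) :
    wt (a :: v) = a.1 - 1 + wt v := by
  simp [wt]

theorem IsLine.sameDeg (hW : IsLine (K := K) W) (a b : V) : SameDeg (W a) (W b) := by
  obtain ⟨w, x, u, v, i, ℓ, h⟩ := hW
  intro y
  rw [h, h]
  by_cases hy : y = x
  · subst hy; simp [wt_append, wt_cons]
  · simp [upd_of_ne hy]

theorem IsLine.length (hW : IsLine (K := K) W) (a b : V) (y : s.I) :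
    (W a y).length = (W b y).length := by
  obtain ⟨w, x, u, v, i, ℓ, h⟩ := hW
  rw [h, h]
  by_cases hy : y = x
  · subst hy; simp
  · simp [upd_of_ne hy]

theorem IsLine.cuts (hW : IsLine (K := K) W) (a b : V) : cuts (W a) = cuts (W b) := by
  unfold PolyMod.cuts
  congr 1
  funext y
  rw [hW.length a b y]

theorem IsLine.ne_empty (hW : IsLine (K := K) W) (a : V) : W a ≠ emptyWord s := by
  obtain ⟨w, x, u, v, i, ℓ, h⟩ := hW
  intro h0
  have := congrFun h0 x
  simp [h, emptyWord] at this

end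

theorem isLinearMap_const_sgn {V : Type*} [AddCommGroup V] [Module K V] {f : V → M} (e : ι)
    (hf : IsLinearMap K f) : IsLinearMap K fun a => sgn e • f a := by
  refine ⟨fun a b => ?_, fun c a => ?_⟩
  · simp only [hf.map_add, smul_add]
  · simp only [hf.map_smul]; rw [smul_comm]

theorem isLinearMap_sum {V : Type*} [AddCommGroup V] [Module K V] {α : Type*} (S : Finset α)
    {f : α → V → M} (hf : ∀ i ∈ S, IsLinearMap K (f i)) : IsLinearMap K fun a => ∑ i ∈ S, f i a := by
  refine ⟨fun a b => ?_, fun c a => ?_⟩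
  · rw [← Finset.sum_add_distrib]
    exact Finset.sum_congr rfl fun i hi => (hf i hi).map_add a b
  · rw [Finset.smul_sum]
    exact Finset.sum_congr rfl fun i hi => (hf i hi).map_smul c a

theorem Multilin.zero : Multilin (K := K) fun _ : Word s => (0 : M) :=
  fun _ _ _ _ _ => ⟨fun _ _ => by simp, fun _ _ => by simp⟩

theorem Multilin.add {f g : Word s → M} (hf : Multilin (K := K) f) (hg : Multilin (K := K) g) :
    Multilin (K := K) (f + g) := fun w x u v i => by
  have h1 := hf w x u v i
  have h2 := hg w x u v i
  refine ⟨fun a b => ?_, fun c a => ?_⟩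
  · simp only [Pi.add_apply, h1.map_add, h2.map_add]; abel
  · simp only [Pi.add_apply, h1.map_smul, h2.map_smul, smul_add]

theorem Multilin.map {f : Word s → M} (hf : Multilin (K := K) f) (L : M →ₗ[K] N) :
    Multilin (K := K) fun w => L (f w) := fun w x u v i => by
  have h1 := hf w x u v i
  refine ⟨fun a b => ?_, fun c a => ?_⟩
  · simp only [h1.map_add, map_add]
  · simp only [h1.map_smul, map_smul]

theorem Multilin.smul {f : Word s → M} (hf : Multilin (K := K) f) (c : K) :
    Multilin (K := K) (c • f) := hf.map (LinearMap.lsmul K M c)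

theorem Multilin.of_injective {f : Word s → M} (L : M →ₗ[K] N) (hL : Function.Injective L)
    (h : Multilin (K := K) fun w => L (f w)) : Multilin (K := K) f := fun w x u v i => by
  have h1 := h w x u v i
  refine ⟨fun a b => hL ?_, fun c a => hL ?_⟩
  · rw [map_add]; exact h1.map_add a b
  · rw [map_smul]; exact h1.map_smul c a

theorem multilin_pi {β : Type*} {F : Word s → β → M}
    (h : ∀ b, Multilin (K := K) fun w => F w b) : Multilin (K := K) F := fun w x u v i =>
  ⟨fun a b => funext fun p => (h p w x u v i).map_add a b,
    fun c a => funext fun p => (h p w x u v i).map_smul c a⟩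

theorem multilin_lin {M' : Type*} [AddCommGroup M'] [Module K M'] {F : Word s → M' →ₗ[K] M}
    (h : ∀ b, Multilin (K := K) fun w => F w b) : Multilin (K := K) F := fun w x u v i =>
  ⟨fun a b => LinearMap.ext fun p => (h p w x u v i).map_add a b,
    fun c a => LinearMap.ext fun p => (h p w x u v i).map_smul c a⟩

/-- Factors that depend on the degrees of the letters only do not affect multilinearity. -/
theorem Multilin.diag (F : Word s → Word s → M) (h1 : ∀ c, Multilin (K := K) (F c))
    (h2 : ∀ c c', SameDeg c c' → F c = F c') : Multilin (K := K) fun w => F w w := by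
  refine multilin_of_line fun x i W hW => ?_
  have : (fun a => F (W a) (W a)) = fun a => F (W 0) (W a) := by
    funext a; rw [h2 _ _ (hW.sameDeg a 0)]
  rw [this]
  exact (h1 (W 0)).line hW

theorem letter_ext {A : GrMod K ι} {i j : ι} {x : A.piece i} {y : A.piece j} (h : i = j)
    (hxy : (x : A) = y) : (⟨i, x⟩ : Letter A) = ⟨j, y⟩ := by
  subst h
  congr 1
  exact Subtype.ext hxy

theorem isLine_cuts {V : Type*} [AddCommGroup V] [Module K V] {W : V → Word s}
    (hW : IsLine (K := K) W) (k : s.I → ℕ) :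
    (IsLine (K := K) (fun a => outer (W a) k) ∧ ∃ c, ∀ a, inner (W a) k = c) ∨
      (IsLine (K := K) (fun a => inner (W a) k) ∧ ∃ c, ∀ a, outer (W a) k = c) := by
  obtain ⟨w, x, u, v, i, ℓ, h⟩ := hW
  -- the two halves of the component `x`
  have hd : ∀ z : Letter (s.κ x).toGrMod, k x ≤ u.length →
      (u ++ z :: v).drop (k x) = u.drop (k x) ++ z :: v ∧
        (u ++ z :: v).take (k x) = u.take (k x) := by
    intro z hk
    exact ⟨List.drop_append_of_le_length hk, List.take_append_of_le_length hk⟩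
  have ht : ∀ z : Letter (s.κ x).toGrMod, u.length < k x →
      (u ++ z :: v).take (k x) = u ++ z :: v.take (k x - u.length - 1) ∧
        (u ++ z :: v).drop (k x) = v.drop (k x - u.length - 1) := by
    intro z hk
    obtain ⟨n, hn⟩ := Nat.exists_eq_add_of_lt hk
    have h1 : k x - u.length = n + 1 := by omega
    rw [List.take_append, List.drop_append, h1, List.take_of_length_le (by omega),
      List.drop_eq_nil_of_le (by omega)]
    simp
  by_cases hs : s.side x
  · rcases le_or_gt (k x) u.length with hk | hk
    · right
      refine ⟨⟨inner w k, x, u.drop (k x), v, i, ℓ, fun a => ?_⟩,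
        upd (outer w k) x (u.take (k x)), fun a => ?_⟩ <;>
      · funext y
        by_cases hy : y = x
        · subst hy; simp [inner, outer, h, hs, hd _ hk]
        · simp [inner, outer, h, upd_of_ne hy]
    · left
      refine ⟨⟨outer w k, x, u, v.take (k x - u.length - 1), i, ℓ, fun a => ?_⟩,
        upd (inner w k) x (v.drop (k x - u.length - 1)), fun a => ?_⟩ <;>
      · funext y
        by_cases hy : y = x
        · subst hy; simp [inner, outer, h, hs, ht _ hk]
        · simp [inner, outer, h, upd_of_ne hy]
  · rcases le_or_gt (k x) u.length with hk | hk
    · left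
      refine ⟨⟨outer w k, x, u.drop (k x), v, i, ℓ, fun a => ?_⟩,
        upd (inner w k) x (u.take (k x)), fun a => ?_⟩ <;>
      · funext y
        by_cases hy : y = x
        · subst hy; simp [inner, outer, h, hs, hd _ hk]
        · simp [inner, outer, h, upd_of_ne hy]
    · right
      refine ⟨⟨inner w k, x, u, v.take (k x - u.length - 1), i, ℓ, fun a => ?_⟩,
        upd (outer w k) x (v.drop (k x - u.length - 1)), fun a => ?_⟩ <;>
      · funext y
        by_cases hy : y = x
        · subst hy; simp [inner, outer, h, hs, ht _ hk]
        · simp [inner, outer, h, upd_of_ne hy]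

/-- Sums over the comultiplication are multilinear. -/
theorem multilin_cuts (G : Word s → Word s → M) (h1 : ∀ n, Multilin (K := K) fun o => G o n)
    (h2 : ∀ o, Multilin (K := K) fun n => G o n) :
    Multilin (K := K) fun w => ∑ k ∈ cuts w, G (outer w k) (inner w k) := by
  refine multilin_of_line fun x i W hW => ?_
  have : (fun a => ∑ k ∈ cuts (W a), G (outer (W a) k) (inner (W a) k)) =
      fun a => ∑ k ∈ cuts (W 0), G (outer (W a) k) (inner (W a) k) := by
    funext a; rw [hW.cuts a 0]
  rw [this]
  refine isLinearMap_sum _ fun k _ => ?_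
  rcases isLine_cuts hW k with ⟨h, c, hc⟩ | ⟨h, c, hc⟩
  · simp only [hc]; exact (h1 c).line h
  · simp only [hc]; exact (h2 c).line h

theorem isLine_contract {V : Type*} [AddCommGroup V] [Module K V] {W : V → Word s}
    (hW : IsLine (K := K) W) (y : s.I) (j k : ℕ) (hjk : ∀ a, j + k < (W a y).length) :
    IsLine (K := K) (fun a => contract (W a) y j k) ∧
      ∀ a b, wt ((W a y).take j) = wt ((W b y).take j) := by
  obtain ⟨w, x, u, v, i, ℓ, h⟩ := hW
  by_cases hy : y = x
  · subst hy
    have hW : ∀ a, W a y = u ++ ⟨i, ℓ a⟩ :: v := fun a => by rw [h]; simp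
    have hup : ∀ a L, upd (W a) y L = upd w y L := fun a L => by
      rw [h]; simp
    have hlen := hjk 0
    rw [hW] at hlen
    simp only [List.length_append, List.length_cons] at hlen
    rcases lt_or_ge u.length j with hj | hj
    · -- the letter lies before the contracted ones
      obtain ⟨n, rfl⟩ : ∃ n, j = u.length + 1 + n := ⟨j - u.length - 1, by omega⟩
      have h1 : ∀ z : Letter (s.κ y).toGrMod, (u ++ z :: v).take (u.length + 1 + n) =
          u ++ z :: v.take n := fun z => by
        rw [List.take_append, List.take_of_length_le (by omega),
          show u.length + 1 + n - u.length = n + 1 by omega]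
        simp
      have h2 : ∀ (z : Letter (s.κ y).toGrMod) (r : ℕ), (u ++ z :: v).drop (u.length + 1 + r) =
          v.drop r := fun z r => by
        rw [List.drop_append, List.drop_eq_nil_of_le (by omega),
          show u.length + 1 + r - u.length = r + 1 by omega]
        simp
      refine ⟨⟨w, y, u, v.take n ++ (s.κ y).mLetter ((v.drop n).take (k + 1)) :: v.drop (n + k + 1), i, ℓ,
        fun a => ?_⟩, fun a b => ?_⟩
      · change contract (W a) y _ _ = _
        unfold contract
        rw [hup]
        simp only [hW, h1, show u.length + 1 + n + k + 1 = u.length + 1 + (n + k + 1) by omega, h2]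
        simp
      · simp only [hW, h1, wt_append, wt_cons]
    · rcases lt_or_ge u.length (j + k + 1) with hk | hk
      · -- the letter is one of the contracted ones
        have h1 : ∀ z : Letter (s.κ y).toGrMod, (u ++ z :: v).take j = u.take j := fun z =>
          List.take_append_of_le_length hj
        have h2 : ∀ z : Letter (s.κ y).toGrMod, ((u ++ z :: v).drop j).take (k + 1) =
            u.drop j ++ z :: v.take (k - (u.length - j)) := fun z => by
          rw [List.drop_append_of_le_length hj, List.take_append,
            List.take_of_length_le (by simp; omega), List.length_drop,
            show k + 1 - (u.length - j) = k - (u.length - j) + 1 by omega]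
          simp
        have h3 : ∀ z : Letter (s.κ y).toGrMod, (u ++ z :: v).drop (j + k + 1) =
            v.drop (j + k - u.length) := fun z => by
          rw [List.drop_append, List.drop_eq_nil_of_le (by omega),
            show j + k + 1 - u.length = j + k - u.length + 1 by omega]
          simp
        set u' := u.drop j
        set v' := v.take (k - (u.length - j))
        have hlin := (s.κ y).m_lin u' v' i
        have hd : ∀ a, wt (u' ++ ⟨i, ℓ a⟩ :: v') = wt u' + (i - 1 + wt v') := fun a => by
          rw [wt_append, wt_cons]
        let ℓ' : V →ₗ[K] (s.κ y).piece (wt u' + (i - 1 + wt v') + 2) :=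
          { toFun := fun a => ⟨(s.κ y).m (u' ++ ⟨i, ℓ a⟩ :: v'), by
              rw [← hd a]; exact (s.κ y).m_mem _⟩
            map_add' := fun a b => Subtype.ext (by simpa using hlin.map_add (ℓ a) (ℓ b))
            map_smul' := fun c a => Subtype.ext (by simpa using hlin.map_smul c (ℓ a)) }
        refine ⟨⟨w, y, u.take j, v.drop (j + k - u.length), _, ℓ', fun a => ?_⟩, fun a b => ?_⟩
        · change contract (W a) y _ _ = _
          unfold contract
          rw [hup]
          simp only [hW, h1, h2, h3]
          congr 3
          exact letter_ext (by rw [hd]) rfl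
        · simp only [hW, h1]
      · -- the letter lies after the contracted ones
        have h1 : ∀ z : Letter (s.κ y).toGrMod, (u ++ z :: v).take j = u.take j := fun z =>
          List.take_append_of_le_length hj
        have h2 : ∀ z : Letter (s.κ y).toGrMod, ((u ++ z :: v).drop j).take (k + 1) =
            (u.drop j).take (k + 1) := fun z => by
          rw [List.drop_append_of_le_length hj, List.take_append_of_le_length]
          rw [List.length_drop]; omega
        have h3 : ∀ z : Letter (s.κ y).toGrMod, (u ++ z :: v).drop (j + k + 1) =
            u.drop (j + k + 1) ++ z :: v := fun z => List.drop_append_of_le_length hk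
        refine ⟨⟨w, y, u.take j ++ (s.κ y).mLetter ((u.drop j).take (k + 1)) :: u.drop (j + k + 1), v, i, ℓ,
          fun a => ?_⟩, fun a b => ?_⟩
        · change contract (W a) y _ _ = _
          unfold contract
          rw [hup]
          simp only [hW, h1, h2, h3]
          simp
        · simp only [hW, h1]
  · have hW : ∀ a, W a y = w y := fun a => by rw [h, upd_of_ne hy]
    refine ⟨⟨upd w y (contract w y j k y), x, u, v, i, ℓ, fun a => ?_⟩,
      fun a b => by rw [hW, hW]⟩
    rw [upd_comm hy, ← h]
    change contract (W a) y j k = _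
    unfold contract
    simp only [hW, upd_self]

theorem before_congr {w w' : Word s} (h : SameDeg w w') (x : s.I) : before w x = before w' x := by
  unfold before; simp only [h _]

/-- Sums over the bar differential are multilinear. -/
theorem multilin_barSum (F : s.I → Word s → M) (h : ∀ x, Multilin (K := K) (F x)) :
    Multilin (K := K) fun w => barSum w F := by
  refine multilin_of_line fun x i W hW => ?_
  have : (fun a => barSum (W a) F) = fun a => ∑ y, ∑ j ∈ Finset.range (W 0 y).length,
      ∑ k ∈ Finset.range ((W 0 y).length - j),
        sgn (before (W 0) y + wt ((W 0 y).take j)) • F y (contract (W a) y j k) := by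
    funext a
    unfold barSum
    refine Finset.sum_congr rfl fun y _ => ?_
    rw [hW.length a 0 y]
    refine Finset.sum_congr rfl fun j hj => Finset.sum_congr rfl fun k hk => ?_
    rw [Finset.mem_range] at hj hk
    rw [before_congr (hW.sameDeg a 0),
      (isLine_contract hW y j k fun b => by rw [hW.length b 0 y]; omega).2 a 0]
  rw [this]
  refine isLinearMap_sum _ fun y _ => isLinearMap_sum _ fun j hj => isLinearMap_sum _ fun k hk => ?_
  rw [Finset.mem_range] at hj hk
  exact isLinearMap_const_sgn _ ((h y).line
    (isLine_contract hW y j k fun b => by rw [hW.length b 0 y]; omega).1)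

theorem pair_upd_left (v : Word s) (w : Word t) (x : s.I) (l : List (Letter (s.κ x).toGrMod)) :
    pair (upd v x l) w = upd (s := s.sum t) (pair v w) (Sum.inl x) l := by
  funext y
  rcases y with y | y
  · by_cases hy : y = x
    · subst hy
      exact (upd_self v y l).trans (upd_self (s := s.sum t) (pair v w) (Sum.inl y) l).symm
    · exact (upd_of_ne hy).trans
        (upd_of_ne (s := s.sum t) (w := pair v w) (fun e => hy (Sum.inl.inj e))).symm
  · exact (upd_of_ne (s := s.sum t) (w := pair v w) (x := Sum.inl x) (y := Sum.inr y)
      Sum.inr_ne_inl).symm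

theorem pair_upd_right (v : Word s) (w : Word t) (x : t.I) (l : List (Letter (t.κ x).toGrMod)) :
    pair v (upd w x l) = upd (s := s.sum t) (pair v w) (Sum.inr x) l := by
  funext y
  rcases y with y | y
  · exact (upd_of_ne (s := s.sum t) (w := pair v w) (x := Sum.inr x) (y := Sum.inl y)
      Sum.inl_ne_inr).symm
  · by_cases hy : y = x
    · subst hy
      exact (upd_self w y l).trans (upd_self (s := s.sum t) (pair v w) (Sum.inr y) l).symm
    · exact (upd_of_ne hy).trans
        (upd_of_ne (s := s.sum t) (w := pair v w) (fun e => hy (Sum.inr.inj e))).symm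

theorem pair_fst_snd (w : Word (s.sum t)) : pair (fstW w) (sndW w) = w := by
  funext y; rcases y with y | y <;> rfl

theorem Multilin.pair_left {f : Word (s.sum t) → M} (hf : Multilin (K := K) f) (w : Word t) :
    Multilin (K := K) fun v => f (pair v w) := fun v x l r i => by
  simp only [pair_upd_left]
  exact hf (pair v w) (Sum.inl x) l r i

theorem Multilin.pair_right {f : Word (s.sum t) → M} (hf : Multilin (K := K) f) (w : Word s) :
    Multilin (K := K) fun v => f (pair w v) := fun v x l r i => by
  simp only [pair_upd_right]
  exact hf (pair w v) (Sum.inr x) l r i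

theorem isLine_sum {V : Type*} [AddCommGroup V] [Module K V] {W : V → Word (s.sum t)}
    (hW : IsLine (K := K) W) :
    (IsLine (K := K) (fun a => fstW (W a)) ∧ ∃ c, ∀ a, sndW (W a) = c) ∨
      (IsLine (K := K) (fun a => sndW (W a)) ∧ ∃ c, ∀ a, fstW (W a) = c) := by
  obtain ⟨w, x, u, v, i, ℓ, h⟩ := hW
  rcases x with x | x
  · left
    have h' : ∀ a, W a = pair (upd (fstW w) x (u ++ ⟨i, ℓ a⟩ :: v)) (sndW w) := fun a =>
      (h a).trans ((congrArg (fun z => upd (s := s.sum t) z (Sum.inl x) _)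
        (pair_fst_snd w).symm).trans (pair_upd_left _ _ x _).symm)
    exact ⟨⟨fstW w, x, u, v, i, ℓ, fun a => congrArg fstW (h' a)⟩, sndW w,
      fun a => (congrArg sndW (h' a) :)⟩
  · right
    have h' : ∀ a, W a = pair (fstW w) (upd (sndW w) x (u ++ ⟨i, ℓ a⟩ :: v)) := fun a =>
      (h a).trans ((congrArg (fun z => upd (s := s.sum t) z (Sum.inr x) _)
        (pair_fst_snd w).symm).trans (pair_upd_right _ _ x _).symm)
    exact ⟨⟨sndW w, x, u, v, i, ℓ, fun a => congrArg sndW (h' a)⟩, fstW w,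
      fun a => (congrArg fstW (h' a) :)⟩

theorem Multilin.ite_snd {f : Word s → M} (hf : Multilin (K := K) f) :
    Multilin (K := K) fun w : Word (s.sum t) => if sndW w = emptyWord t then f (fstW w) else 0 := by
  refine multilin_of_line fun x i W hW => ?_
  rcases isLine_sum hW with ⟨h, c, hc⟩ | ⟨h, c, hc⟩
  · by_cases h0 : c = emptyWord t
    · simp only [hc, h0, if_true]; exact hf.line h
    · simp only [hc, h0, if_false]; exact ⟨fun _ _ => by simp, fun _ _ => by simp⟩
  · simp only [h.ne_empty, if_false]; exact ⟨fun _ _ => by simp, fun _ _ => by simp⟩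

theorem Multilin.ite_fst {f : Word t → M} (hf : Multilin (K := K) f) :
    Multilin (K := K) fun w : Word (s.sum t) => if fstW w = emptyWord s then f (sndW w) else 0 := by
  refine multilin_of_line fun x i W hW => ?_
  rcases isLine_sum hW with ⟨h, c, hc⟩ | ⟨h, c, hc⟩
  · simp only [h.ne_empty, if_false]; exact ⟨fun _ _ => by simp, fun _ _ => by simp⟩
  · by_cases h0 : c = emptyWord s
    · simp only [hc, h0, if_true]; exact hf.line h
    · simp only [hc, h0, if_false]; exact ⟨fun _ _ => by simp, fun _ _ => by simp⟩

theorem push_apply (i : LSet.Hom s t) (w : Word s) (x : s.I) :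
    push i w (i.f x) = castL (i.κ_eq x).symm (w x) := by
  have h : ∃ x', i.f x' = i.f x := ⟨x, rfl⟩
  have hx : h.choose = x := i.inj h.choose_spec
  unfold push
  rw [dif_pos h]
  have gen : ∀ (x' : s.I) (hx' : x' = x) (hk : s.κ x' = t.κ (i.f x)),
      castL hk (w x') = castL (i.κ_eq x).symm (w x) := by
    intro x' hx' hk; subst hx'; rfl
  exact gen _ hx _

theorem push_of_notMem (i : LSet.Hom s t) (w : Word s) (y : t.I) (hy : ¬ ∃ x, i.f x = y) :
    push i w y = [] := dif_neg hy

theorem castL_append {A B : AInfAlg K ι} (h : A = B) (l l' : List (Letter A.toGrMod)) :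
    castL h (l ++ l') = castL h l ++ castL h l' := by subst h; rfl

theorem wt_castL {A B : AInfAlg K ι} (h : A = B) (l : List (Letter A.toGrMod)) :
    wt (castL h l) = wt l := by subst h; rfl

theorem castL_line {V : Type*} [AddCommGroup V] [Module K V] {A B : AInfAlg K ι} (h : A = B)
    (u v : List (Letter A.toGrMod)) (i : ι) (ℓ : V →ₗ[K] A.piece i) :
    ∃ ℓ' : V →ₗ[K] B.piece i, ∀ a, castL h (u ++ ⟨i, ℓ a⟩ :: v) =
      castL h u ++ ⟨i, ℓ' a⟩ :: castL h v := by
  subst h; exact ⟨ℓ, fun _ => rfl⟩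

theorem isLine_push {V : Type*} [AddCommGroup V] [Module K V] {W : V → Word s}
    (hW : IsLine (K := K) W) (i : LSet.Hom s t) : IsLine (K := K) fun a => push i (W a) := by
  obtain ⟨w, x, u, v, d, ℓ, h⟩ := hW
  obtain ⟨ℓ', hℓ'⟩ := castL_line (i.κ_eq x).symm u v d ℓ
  refine ⟨push i w, i.f x, castL (i.κ_eq x).symm u, castL (i.κ_eq x).symm v, d, ℓ', fun a => ?_⟩
  funext y
  change PolyMod.push i (W a) y = _
  by_cases hy : ∃ x', i.f x' = y
  · obtain ⟨x', rfl⟩ := hy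
    by_cases hx : x' = x
    · subst hx
      rw [upd_self, push_apply, h, upd_self, hℓ']
    · rw [upd_of_ne (fun e => hx (i.inj e)), push_apply, push_apply, h,
        upd_of_ne hx]
  · rw [upd_of_ne (by rintro rfl; exact hy ⟨x, rfl⟩), push_of_notMem _ _ _ hy,
      push_of_notMem _ _ _ hy]

theorem Multilin.push {f : Word t → M} (hf : Multilin (K := K) f) (i : LSet.Hom s t) :
    Multilin (K := K) fun w => f (push i w) :=
  multilin_of_line fun _ _ _ hW => hf.line (isLine_push hW i)

end multilinear

/-! ### Degrees of words -/

section degrees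

variable {s t : LSet K ι}

theorem deg_emptyWord : deg (emptyWord s) = 0 := by simp [deg, emptyWord, wt]

theorem deg_cut (w : Word s) (k : s.I → ℕ) : deg (outer w k) + deg (inner w k) = deg w := by
  unfold deg
  rw [← Finset.sum_add_distrib]
  refine Finset.sum_congr rfl fun x _ => ?_
  unfold outer inner
  split_ifs
  · rw [← wt_append, List.take_append_drop]
  · rw [add_comm, ← wt_append, List.take_append_drop]

theorem deg_pair (v : Word s) (w : Word t) : deg (pair v w) = deg v + deg w := by
  simp only [deg]
  exact Fintype.sum_sum_type (α₁ := s.I) (α₂ := t.I) _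

theorem deg_eq (w : Word (s.sum t)) : deg w = deg (fstW w) + deg (sndW w) := by
  simp only [deg]
  exact Fintype.sum_sum_type (α₁ := s.I) (α₂ := t.I) _

theorem deg_contract (w : Word s) (x : s.I) (j k : ℕ) : deg (contract w x j k) = deg w + 1 := by
  have h : ∀ y, wt (contract w x j k y) = wt (w y) + if y = x then 1 else 0 := by
    intro y
    by_cases hy : y = x
    · subst hy
      have h1 : wt (w y) = wt ((w y).take j) + (wt (((w y).drop j).take (k + 1)) +
          wt ((w y).drop (j + k + 1))) := by
        rw [show j + k + 1 = j + (k + 1) by omega, ← List.drop_drop, ← wt_append, ← wt_append,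
          List.take_append_drop, List.take_append_drop]
      rw [h1]
      simp only [contract, upd_self, if_true, wt_append, wt_cons, AInfAlg.mLetter]
      ring
    · simp [contract, hy]
  unfold deg
  simp only [h, Finset.sum_add_distrib]
  simp

theorem deg_push (i : LSet.Hom s t) (w : Word s) : deg (push i w) = deg w := by
  unfold deg
  symm
  refine Finset.sum_of_injOn i.f (fun a _ b _ h => i.inj h) (fun _ _ => Finset.mem_coe.2
    (Finset.mem_univ _)) (fun y _ hy => ?_) (fun x _ => ?_)
  · rw [push_of_notMem]
    · simp [wt]
    · rintro ⟨x, rfl⟩; exact hy ⟨x, by simp, rfl⟩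
  · rw [push_apply, wt_castL]

theorem SameDeg.degL {w w' : Word s} (h : SameDeg w w') : degL w = degL w' := by
  unfold PolyMod.degL; simp only [h _]

theorem SameDeg.degR {w w' : Word s} (h : SameDeg w w') : degR w = degR w' := by
  unfold PolyMod.degR; simp only [h _]

theorem SameDeg.deg {w w' : Word s} (h : SameDeg w w') : deg w = deg w' := by
  unfold PolyMod.deg; simp only [h _]

theorem SameDeg.shuffle_left {w w' : Word s} (h : SameDeg w w') (n : Word s) :
    shuffle w n = shuffle w' n := by
  unfold shuffle; simp only [h _]

theorem SameDeg.shuffle_right {w w' : Word s} (h : SameDeg w w') (o : Word s) :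
    shuffle o w = shuffle o w' := by
  unfold shuffle; simp only [h _]

theorem SameDeg.reorder {w w' : Word s} (h : SameDeg w w') (i : LSet.Hom s t) :
    reorder i w = reorder i w' := by
  unfold PolyMod.reorder; simp only [h _]

end degrees

/-! ### Graded maps and polymodules -/

/-- Linear maps out of a graded vector space, given on the pieces. -/
def GrMod.elim (P : GrMod K ι) {M : Type*} [AddCommGroup M] [Module K M] (L : ι → P →ₗ[K] M) :
    P →ₗ[K] M :=
  (DirectSum.toModule K ι M fun i => L i ∘ₗ (P.piece i).subtype) ∘ₗ
    (P.decomp : P →ₗ[K] DirectSum ι fun i => P.piece i)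

theorem GrMod.elim_of_mem (P : GrMod K ι) {M : Type*} [AddCommGroup M] [Module K M]
    (L : ι → P →ₗ[K] M) {i : ι} {p : P} (hp : p ∈ P.piece i) : P.elim L p = L i p := by
  simp [GrMod.elim, P.decomp_of_mem hp]

theorem GrMod.induction (P : GrMod K ι) {C : P → Prop} (h : ∀ i, ∀ p ∈ P.piece i, C p)
    (h0 : C 0) (ha : ∀ p q, C p → C q → C (p + q)) (p : P) : C p :=
  Submodule.iSup_induction P.piece (motive := C)
    (by rw [P.span]; exact Submodule.mem_top : p ∈ ⨆ i, P.piece i) h h0 ha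

section maps

variable {s t : LSet K ι} {P P' Q R : GrMod K ι}

theorem multilin_of_pieces {M : Type*} [AddCommGroup M] [Module K M] {F : Word s → P →ₗ[K] M}
    (h : ∀ i, ∀ p ∈ P.piece i, Multilin (K := K) fun w => F w p) : Multilin (K := K) F := by
  refine multilin_lin fun p => ?_
  refine P.induction (C := fun p => Multilin (K := K) fun w => F w p) h ?_ ?_ p
  · simpa using (Multilin.zero (K := K) (s := s) (M := M))
  · intro p q hp hq
    simp only [map_add]
    exact hp.add hq

theorem multilin_sgn {M : Type*} [AddCommGroup M] [Module K M] {f : Word s → M} (e : Word s → ι)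
    (he : ∀ w w', SameDeg w w' → e w = e w') (hf : Multilin (K := K) f) :
    Multilin (K := K) fun w => sgn (e w) • f w :=
  Multilin.diag (fun c w => sgn (e c) • f w)
    (fun c w x u v i => isLinearMap_const_sgn (e c) (hf w x u v i))
    fun c c' h => by rw [he c c' h]

/-- `f : 𝓑 ⊗ P → Q` is homogeneous of degree `k`. -/
def HasDeg (k : ι) (f : Word s → P →ₗ[K] Q) : Prop :=
  ∀ w i, ∀ p ∈ P.piece i, f w p ∈ Q.piece (i + deg w + k)

/-- Homogeneous maps `⊗ₓ 𝓑 κ(x) ⊗ P → Q` of degree `k`, i.e. the morphisms of degree `k` between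
polymodules over `s` with underlying graded vector spaces `P` and `Q`. -/
def homPiece (s : LSet K ι) (P Q : GrMod K ι) (k : ι) : Submodule K (Word s → P →ₗ[K] Q) where
  carrier := {f | Multilin (K := K) f ∧ HasDeg k f}
  zero_mem' := ⟨Multilin.zero, fun _ _ _ _ => Submodule.zero_mem _⟩
  add_mem' hf hg := ⟨hf.1.add hg.1, fun w i p hp => Submodule.add_mem _ (hf.2 w i p hp)
    (hg.2 w i p hp)⟩
  smul_mem' c _ hf := ⟨hf.1.smul c, fun w i p hp => Submodule.smul_mem _ c (hf.2 w i p hp)⟩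

/-- The graded vector space with given independent pieces. -/
def GrMod.ofIndep {M : Type u} [AddCommGroup M] [Module K M] (N : ι → Submodule K M)
    (h : iSupIndep N) : GrMod K ι where
  carrier := ↥(⨆ i, N i)
  piece i := (N i).comap (⨆ i, N i).subtype
  indep := by
    rw [iSupIndep_def] at h ⊢
    intro i
    rw [Submodule.disjoint_def]
    intro x hx hx'
    refine Subtype.ext ((Submodule.disjoint_def.1 (h i)) x hx ?_)
    have : (⨆ (j) (_ : j ≠ i), (N j).comap (⨆ i, N i).subtype) ≤
        (⨆ (j) (_ : j ≠ i), N j).comap (⨆ i, N i).subtype :=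
      iSup_le fun j => iSup_le fun hj => Submodule.comap_mono (le_iSup₂_of_le j hj le_rfl)
    exact this hx'
  span := by
    refine Submodule.map_injective_of_injective (⨆ i, N i).injective_subtype ?_
    rw [Submodule.map_iSup, Submodule.map_top, Submodule.range_subtype]
    refine iSup_congr fun i => ?_
    rw [Submodule.map_comap_subtype]
    exact inf_eq_right.2 (le_iSup N i)

theorem homPiece_indep (s : LSet K ι) (P Q : GrMod K ι) : iSupIndep (homPiece s P Q) := by
  rw [iSupIndep_def]
  intro k
  rw [Submodule.disjoint_def]
  intro f hf hf'
  funext w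
  refine LinearMap.ext fun p => ?_
  refine (Submodule.mem_bot K).1 (P.le_of_pieces (f w) ⊥ (fun i p hp => ?_) p)
  have hQ := (iSupIndep_def.1 Q.indep) (i + deg w + k)
  have hle : (⨆ (j) (_ : j ≠ k), homPiece s P Q j) ≤
      (⨆ (j) (_ : j ≠ i + deg w + k), Q.piece j).comap
        ((LinearMap.applyₗ p : (P →ₗ[K] Q) →ₗ[K] Q) ∘ₗ LinearMap.proj w) := by
    refine iSup_le fun j => iSup_le fun hj g hg => ?_
    have : i + deg w + j ≠ i + deg w + k := fun e => hj (add_left_cancel e)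
    exact (le_iSup₂_of_le (f := fun j (_ : j ≠ i + deg w + k) => Q.piece j) _ this le_rfl)
      (hg.2 w i p hp)
  exact (Submodule.mem_bot K).2 ((Submodule.disjoint_def.1 hQ) _ (hf.2 w i p hp) (hle hf'))

/-- The graded vector space of maps `⊗ₓ 𝓑 κ(x) ⊗ P → Q`. -/
def PHom (s : LSet K ι) (P Q : GrMod K ι) : GrMod K ι := GrMod.ofIndep _ (homPiece_indep s P Q)

/-- The underlying map of an element of `PHom s P Q`. -/
def PHom.val {s : LSet K ι} {P Q : GrMod K ι} : PHom s P Q →ₗ[K] (Word s → P →ₗ[K] Q) :=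
  (⨆ i, homPiece s P Q i).subtype

theorem PHom.val_mem {i : ι} {φ : PHom s P Q} (hφ : φ ∈ (PHom s P Q).piece i) :
    PHom.val φ ∈ homPiece s P Q i := hφ

theorem PHom.val_injective : Function.Injective (PHom.val : PHom s P Q →ₗ[K] _) :=
  Subtype.val_injective

/-- Lift a linear map of degree `d` with values in maps to one with values in `PHom`. -/
def PHom.lift {V : GrMod K ι} (L : V →ₗ[K] (Word s → P →ₗ[K] Q)) (d : ι)
    (h : ∀ i, ∀ v ∈ V.piece i, L v ∈ homPiece s P Q (i + d)) : V →ₗ[K] PHom s P Q :=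
  LinearMap.codRestrict (⨆ i, homPiece s P Q i) L
    (V.le_of_pieces L _ fun i v hv => le_iSup (homPiece s P Q) (i + d) (h i v hv))

theorem PHom.val_lift {V : GrMod K ι} (L : V →ₗ[K] (Word s → P →ₗ[K] Q)) (d : ι)
    (h : ∀ i, ∀ v ∈ V.piece i, L v ∈ homPiece s P Q (i + d)) (v : V) :
    PHom.val (PHom.lift L d h v) = L v := rfl

/-- Restriction of scalars along a morphism of labelled sets. -/
def pull (i : LSet.Hom s t) (f : Word t → P →ₗ[K] Q) (w : Word s) : P →ₗ[K] Q :=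
  sgn (reorder i w) • f (push i w)

theorem pull_mem (i : LSet.Hom s t) {k : ι} {f : Word t → P →ₗ[K] Q} (hf : f ∈ homPiece t P Q k) :
    pull i f ∈ homPiece s P Q k :=
  ⟨multilin_sgn (reorder i) (fun _ _ h => h.reorder i) (hf.1.push i), fun w d p hp => by
    have := hf.2 (push i w) d p hp
    rw [deg_push] at this
    exact sgn_smul_mem _ _ this⟩

/-- Composition `ψ ∘ φ` of morphisms, where `φ` has degree `k`: the composition of the induced
comodule maps of the bar constructions, followed by the projection. -/
def comp (k : ι) (ψ : Word s → Q →ₗ[K] R) (φ : Word s → P →ₗ[K] Q) (w : Word s) : P →ₗ[K] R :=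
  ∑ c ∈ cuts w, sgn (shuffle (outer w c) (inner w c) + k * degL (outer w c)) •
    (ψ (outer w c) ∘ₗ φ (inner w c))

/-- Precomposition of `f : 𝓑 ⊗ P → Q` with the differential of the bar coalgebra. -/
def preD (f : Word s → P →ₗ[K] Q) (w : Word s) : P →ₗ[K] Q :=
  barSum w fun x w' => if s.side x then f w' else f w' ∘ₗ P.twist 1

/-- The identity morphism. -/
def idMor (s : LSet K ι) (P : GrMod K ι) (w : Word s) : P →ₗ[K] P :=
  if w = emptyWord s then LinearMap.id else 0

/-- The word `l` in the factor `x`. -/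
def single (x : s.I) (l : List (Letter (s.κ x).toGrMod)) : Word s := upd (emptyWord s) x l

/-- The total number of letters of a word. -/
def len (w : Word s) : ℕ := ∑ x, (w x).length

end maps

/-- A graded vector space with a map `μ : ⊗ₓ 𝓑 κ(x) ⊗ P → P` of degree `1`. -/
structure PreMod (s : LSet K ι) extends GrMod K ι where
  μ : Word s → carrier →ₗ[K] carrier
  μ_mem : μ ∈ homPiece s toGrMod toGrMod 1

/-- The conditions on a polymodule: the differential of the bar construction squares to zero, and
the units act strictly. -/
structure IsPolymodule {s : LSet K ι} (M : PreMod s) : Prop where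
  rel : ∀ w, comp 1 M.μ M.μ w + preD M.μ w = 0
  unit_left : ∀ x, s.side x = true → M.μ (single x [⟨0, (s.κ x).one⟩]) = LinearMap.id
  unit_right : ∀ x, s.side x = false → M.μ (single x [⟨0, (s.κ x).one⟩]) = -M.twist 1
  unit_zero : ∀ (w : Word s) (x : s.I),
    (⟨0, (s.κ x).one⟩ : Letter (s.κ x).toGrMod) ∈ w x → len w ≠ 1 → M.μ w = 0

/-- A polymodule over the labelled set `s`. -/
structure Polymod (s : LSet K ι) extends PreMod s where
  isPolymodule : IsPolymodule toPreMod

section premod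

variable {s t : LSet K ι}

def PreMod.pull (i : LSet.Hom s t) (M : PreMod t) : PreMod s where
  toGrMod := M.toGrMod
  μ := PolyMod.pull i M.μ
  μ_mem := pull_mem i M.μ_mem

/-- The differential of the complex of morphisms, on a morphism of degree `k`. -/
def dMor {P Q : PreMod s} (k : ι) (φ : Word s → P.toGrMod →ₗ[K] Q.toGrMod) (w : Word s) :
    P.toGrMod →ₗ[K] Q.toGrMod :=
  comp k Q.μ φ w - sgn k • (comp 1 φ P.μ w + preD φ w)

/-- Strict maps: those which vanish as soon as there is a letter. -/
def IsStrict {P Q : GrMod K ι} (φ : Word s → P →ₗ[K] Q) : Prop :=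
  ∀ w, w ≠ emptyWord s → φ w = 0

end premod

/-! ### Tensor products -/

section words

variable {s : LSet K ι}

/-- The relations that make letters linear. -/
def wordRel (s : LSet K ι) : Set (Word s →₀ K) :=
  {z | ∃ (w : Word s) (x : s.I) (u v : List (Letter (s.κ x).toGrMod)) (i : ι)
    (a b : (s.κ x).piece i) (c : K),
    z = Finsupp.single (upd w x (u ++ ⟨i, a + c • b⟩ :: v)) 1 -
      Finsupp.single (upd w x (u ++ ⟨i, a⟩ :: v)) 1 -
      c • Finsupp.single (upd w x (u ++ ⟨i, b⟩ :: v)) 1}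

/-- The vector space `⊗ₓ 𝓑 κ(x)`: words modulo multilinearity in the letters. -/
def WordMod (s : LSet K ι) : Type u := (Word s →₀ K) ⧸ Submodule.span K (wordRel s)

instance : AddCommGroup (WordMod s) :=
  inferInstanceAs (AddCommGroup ((Word s →₀ K) ⧸ Submodule.span K (wordRel s)))

instance : Module K (WordMod s) :=
  inferInstanceAs (Module K ((Word s →₀ K) ⧸ Submodule.span K (wordRel s)))

/-- The class of a word. -/
def WordMod.mk (w : Word s) : WordMod s :=
  (Submodule.span K (wordRel s)).mkQ (Finsupp.single w 1)

theorem WordMod.mk_rel (w : Word s) (x : s.I) (u v : List (Letter (s.κ x).toGrMod)) (i : ι)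
    (a b : (s.κ x).piece i) (c : K) : WordMod.mk (upd w x (u ++ ⟨i, a + c • b⟩ :: v)) =
      WordMod.mk (upd w x (u ++ ⟨i, a⟩ :: v)) + c • WordMod.mk (upd w x (u ++ ⟨i, b⟩ :: v)) := by
  have h : (Submodule.span K (wordRel s)).mkQ
      (Finsupp.single (upd w x (u ++ ⟨i, a + c • b⟩ :: v)) 1 -
      Finsupp.single (upd w x (u ++ ⟨i, a⟩ :: v)) 1 -
      c • Finsupp.single (upd w x (u ++ ⟨i, b⟩ :: v)) 1) = 0 := by
    rw [Submodule.mkQ_apply, Submodule.Quotient.mk_eq_zero]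
    exact Submodule.subset_span ⟨w, x, u, v, i, a, b, c, rfl⟩
  rw [map_sub, map_sub, map_smul, sub_sub, sub_eq_zero] at h
  exact h

theorem WordMod.multilin_mk : Multilin (K := K) (WordMod.mk : Word s → WordMod s) :=
  fun w x u v i => by
    have h0 : WordMod.mk (upd w x (u ++ ⟨i, (0 : (s.κ x).piece i)⟩ :: v)) = 0 := by
      have := WordMod.mk_rel w x u v i 0 0 1
      rw [one_smul, one_smul, add_zero] at this
      exact left_eq_add.1 this
    refine ⟨fun a b => ?_, fun c a => ?_⟩
    · have := WordMod.mk_rel w x u v i a b 1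
      rwa [one_smul, one_smul] at this
    · have := WordMod.mk_rel w x u v i 0 a c
      rwa [zero_add, h0, zero_add] at this

/-- The linear map on `⊗ₓ 𝓑 κ(x)` given by a multilinear function of words. -/
def WordMod.lift {M : Type*} [AddCommGroup M] [Module K M] (f : Word s → M)
    (hf : Multilin (K := K) f) : WordMod s →ₗ[K] M :=
  (Submodule.span K (wordRel s)).liftQ (Finsupp.linearCombination K f) (by
    rw [Submodule.span_le]
    rintro _ ⟨w, x, u, v, i, a, b, c, rfl⟩
    have h := hf w x u v i
    simp [h.map_add, h.map_smul])

theorem WordMod.lift_mk {M : Type*} [AddCommGroup M] [Module K M] (f : Word s → M)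
    (hf : Multilin (K := K) f) (w : Word s) : WordMod.lift f hf (WordMod.mk w) = f w := by
  change (Submodule.span K (wordRel s)).liftQ _ _ (Submodule.Quotient.mk _) = _
  rw [Submodule.liftQ_apply]
  simp

theorem WordMod.ext {M : Type*} [AddCommGroup M] [Module K M] {f g : WordMod s →ₗ[K] M}
    (h : ∀ w, f (WordMod.mk w) = g (WordMod.mk w)) : f = g := by
  refine Submodule.linearMap_qext _ (Finsupp.lhom_ext fun w c => ?_)
  have := h w
  have e : Finsupp.single w c = c • Finsupp.single w (1 : K) := by simp
  rw [e, map_smul, map_smul]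
  exact congrArg (c • ·) this

end words

section tensor

variable {s : LSet K ι} {P P' Q Q' : GrMod K ι}

/-- The vector space `P ⊗ (⊗ₓ 𝓑 κ(x)) ⊗ Q`. -/
abbrev TSpace (s : LSet K ι) (P Q : GrMod K ι) : Type u := P ⊗[K] (WordMod s ⊗[K] Q)

/-- `(p, q) ↦ A p ⊗ [w] ⊗ B q`. -/
def tri (A : P →ₗ[K] P') (w : Word s) (B : Q →ₗ[K] Q') : P →ₗ[K] Q →ₗ[K] TSpace s P' Q' :=
  (TensorProduct.mk K P' (WordMod s ⊗[K] Q')).compl₁₂ A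
    ((TensorProduct.mk K (WordMod s) Q' (WordMod.mk w)) ∘ₗ B)

theorem tri_apply (A : P →ₗ[K] P') (w : Word s) (B : Q →ₗ[K] Q') (p : P) (q : Q) :
    tri A w B p q = A p ⊗ₜ (WordMod.mk w ⊗ₜ B q) := rfl

theorem multilin_tri_apply (p : P) (q : Q) :
    Multilin (K := K) fun w : Word s => (p ⊗ₜ (WordMod.mk w ⊗ₜ q) : TSpace s P Q) :=
  WordMod.multilin_mk.map ((TensorProduct.mk K P (WordMod s ⊗[K] Q) p) ∘ₗ
    (TensorProduct.mk K (WordMod s) Q).flip q)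

/-- The linear map on `P ⊗ (⊗ₓ 𝓑 κ(x)) ⊗ Q` given by a multilinear function. -/
def tlift {M : Type*} [AddCommGroup M] [Module K M] (F : Word s → P →ₗ[K] Q →ₗ[K] M)
    (hF : Multilin (K := K) F) : TSpace s P Q →ₗ[K] M :=
  TensorProduct.lift ((TensorProduct.uncurry (RingHom.id K) (WordMod s) Q M).comp
    (WordMod.lift F hF).flip)

theorem tlift_tmul {M : Type*} [AddCommGroup M] [Module K M] (F : Word s → P →ₗ[K] Q →ₗ[K] M)
    (hF : Multilin (K := K) F) (p : P) (w : Word s) (q : Q) :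
    tlift F hF (p ⊗ₜ (WordMod.mk w ⊗ₜ q)) = F w p q := by
  change (WordMod.lift F hF).flip p (WordMod.mk w) q = _
  rw [LinearMap.flip_apply, WordMod.lift_mk]

theorem tspace_ext {M : Type*} [AddCommGroup M] [Module K M] {f g : TSpace s P Q →ₗ[K] M}
    (h : ∀ p w q, f (p ⊗ₜ (WordMod.mk w ⊗ₜ q)) = g (p ⊗ₜ (WordMod.mk w ⊗ₜ q))) : f = g := by
  refine TensorProduct.ext (LinearMap.ext fun p => TensorProduct.ext ?_)
  exact WordMod.ext fun w => LinearMap.ext fun q => h p w q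

/-- Homogeneous elements of degree `i`. -/
def tgen (s : LSet K ι) (P Q : GrMod K ι) (i : ι) : Set (TSpace s P Q) :=
  {z | ∃ (a b : ι) (p : P) (w : Word s) (q : Q), p ∈ P.piece a ∧ q ∈ Q.piece b ∧
    a + deg w + b = i ∧ z = p ⊗ₜ (WordMod.mk w ⊗ₜ q)}

theorem tgen_span (s : LSet K ι) (P Q : GrMod K ι) :
    ⨆ i, Submodule.span K (tgen s P Q i) = ⊤ := by
  have key : ∀ p w q, (p ⊗ₜ (WordMod.mk w ⊗ₜ q) : TSpace s P Q) ∈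
      ⨆ i, Submodule.span K (tgen s P Q i) := by
    intro p w q
    have h2 : ∀ a, ∀ p ∈ P.piece a, ∀ q, (p ⊗ₜ (WordMod.mk w ⊗ₜ q) : TSpace s P Q) ∈
        ⨆ i, Submodule.span K (tgen s P Q i) := fun a p hp q =>
      Q.le_of_pieces (tri (Q := Q) LinearMap.id w LinearMap.id p)
        (⨆ i, Submodule.span K (tgen s P Q i)) (fun b q hq =>
          Submodule.mem_iSup_of_mem (a + deg w + b)
            (Submodule.subset_span ⟨a, b, p, w, q, hp, hq, rfl, rfl⟩)) q
    exact P.le_of_pieces ((tri (P := P) LinearMap.id w LinearMap.id).flip q) _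
      (fun a p hp => h2 a p hp q) p
  have h : (⨆ i, Submodule.span K (tgen s P Q i)).mkQ = 0 :=
    tspace_ext fun p w q => (Submodule.Quotient.mk_eq_zero _).2 (key p w q)
  rw [← Submodule.ker_mkQ (⨆ i, Submodule.span K (tgen s P Q i)), h, LinearMap.ker_zero]

/-- The function that sends homogeneous elements to themselves, placed in their degree. -/
def tdec (w : Word s) : P →ₗ[K] Q →ₗ[K] (ι → TSpace s P Q) :=
  P.elim fun a => (Q.elim fun b =>
    ((tri LinearMap.id w LinearMap.id).compr₂ (LinearMap.single K (fun _ => TSpace s P Q)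
      (a + deg w + b))).flip).flip

theorem tdec_of_mem (w : Word s) {a b : ι} {p : P} {q : Q} (hp : p ∈ P.piece a)
    (hq : q ∈ Q.piece b) :
    tdec w p q = LinearMap.single K (fun _ => TSpace s P Q) (a + deg w + b)
      (p ⊗ₜ (WordMod.mk w ⊗ₜ q)) := by
  unfold tdec
  rw [P.elim_of_mem _ hp, LinearMap.flip_apply, Q.elim_of_mem _ hq]
  rfl

theorem multilin_tdec : Multilin (K := K) (tdec : Word s → P →ₗ[K] Q →ₗ[K] _) := by
  refine multilin_of_pieces fun a p hp => multilin_of_pieces fun b q hq => ?_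
  simp only [tdec_of_mem _ hp hq]
  refine Multilin.diag
    (fun c w => LinearMap.single K (fun _ => TSpace s P Q) (a + deg c + b)
      (p ⊗ₜ[K] (WordMod.mk w ⊗ₜ[K] q))) (fun c => ?_)
    fun c c' h => by rw [h.deg]
  exact (multilin_tri_apply p q).map (LinearMap.single K (fun _ => TSpace s P Q) (a + deg c + b))

/-- The graded vector space `P ⊗ (⊗ₓ 𝓑 κ(x)) ⊗ Q`. -/
def tens (s : LSet K ι) (P Q : GrMod K ι) : GrMod K ι :=
  GrMod.ofSpan (TSpace s P Q) (tgen s P Q) (tgen_span s P Q) (tlift tdec multilin_tdec) (by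
    rintro i _ ⟨a, b, p, w, q, hp, hq, rfl, rfl⟩
    rw [tlift_tmul, tdec_of_mem w hp hq])

/-- The identification of the underlying vector space of `tens s P Q`. -/
def tensEquiv (s : LSet K ι) (P Q : GrMod K ι) : TSpace s P Q ≃ₗ[K] tens s P Q :=
  LinearEquiv.refl K (TSpace s P Q)

/-- The bilinear map `(p, q) ↦ A p ⊗ [w] ⊗ B q`. -/
def tmap (A : P →ₗ[K] P') (w : Word s) (B : Q →ₗ[K] Q') : P →ₗ[K] Q →ₗ[K] tens s P' Q' :=
  (tri A w B).compr₂ (tensEquiv s P' Q' : TSpace s P' Q' →ₗ[K] tens s P' Q')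

/-- The element `p ⊗ [w] ⊗ q`. -/
def tmk (p : P) (w : Word s) (q : Q) : tens s P Q := tmap LinearMap.id w LinearMap.id p q

theorem tmap_apply (A : P →ₗ[K] P') (w : Word s) (B : Q →ₗ[K] Q') (p : P) (q : Q) :
    tmap A w B p q = tmk (A p) w (B q) := rfl

theorem tmk_mem {a b i : ι} {p : P} {w : Word s} {q : Q} (hp : p ∈ P.piece a)
    (hq : q ∈ Q.piece b) (h : a + deg w + b = i) : tmk p w q ∈ (tens s P Q).piece i :=
  (Submodule.subset_span ⟨a, b, p, w, q, hp, hq, h, rfl⟩ :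
    (p ⊗ₜ (WordMod.mk w ⊗ₜ q) : TSpace s P Q) ∈ Submodule.span K (tgen s P Q i))

theorem tens_piece_le {i : ι} {N : Submodule K (tens s P Q)}
    (h : ∀ a b, ∀ p ∈ P.piece a, ∀ w, ∀ q ∈ Q.piece b, a + deg w + b = i → tmk p w q ∈ N) :
    (tens s P Q).piece i ≤ N := by
  refine Submodule.span_le.2 ?_
  rintro _ ⟨a, b, p, w, q, hp, hq, hi, rfl⟩
  exact h a b p hp w q hq hi

/-- The linear map on `P ⊗ (⊗ₓ 𝓑 κ(x)) ⊗ Q` given by a multilinear function. -/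
def tensLift {M : Type*} [AddCommGroup M] [Module K M] (F : Word s → P →ₗ[K] Q →ₗ[K] M)
    (hF : Multilin (K := K) F) : tens s P Q →ₗ[K] M :=
  tlift F hF ∘ₗ ((tensEquiv s P Q).symm : tens s P Q →ₗ[K] TSpace s P Q)

theorem tensLift_tmk {M : Type*} [AddCommGroup M] [Module K M] (F : Word s → P →ₗ[K] Q →ₗ[K] M)
    (hF : Multilin (K := K) F) (p : P) (w : Word s) (q : Q) :
    tensLift F hF (tmk p w q) = F w p q := tlift_tmul F hF p w q

theorem tens_ext {M : Type*} [AddCommGroup M] [Module K M] {f g : tens s P Q →ₗ[K] M}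
    (h : ∀ p w q, f (tmk p w q) = g (tmk p w q)) : f = g := by
  have : f ∘ₗ (tensEquiv s P Q : TSpace s P Q →ₗ[K] tens s P Q) =
      g ∘ₗ (tensEquiv s P Q : TSpace s P Q →ₗ[K] tens s P Q) := tspace_ext h
  exact LinearMap.ext fun x => LinearMap.congr_fun this ((tensEquiv s P Q).symm x)

theorem multilin_tmap (A : P →ₗ[K] P') (B : Q →ₗ[K] Q') :
    Multilin (K := K) fun w : Word s => tmap A w B :=
  multilin_lin fun p => multilin_lin fun q => (multilin_tri_apply (A p) (B q)).map
    (tensEquiv s P' Q' : TSpace s P' Q' →ₗ[K] tens s P' Q')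

theorem multilin_tmap_left {t : LSet K ι} {f : Word t → P →ₗ[K] P'} (hf : Multilin (K := K) f)
    (w : Word s) (B : Q →ₗ[K] Q') : Multilin (K := K) fun v => tmap (f v) w B :=
  multilin_lin fun p => multilin_lin fun q => hf.map
    ((tmap LinearMap.id w LinearMap.id).flip (B q) ∘ₗ LinearMap.applyₗ p)

theorem multilin_tmap_right {t : LSet K ι} {f : Word t → Q →ₗ[K] Q'} (hf : Multilin (K := K) f)
    (A : P →ₗ[K] P') (w : Word s) : Multilin (K := K) fun v => tmap A w (f v) :=
  multilin_lin fun p => multilin_lin fun q => hf.map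
    (tmap LinearMap.id w LinearMap.id (A p) ∘ₗ LinearMap.applyₗ q)

/-- A family of maps on `P ⊗ (⊗ₓ 𝓑 κ(x)) ⊗ Q`, described on generators, is homogeneous. -/
theorem tensLift_mem {t : LSet K ι} {R : GrMod K ι} {k : ι}
    (F : Word t → Word s → P →ₗ[K] Q →ₗ[K] R)
    (hF : ∀ v, Multilin (K := K) (F v)) (hF' : ∀ g, Multilin (K := K) fun v => F v g)
    (hdeg : ∀ v g a b, ∀ p ∈ P.piece a, ∀ q ∈ Q.piece b,
      F v g p q ∈ R.piece (a + deg g + b + deg v + k)) :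
    (fun v => tensLift (F v) (hF v)) ∈ homPiece t (tens s P Q) R k := by
  constructor
  · intro w x u v i
    refine ⟨fun a b => tens_ext fun p g q => ?_, fun c a => tens_ext fun p g q => ?_⟩
    · rw [LinearMap.add_apply]
      beta_reduce
      rw [tensLift_tmk, tensLift_tmk, tensLift_tmk]
      exact LinearMap.congr_fun (LinearMap.congr_fun ((hF' g w x u v i).map_add a b) p) q
    · rw [LinearMap.smul_apply]
      beta_reduce
      rw [tensLift_tmk, tensLift_tmk]
      exact LinearMap.congr_fun (LinearMap.congr_fun ((hF' g w x u v i).map_smul c a) p) q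
  · intro v i z hz
    have : (tens s P Q).piece i ≤ (R.piece (i + deg v + k)).comap (tensLift (F v) (hF v)) :=
      tens_piece_le fun a b p hp g q hq hi => by
        rw [Submodule.mem_comap, tensLift_tmk, ← hi]
        exact hdeg v g a b p hp q hq
    exact this hz

end tensor

section structure_maps

variable {s t r₁ r₂ : LSet K ι} {P P' Q Q' : GrMod K ι} {k : ι}

/-- Extend a function of words over `r₁` by zero to words over `r₁ ⊔ r₂`. -/
def extL (r₂ : LSet K ι) (h : Word r₁ → P →ₗ[K] Q) (w : Word (r₁.sum r₂)) : P →ₗ[K] Q :=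
  if sndW w = emptyWord r₂ then h (fstW w) else 0

/-- Extend a function of words over `r₂` by zero to words over `r₁ ⊔ r₂`. -/
def extR (r₁ : LSet K ι) (h : Word r₂ → P →ₗ[K] Q) (w : Word (r₁.sum r₂)) : P →ₗ[K] Q :=
  if fstW w = emptyWord r₁ then h (sndW w) else 0

/-- Extend a single map by zero to all words. -/
def extE (s : LSet K ι) (h : P →ₗ[K] Q) (w : Word s) : P →ₗ[K] Q :=
  if w = emptyWord s then h else 0

theorem extL_mem {h : Word r₁ → P →ₗ[K] Q} (hh : h ∈ homPiece r₁ P Q k) :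
    extL r₂ h ∈ homPiece (r₁.sum r₂) P Q k :=
  ⟨hh.1.ite_snd, fun w i p hp => by
    unfold extL
    split_ifs with h0
    · have := hh.2 (fstW w) i p hp
      rwa [deg_eq, h0, deg_emptyWord, add_zero]
    · exact Submodule.zero_mem _⟩

theorem extR_mem {h : Word r₂ → P →ₗ[K] Q} (hh : h ∈ homPiece r₂ P Q k) :
    extR r₁ h ∈ homPiece (r₁.sum r₂) P Q k :=
  ⟨hh.1.ite_fst, fun w i p hp => by
    unfold extR
    split_ifs with h0
    · have := hh.2 (sndW w) i p hp
      rwa [deg_eq, h0, deg_emptyWord, zero_add]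
    · exact Submodule.zero_mem _⟩

theorem extE_mem {h : P →ₗ[K] Q} (hh : ∀ i, ∀ p ∈ P.piece i, h p ∈ Q.piece (i + k)) :
    extE s h ∈ homPiece s P Q k := by
  refine ⟨multilin_of_line fun x i W hW => ?_, fun w i p hp => ?_⟩
  · simp only [extE, hW.ne_empty, if_false]
    exact ⟨fun _ _ => by simp, fun _ _ => by simp⟩
  · unfold extE
    split_ifs with h0
    · rw [h0, deg_emptyWord, add_zero]
      exact hh i p hp
    · exact Submodule.zero_mem _

/-- A word over `s`, as a word over `s*`. -/
def toDual (w : Word s) : Word s.dual := w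

theorem deg_toDual (w : Word s) : deg (toDual w) = deg w := rfl

theorem Multilin.toDual {M : Type*} [AddCommGroup M] [Module K M] {f : Word s.dual → M}
    (hf : Multilin (K := K) f) : Multilin (K := K) fun w => f (toDual w) := hf

theorem multilin_sum {M : Type*} [AddCommGroup M] [Module K M] {α : Type*} (S : Finset α)
    {f : α → Word s → M} (hf : ∀ i ∈ S, Multilin (K := K) (f i)) :
    Multilin (K := K) fun w => ∑ i ∈ S, f i w :=
  fun w x u v i => isLinearMap_sum S fun j hj => hf j hj w x u v i

/-- The action of `f` on the first factor of `P ⊗ 𝓑 ⊗ Q`: the words `o` in the decompositions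
`g = (o, n)` are absorbed by `f`. -/
def tensLFun (f : Word (s.dual.sum r₁) → P →ₗ[K] P') (v : Word r₁) (g : Word s) :
    P →ₗ[K] Q →ₗ[K] tens s P' Q :=
  ∑ c ∈ cuts g,
    sgn (shuffle (outer g c) (inner g c) +
      degR (outer g c) * (deg (inner g c) + degL (outer g c) + degL v) +
      degR v * deg (inner g c)) •
    tmap (f (pair (toDual (outer g c)) v) ∘ₗ P.twist (degR (outer g c))) (inner g c)
      (Q.twist (degR v))

/-- The action of `f`, of degree `k`, on the last factor of `P ⊗ 𝓑 ⊗ Q`: the words `n` in the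
decompositions `g = (o, n)` are absorbed by `f`. -/
def tensRFun (k : ι) (f : Word (s.sum r₂) → Q →ₗ[K] Q') (v : Word r₂) (g : Word s) :
    P →ₗ[K] Q →ₗ[K] tens s P Q' :=
  ∑ c ∈ cuts g,
    sgn (shuffle (outer g c) (inner g c) + degR (outer g c) * deg (inner g c) +
      degL v * (deg (outer g c) + degL (inner g c)) + k * deg (outer g c)) •
    tmap (P.twist (degL v + k)) (outer g c)
      (f (pair (inner g c) v) ∘ₗ Q.twist (degR (inner g c)))

/-- The differential of the middle factor of `P ⊗ 𝓑 ⊗ Q`. -/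
def tensDFun (g : Word s) : P →ₗ[K] Q →ₗ[K] tens s P Q :=
  barSum g fun _ g' => tmap (P.twist 1) g' LinearMap.id

theorem multilin_tensLFun {f : Word (s.dual.sum r₁) → P →ₗ[K] P'} (hf : Multilin (K := K) f)
    (v : Word r₁) : Multilin (K := K) (tensLFun (Q := Q) f v) := by
  refine multilin_cuts (fun o n : Word s => sgn (shuffle o n +
      degR o * (deg n + degL o + degL v) + degR v * deg n) •
    tmap (f (pair (toDual o) v) ∘ₗ P.twist (degR o)) n (Q.twist (degR v)))
    (fun n => ?_) (fun o => ?_)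
  · refine Multilin.diag (fun c o : Word s => sgn (shuffle c n +
      degR c * (deg n + degL c + degL v) + degR v * deg n) •
      tmap (f (pair (toDual o) v) ∘ₗ P.twist (degR c)) n (Q.twist (degR v)))
      (fun c => multilin_sgn _ (fun _ _ _ => rfl) (multilin_tmap_left ?_ _ _)) fun c c' h => ?_
    · exact multilin_lin fun p => (hf.pair_left v).toDual.map (LinearMap.applyₗ (P.twist (degR c) p))
    · funext o
      rw [h.shuffle_left, h.degR, h.degL]
  · exact multilin_sgn (fun n => shuffle o n + degR o * (deg n + degL o + degL v) + degR v * deg n)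
      (fun w w' h => by rw [h.shuffle_right, h.deg]) (multilin_tmap _ _)

theorem multilin_tensRFun {f : Word (s.sum r₂) → Q →ₗ[K] Q'} (hf : Multilin (K := K) f)
    (v : Word r₂) : Multilin (K := K) (tensRFun (P := P) k f v) := by
  refine multilin_cuts (fun o n : Word s => sgn (shuffle o n + degR o * deg n +
      degL v * (deg o + degL n) + k * deg o) •
    tmap (P.twist (degL v + k)) o (f (pair n v) ∘ₗ Q.twist (degR n)))
    (fun n => ?_) (fun o => ?_)
  · exact multilin_sgn (fun o => shuffle o n + degR o * deg n +
      degL v * (deg o + degL n) + k * deg o)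
      (fun w w' h => by rw [h.shuffle_left, h.deg, h.degR]) (multilin_tmap _ _)
  · refine Multilin.diag (fun c n : Word s => sgn (shuffle o c + degR o * deg c +
      degL v * (deg o + degL c) + k * deg o) •
      tmap (P.twist (degL v + k)) o (f (pair n v) ∘ₗ Q.twist (degR c)))
      (fun c => multilin_sgn _ (fun _ _ _ => rfl) (multilin_tmap_right ?_ _ _)) fun c c' h => ?_
    · exact multilin_lin fun p => (hf.pair_left v).map (LinearMap.applyₗ (Q.twist (degR c) p))
    · funext o
      rw [h.shuffle_right, h.degR, h.degL, h.deg]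

theorem multilin_tensDFun :
    Multilin (K := K) (tensDFun : Word s → P →ₗ[K] Q →ₗ[K] tens s P Q) :=
  multilin_barSum _ fun _ => multilin_tmap _ _

/-- `f ⊗ 1`, for a map `f` out of `𝓑 ⊗ P`. -/
def tensL (r₂ : LSet K ι) (Q : GrMod K ι) (f : homPiece (s.dual.sum r₁) P P' k) :
    homPiece (r₁.sum r₂) (tens s P Q) (tens s P' Q) k :=
  ⟨extL r₂ fun v => tensLift (tensLFun f.1 v) (multilin_tensLFun f.2.1 v), by
    refine extL_mem (tensLift_mem (tensLFun (Q := Q) f.1) _ (fun g => ?_) ?_)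
    · refine multilin_sum _ fun c _ => ?_
      generalize outer g c = o
      generalize inner g c = n
      refine Multilin.diag (fun w v : Word r₁ => sgn (shuffle o n +
        degR o * (deg n + degL o + degL w) + degR w * deg n) •
        tmap (f.1 (pair (toDual o) v) ∘ₗ P.twist (degR o)) n (Q.twist (degR w)))
        (fun c => multilin_sgn _ (fun _ _ _ => rfl) (multilin_tmap_left ?_ _ _)) fun c c' h => ?_
      · exact multilin_lin fun p =>
          (f.2.1.pair_right (toDual o)).map (LinearMap.applyₗ (P.twist (degR o) p))
      · funext v
        rw [h.degR, h.degL]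
    · intro v g a b p hp q hq
      unfold tensLFun
      rw [LinearMap.sum_apply, LinearMap.sum_apply]
      refine Submodule.sum_mem _ fun c _ => ?_
      rw [LinearMap.smul_apply, LinearMap.smul_apply]
      refine sgn_smul_mem _ _ ?_
      rw [tmap_apply]
      refine tmk_mem (f.2.2 _ a _ (P.twist_mem _ hp)) (Q.twist_mem _ hq) ?_
      rw [deg_pair, deg_toDual, ← deg_cut g c]
      ring⟩

/-- `1 ⊗ f`, for a map `f` out of `𝓑 ⊗ Q`. -/
def tensR (r₁ : LSet K ι) (P : GrMod K ι) (f : homPiece (s.sum r₂) Q Q' k) :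
    homPiece (r₁.sum r₂) (tens s P Q) (tens s P Q') k :=
  ⟨extR r₁ fun v => tensLift (tensRFun k f.1 v) (multilin_tensRFun f.2.1 v), by
    refine extR_mem (tensLift_mem (tensRFun (P := P) k f.1) _ (fun g => ?_) ?_)
    · refine multilin_sum _ fun c _ => ?_
      generalize outer g c = o
      generalize inner g c = n
      refine Multilin.diag (fun w v : Word r₂ => sgn (shuffle o n + degR o * deg n +
        degL w * (deg o + degL n) + k * deg o) •
        tmap (P.twist (degL w + k)) o (f.1 (pair n v) ∘ₗ Q.twist (degR n)))
        (fun c => multilin_sgn _ (fun _ _ _ => rfl) (multilin_tmap_right ?_ _ _)) fun c c' h => ?_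
      · exact multilin_lin fun p =>
          (f.2.1.pair_right n).map (LinearMap.applyₗ (Q.twist (degR n) p))
      · funext v
        rw [h.degL]
    · intro v g a b p hp q hq
      unfold tensRFun
      rw [LinearMap.sum_apply, LinearMap.sum_apply]
      refine Submodule.sum_mem _ fun c _ => ?_
      rw [LinearMap.smul_apply, LinearMap.smul_apply]
      refine sgn_smul_mem _ _ ?_
      rw [tmap_apply]
      refine tmk_mem (P.twist_mem _ hp) (f.2.2 _ b _ (Q.twist_mem _ hq)) ?_
      rw [deg_pair, ← deg_cut g c]
      ring⟩

/-- The differential of the middle factor of `P ⊗ 𝓑 ⊗ Q`. -/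
def tensD (s t : LSet K ι) (P Q : GrMod K ι) : homPiece t (tens s P Q) (tens s P Q) 1 :=
  ⟨extE t (tensLift tensDFun multilin_tensDFun), extE_mem fun i z hz => by
    have : (tens s P Q).piece i ≤
        ((tens s P Q).piece (i + 1)).comap (tensLift tensDFun multilin_tensDFun) :=
      tens_piece_le fun a b p hp g q hq hi => by
        rw [Submodule.mem_comap, tensLift_tmk]
        simp only [tensDFun, barSum, LinearMap.sum_apply, LinearMap.smul_apply]
        refine Submodule.sum_mem _ fun x _ => Submodule.sum_mem _ fun j _ =>
          Submodule.sum_mem _ fun l _ => sgn_smul_mem _ _ ?_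
        rw [tmap_apply]
        refine tmk_mem (P.twist_mem _ hp) hq ?_
        rw [deg_contract, ← hi]
        ring
    exact this hz⟩

end structure_maps

/-! ### Internal Hom -/

section internal_hom

variable {s t r₁ r₂ : LSet K ι} {P P' Q Q' : GrMod K ι} {k : ι}

theorem PHom.twist_val {i : ι} {φ : PHom s P Q} (hφ : φ ∈ (PHom s P Q).piece i) (d : ι) :
    PHom.val ((PHom s P Q).twist d φ) = sgn (d * i) • PHom.val φ := by
  rw [(PHom s P Q).twist_of_mem d hφ]
  rcases Int.units_eq_one_or (sgn (d * i)) with h | h <;> rw [h] <;> simp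

/-- Postcomposition of `φ` with `f : 𝓑 ⊗ Q → Q'`, evaluated at the letters `v` and `a`. -/
def postFun (f : Word (s.sum r₂) → Q →ₗ[K] Q') (v : Word r₂) :
    PHom s P Q →ₗ[K] (Word s → P →ₗ[K] Q') :=
  LinearMap.pi fun a => ∑ c ∈ cuts a,
    sgn (shuffle (outer a c) (inner a c) + degR v * (deg (outer a c) + deg (inner a c)) +
      degL (outer a c) * degL v) •
    (LinearMap.llcomp K P Q Q' (f (pair (outer a c) v)) ∘ₗ
      (LinearMap.lcomp K Q (P.twist (degR v)) ∘ₗ LinearMap.proj (inner a c)) ∘ₗ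
        PHom.val ∘ₗ (PHom s P Q).twist (degL (outer a c)))

theorem postFun_apply (f : Word (s.sum r₂) → Q →ₗ[K] Q') (v : Word r₂) (φ : PHom s P Q)
    (a : Word s) : postFun f v φ a = ∑ c ∈ cuts a,
      sgn (shuffle (outer a c) (inner a c) + degR v * (deg (outer a c) + deg (inner a c)) +
        degL (outer a c) * degL v) •
      (f (pair (outer a c) v) ∘ₗ
        PHom.val ((PHom s P Q).twist (degL (outer a c)) φ) (inner a c) ∘ₗ
          P.twist (degR v)) := by
  simp only [postFun, LinearMap.pi_apply, LinearMap.sum_apply, LinearMap.smul_apply]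
  rfl

/-- Precomposition of `φ` with `f : 𝓑 ⊗ P' → P`, of degree `k`, evaluated at the letters `u`
and `a`. -/
def preFun (k : ι) (f : Word (s.sum r₁) → P' →ₗ[K] P) (u : Word r₁) :
    PHom s P Q →ₗ[K] (Word s → P' →ₗ[K] Q) :=
  LinearMap.pi fun a => ∑ c ∈ cuts a,
    sgn (shuffle (outer a c) (inner a c) +
      degL u * (degL (outer a c) + degL (inner a c)) +
      degR u * (degL (outer a c) + degL (inner a c) + degL u + degR (inner a c)) +
      k * degL (outer a c)) •
    ((LinearMap.lcomp K Q (f (pair (inner a c) u) ∘ₗ P'.twist (degR u)) ∘ₗ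
      LinearMap.proj (outer a c)) ∘ₗ PHom.val ∘ₗ (PHom s P Q).twist (degR u + k))

theorem preFun_apply (f : Word (s.sum r₁) → P' →ₗ[K] P) (u : Word r₁) (φ : PHom s P Q)
    (a : Word s) : preFun k f u φ a = ∑ c ∈ cuts a,
      sgn (shuffle (outer a c) (inner a c) +
        degL u * (degL (outer a c) + degL (inner a c)) +
        degR u * (degL (outer a c) + degL (inner a c) + degL u + degR (inner a c)) +
        k * degL (outer a c)) •
      (PHom.val ((PHom s P Q).twist (degR u + k) φ) (outer a c) ∘ₗ
        f (pair (inner a c) u) ∘ₗ P'.twist (degR u)) := by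
  simp only [preFun, LinearMap.pi_apply, LinearMap.sum_apply, LinearMap.smul_apply]
  rfl

/-- Precomposition of `φ` with the differential of the bar coalgebra. -/
def dFun : PHom s P Q →ₗ[K] (Word s → P →ₗ[K] Q) :=
  LinearMap.pi fun a => (∑ x, ∑ j ∈ Finset.range (a x).length,
    ∑ l ∈ Finset.range ((a x).length - j), sgn (before a x + wt ((a x).take j)) •
      ((if s.side x then LinearMap.id else LinearMap.lcomp K Q (P.twist 1)) ∘ₗ
        LinearMap.proj (contract a x j l))) ∘ₗ PHom.val ∘ₗ (PHom s P Q).twist 1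

theorem dFun_apply (φ : PHom s P Q) (a : Word s) :
    dFun φ a = preD (PHom.val ((PHom s P Q).twist 1 φ)) a := by
  simp only [dFun, preD, barSum, LinearMap.pi_apply, LinearMap.comp_apply, LinearMap.sum_apply,
    LinearMap.smul_apply]
  refine Finset.sum_congr rfl fun x _ => Finset.sum_congr rfl fun j _ =>
    Finset.sum_congr rfl fun l _ => ?_
  split_ifs <;> rfl

theorem PHom.lift_mem {V : GrMod K ι} {L : Word t → V →ₗ[K] (Word s → P →ₗ[K] Q)}
    (hL : Multilin (K := K) L)
    (h : ∀ v i, ∀ x ∈ V.piece i, L v x ∈ homPiece s P Q (i + (deg v + k))) :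
    (fun v => PHom.lift (L v) (deg v + k) (h v)) ∈ homPiece t V (PHom s P Q) k := by
  constructor
  · refine multilin_lin fun x => Multilin.of_injective PHom.val PHom.val_injective ?_
    exact hL.map (LinearMap.applyₗ x)
  · intro w i x hx
    have := h w i x hx
    rw [← add_assoc] at this
    exact this

theorem multilin_postFun {f : Word (s.sum r₂) → Q →ₗ[K] Q'} (hf : Multilin (K := K) f) :
    Multilin (K := K) (postFun (P := P) f) := by
  refine multilin_lin fun φ => multilin_pi fun a => ?_
  simp only [postFun_apply]
  refine multilin_sum _ fun c _ => ?_
  generalize outer a c = o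
  generalize inner a c = n
  refine Multilin.diag (fun w v : Word r₂ => sgn (shuffle o n + degR w * (deg o + deg n) +
    degL o * degL w) • (f (pair o v) ∘ₗ PHom.val ((PHom s P Q).twist (degL o) φ) n ∘ₗ
      P.twist (degR w))) (fun c => multilin_sgn _ (fun _ _ _ => rfl) ?_) fun c c' h => ?_
  · exact multilin_lin fun p => (hf.pair_right o).map (LinearMap.applyₗ _)
  · funext v
    rw [h.degR, h.degL]

theorem multilin_preFun {f : Word (s.sum r₁) → P' →ₗ[K] P} (hf : Multilin (K := K) f) :
    Multilin (K := K) (preFun (Q := Q) k f) := by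
  refine multilin_lin fun φ => multilin_pi fun a => ?_
  simp only [preFun_apply]
  refine multilin_sum _ fun c _ => ?_
  generalize outer a c = o
  generalize inner a c = n
  refine Multilin.diag (fun w u : Word r₁ => sgn (shuffle o n + degL w * (degL o + degL n) +
    degR w * (degL o + degL n + degL w + degR n) + k * degL o) •
    (PHom.val ((PHom s P Q).twist (degR w + k) φ) o ∘ₗ f (pair n u) ∘ₗ P'.twist (degR w)))
    (fun c => multilin_sgn _ (fun _ _ _ => rfl) ?_) fun c c' h => ?_
  · exact multilin_lin fun p => (hf.pair_right n).map
      (PHom.val ((PHom s P Q).twist (degR c + k) φ) o ∘ₗ LinearMap.applyₗ _)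
  · funext v
    rw [h.degR, h.degL]

theorem postFun_mem {f : Word (s.sum r₂) → Q →ₗ[K] Q'} (hf : f ∈ homPiece (s.sum r₂) Q Q' k)
    (v : Word r₂) (i : ι) (φ : PHom s P Q) (hφ : φ ∈ (PHom s P Q).piece i) :
    postFun f v φ ∈ homPiece s P Q' (i + (deg v + k)) := by
  have hφ' := PHom.val_mem hφ
  constructor
  · simp only [funext (postFun_apply f v φ), PHom.twist_val hφ]
    refine multilin_cuts (fun o n : Word s => sgn (shuffle o n + degR v * (deg o + deg n) +
      degL o * degL v) • (f (pair o v) ∘ₗ (sgn (degL o * i) • PHom.val φ) n ∘ₗ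
        P.twist (degR v))) (fun n => ?_) fun o => ?_
    · refine Multilin.diag (fun c o : Word s => sgn (shuffle c n + degR v * (deg c + deg n) +
        degL c * degL v) • (f (pair o v) ∘ₗ (sgn (degL c * i) • PHom.val φ) n ∘ₗ
        P.twist (degR v))) (fun c => multilin_sgn _ (fun _ _ _ => rfl) ?_) fun c c' h => ?_
      · exact multilin_lin fun p => (hf.1.pair_left v).map (LinearMap.applyₗ _)
      · funext o
        rw [h.shuffle_left, h.deg, h.degL]
    · refine multilin_sgn (fun n => shuffle o n + degR v * (deg o + deg n) + degL o * degL v)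
        (fun w w' h => by rw [h.shuffle_right, h.deg]) ?_
      refine multilin_lin fun p => Multilin.map (f := fun n =>
        (sgn (degL o * i) • PHom.val φ) n (P.twist (degR v) p)) ?_ (f (pair o v))
      exact multilin_sgn (fun _ => degL o * i) (fun _ _ _ => rfl)
        (hφ'.1.map (LinearMap.applyₗ (P.twist (degR v) p)))
  · intro a j p hp
    rw [postFun_apply, LinearMap.sum_apply]
    refine Submodule.sum_mem _ fun c _ => ?_
    rw [LinearMap.smul_apply]
    refine sgn_smul_mem _ _ ?_
    have h1 := hφ'.2 (inner a c) j _ (P.twist_mem (degR v) hp)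
    have h2 := hf.2 (pair (outer a c) v) _ _ (sgn_smul_mem _ (degL (outer a c) * i) h1)
    rw [PHom.twist_val hφ]
    rw [show j + deg a + (i + (deg v + k)) =
      j + deg (inner a c) + i + deg (pair (outer a c) v) + k by
        rw [deg_pair, ← deg_cut a c]; ring]
    exact h2

theorem preFun_mem {f : Word (s.sum r₁) → P' →ₗ[K] P} (hf : f ∈ homPiece (s.sum r₁) P' P k)
    (u : Word r₁) (i : ι) (φ : PHom s P Q) (hφ : φ ∈ (PHom s P Q).piece i) :
    preFun k f u φ ∈ homPiece s P' Q (i + (deg u + k)) := by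
  have hφ' := PHom.val_mem hφ
  constructor
  · simp only [funext (preFun_apply f u φ), PHom.twist_val hφ]
    refine multilin_cuts (fun o n : Word s => sgn (shuffle o n + degL u * (degL o + degL n) +
      degR u * (degL o + degL n + degL u + degR n) + k * degL o) •
      ((sgn ((degR u + k) * i) • PHom.val φ) o ∘ₗ f (pair n u) ∘ₗ P'.twist (degR u)))
      (fun n => ?_) fun o => ?_
    · refine multilin_sgn (fun o => shuffle o n + degL u * (degL o + degL n) +
        degR u * (degL o + degL n + degL u + degR n) + k * degL o)
        (fun w w' h => by rw [h.shuffle_left, h.degL]) ?_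
      refine multilin_lin fun p => ?_
      exact multilin_sgn (fun _ => (degR u + k) * i) (fun _ _ _ => rfl)
        (hφ'.1.map (LinearMap.applyₗ (f (pair n u) (P'.twist (degR u) p))))
    · refine multilin_sgn (fun n => shuffle o n + degL u * (degL o + degL n) +
        degR u * (degL o + degL n + degL u + degR n) + k * degL o)
        (fun w w' h => by rw [h.shuffle_right, h.degL, h.degR]) ?_
      exact multilin_lin fun p => (hf.1.pair_left u).map
        ((sgn ((degR u + k) * i) • PHom.val φ) o ∘ₗ LinearMap.applyₗ _)
  · intro a j p hp
    rw [preFun_apply, LinearMap.sum_apply]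
    refine Submodule.sum_mem _ fun c _ => ?_
    rw [LinearMap.smul_apply]
    refine sgn_smul_mem _ _ ?_
    have h1 := hf.2 (pair (inner a c) u) _ _ (P'.twist_mem (degR u) hp)
    have h2 := hφ'.2 (outer a c) _ _ h1
    rw [PHom.twist_val hφ]
    rw [show j + deg a + (i + (deg u + k)) =
      j + deg (pair (inner a c) u) + k + deg (outer a c) + i by
        rw [deg_pair, ← deg_cut a c]; ring]
    exact sgn_smul_mem _ ((degR u + k) * i) h2

theorem dFun_mem (i : ι) (φ : PHom s P Q) (hφ : φ ∈ (PHom s P Q).piece i) :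
    dFun φ ∈ homPiece s P Q (i + 1) := by
  have hφ' := (PHom s P Q).twist_mem 1 hφ
  have hφ'' := PHom.val_mem hφ'
  constructor
  · simp only [funext (dFun_apply φ)]
    refine multilin_barSum _ fun x => ?_
    split_ifs
    · exact hφ''.1
    · exact multilin_lin fun p => hφ''.1.map (LinearMap.applyₗ (P.twist 1 p))
  · intro a j p hp
    rw [dFun_apply]
    simp only [preD, barSum, LinearMap.sum_apply, LinearMap.smul_apply]
    refine Submodule.sum_mem _ fun x _ => Submodule.sum_mem _ fun m _ =>
      Submodule.sum_mem _ fun l _ => sgn_smul_mem _ _ ?_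
    have key : ∀ p ∈ P.piece j, PHom.val ((PHom s P Q).twist 1 φ) (contract a x m l) p ∈
        Q.piece (j + deg a + (i + 1)) := fun p hp => by
      have := hφ''.2 (contract a x m l) j p hp
      rw [deg_contract] at this
      rwa [show j + deg a + (i + 1) = j + (deg a + 1) + i by ring]
    split_ifs
    · exact key p hp
    · exact key _ (P.twist_mem 1 hp)

/-- A word over `s*`, as a word over `s`. -/
def ofDual (w : Word s.dual) : Word s := w

theorem dual_mem {h : Word s → P →ₗ[K] Q} (hh : h ∈ homPiece s P Q k) :
    (fun w => h (ofDual w)) ∈ homPiece s.dual P Q k :=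
  ⟨hh.1, hh.2⟩

/-- `φ ↦ f ∘ φ`, for a map `f` out of `𝓑 ⊗ Q`. -/
def homPost (r₁ : LSet K ι) (P : GrMod K ι) (f : homPiece (s.sum r₂) Q Q' k) :
    homPiece (r₁.dual.sum r₂) (PHom s P Q) (PHom s P Q') k :=
  ⟨extR r₁.dual fun v => PHom.lift (postFun f.1 v) (deg v + k) (postFun_mem f.2 v),
    extR_mem (PHom.lift_mem (multilin_postFun f.2.1) (postFun_mem f.2))⟩

/-- `φ ↦ ± φ ∘ f`, for a map `f` out of `𝓑 ⊗ P'`. -/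
def homPre (r₂ : LSet K ι) (Q : GrMod K ι) (f : homPiece (s.sum r₁) P' P k) :
    homPiece (r₁.dual.sum r₂) (PHom s P Q) (PHom s P' Q) k :=
  ⟨extL r₂ fun u => PHom.lift (preFun k f.1 (ofDual u)) (deg (ofDual u) + k)
      (preFun_mem f.2 (ofDual u)),
    extL_mem (dual_mem (PHom.lift_mem (multilin_preFun f.2.1) (preFun_mem f.2)))⟩

/-- `φ ↦ ± φ ∘ d`, for the differential `d` of the bar coalgebra. -/
def homD (s t : LSet K ι) (P Q : GrMod K ι) : homPiece t (PHom s P Q) (PHom s P Q) 1 :=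
  ⟨extE t (PHom.lift dFun 1 dFun_mem), extE_mem fun i φ hφ => dFun_mem i φ hφ⟩

end internal_hom

/-! ### Tensor products and internal Hom of polymodules -/

section label_maps

variable {s t u : LSet K ι}

/-- The morphism out of a disjoint union given by two morphisms with disjoint images. -/
def LSet.Hom.desc (i : LSet.Hom s u) (j : LSet.Hom t u)
    (h : Disjoint (Set.range i.f) (Set.range j.f)) : LSet.Hom (s.sum t) u where
  f := Sum.elim i.f j.f
  inj := by
    have h' : ∀ x y, i.f x ≠ j.f y := fun x y e =>
      Set.disjoint_left.1 h ⟨x, rfl⟩ ⟨y, e.symm⟩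
    exact i.inj.sumElim j.inj h'
  side_eq := by rintro (x | x); exacts [i.side_eq x, j.side_eq x]
  κ_eq := by rintro (x | x); exacts [i.κ_eq x, j.κ_eq x]

/-- The inclusion of the complement of a subset. -/
def LSet.Hom.incl (A : Set t.I) : LSet.Hom (t.minus A) t where
  f := Subtype.val
  inj := Subtype.val_injective
  side_eq _ := rfl
  κ_eq _ := rfl

/-- A morphism that avoids `A`, as a morphism to the complement of `A`. -/
def LSet.Hom.avoid (i : LSet.Hom s t) (A : Set t.I) (h : Disjoint A (Set.range i.f)) :
    LSet.Hom s (t.minus A) where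
  f x := ⟨i.f x, fun hx => Set.disjoint_left.1 h hx ⟨x, rfl⟩⟩
  inj _ _ e := i.inj (congrArg Subtype.val e)
  side_eq := i.side_eq
  κ_eq := i.κ_eq

/-- The inclusion of the first summand, after a morphism. -/
def LSet.Hom.toL (i : LSet.Hom s t) (u : LSet K ι) : LSet.Hom s (t.sum u) where
  f x := Sum.inl (i.f x)
  inj _ _ e := i.inj (Sum.inl_injective e)
  side_eq := i.side_eq
  κ_eq := i.κ_eq

/-- The inclusion of the second summand, after a morphism. -/
def LSet.Hom.toR (i : LSet.Hom s t) (u : LSet K ι) : LSet.Hom s (u.sum t) where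
  f x := Sum.inr (i.f x)
  inj _ _ e := i.inj (Sum.inr_injective e)
  side_eq := i.side_eq
  κ_eq := i.κ_eq

/-- The dual morphism `s* → t*`. -/
def LSet.Hom.dual (i : LSet.Hom s t) : LSet.Hom s.dual t.dual where
  f := i.f
  inj := i.inj
  side_eq x := congrArg (! ·) (i.side_eq x)
  κ_eq := i.κ_eq

theorem disjoint_toL_toR (i : LSet.Hom s t) {s' t' : LSet K ι} (j : LSet.Hom s' t') :
    Disjoint (Set.range (i.toL t').f) (Set.range (j.toR t).f) := by
  rw [Set.disjoint_left]
  rintro _ ⟨x, rfl⟩ ⟨y, e⟩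
  exact Sum.inr_ne_inl e

/-- `i ⊔ j`. -/
def LSet.Hom.sum (i : LSet.Hom s t) {s' t' : LSet K ι} (j : LSet.Hom s' t') :
    LSet.Hom (s.sum s') (t.sum t') :=
  (i.toL t').desc (j.toR t) (disjoint_toL_toR i j)

/-- Restriction of scalars of morphisms. -/
def pullHom {P Q : GrMod K ι} {k : ι} (i : LSet.Hom s t) (f : homPiece t P Q k) :
    homPiece s P Q k := ⟨pull i f.1, pull_mem i f.2⟩

end label_maps

section gluing

variable {s₀ s₁ s₂ : LSet K ι}

theorem disjoint_incl {s t : LSet K ι} (i : LSet.Hom s t) :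
    Disjoint (Set.range i.f) (Set.range (LSet.Hom.incl (Set.range i.f)).f) := by
  rw [Set.disjoint_left]
  rintro y hy ⟨x, rfl⟩
  exact x.2 hy

/-- The decomposition `s₂ = s₀ ⊔ (s₂ - s₀)` given by a morphism `s₀ → s₂`. -/
def split (i : LSet.Hom s₀ s₂) : LSet.Hom (s₀.sum (s₂.minus (Set.range i.f))) s₂ :=
  i.desc (LSet.Hom.incl _) (disjoint_incl i)

/-- The decomposition `s₁ = s₀* ⊔ (s₁ - s₀)` given by a morphism `s₀ → s₁*`. -/
def splitDual (i : LSet.Hom s₀ s₁.dual) : LSet.Hom (s₀.dual.sum (s₁.minus (Set.range i.f))) s₁ :=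
  split i.flip

/-- `s₁ ♯ s₂`, glued along `s₀`. -/
abbrev glue (i₁ : LSet.Hom s₀ s₁.dual) (i₂ : LSet.Hom s₀ s₂) : LSet K ι :=
  (s₁.minus (Set.range i₁.f)).sum (s₂.minus (Set.range i₂.f))

/-- `s₁* ♯ s₂`, glued along `s₀`. -/
abbrev glueHom (i₁ : LSet.Hom s₀ s₁) (i₂ : LSet.Hom s₀ s₂) : LSet K ι :=
  (s₁.minus (Set.range i₁.f)).dual.sum (s₂.minus (Set.range i₂.f))

/-- `f ⊗ 1 : P ⊗ Q → P' ⊗ Q` for a morphism `f : P → P'`. -/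
def tensorMapL (i₁ : LSet.Hom s₀ s₁.dual) (i₂ : LSet.Hom s₀ s₂) {P P' : GrMod K ι} (Q : GrMod K ι)
    {k : ι} (f : homPiece s₁ P P' k) : homPiece (glue i₁ i₂) (tens s₀ P Q) (tens s₀ P' Q) k :=
  tensL _ Q (pullHom (splitDual i₁) f)

/-- `1 ⊗ f : P ⊗ Q → P ⊗ Q'` for a morphism `f : Q → Q'`. -/
def tensorMapR (i₁ : LSet.Hom s₀ s₁.dual) (i₂ : LSet.Hom s₀ s₂) (P : GrMod K ι) {Q Q' : GrMod K ι}
    {k : ι} (f : homPiece s₂ Q Q' k) : homPiece (glue i₁ i₂) (tens s₀ P Q) (tens s₀ P Q') k :=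
  tensR _ P (pullHom (split i₂) f)

/-- `φ ↦ f ∘ φ` from `Hom(P, Q)` to `Hom(P, Q')` for a morphism `f : Q → Q'`. -/
def ihomPost (i₁ : LSet.Hom s₀ s₁) (i₂ : LSet.Hom s₀ s₂) (P : GrMod K ι) {Q Q' : GrMod K ι}
    {k : ι} (f : homPiece s₂ Q Q' k) : homPiece (glueHom i₁ i₂) (PHom s₀ P Q) (PHom s₀ P Q') k :=
  homPost _ P (pullHom (split i₂) f)

/-- `φ ↦ (-1)^{k |φ|} φ ∘ f` from `Hom(P, Q)` to `Hom(P', Q)` for a morphism `f : P' → P` of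
degree `k`. -/
def ihomPre (i₁ : LSet.Hom s₀ s₁) (i₂ : LSet.Hom s₀ s₂) {P P' : GrMod K ι} (Q : GrMod K ι)
    {k : ι} (f : homPiece s₁ P' P k) : homPiece (glueHom i₁ i₂) (PHom s₀ P Q) (PHom s₀ P' Q) k :=
  homPre _ Q (pullHom (split i₁) f)

/-- The tensor product `P₁ ⊗_{s₀} P₂` of polymodules: the underlying graded vector space is
`P₁ ⊗ (⊗ₓ 𝓑 κ(x)) ⊗ P₂`. -/
def tensor (i₁ : LSet.Hom s₀ s₁.dual) (i₂ : LSet.Hom s₀ s₂) (P₁ : PreMod s₁) (P₂ : PreMod s₂) :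
    PreMod (glue i₁ i₂) :=
  let m : homPiece (glue i₁ i₂) (tens s₀ P₁.toGrMod P₂.toGrMod) (tens s₀ P₁.toGrMod P₂.toGrMod) 1 :=
    tensorMapL i₁ i₂ P₂.toGrMod ⟨P₁.μ, P₁.μ_mem⟩ + tensorMapR i₁ i₂ P₁.toGrMod ⟨P₂.μ, P₂.μ_mem⟩ +
      tensD s₀ (glue i₁ i₂) P₁.toGrMod P₂.toGrMod
  { toGrMod := tens s₀ P₁.toGrMod P₂.toGrMod
    μ := m.1
    μ_mem := m.2 }

/-- The internal Hom `Hom_{s₀}(P₁, P₂)` of polymodules: the underlying graded vector space consists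
of the maps `(⊗ₓ 𝓑 κ(x)) ⊗ P₁ → P₂`. -/
def ihom (i₁ : LSet.Hom s₀ s₁) (i₂ : LSet.Hom s₀ s₂) (P₁ : PreMod s₁) (P₂ : PreMod s₂) :
    PreMod (glueHom i₁ i₂) :=
  let m : homPiece (glueHom i₁ i₂) (PHom s₀ P₁.toGrMod P₂.toGrMod)
      (PHom s₀ P₁.toGrMod P₂.toGrMod) 1 :=
    ihomPost i₁ i₂ P₁.toGrMod ⟨P₂.μ, P₂.μ_mem⟩ - ihomPre i₁ i₂ P₂.toGrMod ⟨P₁.μ, P₁.μ_mem⟩ -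
      homD s₀ (glueHom i₁ i₂) P₁.toGrMod P₂.toGrMod
  { toGrMod := PHom s₀ P₁.toGrMod P₂.toGrMod
    μ := m.1
    μ_mem := m.2 }

end gluing

/-! ### Lattice filtrations -/

section filtrations

variable {s : LSet K ι}

/-- The step `γ` of the filtration of `P ⊗ (⊗ₓ 𝓑 κ(x)) ⊗ Q` by the lengths of words. -/
def tensFilt (s : LSet K ι) (P Q : GrMod K ι) (γ : s.I → ℤ) : Submodule K (tens s P Q) :=
  Submodule.span K {z | ∃ (p : P) (w : Word s) (q : Q),
    (∀ x, ((w x).length : ℤ) ≤ γ x) ∧ z = tmk p w q}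

/-- The maps `φ : (⊗ₓ 𝓑 κ(x)) ⊗ P → Q` that send `(⊗ₓ 𝓑 κ(x))_{-β} ⊗ U` to `V`. For `U = P` and
`V = 0` this is the step `β` of the filtration of the internal Hom dual to the length filtration. -/
def homFilt (s : LSet K ι) {P Q : GrMod K ι} (U : Submodule K P) (V : Submodule K Q)
    (β : s.I → ℤ) : Submodule K (PHom s P Q) where
  carrier := {φ | ∀ a : Word s, (∀ x, ((a x).length : ℤ) ≤ -β x) → ∀ p ∈ U, PHom.val φ a p ∈ V}
  zero_mem' _ _ _ _ := by simp
  add_mem' h h' a ha p hp := by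
    simpa using V.add_mem (h a ha p hp) (h' a ha p hp)
  smul_mem' c _ h a ha p hp := by
    simpa using V.smul_mem c (h a ha p hp)

/-- `F` is a filtration of `M` by graded subspaces that are stable under the structure maps. -/
structure IsLatticeFiltration (M : PreMod s) {L : Type} (F : (L → ℤ) → Submodule K M.toGrMod) :
    Prop where
  mono : Monotone F
  graded : ∀ γ, F γ = ⨆ i, F γ ⊓ M.piece i
  stable : ∀ γ w, ∀ p ∈ F γ, M.μ w p ∈ F γ

/-- `Φ` is an isomorphism of lattice filtered polymodules: a closed strict morphism of degree `0`
with a closed strict inverse, that identifies the filtrations. -/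
structure IsFilteredIso {M N : PreMod s} {L : Type} (F : (L → ℤ) → Submodule K M.toGrMod)
    (G : (L → ℤ) → Submodule K N.toGrMod) (Φ : homPiece s M.toGrMod N.toGrMod 0) : Prop where
  strict : IsStrict Φ.1
  closed : ∀ w, dMor 0 Φ.1 w = 0
  inverse : ∃ Ψ : homPiece s N.toGrMod M.toGrMod 0, IsStrict Ψ.1 ∧ (∀ w, dMor 0 Ψ.1 w = 0) ∧
    comp 0 Ψ.1 Φ.1 = idMor s M.toGrMod ∧ comp 0 Φ.1 Ψ.1 = idMor s N.toGrMod
  filtered : ∀ γ, (F γ).map (Φ.1 (emptyWord s)) = G γ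

end filtrations

/-! ### Gluing cycles -/

/-- A gluing cycle: gluing data for `(s₁, s₂)` along `s₁₂`, for `(s₂*, s₃)` along `s₂₃` and for
`(s₃, s₁*)` along `s₃₁`, with disjoint images. -/
structure GluingCycle (K : Type u) (ι : Type) [Field K] [CommRing ι] [Module ι (Additive ℤˣ)] where
  s₁ : LSet K ι
  s₂ : LSet K ι
  s₃ : LSet K ι
  s₁₂ : LSet K ι
  s₂₃ : LSet K ι
  s₃₁ : LSet K ι
  i₁₂ : LSet.Hom s₁₂ s₁.dual
  i₁₂' : LSet.Hom s₁₂ s₂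
  i₂₃ : LSet.Hom s₂₃ s₂
  i₂₃' : LSet.Hom s₂₃ s₃
  i₃₁ : LSet.Hom s₃₁ s₃.dual
  i₃₁' : LSet.Hom s₃₁ s₁.dual
  disj₁ : Disjoint (Set.range i₁₂.f) (Set.range i₃₁'.f)
  disj₂ : Disjoint (Set.range i₁₂'.f) (Set.range i₂₃.f)
  disj₃ : Disjoint (Set.range i₃₁.f) (Set.range i₂₃'.f)

namespace GluingCycle

variable (r : GluingCycle K ι)

/-- The unglued part of `s₁`. -/
abbrev q₁ : LSet K ι := r.s₁.minus (Set.range r.i₁₂.f ∪ Set.range r.i₃₁'.f)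

/-- The unglued part of `s₂`. -/
abbrev q₂ : LSet K ι := r.s₂.minus (Set.range r.i₁₂'.f ∪ Set.range r.i₂₃.f)

/-- The unglued part of `s₃`. -/
abbrev q₃ : LSet K ι := r.s₃.minus (Set.range r.i₃₁.f ∪ Set.range r.i₂₃'.f)

/-- The labelled set `(s₁ ♯ s₂)* ♯ s₃` of half edges. -/
abbrev sr : LSet K ι := (r.q₁.sum r.q₂).dual.sum r.q₃

/-- The index set of the lattice of filtrations. -/
abbrev L : Type := (r.s₁₂.I ⊕ r.s₂₃.I) ⊕ r.s₃₁.I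

/-- `s₃₁* ⊔ s₂₃ → s₁ ♯ s₂`. -/
def h₁₂ : LSet.Hom (r.s₃₁.dual.sum r.s₂₃) (glue r.i₁₂ r.i₁₂') :=
  (r.i₃₁'.flip.avoid (Set.range r.i₁₂.f) r.disj₁).sum
    (r.i₂₃.avoid (Set.range r.i₁₂'.f) r.disj₂)

/-- `s₃₁* ⊔ s₂₃ → s₃`. -/
def h₃ : LSet.Hom (r.s₃₁.dual.sum r.s₂₃) r.s₃ := r.i₃₁.flip.desc r.i₂₃' r.disj₃

/-- `s₃₁* ⊔ s₁₂* → s₁`. -/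
def k₁ : LSet.Hom (r.s₃₁.dual.sum r.s₁₂.dual) r.s₁ := r.i₃₁'.flip.desc r.i₁₂.flip r.disj₁.symm

/-- `s₃₁* ⊔ s₁₂* → s₂* ♯ s₃`. -/
def k₂₃ : LSet.Hom (r.s₃₁.dual.sum r.s₁₂.dual) (glueHom r.i₂₃ r.i₂₃') :=
  ((r.i₃₁.flip.avoid (Set.range r.i₂₃'.f) r.disj₃.symm).toR _).desc
    ((r.i₁₂'.avoid (Set.range r.i₂₃.f) r.disj₂.symm).dual.toL _)
    (disjoint_toL_toR _ _).symm

/-- `s₁₂ ⊔ s₂₃ → s₂`. -/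
def l₂ : LSet.Hom (r.s₁₂.sum r.s₂₃) r.s₂ := r.i₁₂'.desc r.i₂₃ r.disj₂

/-- `s₁₂ ⊔ s₂₃ → s₁* ♯ s₃`. -/
def l₁₃ : LSet.Hom (r.s₁₂.sum r.s₂₃) (glueHom r.i₃₁'.flip r.i₃₁.flip) :=
  LSet.Hom.sum (s' := r.s₂₃)
    (LSet.Hom.avoid (t := r.s₁.dual) r.i₁₂ (Set.range r.i₃₁'.f) r.disj₁.symm)
    (r.i₂₃'.avoid (Set.range r.i₃₁.f) r.disj₃)

theorem notMem_h₁₂_left (x : r.q₁.I) (hx : x.1 ∉ Set.range r.i₁₂.f) :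
    (Sum.inl ⟨x.1, hx⟩ : (glue r.i₁₂ r.i₁₂').I) ∉ Set.range r.h₁₂.f := by
  rintro ⟨y | y, hy⟩
  · exact x.2 (Or.inr ⟨y, congrArg Subtype.val (Sum.inl_injective hy)⟩)
  · exact Sum.inr_ne_inl hy

theorem notMem_h₁₂_right (x : r.q₂.I) (hx : x.1 ∉ Set.range r.i₁₂'.f) :
    (Sum.inr ⟨x.1, hx⟩ : (glue r.i₁₂ r.i₁₂').I) ∉ Set.range r.h₁₂.f := by
  rintro ⟨y | y, hy⟩
  · exact Sum.inl_ne_inr hy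
  · exact x.2 (Or.inr ⟨y, congrArg Subtype.val (Sum.inr_injective hy)⟩)

theorem notMem_h₃ (x : r.q₃.I) : x.1 ∉ Set.range r.h₃.f := by
  rintro ⟨y | y, hy⟩
  · exact x.2 (Or.inl ⟨y, hy⟩)
  · exact x.2 (Or.inr ⟨y, hy⟩)

theorem notMem_k₁ (x : r.q₁.I) : x.1 ∉ Set.range r.k₁.f := by
  rintro ⟨y | y, hy⟩
  · exact x.2 (Or.inr ⟨y, hy⟩)
  · exact x.2 (Or.inl ⟨y, hy⟩)

theorem notMem_k₂₃_left (x : r.q₂.I) (hx : x.1 ∉ Set.range r.i₂₃.f) :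
    (Sum.inl ⟨x.1, hx⟩ : (glueHom r.i₂₃ r.i₂₃').I) ∉ Set.range r.k₂₃.f := by
  rintro ⟨y | y, hy⟩
  · exact Sum.inr_ne_inl hy
  · exact x.2 (Or.inl ⟨y, congrArg Subtype.val (Sum.inl_injective hy)⟩)

theorem notMem_k₂₃_right (x : r.q₃.I) (hx : x.1 ∉ Set.range r.i₂₃'.f) :
    (Sum.inr ⟨x.1, hx⟩ : (glueHom r.i₂₃ r.i₂₃').I) ∉ Set.range r.k₂₃.f := by
  rintro ⟨y | y, hy⟩
  · exact x.2 (Or.inl ⟨y, congrArg Subtype.val (Sum.inr_injective hy)⟩)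
  · exact Sum.inl_ne_inr hy

theorem notMem_l₂ (x : r.q₂.I) : x.1 ∉ Set.range r.l₂.f := by
  rintro ⟨y | y, hy⟩
  · exact x.2 (Or.inl ⟨y, hy⟩)
  · exact x.2 (Or.inr ⟨y, hy⟩)

theorem notMem_l₁₃_left (x : r.q₁.I) (hx : x.1 ∉ Set.range r.i₃₁'.f) :
    (Sum.inl ⟨x.1, hx⟩ : (glueHom r.i₃₁'.flip r.i₃₁.flip).I) ∉ Set.range r.l₁₃.f := by
  rintro ⟨y | y, hy⟩
  · exact x.2 (Or.inl ⟨y, congrArg Subtype.val (Sum.inl_injective hy)⟩)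
  · exact Sum.inr_ne_inl hy

theorem notMem_l₁₃_right (x : r.q₃.I) (hx : x.1 ∉ Set.range r.i₃₁.f) :
    (Sum.inr ⟨x.1, hx⟩ : (glueHom r.i₃₁'.flip r.i₃₁.flip).I) ∉ Set.range r.l₁₃.f := by
  rintro ⟨y | y, hy⟩
  · exact Sum.inl_ne_inr hy
  · exact x.2 (Or.inr ⟨y, congrArg Subtype.val (Sum.inr_injective hy)⟩)

/-- The half edges as the labels of `Hom(P₁ ⊗ P₂, P₃)`. -/
def eL : LSet.Hom r.sr (glueHom r.h₁₂ r.h₃) where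
  f := Sum.elim
    (Sum.elim
      (fun x => Sum.inl ⟨Sum.inl ⟨x.1, fun h => x.2 (Or.inl h)⟩, r.notMem_h₁₂_left x _⟩)
      (fun x => Sum.inl ⟨Sum.inr ⟨x.1, fun h => x.2 (Or.inl h)⟩, r.notMem_h₁₂_right x _⟩))
    (fun x => Sum.inr ⟨x.1, r.notMem_h₃ x⟩)
  inj := by
    rintro ((⟨x, _⟩ | ⟨x, _⟩) | ⟨x, _⟩) ((⟨y, _⟩ | ⟨y, _⟩) | ⟨y, _⟩) <;> simp
  side_eq := by rintro ((x | x) | x) <;> rfl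
  κ_eq := by rintro ((x | x) | x) <;> rfl

/-- The half edges as the labels of `Hom(P₁, Hom(P₂, P₃))`. -/
def eR : LSet.Hom r.sr (glueHom r.k₁ r.k₂₃) where
  f := Sum.elim
    (Sum.elim
      (fun x => Sum.inl ⟨x.1, r.notMem_k₁ x⟩)
      (fun x => Sum.inr ⟨Sum.inl ⟨x.1, fun h => x.2 (Or.inr h)⟩, r.notMem_k₂₃_left x _⟩))
    (fun x => Sum.inr ⟨Sum.inr ⟨x.1, fun h => x.2 (Or.inr h)⟩, r.notMem_k₂₃_right x _⟩)
  inj := by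
    rintro ((⟨x, _⟩ | ⟨x, _⟩) | ⟨x, _⟩) ((⟨y, _⟩ | ⟨y, _⟩) | ⟨y, _⟩) <;> simp
  side_eq := by rintro ((x | x) | x) <;> rfl
  κ_eq := by rintro ((x | x) | x) <;> rfl

/-- The half edges as the labels of `Hom(P₂, Hom(P₁, P₃))`. -/
def eR' : LSet.Hom r.sr (glueHom r.l₂ r.l₁₃) where
  f := Sum.elim
    (Sum.elim
      (fun x => Sum.inr ⟨Sum.inl ⟨x.1, fun h => x.2 (Or.inr h)⟩, r.notMem_l₁₃_left x _⟩)
      (fun x => Sum.inl ⟨x.1, r.notMem_l₂ x⟩))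
    (fun x => Sum.inr ⟨Sum.inr ⟨x.1, fun h => x.2 (Or.inl h)⟩, r.notMem_l₁₃_right x _⟩)
  inj := by
    rintro ((⟨x, _⟩ | ⟨x, _⟩) | ⟨x, _⟩) ((⟨y, _⟩ | ⟨y, _⟩) | ⟨y, _⟩) <;> simp
  side_eq := by rintro ((x | x) | x) <;> rfl
  κ_eq := by rintro ((x | x) | x) <;> rfl

end GluingCycle

namespace GluingCycle

variable (r : GluingCycle K ι)

/-- The graded vector space underlying `Hom(P₁ ⊗ P₂, P₃)`. -/
abbrev lhsGr (P₁ P₂ P₃ : GrMod K ι) : GrMod K ι :=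
  PHom (r.s₃₁.dual.sum r.s₂₃) (tens r.s₁₂ P₁ P₂) P₃

/-- The graded vector space underlying `Hom(P₁, Hom(P₂, P₃))`. -/
abbrev rhsGr (P₁ P₂ P₃ : GrMod K ι) : GrMod K ι :=
  PHom (r.s₃₁.dual.sum r.s₁₂.dual) P₁ (PHom r.s₂₃ P₂ P₃)

/-- The graded vector space underlying `Hom(P₂, Hom(P₁, P₃))`. -/
abbrev rhsGr' (P₁ P₂ P₃ : GrMod K ι) : GrMod K ι :=
  PHom (r.s₁₂.sum r.s₂₃) P₂ (PHom r.s₃₁.dual P₁ P₃)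

/-- The polymodule `P₁ ⊗_{s₁₂} P₂`. -/
def tensor₁₂ (P₁ : PreMod r.s₁) (P₂ : PreMod r.s₂) : PreMod (glue r.i₁₂ r.i₁₂') :=
  tensor r.i₁₂ r.i₁₂' P₁ P₂

/-- The polymodule `Hom_{s₂₃}(P₂, P₃)`. -/
def hom₂₃ (P₂ : PreMod r.s₂) (P₃ : PreMod r.s₃) : PreMod (glueHom r.i₂₃ r.i₂₃') :=
  ihom r.i₂₃ r.i₂₃' P₂ P₃

/-- The polymodule `Hom_{s₃₁*}(P₁, P₃)`. -/
def hom₁₃ (P₁ : PreMod r.s₁) (P₃ : PreMod r.s₃) : PreMod (glueHom r.i₃₁'.flip r.i₃₁.flip) :=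
  ihom r.i₃₁'.flip r.i₃₁.flip P₁ P₃

/-- The polymodule `Hom_{s₃₁* ⊔ s₂₃}(P₁ ⊗_{s₁₂} P₂, P₃)` over the half edges. -/
def lhs (P₁ : PreMod r.s₁) (P₂ : PreMod r.s₂) (P₃ : PreMod r.s₃) : PreMod r.sr :=
  (ihom r.h₁₂ r.h₃ (r.tensor₁₂ P₁ P₂) P₃).pull r.eL

/-- The polymodule `Hom_{s₃₁* ⊔ s₁₂*}(P₁, Hom_{s₂₃}(P₂, P₃))` over the half edges. -/
def rhs (P₁ : PreMod r.s₁) (P₂ : PreMod r.s₂) (P₃ : PreMod r.s₃) : PreMod r.sr :=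
  (ihom r.k₁ r.k₂₃ P₁ (r.hom₂₃ P₂ P₃)).pull r.eR

/-- The polymodule `Hom_{s₁₂ ⊔ s₂₃}(P₂, Hom_{s₃₁*}(P₁, P₃))` over the half edges. -/
def rhs' (P₁ : PreMod r.s₁) (P₂ : PreMod r.s₂) (P₃ : PreMod r.s₃) : PreMod r.sr :=
  (ihom r.l₂ r.l₁₃ P₂ (r.hom₁₃ P₁ P₃)).pull r.eR'

variable {P₁ P₁' P₂ P₂' P₃ P₃' : GrMod K ι} {k : ι}

/-- The lattice filtration of `Hom(P₁ ⊗ P₂, P₃)`, induced by that of `P₁ ⊗ P₂` and by the lengths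
of words over `s₃₁* ⊔ s₂₃`. -/
def lhsFilt (P₁ P₂ P₃ : GrMod K ι) (γ : r.L → ℤ) : Submodule K (r.lhsGr P₁ P₂ P₃) :=
  homFilt (r.s₃₁.dual.sum r.s₂₃) (tensFilt r.s₁₂ P₁ P₂ fun x => -γ (Sum.inl (Sum.inl x))) ⊥
    (Sum.elim (fun x => γ (Sum.inr x)) fun x => γ (Sum.inl (Sum.inr x)))

/-- The lattice filtration of `Hom(P₁, Hom(P₂, P₃))`, induced by that of `Hom(P₂, P₃)` and by the
lengths of words over `s₃₁* ⊔ s₁₂*`. -/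
def rhsFilt (P₁ P₂ P₃ : GrMod K ι) (γ : r.L → ℤ) : Submodule K (r.rhsGr P₁ P₂ P₃) :=
  homFilt (r.s₃₁.dual.sum r.s₁₂.dual) ⊤ (homFilt r.s₂₃ ⊤ ⊥ fun x => γ (Sum.inl (Sum.inr x)))
    (Sum.elim (fun x => γ (Sum.inr x)) fun x => γ (Sum.inl (Sum.inl x)))

/-- The lattice filtration of `Hom(P₂, Hom(P₁, P₃))`. -/
def rhsFilt' (P₁ P₂ P₃ : GrMod K ι) (γ : r.L → ℤ) : Submodule K (r.rhsGr' P₁ P₂ P₃) :=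
  homFilt (r.s₁₂.sum r.s₂₃) ⊤ (homFilt r.s₃₁.dual ⊤ ⊥ fun x => γ (Sum.inr x))
    (Sum.elim (fun x => γ (Sum.inl (Sum.inl x))) fun x => γ (Sum.inl (Sum.inr x)))

/-- `Hom(P₁ ⊗ P₂, P₃)` as a functor of `P₁`. -/
def lhsMap₁ (P₂ P₃ : GrMod K ι) (f : homPiece r.s₁ P₁' P₁ k) :
    homPiece r.sr (r.lhsGr P₁ P₂ P₃) (r.lhsGr P₁' P₂ P₃) k :=
  pullHom r.eL (ihomPre r.h₁₂ r.h₃ P₃ (tensorMapL r.i₁₂ r.i₁₂' P₂ f))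

/-- `Hom(P₁ ⊗ P₂, P₃)` as a functor of `P₂`. -/
def lhsMap₂ (P₁ P₃ : GrMod K ι) (f : homPiece r.s₂ P₂' P₂ k) :
    homPiece r.sr (r.lhsGr P₁ P₂ P₃) (r.lhsGr P₁ P₂' P₃) k :=
  pullHom r.eL (ihomPre r.h₁₂ r.h₃ P₃ (tensorMapR r.i₁₂ r.i₁₂' P₁ f))

/-- `Hom(P₁ ⊗ P₂, P₃)` as a functor of `P₃`. -/
def lhsMap₃ (P₁ P₂ : GrMod K ι) (f : homPiece r.s₃ P₃ P₃' k) :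
    homPiece r.sr (r.lhsGr P₁ P₂ P₃) (r.lhsGr P₁ P₂ P₃') k :=
  pullHom r.eL (ihomPost r.h₁₂ r.h₃ (tens r.s₁₂ P₁ P₂) f)

/-- `Hom(P₁, Hom(P₂, P₃))` as a functor of `P₁`. -/
def rhsMap₁ (P₂ P₃ : GrMod K ι) (f : homPiece r.s₁ P₁' P₁ k) :
    homPiece r.sr (r.rhsGr P₁ P₂ P₃) (r.rhsGr P₁' P₂ P₃) k :=
  pullHom r.eR (ihomPre r.k₁ r.k₂₃ (PHom r.s₂₃ P₂ P₃) f)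

/-- `Hom(P₁, Hom(P₂, P₃))` as a functor of `P₂`. -/
def rhsMap₂ (P₁ P₃ : GrMod K ι) (f : homPiece r.s₂ P₂' P₂ k) :
    homPiece r.sr (r.rhsGr P₁ P₂ P₃) (r.rhsGr P₁ P₂' P₃) k :=
  pullHom r.eR (ihomPost r.k₁ r.k₂₃ P₁ (ihomPre r.i₂₃ r.i₂₃' P₃ f))

/-- `Hom(P₁, Hom(P₂, P₃))` as a functor of `P₃`. -/
def rhsMap₃ (P₁ P₂ : GrMod K ι) (f : homPiece r.s₃ P₃ P₃' k) :
    homPiece r.sr (r.rhsGr P₁ P₂ P₃) (r.rhsGr P₁ P₂ P₃') k :=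
  pullHom r.eR (ihomPost r.k₁ r.k₂₃ P₁ (ihomPost r.i₂₃ r.i₂₃' P₂ f))

/-- `Hom(P₂, Hom(P₁, P₃))` as a functor of `P₁`. -/
def rhsMap₁' (P₂ P₃ : GrMod K ι) (f : homPiece r.s₁ P₁' P₁ k) :
    homPiece r.sr (r.rhsGr' P₁ P₂ P₃) (r.rhsGr' P₁' P₂ P₃) k :=
  pullHom r.eR' (ihomPost r.l₂ r.l₁₃ P₂ (ihomPre r.i₃₁'.flip r.i₃₁.flip P₃ f))

/-- `Hom(P₂, Hom(P₁, P₃))` as a functor of `P₂`. -/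
def rhsMap₂' (P₁ P₃ : GrMod K ι) (f : homPiece r.s₂ P₂' P₂ k) :
    homPiece r.sr (r.rhsGr' P₁ P₂ P₃) (r.rhsGr' P₁ P₂' P₃) k :=
  pullHom r.eR' (ihomPre r.l₂ r.l₁₃ (PHom r.s₃₁.dual P₁ P₃) f)

/-- `Hom(P₂, Hom(P₁, P₃))` as a functor of `P₃`. -/
def rhsMap₃' (P₁ P₂ : GrMod K ι) (f : homPiece r.s₃ P₃ P₃' k) :
    homPiece r.sr (r.rhsGr' P₁ P₂ P₃) (r.rhsGr' P₁ P₂ P₃') k :=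
  pullHom r.eR' (ihomPost r.l₂ r.l₁₃ P₂ (ihomPost r.i₃₁'.flip r.i₃₁.flip P₁ f))

end GluingCycle

end

end PolyMod

namespace PolyMod

noncomputable section

set_option linter.unusedSectionVars false
set_option linter.unusedSimpArgs false

variable {K : Type u} {ι : Type} [Field K] [CommRing ι] [Module ι (Additive ℤˣ)]

/-! ### Signs with exponents in `ZMod 2` -/

/-- The sign `(-1)^a` of a residue class modulo `2`. -/
def zs (a : ZMod 2) : ℤˣ := if a = 0 then 1 else -1

theorem zs_zero : zs 0 = 1 := if_pos rfl

theorem zs_one : zs 1 = -1 := by decide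

theorem zs_add (a b : ZMod 2) : zs (a + b) = zs a * zs b := by
  revert a b; decide

theorem sgn_add (a b : ι) : sgn (a + b) = sgn a * sgn b := uzpow_add _ _ _

theorem sgn_zero : sgn (0 : ι) = 1 := by
  have h := sgn_add (0 : ι) 0
  rw [add_zero] at h
  exact left_eq_mul.1 h

theorem sgn_one : sgn (1 : ι) = -1 := uzpow_one _

theorem sgn_mul (a b : ι) : sgn (a * b) = (sgn a) ^ b := uzpow_mul _ _ _

theorem sgn_mul_of_left {a b : ι} (h : sgn a = 1) : sgn (a * b) = 1 := by
  rw [sgn_mul, h]; exact one_uzpow b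

theorem sgn_mul_of_right {a b : ι} (h : sgn b = 1) : sgn (a * b) = 1 := by
  rw [mul_comm]; exact sgn_mul_of_left h

theorem sgn_mul_of_ne {a b : ι} (h : sgn a = -1) (h' : sgn b = -1) : sgn (a * b) = -1 := by
  rw [sgn_mul, h]; exact h'

/-- The parity of a degree. -/
def par : ι →+* ZMod 2 where
  toFun e := if sgn e = 1 then 0 else 1
  map_zero' := by simp [sgn_zero]
  map_one' := by simp [sgn_one]
  map_add' a b := by
    rw [sgn_add]
    rcases Int.units_eq_one_or (sgn a) with h | h <;>
      rcases Int.units_eq_one_or (sgn b) with h' | h' <;> rw [h, h'] <;> decide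
  map_mul' a b := by
    rcases Int.units_eq_one_or (sgn a) with h | h
    · simp [h, sgn_mul_of_left h]
    · rcases Int.units_eq_one_or (sgn b) with h' | h'
      · simp [h', sgn_mul_of_right h']
      · simp [h, h', sgn_mul_of_ne h h']

theorem sgn_eq (e : ι) : sgn e = zs (par e) := by
  change _ = zs (if sgn e = 1 then 0 else 1)
  rcases Int.units_eq_one_or (sgn e) with h | h <;> rw [h] <;> decide

section signs

variable {M : Type*} [AddCommGroup M]

theorem zs_smul_zs_smul (a b : ZMod 2) (x : M) : zs a • zs b • x = zs (a + b) • x := by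
  rw [zs_add, mul_smul]

theorem zs_zero_smul (x : M) : zs 0 • x = x := by rw [zs_zero, one_smul]

theorem zs_one_smul (x : M) : zs 1 • x = -x := by rw [zs_one, Units.neg_smul, one_smul]

theorem neg_eq_zs_smul (x : M) : -x = zs 1 • x := (zs_one_smul x).symm

theorem zs_add_one_smul (a : ZMod 2) (x : M) : zs (a + 1) • x = -(zs a • x) := by
  rw [zs_add, mul_smul, zs_one_smul, smul_neg]

theorem zs_smul_self (a : ZMod 2) (x : M) : zs a • zs a • x = x := by
  rw [zs_smul_zs_smul, CharTwo.add_self_eq_zero, zs_zero_smul]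

theorem zs_smul_injective (a : ZMod 2) : Function.Injective fun x : M => zs a • x :=
  fun x y h => by rw [← zs_smul_self a x, ← zs_smul_self a y]; exact congrArg (zs a • ·) h

theorem zs_smul_eq_zero {a : ZMod 2} {x : M} : zs a • x = 0 ↔ x = 0 :=
  ⟨fun h => zs_smul_injective a (h.trans (smul_zero _).symm), fun h => by rw [h, smul_zero]⟩

variable [Module K M]

theorem zs_smul_mem (p : Submodule K M) (e : ZMod 2) {x : M} (hx : x ∈ p) : zs e • x ∈ p := by
  rcases Int.units_eq_one_or (zs e) with h | h
  · simpa [h] using hx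
  · simpa [h] using hx

theorem zs_smul_mem_iff (p : Submodule K M) (e : ZMod 2) {x : M} : zs e • x ∈ p ↔ x ∈ p :=
  ⟨fun h => by simpa [zs_smul_self] using zs_smul_mem p e h, zs_smul_mem p e⟩

theorem map_zs_smul {N F : Type*} [AddCommGroup N] [FunLike F M N] [AddMonoidHomClass F M N]
    (L : F) (e : ZMod 2) (x : M) : L (zs e • x) = zs e • L x := by
  rcases Int.units_eq_one_or (zs e) with h | h <;> rw [h] <;> simp

end signs

/-! ### Sums over the decompositions of a list -/

section lists

variable {α M N : Type*} [AddCommGroup M] [AddCommGroup N]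

/-- The sum of `F u v` over all decompositions `l = u ++ v`. -/
def splitSum (l : List α) (F : List α → List α → M) : M :=
  ∑ m ∈ Finset.range (l.length + 1), F (l.take m) (l.drop m)

theorem splitSum_nil (F : List α → List α → M) : splitSum [] F = F [] [] := by simp [splitSum]

theorem splitSum_cons (a : α) (l : List α) (F : List α → List α → M) :
    splitSum (a :: l) F = F [] (a :: l) + splitSum l fun u v => F (a :: u) v := by
  unfold splitSum
  rw [List.length_cons, Finset.sum_range_succ', add_comm]
  rfl

theorem splitSum_congr {l : List α} {F G : List α → List α → M}
    (h : ∀ u v, u ++ v = l → F u v = G u v) : splitSum l F = splitSum l G :=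
  Finset.sum_congr rfl fun _ _ => h _ _ (List.take_append_drop _ _)

theorem splitSum_add (l : List α) (F G : List α → List α → M) :
    splitSum l (fun u v => F u v + G u v) = splitSum l F + splitSum l G := Finset.sum_add_distrib

theorem splitSum_zero (l : List α) : splitSum l (fun _ _ => (0 : M)) = 0 := Finset.sum_const_zero

theorem map_splitSum {F' : Type*} [FunLike F' M N] [AddMonoidHomClass F' M N] (L : F')
    (l : List α) (F : List α → List α → M) :
    L (splitSum l F) = splitSum l fun u v => L (F u v) := map_sum L _ _

theorem zs_smul_splitSum (e : ZMod 2) (l : List α) (F : List α → List α → M) :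
    zs e • splitSum l F = splitSum l fun u v => zs e • F u v := Finset.smul_sum

theorem splitSum_comm (l l' : List α) (F : List α → List α → List α → List α → M) :
    (splitSum l fun u v => splitSum l' fun u' v' => F u v u' v') =
      splitSum l' fun u' v' => splitSum l fun u v => F u v u' v' := Finset.sum_comm

theorem splitSum_assoc (l : List α) (F : List α → List α → List α → M) :
    splitSum l (fun u c => splitSum u fun a b => F a b c) =
      splitSum l fun a v => splitSum v fun b c => F a b c := by
  induction l generalizing F with
  | nil => simp only [splitSum_nil]
  | cons x l ih =>
    simp only [splitSum_cons, splitSum_nil, splitSum_add]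
    rw [ih, add_assoc]

theorem splitSum_append_cons (u : List α) (x : α) (v : List α) (F : List α → List α → M) :
    splitSum (u ++ x :: v) F = splitSum u (fun a b => F a (b ++ x :: v)) +
      splitSum v fun a b => F (u ++ x :: a) b := by
  induction u generalizing F with
  | nil => simp only [List.nil_append, splitSum_cons, splitSum_nil]
  | cons y u ih =>
    simp only [List.cons_append, splitSum_cons]
    rw [ih, add_assoc]

/-- The sum of `F u v` over all decompositions `l = u ++ v` with `u ≠ []`. -/
def splitSum' (l : List α) (F : List α → List α → M) : M :=
  splitSum l fun u v => if u = [] then 0 else F u v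

theorem splitSum'_eq (l : List α) (F : List α → List α → M) :
    splitSum' l F = ∑ k ∈ Finset.range l.length, F (l.take (k + 1)) (l.drop (k + 1)) := by
  unfold splitSum' splitSum
  rw [Finset.sum_range_succ']
  simp only [List.take_zero, if_true, add_zero]
  refine Finset.sum_congr rfl fun k hk => if_neg ?_
  rw [Finset.mem_range] at hk
  simp only [List.take_eq_nil_iff]
  rintro (h | h)
  · omega
  · simp [h] at hk

/-- The sum of `F a b c` over all decompositions `l = a ++ b ++ c` with `b ≠ []`. -/
def blockSum (l : List α) (F : List α → List α → List α → M) : M :=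
  splitSum l fun a v => splitSum v fun b c => if b = [] then 0 else F a b c

theorem blockSum_eq (l : List α) (F : List α → List α → List α → M) :
    blockSum l F = ∑ j ∈ Finset.range l.length, ∑ k ∈ Finset.range (l.length - j),
      F (l.take j) ((l.drop j).take (k + 1)) (l.drop (j + k + 1)) := by
  have h : blockSum l F = splitSum l fun a v => splitSum' v fun b c => F a b c := rfl
  rw [h]
  unfold splitSum
  rw [Finset.sum_range_succ]
  simp only [splitSum'_eq, List.drop_length, List.length_nil, Finset.range_zero, Finset.sum_empty,
    add_zero, List.length_drop, List.drop_drop, ← add_assoc]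

theorem blockSum_congr {l : List α} {F G : List α → List α → List α → M}
    (h : ∀ a b c, b ≠ [] → a ++ (b ++ c) = l → F a b c = G a b c) :
    blockSum l F = blockSum l G := by
  refine splitSum_congr fun a v hv => splitSum_congr fun b c hc => ?_
  split_ifs with hb
  · rfl
  · exact h a b c hb (by rw [hc, hv])

theorem blockSum_add (l : List α) (F G : List α → List α → List α → M) :
    blockSum l (fun a b c => F a b c + G a b c) = blockSum l F + blockSum l G := by
  simp only [blockSum_eq, Finset.sum_add_distrib]

theorem blockSum_zero (l : List α) : blockSum l (fun _ _ _ => (0 : M)) = 0 := by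
  simp only [blockSum_eq, Finset.sum_const_zero]

theorem map_blockSum {F' : Type*} [FunLike F' M N] [AddMonoidHomClass F' M N] (L : F')
    (l : List α) (F : List α → List α → List α → M) :
    L (blockSum l F) = blockSum l fun a b c => L (F a b c) := by
  simp only [blockSum_eq, map_sum]

theorem zs_smul_blockSum (e : ZMod 2) (l : List α) (F : List α → List α → List α → M) :
    zs e • blockSum l F = blockSum l fun a b c => zs e • F a b c := by
  simp only [blockSum_eq, Finset.smul_sum]

theorem splitSum_ite {p : Prop} [Decidable p] (l : List α) (F : List α → List α → M) :
    (splitSum l fun u v => if p then 0 else F u v) = if p then 0 else splitSum l F := by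
  split_ifs
  · exact splitSum_zero _
  · rfl

theorem splitSum_blockSum_right (l : List α) (F : List α → List α → List α → List α → M) :
    (splitSum l fun u v => blockSum v fun a b c => F u a b c) =
      blockSum l fun a b c => splitSum a fun u a' => F u a' b c := by
  unfold blockSum
  rw [← splitSum_assoc]
  refine splitSum_congr fun a v _ => ?_
  have : ∀ b c, (if b = [] then (0 : M) else splitSum a fun u a' => F u a' b c) =
      splitSum a fun u a' => if b = [] then 0 else F u a' b c := fun b c => by
    rw [splitSum_ite]
  simp only [this]
  exact Finset.sum_comm

theorem splitSum_blockSum_left (l : List α) (F : List α → List α → List α → List α → M) :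
    (splitSum l fun u v => blockSum u fun a b c => F a b c v) =
      blockSum l fun a b c => splitSum c fun c' v => F a b c' v := by
  unfold blockSum
  rw [splitSum_assoc]
  refine splitSum_congr fun a v _ => ?_
  rw [splitSum_assoc]
  refine splitSum_congr fun b c _ => ?_
  rw [splitSum_ite]

theorem blockSum_append_cons (u : List α) (x : α) (v : List α)
    (F : List α → List α → List α → M) :
    blockSum (u ++ x :: v) F = blockSum u (fun a b c => F a b (c ++ x :: v)) +
      (splitSum u fun a u' => splitSum v fun v' c => F a (u' ++ x :: v') c) +
      blockSum v fun a b c => F (u ++ x :: a) b c := by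
  unfold blockSum
  rw [splitSum_append_cons]
  congr 1
  rw [← splitSum_add]
  refine splitSum_congr fun a w _ => ?_
  rw [splitSum_append_cons]
  congr 1
  exact splitSum_congr fun v' c _ => if_neg (by simp)

end lists

/-! ### The bar differential of one factor -/

section bar

variable {A : AInfAlg K ι} {M N : Type*} [AddCommGroup M] [AddCommGroup N]

/-- The parity of the degree of a list of letters. -/
def pw {A : GrMod K ι} (l : List (Letter A)) : ZMod 2 := par (wt l)

theorem pw_nil {A : GrMod K ι} : pw ([] : List (Letter A)) = 0 := by simp [pw, wt]

theorem pw_append {A : GrMod K ι} (u v : List (Letter A)) : pw (u ++ v) = pw u + pw v := by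
  rw [pw, wt_append, map_add]; rfl

theorem pw_mLetter_cons (b v : List (Letter A.toGrMod)) :
    pw (A.mLetter b :: v) = pw b + 1 + pw v := by
  rw [pw, wt_cons, map_add]
  change par (wt b + 2 - 1) + pw v = _
  rw [show wt b + 2 - 1 = wt b + 1 by ring, map_add, map_one]; rfl

/-- The sum of `F` over the terms of the bar differential of a list. -/
def listDiff (l : List (Letter A.toGrMod)) (F : List (Letter A.toGrMod) → M) : M :=
  blockSum l fun a b c => zs (pw a) • F (a ++ A.mLetter b :: c)

theorem listDiff_congr {l : List (Letter A.toGrMod)} {F G : List (Letter A.toGrMod) → M}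
    (h : ∀ t, pw t = pw l + 1 → F t = G t) : listDiff l F = listDiff l G := by
  refine blockSum_congr fun a b c _ hl => ?_
  rw [h]
  rw [← hl, pw_append, pw_append, pw_append, pw_mLetter_cons]
  ring

/-- The bar differential is a coderivation. -/
theorem listDiff_splitSum (l : List (Letter A.toGrMod))
    (F : List (Letter A.toGrMod) → List (Letter A.toGrMod) → M) :
    listDiff l (fun t => splitSum t F) = splitSum l fun u v =>
      listDiff u (fun t => F t v) + zs (pw u) • listDiff v fun t => F u t := by
  unfold listDiff
  simp only [zs_smul_blockSum]
  rw [splitSum_add, splitSum_blockSum_left, splitSum_blockSum_right, ← blockSum_add]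
  refine blockSum_congr fun a b c _ _ => ?_
  rw [splitSum_append_cons, smul_add, zs_smul_splitSum, zs_smul_splitSum, add_comm]
  congr 1
  refine splitSum_congr fun u v h => ?_
  rw [zs_smul_zs_smul, ← h, pw_append]

variable [Module K M]

theorem listDiff_listDiff (l : List (Letter A.toGrMod)) (F : List (Letter A.toGrMod) → M)
    (hF : ∀ u v i, IsLinearMap K fun a : A.piece i => F (u ++ ⟨i, a⟩ :: v)) :
    listDiff l (fun t => listDiff t F) = 0 := by
  have hmid : ∀ a β c : List (Letter A.toGrMod), blockSum β (fun a2 b c1 =>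
      zs (pw a2) • F (a ++ A.mLetter (a2 ++ A.mLetter b :: c1) :: c)) = 0 := by
    intro α β γ
    have hlin := hF α γ (wt β + 1 + 2)
    let L : A.piece (wt β + 1 + 2) →ₗ[K] M := hlin.mk'
    have hm : ∀ a b c : List (Letter A.toGrMod), a ++ (b ++ c) = β →
        wt (a ++ A.mLetter b :: c) = wt β + 1 := by
      intro a b c h
      rw [← h, wt_append, wt_append, wt_append, wt_cons]
      change _ + (wt b + 2 - 1 + _) = _
      ring
    let g : List (Letter A.toGrMod) → List (Letter A.toGrMod) → List (Letter A.toGrMod) →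
      A.piece (wt β + 1 + 2) := fun a b c =>
        if h : a ++ (b ++ c) = β then
          ⟨A.m (a ++ A.mLetter b :: c), hm a b c h ▸ A.m_mem _⟩ else 0
    have hg : ∀ a b c, a ++ (b ++ c) = β →
        F (α ++ A.mLetter (a ++ A.mLetter b :: c) :: γ) = L (g a b c) := by
      intro a b c h
      change _ = F (α ++ ⟨_, g a b c⟩ :: γ)
      congr 3
      refine letter_ext ?_ ?_
      · rw [hm a b c h]
      · simp only [g, dif_pos h]
    have : blockSum β (fun a2 b c1 =>
        zs (pw a2) • F (α ++ A.mLetter (a2 ++ A.mLetter b :: c1) :: γ)) =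
        L (blockSum β fun a b c => zs (pw a) • g a b c) := by
      rw [map_blockSum]
      refine blockSum_congr fun a b c _ h => ?_
      rw [map_zs_smul, hg a b c h]
    rw [this]
    convert map_zero L
    have h0 : (A.piece (wt β + 1 + 2)).subtype (blockSum β fun a b c => zs (pw a) • g a b c) =
        0 := by
      rw [map_blockSum]
      have hr := A.m_rel β
      have hr' : blockSum β (fun a b c => sgn (wt a) • A.m (a ++ A.mLetter b :: c)) = 0 := by
        rw [blockSum_eq]; exact hr
      rw [← hr']
      refine blockSum_congr fun a b c _ h => ?_
      rw [map_zs_smul, sgn_eq]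
      simp only [g, dif_pos h]
      rfl
    exact Subtype.ext h0
  unfold listDiff
  simp only [blockSum_append_cons, smul_add, blockSum_add]
  -- the nested contractions
  have h2 : blockSum l (fun a b c => zs (pw a) • splitSum a fun α u' => splitSum c fun v' γ =>
      zs (pw α) • F (α ++ A.mLetter (u' ++ A.mLetter b :: v') :: γ)) = 0 := by
    have : blockSum l (fun a b c => zs (pw a) • splitSum a fun α u' => splitSum c fun v' γ =>
        zs (pw α) • F (α ++ A.mLetter (u' ++ A.mLetter b :: v') :: γ)) =
        splitSum l fun α v => splitSum v fun β γ => blockSum β fun a2 b c1 =>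
          zs (pw a2) • F (α ++ A.mLetter (a2 ++ A.mLetter b :: c1) :: γ) := by
      simp only [splitSum_blockSum_left, splitSum_blockSum_right]
      refine blockSum_congr fun a b c _ _ => ?_
      rw [zs_smul_splitSum]
      refine splitSum_congr fun α u h => ?_
      rw [zs_smul_splitSum]
      refine splitSum_congr fun v' γ _ => ?_
      rw [zs_smul_zs_smul, ← h, pw_append]
      congr 2
      grind
    rw [this]
    simp only [hmid, splitSum_zero]
  rw [h2, add_zero]
  -- the disjoint contractions
  have h3 : blockSum l (fun a b c => zs (pw a) • blockSum c fun a1 b1 c1 =>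
      zs (pw (a ++ A.mLetter b :: a1)) • F (a ++ A.mLetter b :: a1 ++ A.mLetter b1 :: c1)) =
      -blockSum l (fun a b c => zs (pw a) • blockSum a fun a1 b1 c1 =>
        zs (pw a1) • F (a1 ++ A.mLetter b1 :: (c1 ++ A.mLetter b :: c))) := by
    have e1 : blockSum l (fun a b c => zs (pw a) • blockSum c fun a1 b1 c1 =>
        zs (pw (a ++ A.mLetter b :: a1)) • F (a ++ A.mLetter b :: a1 ++ A.mLetter b1 :: c1)) =
        splitSum l fun a v => splitSum v fun b w => splitSum w fun a1 v1 => splitSum v1 fun b1 c1 =>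
          if b = [] then 0 else if b1 = [] then 0 else zs (pw b + pw a1 + 1) •
            F (a ++ A.mLetter b :: (a1 ++ A.mLetter b1 :: c1)) := by
      unfold blockSum
      refine splitSum_congr fun a v _ => splitSum_congr fun b c _ => ?_
      beta_reduce
      split_ifs with hb
      · simp only [splitSum_zero]
      · rw [zs_smul_splitSum]
        refine splitSum_congr fun a1 v1 _ => ?_
        rw [zs_smul_splitSum]
        refine splitSum_congr fun b1 c1 _ => ?_
        split_ifs
        · rw [smul_zero]
        · rw [zs_smul_zs_smul, pw_append, pw_mLetter_cons, List.append_assoc, List.cons_append]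
          congr 2
          grind
    have e2 : blockSum l (fun a b c => zs (pw a) • blockSum a fun a1 b1 c1 =>
        zs (pw a1) • F (a1 ++ A.mLetter b1 :: (c1 ++ A.mLetter b :: c))) =
        splitSum l fun a v => splitSum v fun b w => splitSum w fun a1 v1 => splitSum v1 fun b1 c1 =>
          if b = [] then 0 else if b1 = [] then 0 else zs (pw b + pw a1) •
            F (a ++ A.mLetter b :: (a1 ++ A.mLetter b1 :: c1)) := by
      rw [← splitSum_assoc]
      have swap : ∀ u w : List (Letter A.toGrMod), splitSum u (fun a b => splitSum w fun a1 v1 =>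
          splitSum v1 fun b1 c1 => if b = [] then (0 : M) else if b1 = [] then 0 else
            zs (pw b + pw a1) • F (a ++ A.mLetter b :: (a1 ++ A.mLetter b1 :: c1))) =
          splitSum w fun a1 v1 => splitSum u fun a b => splitSum v1 fun b1 c1 =>
            if b = [] then 0 else if b1 = [] then 0 else
            zs (pw b + pw a1) • F (a ++ A.mLetter b :: (a1 ++ A.mLetter b1 :: c1)) :=
        fun u w => splitSum_comm _ _ _
      simp only [swap]
      rw [← splitSum_assoc]
      refine splitSum_congr fun t v _ => ?_
      rw [splitSum_assoc]
      have : ∀ b c : List (Letter A.toGrMod), (if b = [] then (0 : M) else zs (pw t) •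
          blockSum t fun a1 b1 c1 =>
            zs (pw a1) • F (a1 ++ A.mLetter b1 :: (c1 ++ A.mLetter b :: c))) =
          splitSum t fun a w => splitSum w fun b1 a1 => if b1 = [] then 0 else if b = [] then 0 else
            zs (pw b1 + pw a1) • F (a ++ A.mLetter b1 :: (a1 ++ A.mLetter b :: c)) := by
        intro b c
        split_ifs
        · simp only [ite_self, splitSum_zero]
        · rw [zs_smul_blockSum]
          refine splitSum_congr fun a1 w h => splitSum_congr fun b1 c1 h' => ?_
          split_ifs
          · rfl
          · beta_reduce
            rw [zs_smul_zs_smul, ← h, ← h', pw_append, pw_append]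
            congr 2
            grind
      simp only [this]
      rw [splitSum_comm]
      refine splitSum_congr fun a w _ => ?_
      rw [splitSum_comm]
    rw [e1, e2]
    have hn : ∀ (l : List (Letter A.toGrMod)) (G : List (Letter A.toGrMod) →
        List (Letter A.toGrMod) → M), -splitSum l G = splitSum l fun u v => -G u v := fun l G =>
      (map_splitSum (-(AddMonoidHom.id M)) l G)
    simp only [hn]
    refine splitSum_congr fun a v _ => splitSum_congr fun b w _ => splitSum_congr fun a1 v1 _ =>
      splitSum_congr fun b1 c1 _ => ?_
    split_ifs <;> simp [zs_add_one_smul]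
  simp only [← List.cons_append, List.append_assoc] at h3 ⊢
  rw [h3, add_neg_cancel]

end bar

/-! ### The comultiplication on words -/

section cut_sums

variable {s t : LSet K ι} {M N : Type*} [AddCommGroup M] [AddCommGroup N]

/-- The parity of the degree of a word. -/
def pd (w : Word s) : ZMod 2 := par (deg w)

theorem pd_eq (w : Word s) : pd w = ∑ x, pw (w x) := by
  simp only [pd, deg, map_sum]; rfl

theorem pd_emptyWord : pd (emptyWord s) = 0 := by rw [pd, deg_emptyWord, map_zero]

theorem pd_pair (v : Word s) (w : Word t) : pd (pair v w) = pd v + pd w := by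
  rw [pd, deg_pair, map_add]; rfl

/-- `o` and `n` are the outer and the inner part of a cut of `w`. -/
def IsCut (o n w : Word s) : Prop :=
  ∀ x, (if s.side x then o x ++ n x else n x ++ o x) = w x

theorem IsCut.pw_add {o n w : Word s} (h : IsCut o n w) (x : s.I) :
    pw (o x) + pw (n x) = pw (w x) := by
  rw [← h x]
  split_ifs
  · rw [pw_append]
  · rw [pw_append, add_comm]

theorem IsCut.pd_add {o n w : Word s} (h : IsCut o n w) : pd o + pd n = pd w := by
  simp only [pd_eq, ← Finset.sum_add_distrib, h.pw_add]

theorem IsCut.length_add {o n w : Word s} (h : IsCut o n w) (x : s.I) :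
    (o x).length + (n x).length = (w x).length := by
  rw [← h x]
  split_ifs
  · rw [List.length_append]
  · rw [List.length_append, add_comm]

theorem isCut_cut (w : Word s) (c : s.I → ℕ) : IsCut (outer w c) (inner w c) w := by
  intro x
  unfold outer inner
  split_ifs <;> exact List.take_append_drop _ _

/-- The sum of `F o n` over all cuts of a word. -/
def cutSum (w : Word s) (F : Word s → Word s → M) : M :=
  ∑ c ∈ cuts w, F (outer w c) (inner w c)

theorem cutSum_congr {w : Word s} {F G : Word s → Word s → M}
    (h : ∀ o n, IsCut o n w → F o n = G o n) : cutSum w F = cutSum w G :=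
  Finset.sum_congr rfl fun c _ => h _ _ (isCut_cut w c)

theorem mem_cuts {w : Word s} {c : s.I → ℕ} : c ∈ cuts w ↔ ∀ x, c x ≤ (w x).length := by
  simp [cuts, Nat.lt_succ_iff]

theorem length_outer {w : Word s} {c : s.I → ℕ} (h : c ∈ cuts w) (x : s.I) :
    (outer w c x).length = if s.side x then c x else (w x).length - c x := by
  have := mem_cuts.1 h x
  unfold outer
  split_ifs
  · rw [List.length_take]; omega
  · rw [List.length_drop]

theorem length_inner {w : Word s} {c : s.I → ℕ} (h : c ∈ cuts w) (x : s.I) :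
    (inner w c x).length = if s.side x then (w x).length - c x else c x := by
  have := mem_cuts.1 h x
  unfold inner
  split_ifs
  · rw [List.length_drop]
  · rw [List.length_take]; omega

theorem cutSum_assoc (w : Word s) (F : Word s → Word s → Word s → M) :
    (cutSum w fun u c => cutSum u fun a b => F a b c) =
      cutSum w fun a v => cutSum v fun b c => F a b c := by
  unfold cutSum
  rw [Finset.sum_sigma', Finset.sum_sigma']
  refine Finset.sum_bij'
    (fun z _ => ⟨fun x => if s.side x then z.2 x else z.1 x + z.2 x,
      fun x => if s.side x then z.1 x - z.2 x else z.1 x⟩)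
    (fun z _ => ⟨fun x => if s.side x then z.1 x + z.2 x else z.2 x,
      fun x => if s.side x then z.1 x else z.1 x - z.2 x⟩) ?_ ?_ ?_ ?_ ?_
  · rintro ⟨c, d⟩ h
    rw [Finset.mem_sigma] at h
    obtain ⟨hc, hd⟩ := h
    have hc' := mem_cuts.1 hc
    have hd' := mem_cuts.1 hd
    simp only [length_outer hc] at hd'
    have h1 : (fun x => if s.side x then d x else c x + d x) ∈ cuts w := by
      rw [mem_cuts]; intro x
      have := hc' x; have := hd' x
      dsimp only at *
      split_ifs at * <;> omega
    rw [Finset.mem_sigma]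
    refine ⟨h1, ?_⟩
    rw [mem_cuts]; intro x
    rw [length_inner h1]
    have := hc' x; have := hd' x
    dsimp only at *
    split_ifs at * <;> omega
  · rintro ⟨c, d⟩ h
    rw [Finset.mem_sigma] at h
    obtain ⟨hc, hd⟩ := h
    have hc' := mem_cuts.1 hc
    have hd' := mem_cuts.1 hd
    simp only [length_inner hc] at hd'
    have h1 : (fun x => if s.side x then c x + d x else d x) ∈ cuts w := by
      rw [mem_cuts]; intro x
      have := hc' x; have := hd' x
      dsimp only at *
      split_ifs at * <;> omega
    rw [Finset.mem_sigma]
    refine ⟨h1, ?_⟩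
    rw [mem_cuts]; intro x
    rw [length_outer h1]
    have := hc' x; have := hd' x
    dsimp only at *
    split_ifs at * <;> omega
  · rintro ⟨c, d⟩ h
    rw [Finset.mem_sigma] at h
    obtain ⟨hc, hd⟩ := h
    have hd' := mem_cuts.1 hd
    simp only [length_outer hc] at hd'
    refine Sigma.ext (funext fun x => ?_) (heq_of_eq (funext fun x => ?_)) <;>
    · have := hd' x
      dsimp only at *
      split_ifs at * <;> omega
  · rintro ⟨c, d⟩ h
    rw [Finset.mem_sigma] at h
    obtain ⟨hc, hd⟩ := h
    have hd' := mem_cuts.1 hd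
    simp only [length_inner hc] at hd'
    refine Sigma.ext (funext fun x => ?_) (heq_of_eq (funext fun x => ?_)) <;>
    · have := hd' x
      dsimp only at *
      split_ifs at * <;> omega
  · rintro ⟨c, d⟩ h
    rw [Finset.mem_sigma] at h
    obtain ⟨hc, hd⟩ := h
    have hd' := mem_cuts.1 hd
    simp only [length_outer hc] at hd'
    dsimp only
    congr 1
    · funext x
      have := hd' x
      simp only [outer]
      dsimp only at *
      split_ifs at *
      · rw [List.take_take, min_eq_left this]
      · rw [List.drop_drop]
    · funext x
      have := hd' x
      simp only [outer, inner]
      dsimp only at *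
      split_ifs at *
      · rw [List.drop_take]
      · rw [List.take_drop]
    · funext x
      have := hd' x
      simp only [inner]
      dsimp only at *
      split_ifs at *
      · rw [List.drop_drop]; congr 1; omega
      · rw [List.take_take]; congr 1; omega

/-- Cuts of the component `x` and of the other components. -/
theorem cutSum_upd (w : Word s) (x : s.I) (l : List (Letter (s.κ x).toGrMod))
    (F : Word s → Word s → M) :
    cutSum (upd w x l) F = cutSum (upd w x []) fun o n =>
      splitSum l fun u v => if s.side x then F (upd o x u) (upd n x v) else
        F (upd o x v) (upd n x u) := by
  unfold cutSum splitSum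
  rw [← Finset.sum_product' (cuts (upd w x []))]
  refine Finset.sum_bij' (fun c _ => (Function.update c x 0, c x))
    (fun z _ => Function.update z.1 x z.2) ?_ ?_ ?_ ?_ ?_
  · intro c hc
    rw [mem_cuts] at hc
    rw [Finset.mem_product, mem_cuts]
    refine ⟨fun y => ?_, ?_⟩
    · by_cases hy : y = x
      · subst hy; simp
      · have := hc y
        rw [upd_of_ne hy] at this
        simpa [hy, upd_of_ne hy] using this
    · have := hc x
      rw [upd_self] at this
      exact Finset.mem_range.2 (Nat.lt_succ_of_le this)
  · rintro ⟨c, m⟩ h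
    rw [Finset.mem_product, mem_cuts, Finset.mem_range] at h
    rw [mem_cuts]
    intro y
    by_cases hy : y = x
    · subst hy; simp; omega
    · have := h.1 y
      rw [upd_of_ne hy] at this
      simpa [hy, upd_of_ne hy] using this
  · intro c _
    simp
  · rintro ⟨c, m⟩ h
    rw [Finset.mem_product, mem_cuts] at h
    have := h.1 x
    rw [upd_self] at this
    have h0 : c x = 0 := Nat.le_zero.1 this
    refine Prod.ext ?_ ?_
    · funext y
      by_cases hy : y = x
      · subst hy; simp [h0]
      · simp [hy]
    · simp
  · intro c hc
    by_cases hs : s.side x <;> simp only [hs, if_true, if_false]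
    · congr 1 <;>
      · funext y
        by_cases hy : y = x
        · subst hy; simp [outer, inner, hs]
        · simp [outer, inner, upd_of_ne hy, hy]
    · rw [if_neg (by simp)]
      congr 1 <;>
      · funext y
        by_cases hy : y = x
        · subst hy; simp [outer, inner, hs]
        · simp [outer, inner, upd_of_ne hy, hy]

/-- The exponent of the sign of a term of the comultiplication, if the tensor factors are in the
order of the enumeration. -/
def cutSign (o n : Word s) : ZMod 2 :=
  ∑ x, ∑ y, if s.lt x y ∨ (x = y ∧ s.side x = false) then pw (n x) * pw (o y) else 0

theorem cutSign_add_left {o a b n : Word s} (h : ∀ x, pw (o x) = pw (a x) + pw (b x)) :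
    cutSign o n = cutSign a n + cutSign b n := by
  unfold cutSign
  rw [← Finset.sum_add_distrib]
  refine Finset.sum_congr rfl fun x _ => ?_
  rw [← Finset.sum_add_distrib]
  refine Finset.sum_congr rfl fun y _ => ?_
  split_ifs
  · rw [h, mul_add]
  · rw [add_zero]

theorem cutSign_add_right {n a b o : Word s} (h : ∀ x, pw (n x) = pw (a x) + pw (b x)) :
    cutSign o n = cutSign o a + cutSign o b := by
  unfold cutSign
  rw [← Finset.sum_add_distrib]
  refine Finset.sum_congr rfl fun x _ => ?_
  rw [← Finset.sum_add_distrib]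
  refine Finset.sum_congr rfl fun y _ => ?_
  split_ifs
  · rw [h, add_mul]
  · rw [add_zero]

/-- The sum of `F o n` over the terms `± o ⊗ n` of the comultiplication. -/
def cop (w : Word s) (F : Word s → Word s → M) : M :=
  cutSum w fun o n => zs (cutSign o n) • F o n

theorem cop_congr {w : Word s} {F G : Word s → Word s → M}
    (h : ∀ o n, pd o + pd n = pd w → F o n = G o n) : cop w F = cop w G :=
  cutSum_congr fun o n hc => by rw [h o n hc.pd_add]

theorem cop_add (w : Word s) (F G : Word s → Word s → M) :
    cop w (fun o n => F o n + G o n) = cop w F + cop w G := by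
  simp only [cop, cutSum, smul_add, Finset.sum_add_distrib]

theorem cop_neg (w : Word s) (F : Word s → Word s → M) :
    cop w (fun o n => -F o n) = -cop w F := by
  simp only [cop, cutSum, smul_neg, Finset.sum_neg_distrib]

theorem cop_zero (w : Word s) : cop w (fun _ _ => (0 : M)) = 0 := by
  simp only [cop, cutSum, smul_zero, Finset.sum_const_zero]

theorem zs_smul_cop (e : ZMod 2) (w : Word s) (F : Word s → Word s → M) :
    zs e • cop w F = cop w fun o n => zs e • F o n := by
  simp only [cop, cutSum, Finset.smul_sum]
  exact Finset.sum_congr rfl fun c _ => smul_comm _ _ _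

theorem map_cop {F' : Type*} [FunLike F' M N] [AddMonoidHomClass F' M N] (L : F') (w : Word s)
    (F : Word s → Word s → M) : L (cop w F) = cop w fun o n => L (F o n) := by
  simp only [cop, cutSum, map_sum, map_zs_smul]

theorem cop_apply [Module K M] [Module K N] (w : Word s) (F : Word s → Word s → M →ₗ[K] N)
    (p : M) : cop w F p = cop w fun o n => F o n p :=
  map_cop (LinearMap.applyₗ p : (M →ₗ[K] N) →ₗ[K] N) w F

theorem cop_mem [Module K M] {w : Word s} {F : Word s → Word s → M} {V : Submodule K M}
    (h : ∀ o n, IsCut o n w → F o n ∈ V) : cop w F ∈ V :=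
  Submodule.sum_mem _ fun c _ => zs_smul_mem _ _ (h _ _ (isCut_cut w c))

theorem cop_comm (w : Word s) (w' : Word t) (F : Word s → Word s → Word t → Word t → M) :
    (cop w fun o n => cop w' fun o' n' => F o n o' n') =
      cop w' fun o' n' => cop w fun o n => F o n o' n' := by
  simp only [cop, cutSum, Finset.smul_sum]
  rw [Finset.sum_comm]
  exact Finset.sum_congr rfl fun _ _ => Finset.sum_congr rfl fun _ _ => smul_comm _ _ _

theorem cop_assoc (w : Word s) (F : Word s → Word s → Word s → M) :
    (cop w fun u c => cop u fun a b => F a b c) = cop w fun a v => cop v fun b c => F a b c := by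
  have h1 : (cop w fun u c => cop u fun a b => F a b c) = cutSum w fun u c => cutSum u fun a b =>
      zs (cutSign a c + cutSign b c + cutSign a b) • F a b c := by
    refine cutSum_congr fun u c _ => ?_
    unfold cop cutSum
    rw [Finset.smul_sum]
    refine Finset.sum_congr rfl fun d _ => ?_
    rw [zs_smul_zs_smul, cutSign_add_left fun x => ((isCut_cut u d).pw_add x).symm]
  have h2 : (cop w fun a v => cop v fun b c => F a b c) = cutSum w fun a v => cutSum v fun b c =>
      zs (cutSign a c + cutSign b c + cutSign a b) • F a b c := by
    refine cutSum_congr fun u c _ => ?_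
    unfold cop cutSum
    rw [Finset.smul_sum]
    refine Finset.sum_congr rfl fun d _ => ?_
    rw [zs_smul_zs_smul, cutSign_add_right fun x => ((isCut_cut c d).pw_add x).symm]
    congr 2
    ring
  rw [h1, h2, cutSum_assoc]

theorem cutSign_empty_left (n : Word s) : cutSign (emptyWord s) n = 0 := by
  simp [cutSign, emptyWord, pw_nil]

theorem cutSign_empty_right (o : Word s) : cutSign o (emptyWord s) = 0 := by
  simp [cutSign, emptyWord, pw_nil]

/-- A sum over the comultiplication in which only the term `∅ ⊗ w` contributes. -/
theorem cop_eq_left {w : Word s} {F : Word s → Word s → M}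
    (h : ∀ o n, o ≠ emptyWord s → F o n = 0) : cop w F = F (emptyWord s) w := by
  have h0 : (fun x => if s.side x then 0 else (w x).length) ∈ cuts w := by
    rw [mem_cuts]; intro x; split_ifs <;> omega
  have h1 : outer w (fun x => if s.side x then 0 else (w x).length) = emptyWord s := by
    funext x; unfold outer; dsimp only; split_ifs <;> simp [emptyWord]
  have h2 : inner w (fun x => if s.side x then 0 else (w x).length) = w := by
    funext x; unfold inner; dsimp only; split_ifs <;> simp
  unfold cop cutSum
  rw [Finset.sum_eq_single_of_mem _ h0, h1, h2]
  · beta_reduce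
    rw [cutSign_empty_left, zs_zero_smul]
  intro c hc hne
  beta_reduce
  rw [h, smul_zero]
  intro he
  apply hne
  funext x
  have hl := length_outer hc x
  have hc' := mem_cuts.1 hc x
  rw [he] at hl
  simp only [emptyWord, List.length_nil] at hl
  split_ifs at hl ⊢ <;> omega

/-- A sum over the comultiplication in which only the term `w ⊗ ∅` contributes. -/
theorem cop_eq_right {w : Word s} {F : Word s → Word s → M}
    (h : ∀ o n, n ≠ emptyWord s → F o n = 0) : cop w F = F w (emptyWord s) := by
  have h0 : (fun x => if s.side x then (w x).length else 0) ∈ cuts w := by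
    rw [mem_cuts]; intro x; split_ifs <;> omega
  have h1 : outer w (fun x => if s.side x then (w x).length else 0) = w := by
    funext x; unfold outer; dsimp only; split_ifs <;> simp
  have h2 : inner w (fun x => if s.side x then (w x).length else 0) = emptyWord s := by
    funext x; unfold inner; dsimp only; split_ifs <;> simp [emptyWord]
  unfold cop cutSum
  rw [Finset.sum_eq_single_of_mem _ h0, h1, h2]
  · beta_reduce
    rw [cutSign_empty_right, zs_zero_smul]
  intro c hc hne
  beta_reduce
  rw [h, smul_zero]
  intro he
  apply hne
  funext x
  have hl := length_inner hc x
  have hc' := mem_cuts.1 hc x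
  rw [he] at hl
  simp only [emptyWord, List.length_nil] at hl
  split_ifs at hl ⊢ <;> omega

theorem cop_toDual (w : Word s) (F : Word s → Word s → M) :
    cop (s := s.dual) w F = cop w fun o n => zs (pd o * pd n) • F n o := by
  unfold cop cutSum
  refine Finset.sum_congr rfl fun c _ => ?_
  have h1 : outer (s := s.dual) w c = inner w c := by
    funext (x : s.I)
    change (if (!s.side x) = true then _ else _) = (if s.side x = true then _ else _)
    cases s.side x <;> rfl
  have h2 : inner (s := s.dual) w c = outer w c := by
    funext (x : s.I)
    change (if (!s.side x) = true then _ else _) = (if s.side x = true then _ else _)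
    cases s.side x <;> rfl
  beta_reduce
  rw [h1, h2, zs_smul_zs_smul]
  generalize outer w c = o
  generalize inner w c = n
  congr 2
  have h3 : pd o * pd n = ∑ x, ∑ y, pw (n x) * pw (o y) := by
    rw [pd_eq, pd_eq, mul_comm, Finset.sum_mul_sum]
  have h4 : cutSign (s := s.dual) n o =
      ∑ x, ∑ y, if s.lt y x ∨ (x = y ∧ s.side x = true) then pw (n x) * pw (o y) else 0 := by
    unfold cutSign
    rw [Finset.sum_comm]
    refine Finset.sum_congr rfl fun x _ => Finset.sum_congr rfl fun y _ => ?_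
    rw [mul_comm]
    refine if_congr (or_congr Iff.rfl ?_) rfl rfl
    constructor
    · rintro ⟨rfl, h⟩; exact ⟨rfl, by simpa using h⟩
    · rintro ⟨rfl, h⟩; exact ⟨rfl, by simpa using h⟩
  rw [h3, h4]
  unfold cutSign
  rw [← Finset.sum_add_distrib]
  refine Finset.sum_congr rfl fun x _ => ?_
  rw [← Finset.sum_add_distrib]
  refine Finset.sum_congr rfl fun y _ => ?_
  rcases trichotomous_of s.lt x y with h | rfl | h
  · have h' : ¬ s.lt y x := fun h' => irrefl_of s.lt x (trans_of s.lt h h')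
    have hne : x ≠ y := by rintro rfl; exact irrefl_of s.lt x h
    simp [h, h', hne, CharTwo.add_self_eq_zero]
  · have h := irrefl_of s.lt x
    cases s.side x <;> simp [h, CharTwo.add_self_eq_zero]
  · have h' : ¬ s.lt x y := fun h' => irrefl_of s.lt x (trans_of s.lt h' h)
    have hne : x ≠ y := by rintro rfl; exact irrefl_of s.lt x h
    simp [h, h', hne]

theorem cutSign_pair (o n : Word s) (o' n' : Word t) :
    cutSign (pair o o') (pair n n') = cutSign o n + cutSign o' n' + pd n * pd o' := by
  have h : cutSign (pair o o') (pair n n') = _ :=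
    (Fintype.sum_sum_type (α₁ := s.I) (α₂ := t.I) _)
  have h1 : ∀ x : s.I ⊕ t.I, (∑ y, if (s.sum t).lt x y ∨ (x = y ∧ (s.sum t).side x = false) then
      pw (pair n n' x) * pw (pair o o' y) else 0) = _ := fun x =>
    (Fintype.sum_sum_type (α₁ := s.I) (α₂ := t.I) _)
  rw [h]
  simp only [h1, Finset.sum_add_distrib]
  have h2 : pd n * pd o' = ∑ x, ∑ y, pw (n x) * pw (o' y) := by
    rw [pd_eq, pd_eq, Finset.sum_mul_sum]
  rw [h2]
  simp [cutSign, pair]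
  ring

theorem cop_pair (v : Word s) (w : Word t) (F : Word (s.sum t) → Word (s.sum t) → M) :
    cop (pair v w) F = cop v fun o n => cop w fun o' n' =>
      zs (pd n * pd o') • F (pair o o') (pair n n') := by
  have : (cop v fun o n => cop w fun o' n' => zs (pd n * pd o') • F (pair o o') (pair n n')) =
      ∑ c ∈ cuts v, ∑ d ∈ cuts w, zs (cutSign (pair (outer v c) (outer w d))
        (pair (inner v c) (inner w d))) • F (pair (outer v c) (outer w d))
          (pair (inner v c) (inner w d)) := by
    refine Finset.sum_congr rfl fun c _ => ?_
    unfold cop cutSum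
    beta_reduce
    rw [Finset.smul_sum]
    refine Finset.sum_congr rfl fun d _ => ?_
    rw [zs_smul_zs_smul, zs_smul_zs_smul, cutSign_pair, add_assoc]
  rw [this, ← Finset.sum_product']
  refine Finset.sum_bij' (fun c _ => (fun x => c (Sum.inl x), fun x => c (Sum.inr x)))
    (fun z _ => Sum.elim z.1 z.2) ?_ ?_ ?_ ?_ ?_
  · intro c hc
    rw [mem_cuts] at hc
    rw [Finset.mem_product, mem_cuts, mem_cuts]
    exact ⟨fun x => hc (Sum.inl x), fun x => hc (Sum.inr x)⟩
  · rintro ⟨c, d⟩ h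
    rw [Finset.mem_product, mem_cuts, mem_cuts] at h
    rw [mem_cuts]
    rintro (x | x)
    · exact h.1 x
    · exact h.2 x
  · intro c _
    funext x
    cases x <;> rfl
  · rintro ⟨c, d⟩ _
    rfl
  · intro c _
    have h1 : outer (pair v w) c = pair (outer v fun x => c (Sum.inl x))
        (outer w fun x => c (Sum.inr x)) := by
      funext x; cases x <;> rfl
    have h2 : inner (pair v w) c = pair (inner v fun x => c (Sum.inl x))
        (inner w fun x => c (Sum.inr x)) := by
      funext x; cases x <;> rfl
    rw [h1, h2]

end cut_sums

/-! ### The bar differential on words -/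

section word_diff

variable {s t : LSet K ι} {M N : Type*} [AddCommGroup M] [AddCommGroup N]

theorem listDiff_sum {A : AInfAlg K ι} {β : Type*} (S : Finset β) (l : List (Letter A.toGrMod))
    (F : β → List (Letter A.toGrMod) → M) :
    (listDiff l fun t => ∑ b ∈ S, F b t) = ∑ b ∈ S, listDiff l (F b) := by
  unfold listDiff
  simp only [blockSum_eq, Finset.smul_sum]
  rw [Finset.sum_comm]
  refine Finset.sum_congr rfl fun b _ => ?_
  exact Finset.sum_comm

theorem map_listDiff {A : AInfAlg K ι} {F' : Type*} [FunLike F' M N] [AddMonoidHomClass F' M N]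
    (L : F') (l : List (Letter A.toGrMod)) (F : List (Letter A.toGrMod) → M) :
    L (listDiff l F) = listDiff l fun t => L (F t) := by
  unfold listDiff
  simp only [map_blockSum, map_zs_smul]

theorem zs_smul_listDiff {A : AInfAlg K ι} (e : ZMod 2) (l : List (Letter A.toGrMod))
    (F : List (Letter A.toGrMod) → M) :
    zs e • listDiff l F = listDiff l fun t => zs e • F t := by
  unfold listDiff
  simp only [zs_smul_blockSum]
  exact blockSum_congr fun _ _ _ _ _ => smul_comm _ _ _

theorem listDiff_comm {A B : AInfAlg K ι} (l : List (Letter A.toGrMod))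
    (l' : List (Letter B.toGrMod)) (F : List (Letter A.toGrMod) → List (Letter B.toGrMod) → M) :
    (listDiff l fun t => listDiff l' fun t' => F t t') =
      listDiff l' fun t' => listDiff l fun t => F t t' := by
  unfold listDiff
  simp only [zs_smul_blockSum, blockSum_eq]
  simp only [Finset.sum_sigma']
  simp only [Finset.smul_sum]
  rw [Finset.sum_comm]
  exact Finset.sum_congr rfl fun _ _ => Finset.sum_congr rfl fun _ _ => smul_comm _ _ _

theorem listDiff_add {A : AInfAlg K ι} (l : List (Letter A.toGrMod))
    (F G : List (Letter A.toGrMod) → M) :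
    (listDiff l fun t => F t + G t) = listDiff l F + listDiff l G := by
  unfold listDiff
  simp only [smul_add, blockSum_add]

theorem listDiff_nil {A : AInfAlg K ι} (F : List (Letter A.toGrMod) → M) : listDiff [] F = 0 := by
  simp [listDiff, blockSum_eq]

/-- The sum of the parities of the components that precede `x`. -/
def bef (w : Word s) (x : s.I) : ZMod 2 := ∑ y, if s.lt y x then pw (w y) else 0

/-- The sum of the parities of the components that follow `x`. -/
def aft (w : Word s) (x : s.I) : ZMod 2 := ∑ y, if s.lt x y then pw (w y) else 0

theorem lt_asymm' {x y : s.I} (h : s.lt x y) : ¬ s.lt y x :=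
  fun h' => irrefl_of s.lt x (trans_of s.lt h h')

theorem ne_of_lt' {x y : s.I} (h : s.lt x y) : x ≠ y := by
  rintro rfl; exact irrefl_of s.lt x h

theorem pd_eq_bef (w : Word s) (x : s.I) : pd w = bef w x + pw (w x) + aft w x := by
  have h : pw (w x) = ∑ y, if y = x then pw (w y) else 0 := by simp
  rw [pd_eq, h, bef, aft, ← Finset.sum_add_distrib, ← Finset.sum_add_distrib]
  refine Finset.sum_congr rfl fun y _ => ?_
  rcases trichotomous_of s.lt x y with h | rfl | h
  · simp [h, lt_asymm' h, (ne_of_lt' h).symm]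
  · simp [irrefl_of s.lt x]
  · simp [h, lt_asymm' h, ne_of_lt' h]

theorem bef_upd (w : Word s) (x : s.I) (l : List (Letter (s.κ x).toGrMod)) :
    bef (upd w x l) x = bef w x := by
  refine Finset.sum_congr rfl fun y _ => ?_
  split_ifs with h
  · rw [upd_of_ne (ne_of_lt' h)]
  · rfl

theorem bef_upd_of_ne {w : Word s} {x y : s.I} {l : List (Letter (s.κ x).toGrMod)}
    (h : pw l = pw (w x) + 1) : bef (upd w x l) y = bef w y + if s.lt x y then 1 else 0 := by
  have h1 : ∀ z, pw (upd w x l z) = pw (w z) + if z = x then 1 else 0 := by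
    intro z
    by_cases hz : z = x
    · subst hz; simp [h]
    · simp [upd_of_ne hz, hz]
  have h2 : (if s.lt x y then (1 : ZMod 2) else 0) =
      ∑ z, if s.lt z y then (if z = x then 1 else 0) else 0 := by
    rw [Finset.sum_eq_single_of_mem x (Finset.mem_univ x)]
    · simp
    · intro z _ hz; simp [hz]
  rw [h2, bef, bef, ← Finset.sum_add_distrib]
  refine Finset.sum_congr rfl fun z _ => ?_
  rw [h1]
  split_ifs <;> simp

theorem cutSign_upd_left {o n : Word s} {x : s.I} {l l' : List (Letter (s.κ x).toGrMod)}
    (h : pw l' = pw l + 1) : cutSign (upd o x l') n =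
      cutSign (upd o x l) n + bef n x + if s.side x = false then pw (n x) else 0 := by
  have h1 : ∀ z, pw (upd o x l' z) = pw (upd o x l z) + if z = x then 1 else 0 := by
    intro z
    by_cases hz : z = x
    · subst hz; simp [h]
    · simp [upd_of_ne hz, hz]
  have h2 : bef n x + (if s.side x = false then pw (n x) else 0) =
      ∑ y, ∑ z, if s.lt y z ∨ (y = z ∧ s.side y = false) then
        pw (n y) * (if z = x then 1 else 0) else 0 := by
    have e : ∀ y, (∑ z, if s.lt y z ∨ (y = z ∧ s.side y = false) then
        pw (n y) * (if z = x then 1 else 0) else 0) =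
        (if s.lt y x then pw (n y) else 0) +
          if y = x then (if s.side y = false then pw (n y) else 0) else 0 := by
      intro y
      rw [Finset.sum_eq_single_of_mem x (Finset.mem_univ x)]
      · by_cases hy : y = x
        · subst hy; simp [irrefl_of s.lt y]
        · simp [hy]
      · intro z _ hz; simp [hz]
    simp only [e, Finset.sum_add_distrib]
    simp [bef]
  rw [add_assoc, h2, cutSign, cutSign, ← Finset.sum_add_distrib]
  refine Finset.sum_congr rfl fun y _ => ?_
  rw [← Finset.sum_add_distrib]
  refine Finset.sum_congr rfl fun z _ => ?_
  rw [h1]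
  split_ifs <;> ring

theorem cutSign_upd_right {o n : Word s} {x : s.I} {l l' : List (Letter (s.κ x).toGrMod)}
    (h : pw l' = pw l + 1) : cutSign o (upd n x l') =
      cutSign o (upd n x l) + aft o x + if s.side x = false then pw (o x) else 0 := by
  have h1 : ∀ z, pw (upd n x l' z) = pw (upd n x l z) + if z = x then 1 else 0 := by
    intro z
    by_cases hz : z = x
    · subst hz; simp [h]
    · simp [upd_of_ne hz, hz]
  have h2 : aft o x + (if s.side x = false then pw (o x) else 0) =
      ∑ y, ∑ z, if s.lt y z ∨ (y = z ∧ s.side y = false) then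
        (if y = x then 1 else 0) * pw (o z) else 0 := by
    have e : ∀ z, (∑ y, if s.lt y z ∨ (y = z ∧ s.side y = false) then
        (if y = x then 1 else 0) * pw (o z) else 0) =
        (if s.lt x z then pw (o z) else 0) +
          if z = x then (if s.side z = false then pw (o z) else 0) else 0 := by
      intro y
      rw [Finset.sum_eq_single_of_mem x (Finset.mem_univ x)]
      · by_cases hy : y = x
        · subst hy; simp [irrefl_of s.lt y]
        · simp [hy, Ne.symm hy]
      · intro z _ hz; simp [hz]
    rw [Finset.sum_comm]
    simp only [e, Finset.sum_add_distrib]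
    simp [aft]
  rw [add_assoc, h2, cutSign, cutSign, ← Finset.sum_add_distrib]
  refine Finset.sum_congr rfl fun y _ => ?_
  rw [← Finset.sum_add_distrib]
  refine Finset.sum_congr rfl fun z _ => ?_
  rw [h1]
  split_ifs <;> ring

/-- The sum of `F` over the terms of the bar differential of a word, if the tensor factors are in
the order of the enumeration. -/
def wordDiff (w : Word s) (F : Word s → M) : M :=
  ∑ x, zs (bef w x) • listDiff (w x) fun l => F (upd w x l)

theorem pd_upd {w : Word s} {x : s.I} {l : List (Letter (s.κ x).toGrMod)}
    (h : pw l = pw (w x) + 1) : pd (upd w x l) = pd w + 1 := by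
  have e : ∀ v : Word s, aft (upd v x l) x = aft v x := fun v =>
    Finset.sum_congr rfl fun y _ => by
      split_ifs with h
      · rw [upd_of_ne (ne_of_lt' h).symm]
      · rfl
  rw [pd_eq_bef _ x, pd_eq_bef w x, bef_upd, upd_self, e, h]
  ring

theorem wordDiff_congr {w : Word s} {F G : Word s → M} (h : ∀ w', pd w' = pd w + 1 → F w' = G w') :
    wordDiff w F = wordDiff w G := by
  refine Finset.sum_congr rfl fun x _ => ?_
  congr 1
  exact listDiff_congr fun l hl => h _ (pd_upd hl)

theorem wordDiff_add (w : Word s) (F G : Word s → M) :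
    (wordDiff w fun w' => F w' + G w') = wordDiff w F + wordDiff w G := by
  simp only [wordDiff, listDiff_add, smul_add, Finset.sum_add_distrib]

theorem map_wordDiff {F' : Type*} [FunLike F' M N] [AddMonoidHomClass F' M N] (L : F')
    (w : Word s) (F : Word s → M) : L (wordDiff w F) = wordDiff w fun w' => L (F w') := by
  simp only [wordDiff, map_sum, map_zs_smul, map_listDiff]

theorem wordDiff_apply [Module K M] [Module K N] (w : Word s) (F : Word s → M →ₗ[K] N) (p : M) :
    wordDiff w F p = wordDiff w fun w' => F w' p :=
  map_wordDiff (LinearMap.applyₗ p : (M →ₗ[K] N) →ₗ[K] N) w F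

theorem zs_smul_wordDiff (e : ZMod 2) (w : Word s) (F : Word s → M) :
    zs e • wordDiff w F = wordDiff w fun w' => zs e • F w' := by
  simp only [wordDiff, Finset.smul_sum, smul_comm (zs e), zs_smul_listDiff]

theorem wordDiff_neg (w : Word s) (F : Word s → M) :
    (wordDiff w fun w' => -F w') = -wordDiff w F := by
  simp only [neg_eq_zs_smul, zs_smul_wordDiff]

theorem wordDiff_zero (w : Word s) : (wordDiff w fun _ => (0 : M)) = 0 := by
  have := wordDiff_add w (fun _ => (0 : M)) fun _ => 0
  simpa using this

theorem listDiff_eq_zero {A : AInfAlg K ι} {l : List (Letter A.toGrMod)}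
    {F : List (Letter A.toGrMod) → M} (h : ∀ t, t ≠ [] → F t = 0) : listDiff l F = 0 := by
  unfold listDiff
  have : ∀ a b c : List (Letter A.toGrMod), zs (pw a) • F (a ++ A.mLetter b :: c) = 0 :=
    fun a b c => by rw [h _ (by simp), smul_zero]
  simp only [this, blockSum_zero]

/-- The terms of the bar differential are not empty. -/
theorem wordDiff_eq_zero {w : Word s} {F : Word s → M} (h : ∀ v, v ≠ emptyWord s → F v = 0) :
    wordDiff w F = 0 := by
  refine Finset.sum_eq_zero fun x _ => ?_
  rw [listDiff_eq_zero, smul_zero]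
  intro t ht
  refine h _ fun e => ht ?_
  simpa [emptyWord] using congrFun e x

theorem wordDiff_mem [Module K M] {w : Word s} {F : Word s → M} {V : Submodule K M}
    (h : ∀ w', (∀ x, (w' x).length ≤ (w x).length) → F w' ∈ V) : wordDiff w F ∈ V := by
  refine Submodule.sum_mem _ fun x _ => zs_smul_mem _ _ ?_
  unfold listDiff
  rw [blockSum_eq]
  refine Submodule.sum_mem _ fun j hj => Submodule.sum_mem _ fun k hk => zs_smul_mem _ _ (h _ ?_)
  rw [Finset.mem_range] at hj hk
  intro y
  by_cases hy : y = x
  · subst hy; simp; omega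
  · rw [upd_of_ne hy]

theorem wordDiff_cop_comm (w : Word s) (w' : Word t) (F : Word s → Word t → Word t → M) :
    (wordDiff w fun v => cop w' fun o n => F v o n) =
      cop w' fun o n => wordDiff w fun v => F v o n := by
  simp only [cop, cutSum, zs_smul_wordDiff]
  simp only [wordDiff, listDiff_sum, Finset.smul_sum]
  rw [Finset.sum_comm]

/-- The bar differential is a coderivation. -/
theorem wordDiff_cop (w : Word s) (F : Word s → Word s → M) :
    (wordDiff w fun w' => cop w' F) = cop w fun o n =>
      wordDiff o (fun o' => F o' n) + zs (pd o) • wordDiff n fun n' => F o n' := by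
  have hR : (cop w fun o n => wordDiff o (fun o' => F o' n) +
      zs (pd o) • wordDiff n fun n' => F o n') = ∑ x, cop w fun o n =>
        zs (bef o x) • listDiff (o x) (fun l => F (upd o x l) n) +
          zs (pd o + bef n x) • listDiff (n x) fun l => F o (upd n x l) := by
    unfold cop cutSum
    rw [Finset.sum_comm]
    refine Finset.sum_congr rfl fun c _ => ?_
    rw [← Finset.smul_sum, Finset.sum_add_distrib]
    simp only [wordDiff, Finset.smul_sum, zs_smul_zs_smul]
  rw [hR]
  refine Finset.sum_congr rfl fun x _ => ?_
  have hL : (zs (bef w x) • listDiff (w x) fun l => cop (upd w x l) F) =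
      cutSum (upd w x []) fun o n => zs (bef w x) • listDiff (w x) fun l => splitSum l fun u v =>
        if s.side x then zs (cutSign (upd o x u) (upd n x v)) • F (upd o x u) (upd n x v) else
          zs (cutSign (upd o x v) (upd n x u)) • F (upd o x v) (upd n x u) := by
    have : ∀ l, cop (upd w x l) F = cutSum (upd w x []) fun o n => splitSum l fun u v =>
        if s.side x then zs (cutSign (upd o x u) (upd n x v)) • F (upd o x u) (upd n x v) else
          zs (cutSign (upd o x v) (upd n x u)) • F (upd o x v) (upd n x u) := fun l => by
      unfold cop
      exact cutSum_upd w x l _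
    simp only [this]
    unfold cutSum
    rw [listDiff_sum, Finset.smul_sum]
  rw [hL]
  have hw : w = upd w x (w x) := (upd_eq_self w x).symm
  conv_rhs => rw [hw, cop, cutSum_upd]
  refine cutSum_congr fun o n hc => ?_
  have hb : bef w x = bef o x + bef n x := by
    rw [← bef_upd w x [], bef, bef, bef, ← Finset.sum_add_distrib]
    refine Finset.sum_congr rfl fun y _ => ?_
    split_ifs
    · rw [hc.pw_add]
    · rw [add_zero]
  rw [listDiff_splitSum, zs_smul_splitSum]
  refine splitSum_congr fun u v huv => ?_
  have ea : ∀ (p : Word s) (l : List (Letter (s.κ x).toGrMod)), pd (upd p x l) =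
      bef p x + pw l + aft (upd p x l) x := fun p l => by
    rw [pd_eq_bef _ x, bef_upd, upd_self]
  by_cases hs : s.side x
  · simp only [hs, if_true, upd_idem, upd_self, smul_add, zs_smul_listDiff, zs_smul_zs_smul,
      bef_upd]
    congr 1
    · refine listDiff_congr fun l hl => ?_
      rw [cutSign_upd_left hl, bef_upd, hb]
      simp only [hs, Bool.true_eq_false, if_false]
      congr 2
      grind
    · refine listDiff_congr fun l hl => ?_
      rw [cutSign_upd_right hl, ea, hb]
      simp only [hs, Bool.true_eq_false, if_false]
      congr 2
      grind
  · have hs' : s.side x = false := by simpa using hs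
    simp only [hs', Bool.false_eq_true, if_false, upd_idem, upd_self, smul_add, zs_smul_listDiff,
      zs_smul_zs_smul, bef_upd]
    rw [add_comm]
    congr 1
    · refine listDiff_congr fun l hl => ?_
      rw [cutSign_upd_left hl, bef_upd, hb]
      simp only [hs', if_true, upd_self]
      congr 2
      grind
    · refine listDiff_congr fun l hl => ?_
      rw [cutSign_upd_right hl, ea, hb]
      simp only [hs', if_true, upd_self]
      congr 2
      grind

/-- A double sum over a finite totally ordered set, as a sum over pairs `x < y` and the diagonal. -/
theorem sum_sum_lt (s : LSet K ι) {M : Type*} [AddCommMonoid M] (g : s.I → s.I → M) :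
    ∑ x, ∑ y, g x y = (∑ x, ∑ y, if s.lt x y then g x y + g y x else 0) + ∑ x, g x x := by
  have h1 : ∀ x y, g x y = (if s.lt x y then g x y else 0) + (if s.lt y x then g x y else 0) +
      if x = y then g x x else 0 := by
    intro x y
    rcases trichotomous_of s.lt x y with h | rfl | h
    · simp [h, lt_asymm' h, ne_of_lt' h]
    · simp [irrefl_of s.lt x]
    · simp [h, lt_asymm' h, (ne_of_lt' h).symm]
  have h2 : (∑ x, ∑ y, if s.lt x y then g x y + g y x else 0) =
      (∑ x, ∑ y, if s.lt x y then g x y else 0) + ∑ x, ∑ y, if s.lt y x then g x y else 0 := by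
    rw [Finset.sum_comm (f := fun x y => if s.lt y x then g x y else 0), ← Finset.sum_add_distrib]
    refine Finset.sum_congr rfl fun x _ => ?_
    rw [← Finset.sum_add_distrib]
    refine Finset.sum_congr rfl fun y _ => ?_
    split_ifs <;> simp
  rw [h2, ← Finset.sum_add_distrib, ← Finset.sum_add_distrib]
  refine Finset.sum_congr rfl fun x _ => ?_
  rw [← Finset.sum_add_distrib, Finset.sum_congr rfl fun y _ => h1 x y, Finset.sum_add_distrib]
  congr 1
  simp

/-- The bar differential squares to zero. -/
theorem wordDiff_wordDiff [Module K M] (w : Word s) {F : Word s → M}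
    (hF : Multilin (K := K) F) : (wordDiff w fun w' => wordDiff w' F) = 0 := by
  have h : (wordDiff w fun w' => wordDiff w' F) = ∑ x, ∑ y, zs (bef w x) • listDiff (w x) fun l =>
      zs (bef (upd w x l) y) • listDiff (upd w x l y) fun l' => F (upd (upd w x l) y l') := by
    simp only [wordDiff, listDiff_sum, Finset.smul_sum]
  rw [h, sum_sum_lt]
  have hxy : ∀ x y, x ≠ y → (zs (bef w x) • listDiff (w x) fun l =>
      zs (bef (upd w x l) y) • listDiff (upd w x l y) fun l' => F (upd (upd w x l) y l')) =
      zs (bef w x + bef w y + if s.lt x y then 1 else 0) • listDiff (w x) fun l =>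
        listDiff (w y) fun l' => F (upd (upd w x l) y l') := by
    intro x y hne
    rw [zs_smul_listDiff, zs_smul_listDiff]
    refine listDiff_congr fun l hl => ?_
    rw [bef_upd_of_ne hl, upd_of_ne hne.symm, zs_smul_zs_smul, add_assoc]
  have h1 : (∑ x, ∑ y, if s.lt x y then
      (zs (bef w x) • listDiff (w x) fun l =>
      zs (bef (upd w x l) y) • listDiff (upd w x l y) fun l' => F (upd (upd w x l) y l')) +
      (zs (bef w y) • listDiff (w y) fun l =>
      zs (bef (upd w y l) x) • listDiff (upd w y l x) fun l' => F (upd (upd w y l) x l'))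
      else 0) = 0 := by
    refine Finset.sum_eq_zero fun x _ => Finset.sum_eq_zero fun y _ => ?_
    split_ifs with hlt
    · have hne := ne_of_lt' hlt
      rw [hxy x y hne, hxy y x hne.symm, if_pos hlt, if_neg (lt_asymm' hlt), listDiff_comm,
        zs_add_one_smul, add_zero, add_comm (bef w y)]
      simp only [upd_comm hne]
      exact neg_add_cancel _
    · rfl
  rw [h1, zero_add]
  refine Finset.sum_eq_zero fun x _ => ?_
  simp only [bef_upd, upd_self, upd_idem]
  rw [zs_smul_eq_zero, ← zs_smul_listDiff, zs_smul_eq_zero]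
  exact listDiff_listDiff (K := K) (w x) (fun l => F (upd w x l)) fun u v i => hF w x u v i

theorem wordDiff_pair (v : Word s) (w : Word t) (F : Word (s.sum t) → M) :
    wordDiff (pair v w) F = wordDiff v (fun v' => F (pair v' w)) +
      zs (pd v) • wordDiff w fun w' => F (pair v w') := by
  have h : wordDiff (pair v w) F = _ :=
    (Fintype.sum_sum_type (α₁ := s.I) (α₂ := t.I) _)
  have hl : ∀ x : s.I, bef (pair v w) (Sum.inl x : s.I ⊕ t.I) = bef v x := by
    intro x
    refine (Fintype.sum_sum_type (α₁ := s.I) (α₂ := t.I) _).trans ?_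
    simp [bef, pair]
  have hr : ∀ x : t.I, bef (pair v w) (Sum.inr x : s.I ⊕ t.I) = pd v + bef w x := by
    intro x
    refine (Fintype.sum_sum_type (α₁ := s.I) (α₂ := t.I) _).trans ?_
    simp [bef, pair, pd_eq]
  rw [h]
  congr 1
  · refine Finset.sum_congr rfl fun x _ => ?_
    rw [hl]
    congr 1
    exact congrArg (listDiff (v x)) (funext fun l => congrArg F (pair_upd_left v w x l).symm)
  · unfold wordDiff
    rw [Finset.smul_sum]
    refine Finset.sum_congr rfl fun x _ => ?_
    rw [hr, zs_smul_zs_smul]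
    congr 1
    exact congrArg (listDiff (w x)) (funext fun l => congrArg F (pair_upd_right v w x l).symm)

theorem wordDiff_toDual (w : Word s) (F : Word s → M) :
    wordDiff (s := s.dual) w F = wordDiff w F := rfl

end word_diff

/-! ### Words and morphisms of labelled sets -/

section push

variable {s t u : LSet K ι} {M : Type*} [AddCommGroup M]

/-- The exponent of the sign of the permutation of tensor factors given by `i`. -/
def ro (i : LSet.Hom s t) (w : Word s) : ZMod 2 :=
  ∑ x, ∑ y, if s.lt x y ∧ t.lt (i.f y) (i.f x) then pw (w x) * pw (w y) else 0

theorem pw_castL {A B : AInfAlg K ι} (h : A = B) (l : List (Letter A.toGrMod)) :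
    pw (castL h l) = pw l := by rw [pw, wt_castL]; rfl

theorem pd_push (i : LSet.Hom s t) (w : Word s) : pd (push i w) = pd w := by
  rw [pd, deg_push]; rfl

theorem pw_push (i : LSet.Hom s t) (w : Word s) (x : s.I) : pw (push i w (i.f x)) = pw (w x) := by
  rw [push_apply, pw_castL]

/-- Sums over `t` of functions supported on the image of `s`. -/
theorem sum_push {N : Type*} [AddCommMonoid N] (i : LSet.Hom s t) (g : t.I → N)
    (h : ∀ y, (¬ ∃ x, i.f x = y) → g y = 0) : ∑ y, g y = ∑ x, g (i.f x) := by
  symm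
  refine Finset.sum_of_injOn i.f (fun a _ b _ h => i.inj h) (fun _ _ => Finset.mem_coe.2
    (Finset.mem_univ _)) (fun y _ hy => h y ?_) (fun x _ => rfl)
  rintro ⟨x, rfl⟩; exact hy ⟨x, by simp, rfl⟩

theorem castL_take {A B : AInfAlg K ι} (h : A = B) (l : List (Letter A.toGrMod)) (n : ℕ) :
    castL h (l.take n) = (castL h l).take n := by subst h; rfl

theorem castL_drop {A B : AInfAlg K ι} (h : A = B) (l : List (Letter A.toGrMod)) (n : ℕ) :
    castL h (l.drop n) = (castL h l).drop n := by subst h; rfl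

theorem length_castL {A B : AInfAlg K ι} (h : A = B) (l : List (Letter A.toGrMod)) :
    (castL h l).length = l.length := by subst h; rfl

theorem listDiff_castL {A B : AInfAlg K ι} (h : A = B) (l : List (Letter A.toGrMod))
    (F : List (Letter B.toGrMod) → M) :
    listDiff (castL h l) F = listDiff l fun t => F (castL h t) := by subst h; rfl

theorem cutSum_push (i : LSet.Hom s t) (w : Word s) (F : Word t → Word t → M) :
    cutSum (push i w) F = cutSum w fun o n => F (push i o) (push i n) := by
  unfold cutSum
  have key : ∀ c : t.I → ℕ, outer (push i w) c = push i (outer w fun x => c (i.f x)) ∧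
      inner (push i w) c = push i (inner w fun x => c (i.f x)) := by
    intro c
    constructor <;>
    · funext y
      by_cases hy : ∃ x, i.f x = y
      · obtain ⟨x, rfl⟩ := hy
        simp only [outer, inner, push_apply, i.side_eq]
        split_ifs <;> simp only [castL_take, castL_drop]
      · simp [outer, inner, push_of_notMem _ _ _ hy]
  refine Finset.sum_bij' (fun c _ x => c (i.f x))
    (fun c _ y => if h : ∃ x, i.f x = y then c h.choose else 0) ?_ ?_ ?_ ?_ ?_
  · intro c hc
    rw [mem_cuts] at hc ⊢
    intro x
    have := hc (i.f x)
    rwa [push_apply, length_castL] at this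
  · intro c hc
    rw [mem_cuts] at hc ⊢
    intro y
    split_ifs with h
    · have h1 := hc h.choose
      have h3 : (push i w y).length = (push i w (i.f h.choose)).length := by
        rw [h.choose_spec]
      rw [h3, push_apply, length_castL]
      exact h1
    · exact Nat.zero_le _
  · intro c hc
    funext y
    dsimp only
    split_ifs with h
    · rw [h.choose_spec]
    · have := (mem_cuts.1 hc) y
      rw [push_of_notMem _ _ _ h] at this
      exact (Nat.le_zero.1 this).symm
  · intro c _
    funext x
    have h : ∃ x', i.f x' = i.f x := ⟨x, rfl⟩
    dsimp only
    rw [dif_pos h]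
    exact congrArg c (i.inj h.choose_spec)
  · intro c _
    rw [(key c).1, (key c).2]

theorem cutSign_push (i : LSet.Hom s t) (o n : Word s) {w : Word s}
    (h : ∀ x, pw (w x) = pw (o x) + pw (n x)) :
    cutSign (push i o) (push i n) + ro i w = cutSign o n + ro i o + ro i n := by
  have e1 : cutSign (push i o) (push i n) = ∑ x, ∑ y, if t.lt (i.f x) (i.f y) ∨
      (x = y ∧ s.side x = false) then pw (n x) * pw (o y) else 0 := by
    unfold cutSign
    rw [sum_push i]
    · refine Finset.sum_congr rfl fun x _ => ?_
      rw [sum_push i]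
      · simp only [pw_push, i.side_eq, i.inj.eq_iff]
      · intro y hy
        simp [push_of_notMem _ _ _ hy, pw_nil]
    · intro y hy
      simp [push_of_notMem _ _ _ hy, pw_nil]
  rw [e1]
  unfold cutSign ro
  simp only [sum_sum_lt s (fun x y => if t.lt (i.f x) (i.f y) ∨
    (x = y ∧ s.side x = false) then pw (n x) * pw (o y) else 0), sum_sum_lt s (fun x y =>
    if s.lt x y ∨ (x = y ∧ s.side x = false) then pw (n x) * pw (o y) else 0)]
  have hirr : ∀ x, ¬ t.lt (i.f x) (i.f x) := fun x => irrefl_of t.lt _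
  have hirr' : ∀ x, ¬ s.lt x x := fun x => irrefl_of s.lt _
  simp only [hirr, hirr', false_or]
  have : ∀ a b c d e f : ZMod 2, a + d = c + e + f → a + b + d = c + b + e + f := by
    intro a b c d e f h; linear_combination h
  refine this _ _ _ _ _ _ ?_
  simp only [← Finset.sum_add_distrib]
  refine Finset.sum_congr rfl fun x _ => Finset.sum_congr rfl fun y _ => ?_
  by_cases hxy : s.lt x y
  · have hyx := lt_asymm' hxy
    have hne := ne_of_lt' hxy
    rcases trichotomous_of t.lt (i.f x) (i.f y) with h' | h' | h'
    · simp [hxy, hyx, hne, hne.symm, h', lt_asymm' h']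
    · exact absurd (i.inj h') hne
    · simp only [hxy, hyx, hne, hne.symm, h', lt_asymm' h', h, if_true, false_and, or_false, or_self,
        if_false, and_self, zero_add, add_zero]
      grind
  · simp [hxy]

theorem cop_push (i : LSet.Hom s t) (w : Word s) (F : Word t → Word t → M) :
    zs (ro i w) • cop (push i w) F =
      cop w fun o n => zs (ro i o + ro i n) • F (push i o) (push i n) := by
  unfold cop
  rw [cutSum_push]
  unfold cutSum
  rw [Finset.smul_sum]
  refine Finset.sum_congr rfl fun c _ => ?_
  beta_reduce
  rw [zs_smul_zs_smul, zs_smul_zs_smul]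
  have := cutSign_push i (outer w c) (inner w c) fun x => ((isCut_cut w c).pw_add x).symm
  rw [add_comm, this, add_assoc]

theorem push_upd (i : LSet.Hom s t) (w : Word s) (x : s.I) (l : List (Letter (s.κ x).toGrMod)) :
    push i (upd w x l) = upd (push i w) (i.f x) (castL (i.κ_eq x).symm l) := by
  funext y
  by_cases hy : ∃ x', i.f x' = y
  · obtain ⟨x', rfl⟩ := hy
    by_cases hx : x' = x
    · subst hx
      rw [upd_self, push_apply, upd_self]
    · rw [upd_of_ne (fun e => hx (i.inj e)), push_apply, push_apply, upd_of_ne hx]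
  · rw [upd_of_ne (by rintro rfl; exact hy ⟨x, rfl⟩), push_of_notMem _ _ _ hy,
      push_of_notMem _ _ _ hy]

theorem ro_upd (i : LSet.Hom s t) (w : Word s) (x : s.I) {l : List (Letter (s.κ x).toGrMod)}
    (h : pw l = pw (w x) + 1) :
    ro i (upd w x l) + bef w x = ro i w + bef (push i w) (i.f x) := by
  have h1 : ∀ z, pw (upd w x l z) = pw (w z) + if z = x then 1 else 0 := by
    intro z
    by_cases hz : z = x
    · subst hz; simp [h]
    · simp [upd_of_ne hz, hz]
  have hb : bef (push i w) (i.f x) = ∑ y, if t.lt (i.f y) (i.f x) then pw (w y) else 0 := by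
    unfold bef
    rw [sum_push i]
    · simp only [pw_push]
    · intro y hy; simp [push_of_notMem _ _ _ hy, pw_nil]
  have hd : ro i (upd w x l) = ro i w +
      ((∑ y, if s.lt x y ∧ t.lt (i.f y) (i.f x) then pw (w y) else 0) +
      ∑ y, if s.lt y x ∧ t.lt (i.f x) (i.f y) then pw (w y) else 0) := by
    have e1 : (∑ y, if s.lt x y ∧ t.lt (i.f y) (i.f x) then pw (w y) else 0) =
        ∑ z, ∑ y, if s.lt z y ∧ t.lt (i.f y) (i.f z) then (if z = x then 1 else 0) * pw (w y)
          else 0 := by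
      rw [Finset.sum_eq_single_of_mem x (Finset.mem_univ x)
        (f := fun z => ∑ y, if s.lt z y ∧ t.lt (i.f y) (i.f z) then (if z = x then 1 else 0) *
          pw (w y) else 0)]
      · simp
      · intro z _ hz; simp [hz]
    have e2 : (∑ y, if s.lt y x ∧ t.lt (i.f x) (i.f y) then pw (w y) else 0) =
        ∑ y, ∑ z, if s.lt y z ∧ t.lt (i.f z) (i.f y) then pw (w y) * (if z = x then 1 else 0)
          else 0 := by
      refine Finset.sum_congr rfl fun y _ => ?_
      rw [Finset.sum_eq_single_of_mem x (Finset.mem_univ x)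
        (f := fun z => if s.lt y z ∧ t.lt (i.f z) (i.f y) then pw (w y) * (if z = x then 1 else 0)
          else 0)]
      · simp
      · intro z _ hz; simp [hz]
    rw [e1, e2]
    unfold ro
    simp only [← Finset.sum_add_distrib]
    refine Finset.sum_congr rfl fun y _ => Finset.sum_congr rfl fun z _ => ?_
    rw [h1, h1]
    split_ifs with hh h2 h3
    · exact absurd (h2.trans h3.symm) (ne_of_lt' hh.1)
    all_goals ring
  rw [hd, hb, add_assoc]
  congr 1
  unfold bef
  simp only [← Finset.sum_add_distrib]
  refine Finset.sum_congr rfl fun y _ => ?_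
  by_cases hxy : y = x
  · subst hxy; simp [irrefl_of s.lt y, irrefl_of t.lt (i.f y)]
  · have hne : i.f y ≠ i.f x := fun e => hxy (i.inj e)
    rcases trichotomous_of s.lt x y with h' | h' | h'
    · simp [h', lt_asymm' h']
    · exact absurd h'.symm hxy
    · rcases trichotomous_of t.lt (i.f x) (i.f y) with h'' | h'' | h''
      · simp [h', lt_asymm' h', h'', lt_asymm' h'', CharTwo.add_self_eq_zero]
      · exact absurd h''.symm hne
      · simp [h', lt_asymm' h', h'', lt_asymm' h'']

theorem wordDiff_push (i : LSet.Hom s t) (w : Word s) (F : Word t → M) :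
    zs (ro i w) • wordDiff (push i w) F = wordDiff w fun w' => zs (ro i w') • F (push i w') := by
  unfold wordDiff
  rw [sum_push i, Finset.smul_sum]
  · refine Finset.sum_congr rfl fun x _ => ?_
    have e : (listDiff (push i w (i.f x)) fun l => F (upd (push i w) (i.f x) l)) =
        listDiff (w x) fun l => F (push i (upd w x l)) := by
      simp only [push_apply, listDiff_castL, push_upd]
    rw [e, zs_smul_zs_smul, zs_smul_listDiff, zs_smul_listDiff]
    refine listDiff_congr fun l hl => ?_
    rw [zs_smul_zs_smul, ← ro_upd i w x hl, add_comm]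
  · intro y hy
    rw [push_of_notMem _ _ _ hy, listDiff_nil, smul_zero]

end push

/-! ### Normalization: all letters to the left of the module, in the order of the enumeration -/

section normalization

variable {s t r₁ r₂ : LSet K ι} {P P' Q Q' R : GrMod K ι} {k : ι}

/-- The parity of the degree of the `S⁻` part of a word. -/
def pR (w : Word s) : ZMod 2 := par (degR w)

/-- The parity of the degree of the `S⁺` part of a word. -/
def pL (w : Word s) : ZMod 2 := par (degL w)

theorem pR_eq (w : Word s) : pR w = ∑ x, if s.side x then 0 else pw (w x) := by
  simp only [pR, degR, map_sum, apply_ite (par : ι → ZMod 2), map_zero]; rfl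

theorem pL_eq (w : Word s) : pL w = ∑ x, if s.side x then pw (w x) else 0 := by
  simp only [pL, degL, map_sum, apply_ite (par : ι → ZMod 2), map_zero]; rfl

theorem pL_add_pR (w : Word s) : pL w + pR w = pd w := by
  rw [pL_eq, pR_eq, pd_eq, ← Finset.sum_add_distrib]
  refine Finset.sum_congr rfl fun x _ => ?_
  split_ifs <;> simp

theorem IsCut.pR_add {o n w : Word s} (h : IsCut o n w) : pR o + pR n = pR w := by
  rw [pR_eq, pR_eq, pR_eq, ← Finset.sum_add_distrib]
  refine Finset.sum_congr rfl fun x _ => ?_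
  split_ifs
  · rw [add_zero]
  · rw [h.pw_add]

theorem pR_toDual (w : Word s) : pR (toDual w) = pL w := by
  rw [pL_eq, pR_eq]
  refine Finset.sum_congr rfl fun (x : s.I) _ => ?_
  change (if (!s.side x) = true then _ else _) = _
  cases s.side x <;> rfl

theorem pR_pair (v : Word s) (w : Word t) : pR (pair v w) = pR v + pR w := by
  rw [pR_eq, pR_eq, pR_eq]
  exact Fintype.sum_sum_type (α₁ := s.I) (α₂ := t.I) _

/-- The exponent of the sign of the permutation of tensor factors from the order `S⁺` before `S⁻` to
the order of the enumeration. -/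
def ninv (w : Word s) : ZMod 2 :=
  ∑ x, ∑ y, if s.lt x y ∧ s.side x = false ∧ s.side y = true then pw (w x) * pw (w y) else 0

theorem ninv_emptyWord : ninv (emptyWord s) = 0 := by simp [ninv, emptyWord, pw_nil]

theorem pR_emptyWord : pR (emptyWord s) = 0 := by simp [pR_eq, emptyWord, pw_nil]

theorem par_shuffle (o n : Word s) : par (shuffle o n) =
    ∑ x, ∑ y, if s.lt x y ∧ s.side x = s.side y then
      (if s.side x then pw (n x) * pw (o y) else pw (o x) * pw (n y)) else 0 := by
  simp only [shuffle, map_sum, apply_ite (par : ι → ZMod 2), map_zero, map_mul]; rfl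

theorem cutSign_eq {o n w : Word s} (h : IsCut o n w) :
    cutSign o n + ninv o + ninv n = ninv w + par (shuffle o n) + pR o * pd n := by
  have e1 : pR o * pd n = ∑ x, ∑ y, if s.side x then 0 else pw (o x) * pw (n y) := by
    rw [pR_eq, pd_eq, Finset.sum_mul_sum]
    refine Finset.sum_congr rfl fun x _ => Finset.sum_congr rfl fun y _ => ?_
    split_ifs <;> simp
  rw [e1, par_shuffle]
  unfold cutSign ninv
  simp only [← Finset.sum_add_distrib]
  rw [sum_sum_lt s]
  rw [sum_sum_lt s (fun x y => _ + (if s.side x then (0 : ZMod 2) else pw (o x) * pw (n y)))]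
  congr 1
  · refine Finset.sum_congr rfl fun x _ => Finset.sum_congr rfl fun y _ => ?_
    by_cases hxy : s.lt x y
    · rw [if_pos hxy, if_pos hxy]
      have hyx := lt_asymm' hxy
      have hne := ne_of_lt' hxy
      rw [← h.pw_add, ← h.pw_add]
      cases hx : s.side x <;> cases hy : s.side y <;>
        simp [hxy, hyx, hne, hne.symm] <;> grind
    · rw [if_neg hxy, if_neg hxy]
  · refine Finset.sum_congr rfl fun x _ => ?_
    have := irrefl_of s.lt x
    cases hx : s.side x <;> simp [this, mul_comm]

theorem ninv_pair (v : Word s) (w : Word t) :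
    ninv (pair v w) = ninv v + ninv w + pR v * pL w := by
  have h : ninv (pair v w) = _ :=
    (Fintype.sum_sum_type (α₁ := s.I) (α₂ := t.I) _)
  have h1 : ∀ x : s.I ⊕ t.I, (∑ y, if (s.sum t).lt x y ∧ (s.sum t).side x = false ∧
      (s.sum t).side y = true then pw (pair v w x) * pw (pair v w y) else 0) = _ := fun x =>
    (Fintype.sum_sum_type (α₁ := s.I) (α₂ := t.I) _)
  rw [h]
  simp only [h1, Finset.sum_add_distrib]
  have h2 : pR v * pL w = ∑ x, ∑ y, if s.side x = false ∧ t.side y = true then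
      pw (v x) * pw (w y) else 0 := by
    rw [pR_eq, pL_eq, Finset.sum_mul_sum]
    refine Finset.sum_congr rfl fun x _ => Finset.sum_congr rfl fun y _ => ?_
    cases s.side x <;> cases t.side y <;> simp
  rw [h2]
  simp [ninv, pair]
  ring

theorem ninv_toDual (w : Word s) : ninv (toDual w) = ninv w + pL w * pR w := by
  have e : ninv (toDual w) = ∑ x, ∑ y, if s.lt x y ∧ s.side x = true ∧ s.side y = false then
      pw (w x) * pw (w y) else 0 := by
    refine Finset.sum_congr rfl fun (x : s.I) _ => Finset.sum_congr rfl fun (y : s.I) _ => ?_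
    change (if s.lt x y ∧ (!s.side x) = false ∧ (!s.side y) = true then _ else _) = _
    refine if_congr (and_congr Iff.rfl ?_) rfl rfl
    cases s.side x <;> cases s.side y <;> simp
  have e1 : pL w * pR w = ∑ x, ∑ y, if s.side x = true ∧ s.side y = false then
      pw (w x) * pw (w y) else 0 := by
    rw [pR_eq, pL_eq, Finset.sum_mul_sum]
    refine Finset.sum_congr rfl fun x _ => Finset.sum_congr rfl fun y _ => ?_
    cases s.side x <;> cases s.side y <;> simp
  rw [e, e1]
  unfold ninv
  simp only [← Finset.sum_add_distrib]
  rw [sum_sum_lt s, sum_sum_lt s (fun x y => _ + (if s.side x = true ∧ s.side y = false then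
    pw (w x) * pw (w y) else 0))]
  congr 1
  · refine Finset.sum_congr rfl fun x _ => Finset.sum_congr rfl fun y _ => ?_
    by_cases hxy : s.lt x y
    · rw [if_pos hxy, if_pos hxy]
      have hyx := lt_asymm' hxy
      cases hx : s.side x <;> cases hy : s.side y <;> simp [hxy, hyx] <;> grind
    · rw [if_neg hxy, if_neg hxy]
  · refine Finset.sum_congr rfl fun x _ => ?_
    have := irrefl_of s.lt x
    cases hx : s.side x <;> simp [this]

theorem GrMod.twist_zs (P : GrMod K ι) (d : ι) {i : ι} {p : P} (hp : p ∈ P.piece i) :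
    P.twist d p = zs (par d * par i) • p := by
  rw [P.twist_of_mem d hp, sgn_eq, map_mul]

theorem GrMod.hom_ext {P : GrMod K ι} {M : Type*} [AddCommGroup M] [Module K M] {f g : P →ₗ[K] M}
    (h : ∀ i, ∀ p ∈ P.piece i, f p = g p) : f = g := by
  refine LinearMap.ext fun p => sub_eq_zero.1 ?_
  exact (Submodule.mem_bot K).1 (P.le_of_pieces (f - g) ⊥ (fun i p hp => by
    rw [LinearMap.sub_apply, h i p hp, sub_self]; exact Submodule.zero_mem _) p)

/-- The normalized form of `f`: all letters act from the left, and the tensor factors are in the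
order of the enumeration. -/
def nrm (f : Word s → P →ₗ[K] Q) (w : Word s) : P →ₗ[K] Q :=
  zs (ninv w) • (f w ∘ₗ P.twist (degR w))

theorem nrm_apply (f : Word s → P →ₗ[K] Q) (w : Word s) {i : ι} {p : P} (hp : p ∈ P.piece i) :
    nrm f w p = zs (ninv w + pR w * par i) • f w p := by
  rw [nrm, LinearMap.smul_apply, LinearMap.comp_apply, P.twist_zs _ hp, map_zs_smul,
    zs_smul_zs_smul]
  rfl

theorem nrm_emptyWord (f : Word s → P →ₗ[K] Q) : nrm f (emptyWord s) = f (emptyWord s) :=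
  GrMod.hom_ext fun i p hp => by
    rw [nrm_apply _ _ hp, ninv_emptyWord, pR_emptyWord, zero_mul, add_zero, zs_zero_smul]

theorem nrm_injective {f g : Word s → P →ₗ[K] Q} {w : Word s} (h : nrm f w = nrm g w) :
    f w = g w := GrMod.hom_ext fun i p hp => by
  have := LinearMap.congr_fun h p
  rw [nrm_apply _ _ hp, nrm_apply _ _ hp] at this
  exact zs_smul_injective _ this

theorem nrm_add (f g : Word s → P →ₗ[K] Q) : nrm (f + g) = nrm f + nrm g := by
  funext w
  simp only [nrm, Pi.add_apply, LinearMap.add_comp, smul_add]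

theorem nrm_neg (f : Word s → P →ₗ[K] Q) : nrm (-f) = -nrm f := by
  funext w
  simp only [nrm, Pi.neg_apply, LinearMap.neg_comp, smul_neg]

theorem nrm_sub (f g : Word s → P →ₗ[K] Q) : nrm (f - g) = nrm f - nrm g := by
  rw [sub_eq_add_neg, nrm_add, nrm_neg, sub_eq_add_neg]

theorem nrm_zero_of {f : Word s → P →ₗ[K] Q} {w : Word s} (h : f w = 0) : nrm f w = 0 := by
  simp [nrm, h]

theorem nrm_eq_zero {f : Word s → P →ₗ[K] Q} {w : Word s} : nrm f w = 0 ↔ f w = 0 :=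
  ⟨fun h => nrm_injective (g := fun _ => 0) (h.trans (nrm_zero_of rfl).symm), nrm_zero_of⟩

theorem HasDeg.nrm {f : Word s → P →ₗ[K] Q} (hf : HasDeg k f) : HasDeg k (nrm f) :=
  fun w i p hp => by rw [nrm_apply _ _ hp]; exact zs_smul_mem _ _ (hf w i p hp)

theorem par_degree (i : ι) (w : Word s) (k : ι) : par (i + deg w + k) = par i + pd w + par k := by
  rw [map_add, map_add]; rfl

/-- The composition of normalized maps. -/
def cmp (k : ZMod 2) (ψ : Word s → Q →ₗ[K] R) (φ : Word s → P →ₗ[K] Q) (w : Word s) : P →ₗ[K] R :=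
  cop w fun o n => zs (k * pd o) • (ψ o ∘ₗ φ n)

theorem cmp_apply (k : ZMod 2) (ψ : Word s → Q →ₗ[K] R) (φ : Word s → P →ₗ[K] Q) (w : Word s)
    (p : P) : cmp k ψ φ w p = cop w fun o n => zs (k * pd o) • ψ o (φ n p) := by
  rw [cmp, cop_apply]; rfl

theorem nrm_comp (ψ : Word s → Q →ₗ[K] R) {φ : Word s → P →ₗ[K] Q} (hφ : HasDeg k φ)
    (w : Word s) : nrm (comp k ψ φ) w = cmp (par k) (nrm ψ) (nrm φ) w := by
  refine GrMod.hom_ext fun i p hp => ?_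
  rw [nrm_apply _ _ hp, cmp_apply]
  unfold comp cop cutSum
  rw [LinearMap.sum_apply, Finset.smul_sum]
  refine Finset.sum_congr rfl fun c _ => ?_
  have hc := isCut_cut w c
  generalize outer w c = o at hc
  generalize inner w c = n at hc
  beta_reduce
  rw [LinearMap.smul_apply, LinearMap.comp_apply, nrm_apply φ n hp, map_zs_smul,
    nrm_apply ψ o (hφ n i p hp), par_degree]
  simp only [zs_smul_zs_smul, sgn_eq]
  congr 2
  rw [map_add, map_mul, ← hc.pR_add]
  have h1 := cutSign_eq hc
  have h2 := pL_add_pR o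
  change _ + (_ + par k * pL o) = _
  grind

theorem ninv_upd {w : Word s} {x : s.I} {l : List (Letter (s.κ x).toGrMod)}
    (h : pw l = pw (w x) + 1) :
    ninv (upd w x l) + bef w x = ninv w + par (before w x) := by
  have h1 : ∀ z, pw (upd w x l z) = pw (w z) + if z = x then 1 else 0 := by
    intro z
    by_cases hz : z = x
    · subst hz; simp [h]
    · simp [upd_of_ne hz, hz]
  have hd : ninv (upd w x l) = ninv w +
      ((∑ y, if s.lt x y ∧ s.side x = false ∧ s.side y = true then pw (w y) else 0) +
      ∑ y, if s.lt y x ∧ s.side y = false ∧ s.side x = true then pw (w y) else 0) := by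
    have e1 : (∑ y, if s.lt x y ∧ s.side x = false ∧ s.side y = true then pw (w y) else 0) =
        ∑ z, ∑ y, if s.lt z y ∧ s.side z = false ∧ s.side y = true then
          (if z = x then 1 else 0) * pw (w y) else 0 := by
      rw [Finset.sum_eq_single_of_mem x (Finset.mem_univ x)
        (f := fun z => ∑ y, if s.lt z y ∧ s.side z = false ∧ s.side y = true then
          (if z = x then 1 else 0) * pw (w y) else 0)]
      · simp
      · intro z _ hz; simp [hz]
    have e2 : (∑ y, if s.lt y x ∧ s.side y = false ∧ s.side x = true then pw (w y) else 0) =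
        ∑ y, ∑ z, if s.lt y z ∧ s.side y = false ∧ s.side z = true then
          pw (w y) * (if z = x then 1 else 0) else 0 := by
      refine Finset.sum_congr rfl fun y _ => ?_
      rw [Finset.sum_eq_single_of_mem x (Finset.mem_univ x)
        (f := fun z => if s.lt y z ∧ s.side y = false ∧ s.side z = true then
          pw (w y) * (if z = x then 1 else 0) else 0)]
      · simp
      · intro z _ hz; simp [hz]
    rw [e1, e2]
    unfold ninv
    simp only [← Finset.sum_add_distrib]
    refine Finset.sum_congr rfl fun y _ => Finset.sum_congr rfl fun z _ => ?_
    rw [h1, h1]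
    split_ifs with hh h2 h3
    · exact absurd (h2.trans h3.symm) (ne_of_lt' hh.1)
    all_goals ring
  have hb : par (before w x) = ∑ y, if (s.side y ∧ ¬ s.side x) ∨ (s.side y = s.side x ∧ s.lt y x)
      then pw (w y) else 0 := by
    simp only [before, map_sum, apply_ite (par : ι → ZMod 2), map_zero]; rfl
  rw [hd, hb, add_assoc]
  congr 1
  unfold bef
  simp only [← Finset.sum_add_distrib]
  refine Finset.sum_congr rfl fun y _ => ?_
  rcases trichotomous_of s.lt x y with h' | rfl | h'
  · cases hx : s.side x <;> cases hy : s.side y <;> simp [h', lt_asymm' h']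
  · cases hx : s.side x <;> simp [irrefl_of s.lt x]
  · cases hx : s.side x <;> cases hy : s.side y <;>
      simp [h', lt_asymm' h', CharTwo.add_self_eq_zero]

theorem pR_upd {w : Word s} {x : s.I} {l : List (Letter (s.κ x).toGrMod)}
    (h : pw l = pw (w x) + 1) : pR (upd w x l) = pR w + if s.side x then 0 else 1 := by
  have h1 : (if s.side x then (0 : ZMod 2) else 1) =
      ∑ y, if y = x then (if s.side y then 0 else 1) else 0 := by simp
  rw [pR_eq, pR_eq, h1, ← Finset.sum_add_distrib]
  refine Finset.sum_congr rfl fun y _ => ?_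
  by_cases hy : y = x
  · subst hy
    rw [upd_self, h, if_pos rfl]
    split_ifs <;> simp
  · simp [upd_of_ne hy, hy]

theorem barSum_eq {M : Type*} [AddCommGroup M] (w : Word s) (F : s.I → Word s → M) :
    barSum w F = ∑ x, zs (par (before w x)) • listDiff (w x) fun l => F x (upd w x l) := by
  refine Finset.sum_congr rfl fun x _ => ?_
  unfold listDiff
  rw [blockSum_eq, Finset.smul_sum]
  refine Finset.sum_congr rfl fun j _ => ?_
  rw [Finset.smul_sum]
  refine Finset.sum_congr rfl fun k _ => ?_
  rw [zs_smul_zs_smul, sgn_eq, map_add]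
  rfl

theorem nrm_preD (f : Word s → P →ₗ[K] Q) (w : Word s) : nrm (preD f) w = wordDiff w (nrm f) := by
  refine GrMod.hom_ext fun i p hp => ?_
  rw [nrm_apply _ _ hp, preD, barSum_eq, LinearMap.sum_apply, wordDiff_apply, Finset.smul_sum]
  refine Finset.sum_congr rfl fun x _ => ?_
  rw [LinearMap.smul_apply, zs_smul_zs_smul]
  have e := map_listDiff (LinearMap.applyₗ p : (P →ₗ[K] Q) →ₗ[K] Q) (w x) fun l =>
    (fun x w' => if s.side x then f w' else f w' ∘ₗ P.twist 1) x (upd w x l)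
  simp only [LinearMap.applyₗ_apply_apply] at e
  rw [e, zs_smul_listDiff, zs_smul_listDiff]
  refine listDiff_congr fun l hl => ?_
  beta_reduce
  rw [nrm_apply _ _ hp, zs_smul_zs_smul, pR_upd hl]
  have h1 := ninv_upd hl
  split_ifs with hs
  · congr 2
    grind
  · rw [LinearMap.comp_apply, P.twist_zs _ hp, map_zs_smul, zs_smul_zs_smul, map_one]
    congr 2
    grind

theorem par_reorder (i : LSet.Hom s t) (w : Word s) : par (reorder i w) =
    ∑ x, ∑ y, if s.side x = s.side y ∧ s.lt x y ∧ t.lt (i.f y) (i.f x) then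
      pw (w x) * pw (w y) else 0 := by
  simp only [reorder, map_sum, apply_ite (par : ι → ZMod 2), map_zero, map_mul]; rfl

theorem ninv_push (i : LSet.Hom s t) (w : Word s) :
    ninv w + par (reorder i w) = ro i w + ninv (push i w) := by
  have e1 : ninv (push i w) = ∑ x, ∑ y, if t.lt (i.f x) (i.f y) ∧ s.side x = false ∧
      s.side y = true then pw (w x) * pw (w y) else 0 := by
    unfold ninv
    rw [sum_push i]
    · refine Finset.sum_congr rfl fun x _ => ?_
      rw [sum_push i]
      · simp only [pw_push, i.side_eq]
      · intro y hy
        simp [push_of_notMem _ _ _ hy, pw_nil]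
    · intro y hy
      simp [push_of_notMem _ _ _ hy, pw_nil]
  rw [e1, par_reorder]
  unfold ninv ro
  simp only [← Finset.sum_add_distrib]
  rw [sum_sum_lt s]
  rw [sum_sum_lt s (fun x y => _ + (if t.lt (i.f x) (i.f y) ∧ s.side x = false ∧
      s.side y = true then pw (w x) * pw (w y) else 0))]
  congr 1
  · refine Finset.sum_congr rfl fun x _ => Finset.sum_congr rfl fun y _ => ?_
    by_cases hxy : s.lt x y
    · rw [if_pos hxy, if_pos hxy]
      have hyx := lt_asymm' hxy
      have hne := ne_of_lt' hxy
      rcases trichotomous_of t.lt (i.f x) (i.f y) with h' | h' | h'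
      · have h'' := lt_asymm' h'
        cases hx : s.side x <;> cases hy : s.side y <;> simp [hxy, hyx, h', h'']
      · exact absurd (i.inj h') hne
      · have h'' := lt_asymm' h'
        cases hx : s.side x <;> cases hy : s.side y <;> simp [hxy, hyx, h', h''] <;> grind
    · rw [if_neg hxy, if_neg hxy]
  · refine Finset.sum_congr rfl fun x _ => ?_
    have := irrefl_of s.lt x
    have h' := irrefl_of t.lt (i.f x)
    cases hx : s.side x <;> simp [this, h']

theorem pR_push (i : LSet.Hom s t) (w : Word s) : pR (push i w) = pR w := by
  rw [pR_eq, pR_eq, sum_push i]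
  · simp only [pw_push, i.side_eq]
  · intro y hy
    simp [push_of_notMem _ _ _ hy, pw_nil]

/-- Normalized restriction of scalars. -/
def npull (i : LSet.Hom s t) (f : Word t → P →ₗ[K] Q) (w : Word s) : P →ₗ[K] Q :=
  zs (ro i w) • f (push i w)

theorem nrm_pull (i : LSet.Hom s t) (f : Word t → P →ₗ[K] Q) (w : Word s) :
    nrm (pull i f) w = npull i (nrm f) w := by
  refine GrMod.hom_ext fun d p hp => ?_
  rw [nrm_apply _ _ hp, npull, LinearMap.smul_apply, nrm_apply _ _ hp, pull, LinearMap.smul_apply,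
    sgn_eq, zs_smul_zs_smul, zs_smul_zs_smul, pR_push]
  congr 2
  have := ninv_push i w
  grind

theorem npull_cmp (i : LSet.Hom s t) (k : ZMod 2) (ψ : Word t → Q →ₗ[K] R) (φ : Word t → P →ₗ[K] Q)
    (w : Word s) : cmp k (npull i ψ) (npull i φ) w = npull i (cmp k ψ φ) w := by
  refine LinearMap.ext fun p => ?_
  rw [npull, LinearMap.smul_apply, cmp_apply, cmp_apply, cop_push]
  refine cop_congr fun o n _ => ?_
  simp only [npull, LinearMap.smul_apply, map_zs_smul, zs_smul_zs_smul, pd_push]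
  congr 2
  ring

theorem npull_wordDiff (i : LSet.Hom s t) (f : Word t → P →ₗ[K] Q) (w : Word s) :
    wordDiff w (npull i f) = npull i (fun w => wordDiff w f) w :=
  (wordDiff_push i w f).symm

theorem fstW_pair (v : Word s) (w : Word t) : fstW (pair v w) = v := rfl

theorem sndW_pair (v : Word s) (w : Word t) : sndW (pair v w) = w := rfl

theorem nrm_extL (h : Word r₁ → P →ₗ[K] Q) : nrm (extL r₂ h) = extL r₂ (nrm h) := by
  funext w
  unfold extL
  split_ifs with hw
  · refine GrMod.hom_ext fun i p hp => ?_
    rw [nrm_apply _ _ hp, nrm_apply _ _ hp, if_pos hw, ← pair_fst_snd w, fstW_pair, ninv_pair,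
      pR_pair, hw, ninv_emptyWord, pR_emptyWord, add_zero, add_zero, pL_eq]
    simp [emptyWord, pw_nil]
  · exact nrm_zero_of (if_neg hw)

theorem nrm_extR (h : Word r₂ → P →ₗ[K] Q) : nrm (extR r₁ h) = extR r₁ (nrm h) := by
  funext w
  unfold extR
  split_ifs with hw
  · refine GrMod.hom_ext fun i p hp => ?_
    rw [nrm_apply _ _ hp, nrm_apply _ _ hp, if_pos hw, ← pair_fst_snd w, sndW_pair, ninv_pair,
      pR_pair, hw, ninv_emptyWord, pR_emptyWord, zero_add, zero_add, zero_mul, add_zero]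
  · exact nrm_zero_of (if_neg hw)

theorem nrm_extE (h : P →ₗ[K] Q) : nrm (extE s h) = extE s h := by
  funext w
  unfold extE
  split_ifs with hw
  · rw [hw, nrm_emptyWord, if_pos rfl]
  · exact nrm_zero_of (if_neg hw)

end normalization

/-! ### The structure maps of tensor products and internal Hom, in normalized form -/

section structure_normal_forms

variable {s t r₁ r₂ : LSet K ι} {P P' Q Q' R : GrMod K ι} {k : ι}

theorem par_deg (w : Word s) : par (deg w) = pd w := rfl

theorem par_degL (w : Word s) : par (degL w) = pL w := rfl

theorem par_degR (w : Word s) : par (degR w) = pR w := rfl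

/-- The element `p ⊗ g ⊗ q`, with the factors of `g` in the order of the enumeration. -/
def tm (p : P) (g : Word s) (q : Q) : tens s P Q := zs (ninv g) • tmk p g q

theorem tm_mem {a b : ι} {p : P} {g : Word s} {q : Q} (hp : p ∈ P.piece a) (hq : q ∈ Q.piece b) :
    tm p g q ∈ (tens s P Q).piece (a + deg g + b) :=
  zs_smul_mem _ _ (tmk_mem hp hq rfl)

/-- The bilinear map `(p, q) ↦ p ⊗ g ⊗ q`. -/
def tmB (g : Word s) : P →ₗ[K] Q →ₗ[K] tens s P Q := zs (ninv g) • tmap LinearMap.id g LinearMap.id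

theorem tmB_apply (p : P) (g : Word s) (q : Q) : tmB g p q = tm p g q := by
  rw [tmB, LinearMap.smul_apply, LinearMap.smul_apply]; rfl

theorem tm_smul_left (e : ZMod 2) (p : P) (g : Word s) (q : Q) :
    tm (zs e • p) g q = zs e • tm p g q := by
  rw [← tmB_apply, map_zs_smul, ← tmB_apply]
  rfl

theorem tm_smul_right (e : ZMod 2) (p : P) (g : Word s) (q : Q) :
    tm p g (zs e • q) = zs e • tm p g q := by
  rw [← tmB_apply, map_zs_smul, ← tmB_apply]

theorem tmk_eq_tm (p : P) (g : Word s) (q : Q) : tmk p g q = zs (ninv g) • tm p g q := by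
  rw [tm, zs_smul_self]

theorem tens_hom_ext {M : Type*} [AddCommGroup M] [Module K M] {f g : tens s P Q →ₗ[K] M}
    (h : ∀ a b, ∀ p ∈ P.piece a, ∀ w, ∀ q ∈ Q.piece b, f (tm p w q) = g (tm p w q)) : f = g := by
  refine GrMod.hom_ext fun i z hz => ?_
  have : (tens s P Q).piece i ≤ LinearMap.eqLocus f g := tens_piece_le fun a b p hp w q hq _ => by
    rw [LinearMap.mem_eqLocus, tmk_eq_tm, map_zs_smul, map_zs_smul, h a b p hp w q hq]
  exact this hz

/-- The normalized action of `f` on the first factor of `P ⊗ 𝓑 ⊗ Q`. -/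
def actL (Q : GrMod K ι) (f : homPiece (s.dual.sum r₁) P P' k) :
    Word r₁ → tens s P Q →ₗ[K] tens s P' Q :=
  nrm fun v => tensLift (tensLFun f.1 v) (multilin_tensLFun f.2.1 v)

theorem nrm_tensL (Q : GrMod K ι) (f : homPiece (s.dual.sum r₁) P P' k) :
    nrm (tensL r₂ Q f).1 = extL r₂ (actL Q f) := nrm_extL _

theorem actL_tm (f : homPiece (s.dual.sum r₁) P P' k) (v : Word r₁) {a b : ι} {p : P} {q : Q}
    (hp : p ∈ P.piece a) (hq : q ∈ Q.piece b) (g : Word s) :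
    actL Q f v (tm p g q) = cop g fun o n =>
      zs (pd o * (pd v + par a)) • tm (nrm f.1 (pair (toDual o) v) p) n q := by
  rw [actL, nrm_apply _ _ (tm_mem hp hq), tm, map_zs_smul, tensLift_tmk, tensLFun]
  unfold cop cutSum
  rw [LinearMap.sum_apply, LinearMap.sum_apply, Finset.smul_sum, Finset.smul_sum]
  refine Finset.sum_congr rfl fun c _ => ?_
  have hc := isCut_cut g c
  generalize outer g c = o at hc
  generalize inner g c = n at hc
  beta_reduce
  rw [LinearMap.smul_apply, LinearMap.smul_apply, tmap_apply, LinearMap.comp_apply,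
    P.twist_zs _ hp, Q.twist_zs _ hq, nrm_apply _ _ hp, tmk_eq_tm, map_zs_smul, tm_smul_left,
    tm_smul_right, tm_smul_left, sgn_eq]
  simp only [zs_smul_zs_smul]
  congr 2
  simp only [map_add, map_mul, par_deg, par_degL, par_degR, ninv_pair, pR_pair, ninv_toDual,
    pR_toDual]
  have h1 := cutSign_eq hc
  have h2 := pL_add_pR o
  have h3 := pL_add_pR v
  have h4 := hc.pd_add
  grind

/-- The normalized action of `f` on the last factor of `P ⊗ 𝓑 ⊗ Q`. -/
def actR (P : GrMod K ι) (f : homPiece (s.sum r₂) Q Q' k) :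
    Word r₂ → tens s P Q →ₗ[K] tens s P Q' :=
  nrm fun v => tensLift (tensRFun k f.1 v) (multilin_tensRFun f.2.1 v)

theorem nrm_tensR (P : GrMod K ι) (f : homPiece (s.sum r₂) Q Q' k) :
    nrm (tensR r₁ P f).1 = extR r₁ (actR P f) := nrm_extR _

theorem actR_tm (f : homPiece (s.sum r₂) Q Q' k) (v : Word r₂) {a b : ι} {p : P} {q : Q}
    (hp : p ∈ P.piece a) (hq : q ∈ Q.piece b) (g : Word s) :
    actR P f v (tm p g q) = cop g fun o n =>
      zs ((par k + pd v) * (par a + pd o) + pd n * pd v) • tm p o (nrm f.1 (pair n v) q) := by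
  rw [actR, nrm_apply _ _ (tm_mem hp hq), tm, map_zs_smul, tensLift_tmk, tensRFun]
  unfold cop cutSum
  rw [LinearMap.sum_apply, LinearMap.sum_apply, Finset.smul_sum, Finset.smul_sum]
  refine Finset.sum_congr rfl fun c _ => ?_
  have hc := isCut_cut g c
  generalize outer g c = o at hc
  generalize inner g c = n at hc
  beta_reduce
  rw [LinearMap.smul_apply, LinearMap.smul_apply, tmap_apply, LinearMap.comp_apply,
    P.twist_zs _ hp, Q.twist_zs _ hq, nrm_apply _ _ hq, tmk_eq_tm, map_zs_smul, tm_smul_left,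
    tm_smul_right, tm_smul_right, sgn_eq]
  simp only [zs_smul_zs_smul]
  congr 2
  simp only [map_add, map_mul, par_deg, par_degL, par_degR, ninv_pair, pR_pair]
  have h1 := cutSign_eq hc
  have h2 := pL_add_pR n
  have h3 := pL_add_pR v
  have h4 := hc.pd_add
  grind

/-- The differential of the middle factor of `P ⊗ 𝓑 ⊗ Q`. -/
def dTens (s : LSet K ι) (P Q : GrMod K ι) : tens s P Q →ₗ[K] tens s P Q :=
  tensLift tensDFun multilin_tensDFun

theorem dTens_tm {a : ι} {p : P} (hp : p ∈ P.piece a) (g : Word s) (q : Q) :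
    dTens s P Q (tm p g q) = zs (par a) • wordDiff g fun g' => tm p g' q := by
  rw [dTens, tm, map_zs_smul, tensLift_tmk, tensDFun, barSum_eq, LinearMap.sum_apply,
    LinearMap.sum_apply, wordDiff, Finset.smul_sum, Finset.smul_sum]
  refine Finset.sum_congr rfl fun x _ => ?_
  rw [LinearMap.smul_apply, LinearMap.smul_apply, zs_smul_zs_smul, zs_smul_zs_smul]
  have e := map_listDiff ((LinearMap.applyₗ q : (Q →ₗ[K] tens s P Q) →ₗ[K] tens s P Q) ∘ₗ
    (LinearMap.applyₗ p : (P →ₗ[K] Q →ₗ[K] tens s P Q) →ₗ[K] Q →ₗ[K] tens s P Q)) (g x) fun l =>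
    (fun _ g' => tmap (P.twist 1) g' LinearMap.id) x (upd g x l)
  simp only [LinearMap.applyₗ_apply_apply, LinearMap.comp_apply] at e
  rw [e, zs_smul_listDiff, zs_smul_listDiff]
  refine listDiff_congr fun l hl => ?_
  rw [tmap_apply, P.twist_zs _ hp, tmk_eq_tm, tm_smul_left, zs_smul_zs_smul, zs_smul_zs_smul,
    map_one]
  have h1 := ninv_upd hl
  congr 2
  grind

theorem tensD_val (s t : LSet K ι) (P Q : GrMod K ι) :
    (tensD s t P Q).1 = extE t (dTens s P Q) := rfl

/-- The normalized form of an element of `PHom s P Q`. -/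
def hv (φ : PHom s P Q) : Word s → P →ₗ[K] Q := nrm (PHom.val φ)

/-- `hv`, evaluated at a word, as a linear map. -/
def hvL (a : Word s) : PHom s P Q →ₗ[K] P →ₗ[K] Q where
  toFun φ := hv φ a
  map_add' φ ψ := by rw [hv, map_add, nrm_add]; rfl
  map_smul' c φ := by
    simp only [hv, nrm, map_smul, Pi.smul_apply, LinearMap.smul_comp, RingHom.id_apply]
    rw [smul_comm]

theorem hvL_apply (a : Word s) (φ : PHom s P Q) : hvL a φ = hv φ a := rfl

theorem hv_zs_smul (e : ZMod 2) (φ : PHom s P Q) (a : Word s) :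
    hv (zs e • φ) a = zs e • hv φ a := map_zs_smul (hvL a) e φ

theorem hv_ext {φ ψ : PHom s P Q} (h : ∀ a i, ∀ p ∈ P.piece i, hv φ a p = hv ψ a p) : φ = ψ := by
  refine PHom.val_injective (funext fun a => nrm_injective ?_)
  exact GrMod.hom_ext (h a)

theorem hv_mem {d : ι} {φ : PHom s P Q} (hφ : φ ∈ (PHom s P Q).piece d) (a : Word s) {i : ι} {p : P}
    (hp : p ∈ P.piece i) : hv φ a p ∈ Q.piece (i + deg a + d) :=
  (HasDeg.nrm (PHom.val_mem hφ).2) a i p hp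

theorem multilin_hv {d : ι} {φ : PHom s P Q} (hφ : φ ∈ (PHom s P Q).piece d) :
    Multilin (K := K) (PHom.val φ) := (PHom.val_mem hφ).1

theorem SameDeg.pw {w w' : Word s} (h : SameDeg w w') (x : s.I) : pw (w x) = pw (w' x) :=
  congrArg par (h x)

theorem SameDeg.ninv {w w' : Word s} (h : SameDeg w w') : ninv w = ninv w' := by
  unfold PolyMod.ninv
  simp only [h.pw]

theorem Multilin.nrm {f : Word s → P →ₗ[K] Q} (hf : Multilin (K := K) f) :
    Multilin (K := K) (nrm f) := by
  refine multilin_of_pieces fun i p hp => ?_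
  have e : (fun w => PolyMod.nrm f w p) = fun w => zs (PolyMod.ninv w + pR w * par i) • f w p :=
    funext fun w => nrm_apply f w hp
  rw [e]
  refine Multilin.diag (fun c w => zs (PolyMod.ninv c + pR c * par i) • f w p) (fun c => ?_)
    fun c c' h => ?_
  · rcases Int.units_eq_one_or (zs (PolyMod.ninv c + pR c * par i)) with h | h <;> rw [h]
    · simpa using hf.map (LinearMap.applyₗ p)
    · simpa using (hf.map (LinearMap.applyₗ p)).map (-LinearMap.id)
  · have : pR c = pR c' := congrArg par h.degR
    rw [h.ninv, this]

theorem PHom.twist_zs {i : ι} {φ : PHom s P Q} (hφ : φ ∈ (PHom s P Q).piece i) (d : ι)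
    (w : Word s) :
    PHom.val ((PHom s P Q).twist d φ) w = zs (par d * par i) • PHom.val φ w := by
  rw [PHom.twist_val hφ, sgn_eq, map_mul]
  rfl

/-- The normalized postcomposition with `f`. -/
def post (P : GrMod K ι) (f : homPiece (s.sum r₂) Q Q' k) :
    Word r₂ → PHom s P Q →ₗ[K] PHom s P Q' :=
  nrm fun v => PHom.lift (postFun f.1 v) (deg v + k) (postFun_mem f.2 v)

theorem nrm_homPost (P : GrMod K ι) (f : homPiece (s.sum r₂) Q Q' k) :
    nrm (homPost r₁ P f).1 = extR r₁.dual (post P f) := nrm_extR _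

theorem hv_post (f : homPiece (s.sum r₂) Q Q' k) (v : Word r₂) {d a : ι} {φ : PHom s P Q}
    (hφ : φ ∈ (PHom s P Q).piece d) {p : P} (hp : p ∈ P.piece a) (w : Word s) :
    hv (post P f v φ) w p = cop w fun o n =>
      zs (pd o * (pd v + par d)) • nrm f.1 (pair o v) (hv φ n p) := by
  rw [post, nrm_apply _ _ hφ, hv_zs_smul, LinearMap.smul_apply, hv, nrm_apply _ _ hp, PHom.val_lift,
    postFun_apply]
  unfold cop cutSum
  rw [LinearMap.sum_apply, Finset.smul_sum, Finset.smul_sum]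
  refine Finset.sum_congr rfl fun c _ => ?_
  have hc := isCut_cut w c
  generalize outer w c = o at hc
  generalize inner w c = n at hc
  beta_reduce
  have h0 := (PHom.val_mem hφ).2 n a p hp
  rw [PHom.twist_zs hφ, LinearMap.smul_apply, LinearMap.comp_apply, LinearMap.comp_apply,
    P.twist_zs _ hp, map_zs_smul, map_zs_smul, LinearMap.smul_apply, map_zs_smul, hv,
    nrm_apply _ _ hp, map_zs_smul, nrm_apply _ _ h0, sgn_eq]
  simp only [zs_smul_zs_smul]
  congr 2
  simp only [map_add, map_mul, par_deg, par_degL, par_degR, ninv_pair, pR_pair]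
  have h1 := cutSign_eq hc
  have h2 := pL_add_pR o
  have h3 := pL_add_pR v
  have h4 := hc.pd_add
  have h5 := hc.pR_add
  grind

/-- The normalized precomposition with `f`. -/
def pre (Q : GrMod K ι) (f : homPiece (s.sum r₁) P' P k) :
    Word r₁.dual → PHom s P Q →ₗ[K] PHom s P' Q :=
  nrm fun u => PHom.lift (preFun k f.1 (ofDual u)) (deg (ofDual u) + k) (preFun_mem f.2 (ofDual u))

theorem nrm_homPre (Q : GrMod K ι) (f : homPiece (s.sum r₁) P' P k) :
    nrm (homPre r₂ Q f).1 = extL r₂ (pre Q f) := nrm_extL _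

theorem hv_pre (f : homPiece (s.sum r₁) P' P k) (u : Word r₁) {d a : ι} {φ : PHom s P Q}
    (hφ : φ ∈ (PHom s P Q).piece d) {p : P'} (hp : p ∈ P'.piece a) (w : Word s) :
    hv (pre Q f (toDual u) φ) w p = cop w fun o n =>
      zs (pd u * (par d + pd w) + par k * (par d + pd o)) • hv φ o (nrm f.1 (pair n u) p) := by
  rw [pre, nrm_apply _ _ hφ, hv_zs_smul, LinearMap.smul_apply, hv, nrm_apply _ _ hp, PHom.val_lift,
    preFun_apply, ninv_toDual, pR_toDual]
  unfold cop cutSum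
  rw [LinearMap.sum_apply, Finset.smul_sum, Finset.smul_sum]
  refine Finset.sum_congr rfl fun c _ => ?_
  have hc := isCut_cut w c
  generalize outer w c = o at hc
  generalize inner w c = n at hc
  beta_reduce
  change _ • _ • (sgn (shuffle o n + degL u * (degL o + degL n) +
      degR u * (degL o + degL n + degL u + degR n) + k * degL o) •
      (PHom.val ((PHom s P Q).twist (degR u + k) φ) o ∘ₗ
        f.1 (pair n u) ∘ₗ P'.twist (degR u))) p = _
  have h0 := f.2.2 (pair n u) a p hp
  rw [PHom.twist_zs hφ, LinearMap.smul_apply, LinearMap.comp_apply, LinearMap.comp_apply,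
    P'.twist_zs _ hp, map_zs_smul, map_zs_smul, LinearMap.smul_apply, nrm_apply _ _ hp, map_zs_smul,
    hv, nrm_apply _ _ h0, sgn_eq]
  simp only [zs_smul_zs_smul]
  congr 2
  simp only [map_add, map_mul, par_deg, par_degL, par_degR, ninv_pair, pR_pair, deg_pair]
  have h1 := cutSign_eq hc
  have h2 := pL_add_pR o
  have h3 := pL_add_pR u
  have h4 := hc.pd_add
  have h5 := hc.pR_add
  have h6 := pL_add_pR n
  have h7 := pL_add_pR w
  grind

/-- Precomposition with the differential of the bar coalgebra. -/
def dHom (s : LSet K ι) (P Q : GrMod K ι) : PHom s P Q →ₗ[K] PHom s P Q :=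
  PHom.lift dFun 1 dFun_mem

theorem homD_val (s t : LSet K ι) (P Q : GrMod K ι) : (homD s t P Q).1 = extE t (dHom s P Q) := rfl

theorem hv_dHom {d : ι} {φ : PHom s P Q} (hφ : φ ∈ (PHom s P Q).piece d) (w : Word s) :
    hv (dHom s P Q φ) w = zs (par d) • wordDiff w (hv φ) := by
  have e : PHom.val (dHom s P Q φ) = preD (PHom.val ((PHom s P Q).twist 1 φ)) :=
    funext fun a => dFun_apply φ a
  have e' : nrm (PHom.val ((PHom s P Q).twist 1 φ)) = fun w => zs (par d) • hv φ w := by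
    change hv ((PHom s P Q).twist 1 φ) = _
    rw [(PHom s P Q).twist_zs 1 hφ, map_one, one_mul]
    exact funext fun w => hv_zs_smul _ _ _
  rw [hv, e, nrm_preD, e', zs_smul_wordDiff]

theorem hv_cop {t : LSet K ι} (w : Word t) (F : Word t → Word t → PHom s P Q) (a : Word s) :
    hv (cop w F) a = cop w fun o n => hv (F o n) a := map_cop (hvL a) w F

theorem hv_wordDiff {t : LSet K ι} (w : Word t) (F : Word t → PHom s P Q) (a : Word s) :
    hv (wordDiff w F) a = wordDiff w fun w' => hv (F w') a := map_wordDiff (hvL a) w F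

theorem hasDeg_post (P : GrMod K ι) (f : homPiece (s.sum r₂) Q Q' k) : HasDeg k (post P f) :=
  HasDeg.nrm (PHom.lift_mem (multilin_postFun f.2.1) (postFun_mem f.2)).2

theorem hasDeg_pre (Q : GrMod K ι) (f : homPiece (s.sum r₁) P' P k) : HasDeg k (pre Q f) :=
  HasDeg.nrm (dual_mem (PHom.lift_mem (multilin_preFun f.2.1) (preFun_mem f.2))).2

theorem dHom_mem {d : ι} {φ : PHom s P Q} (hφ : φ ∈ (PHom s P Q).piece d) :
    dHom s P Q φ ∈ (PHom s P Q).piece (d + 1) := dFun_mem d φ hφ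

end structure_normal_forms

/-! ### The equation `d² = 0` for the bar construction of a normalized map -/

section relation

variable {s t r₁ r₂ : LSet K ι} {M N P P' Q Q' R : GrMod K ι} {k : ι}

theorem cmp_add_left (k : ZMod 2) (ψ ψ' : Word s → Q →ₗ[K] R) (φ : Word s → P →ₗ[K] Q) :
    cmp k (ψ + ψ') φ = cmp k ψ φ + cmp k ψ' φ := by
  funext w
  simp only [cmp, Pi.add_apply, LinearMap.add_comp, smul_add, cop_add]

theorem cmp_add_right (k : ZMod 2) (ψ : Word s → Q →ₗ[K] R) (φ φ' : Word s → P →ₗ[K] Q) :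
    cmp k ψ (φ + φ') = cmp k ψ φ + cmp k ψ φ' := by
  funext w
  simp only [cmp, Pi.add_apply, LinearMap.comp_add, smul_add, cop_add]

theorem cmp_neg_left (k : ZMod 2) (ψ : Word s → Q →ₗ[K] R) (φ : Word s → P →ₗ[K] Q) :
    cmp k (-ψ) φ = -cmp k ψ φ := by
  funext w
  simp only [cmp, Pi.neg_apply, LinearMap.neg_comp, smul_neg, cop_neg]

theorem cmp_neg_right (k : ZMod 2) (ψ : Word s → Q →ₗ[K] R) (φ : Word s → P →ₗ[K] Q) :
    cmp k ψ (-φ) = -cmp k ψ φ := by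
  funext w
  simp only [cmp, Pi.neg_apply, LinearMap.comp_neg, smul_neg, cop_neg]

theorem extL_pair (h : Word r₁ → P →ₗ[K] Q) (v : Word r₁) (w : Word r₂) :
    extL r₂ h (pair v w) = if w = emptyWord r₂ then h v else 0 := rfl

theorem extR_pair (h : Word r₂ → P →ₗ[K] Q) (v : Word r₁) (w : Word r₂) :
    extR r₁ h (pair v w) = if v = emptyWord r₁ then h w else 0 := rfl

theorem cmp_extL_extL (k : ZMod 2) (f : Word r₁ → Q →ₗ[K] R) (g : Word r₁ → P →ₗ[K] Q) :
    cmp k (extL r₂ f) (extL r₂ g) = extL r₂ (cmp k f g) := by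
  funext x
  rw [← pair_fst_snd x, cmp, cop_pair, extL_pair]
  generalize fstW x = v
  generalize sndW x = w
  rw [cop_comm, cop_eq_left]
  · split_ifs with h
    · refine cop_congr fun o n _ => ?_
      rw [extL_pair, extL_pair, if_pos rfl, if_pos h, pd_pair, pd_emptyWord, mul_zero, zs_zero_smul,
        add_zero]
    · simp only [extL_pair, if_neg h, LinearMap.comp_zero, smul_zero, cop_zero]
  · intro o' n' ho
    simp only [extL_pair, if_neg ho, LinearMap.zero_comp, smul_zero, cop_zero]

theorem cmp_extR_extR (k : ZMod 2) (f : Word r₂ → Q →ₗ[K] R) (g : Word r₂ → P →ₗ[K] Q) :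
    cmp k (extR r₁ f) (extR r₁ g) = extR r₁ (cmp k f g) := by
  funext x
  rw [← pair_fst_snd x, cmp, cop_pair, extR_pair]
  generalize fstW x = v
  generalize sndW x = w
  rw [cop_eq_left]
  · split_ifs with h
    · refine cop_congr fun o n _ => ?_
      rw [extR_pair, extR_pair, if_pos rfl, if_pos h, pd_pair, pd_emptyWord, h, pd_emptyWord,
        zero_mul, zs_zero_smul, zero_add]
    · simp only [extR_pair, if_neg h, LinearMap.comp_zero, smul_zero, cop_zero]
  · intro o' n' ho
    simp only [extR_pair, if_neg ho, LinearMap.zero_comp, smul_zero, cop_zero]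

theorem cmp_extL_extR (k : ZMod 2) (f : Word r₁ → Q →ₗ[K] R) (g : Word r₂ → P →ₗ[K] Q)
    (v : Word r₁) (w : Word r₂) :
    cmp k (extL r₂ f) (extR r₁ g) (pair v w) = zs (k * pd v) • (f v ∘ₗ g w) := by
  rw [cmp, cop_pair, cop_eq_right, cop_eq_left]
  · rw [extL_pair, extR_pair, if_pos rfl, if_pos rfl, pd_pair, pd_emptyWord, pd_emptyWord, zero_mul,
      zs_zero_smul, add_zero]
  · intro o n h
    simp only [extL_pair, if_neg h, LinearMap.zero_comp, smul_zero]
  · intro o n h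
    simp only [extR_pair, if_neg h, LinearMap.comp_zero, smul_zero, cop_zero]

theorem cmp_extR_extL (k : ZMod 2) (f : Word r₁ → P →ₗ[K] Q) (g : Word r₂ → Q →ₗ[K] R)
    (v : Word r₁) (w : Word r₂) :
    cmp k (extR r₁ g) (extL r₂ f) (pair v w) = zs (pd v * pd w + k * pd w) • (g w ∘ₗ f v) := by
  rw [cmp, cop_pair, cop_eq_left, cop_eq_right]
  · rw [extL_pair, extR_pair, if_pos rfl, if_pos rfl, pd_pair, pd_emptyWord, zs_smul_zs_smul,
      zero_add]
  · intro o n h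
    simp only [extL_pair, if_neg h, LinearMap.comp_zero, smul_zero]
  · intro o n h
    simp only [extR_pair, if_neg h, LinearMap.zero_comp, smul_zero, cop_zero]

theorem cmp_extE_left (k : ZMod 2) (D : Q →ₗ[K] R) (f : Word s → P →ₗ[K] Q) (w : Word s) :
    cmp k (extE s D) f w = D ∘ₗ f w := by
  rw [cmp, cop_eq_left]
  · rw [extE, if_pos rfl, pd_emptyWord, mul_zero, zs_zero_smul]
  · intro o n h
    rw [extE, if_neg h, LinearMap.zero_comp, smul_zero]

theorem cmp_extE_right (k : ZMod 2) (D : P →ₗ[K] Q) (f : Word s → Q →ₗ[K] R) (w : Word s) :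
    cmp k f (extE s D) w = zs (k * pd w) • (f w ∘ₗ D) := by
  rw [cmp, cop_eq_right]
  · rw [extE, if_pos rfl]
  · intro o n h
    rw [extE, if_neg h, LinearMap.comp_zero, smul_zero]

theorem wordDiff_extL (h : Word r₁ → P →ₗ[K] Q) (v : Word r₁) (w : Word r₂) :
    wordDiff (pair v w) (extL r₂ h) = extL r₂ (fun v => wordDiff v h) (pair v w) := by
  rw [wordDiff_pair, extL_pair, wordDiff_eq_zero (w := w), smul_zero, add_zero]
  · simp only [extL_pair]
    split_ifs
    · rfl
    · exact wordDiff_zero v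
  · intro u hu
    rw [extL_pair, if_neg hu]

theorem wordDiff_extR (h : Word r₂ → P →ₗ[K] Q) (v : Word r₁) (w : Word r₂) :
    wordDiff (pair v w) (extR r₁ h) = extR r₁ (fun v => wordDiff v h) (pair v w) := by
  rw [wordDiff_pair, extR_pair, wordDiff_eq_zero (w := v), zero_add]
  · simp only [extR_pair]
    split_ifs with hv
    · rw [hv, pd_emptyWord, zs_zero_smul]
    · rw [wordDiff_zero w, smul_zero]
  · intro u hu
    rw [extR_pair, if_neg hu]

theorem wordDiff_extE (D : P →ₗ[K] Q) (w : Word s) : wordDiff w (extE s D) = 0 :=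
  wordDiff_eq_zero fun _ hv => if_neg hv

/-- The equation `d² = 0` for the bar construction of a normalized map. -/
def NRel (f : Word s → P →ₗ[K] P) : Prop := ∀ w, cmp 1 f f w + wordDiff w f = 0

theorem rel_iff_nRel {f : Word s → P →ₗ[K] P} (hf : f ∈ homPiece s P P 1) :
    (∀ w, comp 1 f f w + preD f w = 0) ↔ NRel (nrm f) := by
  refine forall_congr' fun w => ?_
  have h : nrm (fun w => comp 1 f f w + preD f w) w =
      cmp 1 (nrm f) (nrm f) w + wordDiff w (nrm f) := by
    have := congrFun (nrm_add (comp 1 f f) (preD f)) w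
    rw [Pi.add_apply, nrm_comp f hf.2, nrm_preD, map_one] at this
    exact this
  rw [← h, nrm_eq_zero]

theorem NRel.npull {f : Word t → P →ₗ[K] P} (hf : NRel f) (i : LSet.Hom s t) :
    NRel (npull i f) := by
  intro w
  rw [npull_cmp, npull_wordDiff, PolyMod.npull, PolyMod.npull, ← smul_add, hf, smul_zero]

theorem nRel_ext {A : Word r₁ → M →ₗ[K] M} {B : Word r₂ → M →ₗ[K] M} {D : M →ₗ[K] M}
    (hA : ∀ v, cmp 1 A A v + wordDiff v A + (D ∘ₗ A v + zs (pd v) • (A v ∘ₗ D)) = 0)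
    (hB : ∀ v, cmp 1 B B v + wordDiff v B + (D ∘ₗ B v + zs (pd v) • (B v ∘ₗ D)) = 0)
    (hAB : ∀ v w, A v ∘ₗ B w + zs (pd v + pd v * pd w + pd w) • (B w ∘ₗ A v) = 0)
    (hD : D ∘ₗ D = 0) : NRel (extL r₂ A + extR r₁ B + extE (r₁.sum r₂) D) := by
  intro x
  rw [← pair_fst_snd x]
  generalize fstW x = v
  generalize sndW x = w
  have hW : wordDiff (pair v w) (extL r₂ A + extR r₁ B + extE (r₁.sum r₂) D) =
      extL r₂ (fun v => wordDiff v A) (pair v w) + extR r₁ (fun v => wordDiff v B) (pair v w) := by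
    have h1 := wordDiff_add (pair v w) (fun x => extL r₂ A x + extR r₁ B x)
      (extE (r₁.sum r₂) D)
    have h2 := wordDiff_add (pair v w) (extL r₂ A) (extR r₁ B)
    rw [h2, wordDiff_extL, wordDiff_extR, wordDiff_extE, add_zero] at h1
    exact h1
  rw [hW]
  simp only [cmp_add_left, cmp_add_right, Pi.add_apply]
  rw [cmp_extL_extL, cmp_extR_extR, cmp_extL_extR, cmp_extR_extL, cmp_extE_left, cmp_extE_left,
    cmp_extE_left, cmp_extE_right, cmp_extE_right]
  have hL : extL r₂ (cmp 1 A A) (pair v w) + extL r₂ (fun v => wordDiff v A) (pair v w) +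
      (D ∘ₗ extL r₂ A (pair v w) + zs (1 * pd (pair v w)) • (extL r₂ A (pair v w) ∘ₗ D)) = 0 := by
    simp only [extL_pair]
    split_ifs with h
    · rw [pd_pair, h, pd_emptyWord, add_zero, one_mul]
      exact hA v
    · simp
  have hR : extR r₁ (cmp 1 B B) (pair v w) + extR r₁ (fun v => wordDiff v B) (pair v w) +
      (D ∘ₗ extR r₁ B (pair v w) + zs (1 * pd (pair v w)) • (extR r₁ B (pair v w) ∘ₗ D)) = 0 := by
    simp only [extR_pair]
    split_ifs with h
    · rw [pd_pair, h, pd_emptyWord, zero_add, one_mul]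
      exact hB w
    · simp
  have hLR : zs (1 * pd v) • (A v ∘ₗ B w) + zs (pd v * pd w + 1 * pd w) • (B w ∘ₗ A v) = 0 := by
    have := congrArg (zs (pd v) • ·) (hAB v w)
    simp only [smul_add, smul_zero, zs_smul_zs_smul] at this
    rw [one_mul, one_mul, ← this]
    congr 3
    grind
  have hE : D ∘ₗ extE (r₁.sum r₂) D (pair v w) = 0 := by
    unfold extE
    split_ifs
    · exact hD
    · exact LinearMap.comp_zero _
  rw [hE]
  have h := congrArg₂ (· + ·) (congrArg₂ (· + ·) hL hR) hLR
  simp only [add_zero] at h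
  refine Eq.trans ?_ h
  abel

end relation

/-! ### The tensor product of polymodules -/

section tensor_relation

variable {s t r₁ r₂ : LSet K ι} {M N P P' Q Q' R : GrMod K ι} {k : ι}

theorem cop_pair_dual {M : Type*} [AddCommGroup M] (v : Word s) (w : Word t)
    (F : Word (s.dual.sum t) → Word (s.dual.sum t) → M) :
    cop (pair (toDual v) w) F = cop v fun o n => cop w fun o' n' =>
      zs (pd o * pd n + pd o * pd o') • F (pair (toDual n) o') (pair (toDual o) n') := by
  rw [cop_pair, toDual, cop_toDual]
  refine cop_congr fun o n _ => ?_
  rw [zs_smul_cop]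
  refine cop_congr fun o' n' _ => ?_
  rw [zs_smul_zs_smul]
  rfl

theorem wordDiff_pair_dual {M : Type*} [AddCommGroup M] (v : Word s) (w : Word t)
    (F : Word (s.dual.sum t) → M) :
    wordDiff (pair (toDual v) w) F = wordDiff v (fun v' => F (pair (toDual v') w)) +
      zs (pd v) • wordDiff w fun w' => F (pair (toDual v) w') := wordDiff_pair _ _ _

theorem pd_toDual (v : Word s) : pd (toDual v) = pd v := rfl

theorem HasDeg.nrm_pair {f : Word (s.sum t) → P →ₗ[K] Q} (hf : HasDeg k f) (v : Word s)
    (w : Word t) {i : ι} {p : P} (hp : p ∈ P.piece i) :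
    PolyMod.nrm f (pair v w) p ∈ Q.piece (i + deg (pair v w) + k) := hf.nrm _ _ _ hp

theorem tm_cop_left (w : Word t) (F : Word t → Word t → P) (g : Word s) (q : Q) :
    tm (cop w F) g q = cop w fun o n => tm (F o n) g q := by
  simp only [← tmB_apply]
  exact map_cop ((tmB g : P →ₗ[K] Q →ₗ[K] tens s P Q).flip q) w F

theorem tm_wordDiff_left (w : Word t) (F : Word t → P) (g : Word s) (q : Q) :
    tm (wordDiff w F) g q = wordDiff w fun w' => tm (F w') g q := by
  simp only [← tmB_apply]
  exact map_wordDiff ((tmB g : P →ₗ[K] Q →ₗ[K] tens s P Q).flip q) w F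

theorem tm_cop_right (w : Word t) (F : Word t → Word t → Q) (g : Word s) (p : P) :
    tm p g (cop w F) = cop w fun o n => tm p g (F o n) := by
  simp only [← tmB_apply]
  exact map_cop (tmB g p : Q →ₗ[K] tens s P Q) w F

theorem tm_wordDiff_right (w : Word t) (F : Word t → Q) (g : Word s) (p : P) :
    tm p g (wordDiff w F) = wordDiff w fun w' => tm p g (F w') := by
  simp only [← tmB_apply]
  exact map_wordDiff (tmB g p : Q →ₗ[K] tens s P Q) w F

theorem tm_add_left (p p' : P) (g : Word s) (q : Q) : tm (p + p') g q = tm p g q + tm p' g q := by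
  simp only [← tmB_apply, map_add, LinearMap.add_apply]

theorem tm_add_right (p : P) (g : Word s) (q q' : Q) : tm p g (q + q') = tm p g q + tm p g q' := by
  simp only [← tmB_apply, map_add]

theorem tm_zero_left (g : Word s) (q : Q) : tm (0 : P) g q = 0 := by
  simp only [← tmB_apply, map_zero, LinearMap.zero_apply]

theorem tm_zero_right (p : P) (g : Word s) : tm p g (0 : Q) = 0 := by
  simp only [← tmB_apply, map_zero]

theorem multilin_tm (p : P) (q : Q) : Multilin (K := K) fun g : Word s => tm p g q := by
  refine Multilin.diag (fun c g : Word s => zs (ninv c) • tmk p g q) (fun c => ?_)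
    fun c c' h => by rw [h.ninv]
  have h : Multilin (K := K) fun g : Word s => tmk p g q :=
    ((multilin_tmap LinearMap.id LinearMap.id).map (LinearMap.applyₗ p)).map (LinearMap.applyₗ q)
  rcases Int.units_eq_one_or (zs (ninv c)) with h' | h' <;> rw [h']
  · simpa using h
  · simpa using h.map (-LinearMap.id)

theorem dTens_dTens (s : LSet K ι) (P Q : GrMod K ι) : dTens s P Q ∘ₗ dTens s P Q = 0 := by
  refine tens_hom_ext fun a b p hp g q hq => ?_
  rw [LinearMap.comp_apply, dTens_tm hp, map_zs_smul, map_wordDiff]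
  simp only [dTens_tm hp]
  rw [← zs_smul_wordDiff, wordDiff_wordDiff (K := K) g (multilin_tm p q), smul_zero, smul_zero]
  rfl

theorem actL_rel (f : homPiece (s.dual.sum r₁) P P 1) (hf : NRel (nrm f.1)) (v : Word r₁) :
    cmp 1 (actL Q f) (actL Q f) v + wordDiff v (actL Q f) +
      (dTens s P Q ∘ₗ actL Q f v + zs (pd v) • (actL Q f v ∘ₗ dTens s P Q)) = 0 := by
  refine tens_hom_ext fun a b p hp g q hq => ?_
  have h1 : cmp 1 (actL Q f) (actL Q f) v (tm p g q) = cop g fun x n =>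
      zs (pd x * (pd v + par a)) • tm (cmp 1 (nrm f.1) (nrm f.1) (pair (toDual x) v) p) n q := by
    rw [cmp_apply]
    calc _ = cop v fun v₁ v₂ => cop g fun o n => cop n fun o₂ n₂ =>
          zs (pd v₁ + pd o * (pd v₂ + par a) + pd o₂ * (pd v₁ + par a + pd o + pd v₂ + 1)) •
            tm (nrm f.1 (pair (toDual o₂) v₁) (nrm f.1 (pair (toDual o) v₂) p)) n₂ q := by
          refine cop_congr fun v₁ v₂ _ => ?_
          rw [actL_tm f v₂ hp hq, map_cop, zs_smul_cop]
          refine cop_congr fun o n _ => ?_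
          rw [map_zs_smul, actL_tm f v₁ (f.2.2.nrm_pair _ _ hp) hq, zs_smul_zs_smul, zs_smul_cop]
          refine cop_congr fun o₂ n₂ _ => ?_
          rw [zs_smul_zs_smul, par_degree, pd_pair, pd_toDual, map_one]
          congr 2
          ring
      _ = cop g fun o n => cop n fun o₂ n₂ => cop v fun v₁ v₂ =>
          zs (pd v₁ + pd o * (pd v₂ + par a) + pd o₂ * (pd v₁ + par a + pd o + pd v₂ + 1)) •
            tm (nrm f.1 (pair (toDual o₂) v₁) (nrm f.1 (pair (toDual o) v₂) p)) n₂ q := by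
          rw [cop_comm]
          exact cop_congr fun o n _ => cop_comm _ _ _
      _ = _ := by
          rw [← cop_assoc g fun o o₂ n₂ => cop v fun v₁ v₂ =>
            zs (pd v₁ + pd o * (pd v₂ + par a) + pd o₂ * (pd v₁ + par a + pd o + pd v₂ + 1)) •
            tm (nrm f.1 (pair (toDual o₂) v₁) (nrm f.1 (pair (toDual o) v₂) p)) n₂ q]
          refine cop_congr fun x n _ => ?_
          rw [cmp_apply, cop_pair_dual, tm_cop_left, zs_smul_cop]
          refine cop_congr fun o o₂ hx => ?_
          rw [tm_cop_left, zs_smul_cop]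
          refine cop_congr fun v₁ v₂ hv => ?_
          rw [tm_smul_left, tm_smul_left, zs_smul_zs_smul, zs_smul_zs_smul, pd_pair, pd_toDual]
          congr 2
          grind
  have h2 : wordDiff v (actL Q f) (tm p g q) = cop g fun x n =>
      zs (pd x * (pd v + par a) + pd x) •
        tm (wordDiff v (fun v' => nrm f.1 (pair (toDual x) v') p)) n q := by
    rw [wordDiff_apply]
    simp only [actL_tm f _ hp hq]
    rw [wordDiff_cop_comm]
    refine cop_congr fun x n _ => ?_
    rw [tm_wordDiff_left, zs_smul_wordDiff]
    refine wordDiff_congr fun v' hv => ?_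
    rw [hv]
    congr 2
    ring
  have h3 : dTens s P Q (actL Q f v (tm p g q)) = cop g fun x n =>
      zs (pd x * (pd v + par a) + (par a + pd x + pd v + 1)) •
        wordDiff n fun n' => tm (nrm f.1 (pair (toDual x) v) p) n' q := by
    rw [actL_tm f v hp hq, map_cop]
    refine cop_congr fun x n _ => ?_
    rw [map_zs_smul, dTens_tm (f.2.2.nrm_pair _ _ hp), zs_smul_zs_smul, par_degree, pd_pair,
      pd_toDual, map_one]
    congr 2
    ring
  have h4 : zs (pd v) • actL Q f v (dTens s P Q (tm p g q)) = cop g fun x n =>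
      zs (pd x * (pd v + par a)) • tm (wordDiff x fun x' => nrm f.1 (pair (toDual x') v) p) n q +
      zs (pd x * (pd v + par a) + pd v + par a + pd x) •
        wordDiff n fun n' => tm (nrm f.1 (pair (toDual x) v) p) n' q := by
    rw [dTens_tm hp, map_zs_smul, map_wordDiff, zs_smul_zs_smul]
    simp only [actL_tm f v hp hq]
    rw [wordDiff_cop, zs_smul_cop]
    refine cop_congr fun x n _ => ?_
    simp only [smul_add, tm_wordDiff_left, zs_smul_wordDiff, zs_smul_zs_smul]
    refine congrArg₂ (· + ·) ?_ ?_
    · refine wordDiff_congr fun x' hx => ?_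
      rw [hx]
      congr 2
      grind
    · refine wordDiff_congr fun n' _ => ?_
      congr 2
      grind
  simp only [LinearMap.add_apply, LinearMap.smul_apply, LinearMap.comp_apply, LinearMap.zero_apply]
  rw [h1, h2, h3, h4, ← cop_add, ← cop_add, ← cop_add]
  refine (cop_congr fun x n _ => ?_).trans (cop_zero g)
  have h5 := LinearMap.congr_fun (hf (pair (toDual x) v)) p
  rw [LinearMap.add_apply, wordDiff_apply, wordDiff_pair_dual] at h5
  have h6 := congrArg (fun z => zs (pd x * (pd v + par a)) • tm z n q) h5
  simp only [tm_add_left, tm_smul_left, smul_add, zs_smul_zs_smul, LinearMap.zero_apply,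
    tm_zero_left, smul_zero] at h6
  have h7 : zs (pd x * (pd v + par a) + pd v + par a + pd x) •
      (wordDiff n fun n' => tm (nrm f.1 (pair (toDual x) v) p) n' q) =
      -(zs (pd x * (pd v + par a) + (par a + pd x + pd v + 1)) •
        wordDiff n fun n' => tm (nrm f.1 (pair (toDual x) v) p) n' q) := by
    rw [← zs_add_one_smul]
    congr 2
    grind
  rw [h7]
  refine Eq.trans ?_ h6
  abel

theorem actR_rel (f : homPiece (s.sum r₂) Q Q 1) (hf : NRel (nrm f.1)) (w : Word r₂) :
    cmp 1 (actR P f) (actR P f) w + wordDiff w (actR P f) +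
      (dTens s P Q ∘ₗ actR P f w + zs (pd w) • (actR P f w ∘ₗ dTens s P Q)) = 0 := by
  refine tens_hom_ext fun a b p hp g q hq => ?_
  have h1 : cmp 1 (actR P f) (actR P f) w (tm p g q) = cop g fun x m =>
      zs (pd w * (par a + pd x) + pd m * pd w) •
        tm p x (cmp 1 (nrm f.1) (nrm f.1) (pair m w) q) := by
    rw [cmp_apply]
    calc _ = cop w fun w₁ w₂ => cop g fun o n => cop o fun o₁ n₁ =>
          zs (pd w₁ + (1 + pd w₂) * (par a + pd o) + pd n * pd w₂ + (1 + pd w₁) * (par a + pd o₁) +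
            pd n₁ * pd w₁) • tm p o₁ (nrm f.1 (pair n₁ w₁) (nrm f.1 (pair n w₂) q)) := by
          refine cop_congr fun w₁ w₂ _ => ?_
          rw [actR_tm f w₂ hp hq, map_cop, zs_smul_cop]
          refine cop_congr fun o n _ => ?_
          rw [map_zs_smul, actR_tm f w₁ hp (f.2.2.nrm_pair _ _ hq), zs_smul_zs_smul, zs_smul_cop]
          refine cop_congr fun o₁ n₁ _ => ?_
          rw [zs_smul_zs_smul, map_one]
          congr 2
          ring
      _ = cop g fun o n => cop o fun o₁ n₁ => cop w fun w₁ w₂ =>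
          zs (pd w₁ + (1 + pd w₂) * (par a + pd o) + pd n * pd w₂ + (1 + pd w₁) * (par a + pd o₁) +
            pd n₁ * pd w₁) • tm p o₁ (nrm f.1 (pair n₁ w₁) (nrm f.1 (pair n w₂) q)) := by
          rw [cop_comm]
          exact cop_congr fun o n _ => cop_comm _ _ _
      _ = cop g fun o n => cop o fun o₁ n₁ => cop w fun w₁ w₂ =>
          zs (pd w₁ + (1 + pd w₂) * (par a + pd o₁ + pd n₁) + pd n * pd w₂ +
            (1 + pd w₁) * (par a + pd o₁) +
            pd n₁ * pd w₁) • tm p o₁ (nrm f.1 (pair n₁ w₁) (nrm f.1 (pair n w₂) q)) := by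
          refine cop_congr fun o n _ => cop_congr fun o₁ n₁ h => cop_congr fun w₁ w₂ _ => ?_
          rw [← h]
          congr 2
          ring
      _ = _ := by
          rw [cop_assoc g fun o₁ n₁ n => cop w fun w₁ w₂ =>
            zs (pd w₁ + (1 + pd w₂) * (par a + pd o₁ + pd n₁) + pd n * pd w₂ +
            (1 + pd w₁) * (par a + pd o₁) +
            pd n₁ * pd w₁) • tm p o₁ (nrm f.1 (pair n₁ w₁) (nrm f.1 (pair n w₂) q))]
          refine cop_congr fun x m _ => ?_
          rw [cmp_apply, cop_pair, tm_cop_right, zs_smul_cop]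
          refine cop_congr fun n₁ n hm => ?_
          rw [tm_cop_right, zs_smul_cop]
          refine cop_congr fun w₁ w₂ hw => ?_
          rw [tm_smul_right, tm_smul_right, zs_smul_zs_smul, zs_smul_zs_smul, pd_pair]
          congr 2
          grind
  have h2 : wordDiff w (actR P f) (tm p g q) = cop g fun x m =>
      zs (pd w * (par a + pd x) + pd m * pd w + pd m) •
        tm p x (wordDiff w (fun w' => nrm f.1 (pair m w') q)) := by
    rw [wordDiff_apply]
    simp only [actR_tm f _ hp hq]
    rw [wordDiff_cop_comm]
    refine cop_congr fun x n _ => ?_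
    rw [tm_wordDiff_right, zs_smul_wordDiff]
    refine wordDiff_congr fun w' hw => ?_
    rw [hw, map_one]
    congr 2
    grind
  have h3 : dTens s P Q (actR P f w (tm p g q)) = cop g fun x m =>
      zs ((1 + pd w) * (par a + pd x) + pd m * pd w + par a) •
        wordDiff x fun x' => tm p x' (nrm f.1 (pair m w) q) := by
    rw [actR_tm f w hp hq, map_cop]
    refine cop_congr fun x m _ => ?_
    rw [map_zs_smul, dTens_tm hp, zs_smul_zs_smul, map_one]
  have h4 : zs (pd w) • actR P f w (dTens s P Q (tm p g q)) = cop g fun x m =>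
      zs ((1 + pd w) * (par a + pd x) + pd m * pd w + par a + 1) •
        (wordDiff x fun x' => tm p x' (nrm f.1 (pair m w) q)) +
      zs (pd w * (par a + pd x) + pd m * pd w) •
        tm p x (wordDiff m fun m' => nrm f.1 (pair m' w) q) := by
    rw [dTens_tm hp, map_zs_smul, map_wordDiff, zs_smul_zs_smul]
    simp only [actR_tm f w hp hq]
    rw [wordDiff_cop, zs_smul_cop]
    refine cop_congr fun x m _ => ?_
    simp only [smul_add, tm_wordDiff_right, zs_smul_wordDiff, zs_smul_zs_smul, map_one]
    refine congrArg₂ (· + ·) ?_ ?_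
    · refine wordDiff_congr fun x' hx => ?_
      rw [hx]
      congr 2
      grind
    · refine wordDiff_congr fun m' hm => ?_
      rw [hm]
      congr 2
      grind
  simp only [LinearMap.add_apply, LinearMap.smul_apply, LinearMap.comp_apply, LinearMap.zero_apply]
  rw [h1, h2, h3, h4, ← cop_add, ← cop_add, ← cop_add]
  refine (cop_congr fun x m _ => ?_).trans (cop_zero g)
  have h5 := LinearMap.congr_fun (hf (pair m w)) q
  rw [LinearMap.add_apply, wordDiff_apply, wordDiff_pair] at h5
  have h6 := congrArg (fun z => zs (pd w * (par a + pd x) + pd m * pd w) • tm p x z) h5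
  simp only [tm_add_right, tm_smul_right, smul_add, zs_smul_zs_smul, LinearMap.zero_apply,
    tm_zero_right, smul_zero] at h6
  rw [zs_add_one_smul]
  refine Eq.trans ?_ h6
  abel

theorem actL_actR (f : homPiece (s.dual.sum r₁) P P 1) (f' : homPiece (s.sum r₂) Q Q 1)
    (v : Word r₁) (w : Word r₂) : actL Q f v ∘ₗ actR P f' w +
      zs (pd v + pd v * pd w + pd w) • (actR P f' w ∘ₗ actL Q f v) = 0 := by
  refine tens_hom_ext fun a b p hp g q hq => ?_
  have h1 : actL Q f v (actR P f' w (tm p g q)) = cop g fun x m => cop m fun y n =>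
      zs ((1 + pd w) * (par a + pd x + pd y) + pd n * pd w + pd x * (pd v + par a)) •
        tm (nrm f.1 (pair (toDual x) v) p) y (nrm f'.1 (pair n w) q) := by
    rw [← cop_assoc g fun x y n =>
      zs ((1 + pd w) * (par a + pd x + pd y) + pd n * pd w + pd x * (pd v + par a)) •
        tm (nrm f.1 (pair (toDual x) v) p) y (nrm f'.1 (pair n w) q), actR_tm f' w hp hq, map_cop]
    refine cop_congr fun o n _ => ?_
    rw [map_zs_smul, actL_tm f v hp (f'.2.2.nrm_pair _ _ hq), zs_smul_cop]
    refine cop_congr fun x y h => ?_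
    rw [zs_smul_zs_smul, ← h, map_one]
    congr 2
    ring
  have h2 : actR P f' w (actL Q f v (tm p g q)) = cop g fun x m => cop m fun y n =>
      zs (pd x * (pd v + par a) + ((1 + pd w) * (par a + pd x + pd v + 1 + pd y) + pd n * pd w)) •
        tm (nrm f.1 (pair (toDual x) v) p) y (nrm f'.1 (pair n w) q) := by
    rw [actL_tm f v hp hq, map_cop]
    refine cop_congr fun x m _ => ?_
    rw [map_zs_smul, actR_tm f' w (f.2.2.nrm_pair _ _ hp) hq, zs_smul_cop]
    refine cop_congr fun y n h => ?_
    rw [zs_smul_zs_smul, par_degree, pd_pair, pd_toDual, map_one]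
    congr 2
    ring
  simp only [LinearMap.add_apply, LinearMap.smul_apply, LinearMap.comp_apply, LinearMap.zero_apply]
  rw [h1, h2, zs_smul_cop, ← cop_add]
  refine (cop_congr fun x m _ => ?_).trans (cop_zero g)
  rw [zs_smul_cop, ← cop_add]
  refine (cop_congr fun y n _ => ?_).trans (cop_zero m)
  rw [zs_smul_zs_smul, ← eq_neg_iff_add_eq_zero, ← zs_add_one_smul]
  congr 2
  grind

theorem nrm_tens_sum (f : homPiece (s.dual.sum r₁) P P 1) (f' : homPiece (s.sum r₂) Q Q 1) :
    nrm (tensL r₂ Q f + tensR r₁ P f' + tensD s (r₁.sum r₂) P Q).1 =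
      extL r₂ (actL Q f) + extR r₁ (actR P f') + extE (r₁.sum r₂) (dTens s P Q) := by
  rw [Submodule.coe_add, Submodule.coe_add, nrm_add, nrm_add, nrm_tensL, nrm_tensR, tensD_val,
    nrm_extE]

/-- The equation `d² = 0` for the tensor product. -/
theorem tens_nRel {f : homPiece (s.dual.sum r₁) P P 1} (hf : NRel (nrm f.1))
    {f' : homPiece (s.sum r₂) Q Q 1} (hf' : NRel (nrm f'.1)) :
    NRel (nrm (tensL r₂ Q f + tensR r₁ P f' + tensD s (r₁.sum r₂) P Q).1) := by
  rw [nrm_tens_sum]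
  exact nRel_ext (actL_rel f hf) (actR_rel f' hf') (actL_actR f f') (dTens_dTens s P Q)

end tensor_relation

/-! ### Internal Hom of polymodules -/

section hom_relation

variable {s t r₁ r₂ : LSet K ι} {M N P P' Q Q' R : GrMod K ι} {k : ι}

theorem pHom_hom_ext {V : GrMod K ι} {F G : V →ₗ[K] PHom s P Q}
    (h : ∀ d, ∀ φ ∈ V.piece d, ∀ x a, ∀ p ∈ P.piece a, hv (F φ) x p = hv (G φ) x p) : F = G :=
  GrMod.hom_ext fun d φ hφ => hv_ext (h d φ hφ)

theorem hv_add (φ ψ : PHom s P Q) (x : Word s) : hv (φ + ψ) x = hv φ x + hv ψ x :=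
  map_add (hvL x) φ ψ

theorem hv_neg (φ : PHom s P Q) (x : Word s) : hv (-φ) x = -hv φ x := map_neg (hvL x) φ

theorem hv_zero (x : Word s) : hv (0 : PHom s P Q) x = 0 := map_zero (hvL x)

theorem dHom_dHom (s : LSet K ι) (P Q : GrMod K ι) : dHom s P Q ∘ₗ dHom s P Q = 0 := by
  refine pHom_hom_ext fun d φ hφ x a p hp => ?_
  have h : hv (dHom s P Q φ) = fun x => zs (par d) • wordDiff x (hv φ) :=
    funext fun x => hv_dHom hφ x
  have h0 : (wordDiff x fun x' => wordDiff x' (hv φ)) = 0 :=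
    wordDiff_wordDiff (K := K) x (multilin_hv hφ).nrm
  rw [LinearMap.comp_apply, hv_dHom (dHom_mem hφ), h, ← zs_smul_wordDiff, h0, smul_zero, smul_zero,
    LinearMap.zero_apply, LinearMap.zero_apply, hv_zero, LinearMap.zero_apply]

theorem post_rel (f : homPiece (s.sum r₂) Q Q 1) (hf : NRel (nrm f.1)) (v : Word r₂) :
    cmp 1 (post P f) (post P f) v + wordDiff v (post P f) +
      ((-dHom s P Q) ∘ₗ post P f v + zs (pd v) • (post P f v ∘ₗ (-dHom s P Q))) = 0 := by
  refine pHom_hom_ext fun d φ hφ x a p hp => ?_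
  have h1 : hv (cmp 1 (post P f) (post P f) v φ) x p = cop x fun m n =>
      zs (pd m * (pd v + par d)) • cmp 1 (nrm f.1) (nrm f.1) (pair m v) (hv φ n p) := by
    rw [cmp_apply, hv_cop, cop_apply]
    calc _ = cop v fun v₁ v₂ => cop x fun o m => cop m fun o₂ n =>
          zs (pd v₁ + pd o * (pd v₁ + par d + pd v₂ + 1) + pd o₂ * (pd v₂ + par d)) •
            nrm f.1 (pair o v₁) (nrm f.1 (pair o₂ v₂) (hv φ n p)) := by
          refine cop_congr fun v₁ v₂ _ => ?_
          rw [hv_zs_smul, LinearMap.smul_apply, hv_post f v₁ (hasDeg_post P f v₂ d φ hφ) hp,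
            zs_smul_cop]
          refine cop_congr fun o m _ => ?_
          rw [hv_post f v₂ hφ hp, map_cop, zs_smul_zs_smul, zs_smul_cop]
          refine cop_congr fun o₂ n _ => ?_
          rw [map_zs_smul, zs_smul_zs_smul, par_degree, map_one]
          congr 2
          ring
      _ = cop x fun o m => cop m fun o₂ n => cop v fun v₁ v₂ =>
          zs (pd v₁ + pd o * (pd v₁ + par d + pd v₂ + 1) + pd o₂ * (pd v₂ + par d)) •
            nrm f.1 (pair o v₁) (nrm f.1 (pair o₂ v₂) (hv φ n p)) := by
          rw [cop_comm]
          exact cop_congr fun o n _ => cop_comm _ _ _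
      _ = _ := by
          rw [← cop_assoc x fun o o₂ n => cop v fun v₁ v₂ =>
          zs (pd v₁ + pd o * (pd v₁ + par d + pd v₂ + 1) + pd o₂ * (pd v₂ + par d)) •
            nrm f.1 (pair o v₁) (nrm f.1 (pair o₂ v₂) (hv φ n p))]
          refine cop_congr fun m n _ => ?_
          rw [cmp_apply, cop_pair, zs_smul_cop]
          refine cop_congr fun o o₂ hx => ?_
          rw [zs_smul_cop]
          refine cop_congr fun v₁ v₂ hv => ?_
          rw [zs_smul_zs_smul, zs_smul_zs_smul, pd_pair]
          congr 2
          grind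
  have h2 : hv (wordDiff v (post P f) φ) x p = cop x fun m n =>
      zs (pd m * (pd v + par d) + pd m) •
        wordDiff v (fun v' => nrm f.1 (pair m v') (hv φ n p)) := by
    rw [wordDiff_apply, hv_wordDiff, wordDiff_apply]
    simp only [hv_post f _ hφ hp]
    rw [wordDiff_cop_comm]
    refine cop_congr fun m n _ => ?_
    rw [zs_smul_wordDiff]
    refine wordDiff_congr fun v' hv' => ?_
    rw [hv']
    congr 2
    ring
  have h3 : hv (dHom s P Q (post P f v φ)) x p = cop x fun m n =>
      zs (pd m * (pd v + par d) + 1) •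
        (wordDiff m fun m' => nrm f.1 (pair m' v) (hv φ n p)) +
      zs (pd m * (pd v + par d) + par d + pd v + 1 + pd m) •
        wordDiff n fun n' => nrm f.1 (pair m v) (hv φ n' p) := by
    rw [hv_dHom (hasDeg_post P f v d φ hφ), LinearMap.smul_apply, wordDiff_apply]
    simp only [hv_post f v hφ hp]
    rw [wordDiff_cop, zs_smul_cop, par_degree]
    refine cop_congr fun m n _ => ?_
    simp only [smul_add, zs_smul_wordDiff, zs_smul_zs_smul, map_one, par_deg]
    refine congrArg₂ (· + ·) ?_ ?_
    · refine wordDiff_congr fun m' hm => ?_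
      rw [hm]
      congr 2
      grind
    · refine wordDiff_congr fun n' _ => ?_
      congr 2
      grind
  have h4 : zs (pd v) • hv (post P f v (dHom s P Q φ)) x p = cop x fun m n =>
      zs (pd m * (pd v + par d) + par d + pd v + pd m) •
        wordDiff n fun n' => nrm f.1 (pair m v) (hv φ n' p) := by
    rw [hv_post f v (dHom_mem hφ) hp, zs_smul_cop]
    refine cop_congr fun m n _ => ?_
    rw [hv_dHom hφ, LinearMap.smul_apply, wordDiff_apply, map_zs_smul, map_wordDiff,
      zs_smul_zs_smul, zs_smul_zs_smul, map_add, map_one]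
    congr 2
    ring
  simp only [LinearMap.add_apply, LinearMap.smul_apply, LinearMap.comp_apply, LinearMap.zero_apply,
    LinearMap.neg_apply, map_neg, hv_add, hv_neg, hv_zero, hv_zs_smul, smul_neg]
  rw [h1, h2, h3, h4, ← cop_neg, ← cop_neg, ← cop_add, ← cop_add, ← cop_add]
  refine (cop_congr fun m n _ => ?_).trans (cop_zero x)
  have h5 := LinearMap.congr_fun (hf (pair m v)) (hv φ n p)
  rw [LinearMap.add_apply, wordDiff_apply, wordDiff_pair] at h5
  have h6 := congrArg (fun z => zs (pd m * (pd v + par d)) • z) h5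
  simp only [smul_add, zs_smul_zs_smul, LinearMap.zero_apply, smul_zero] at h6
  have e : pd m * (pd v + par d) + par d + pd v + 1 + pd m =
      pd m * (pd v + par d) + par d + pd v + pd m + 1 := by ring
  rw [e, zs_add_one_smul, zs_add_one_smul]
  refine Eq.trans ?_ h6
  abel

theorem pre_rel (f : homPiece (s.sum r₁) P P 1) (hf : NRel (nrm f.1)) (u : Word r₁) :
    cmp 1 (-pre Q f) (-pre Q f) (toDual u) + wordDiff (toDual u) (-pre Q f) +
      ((-dHom s P Q) ∘ₗ (-pre Q f) (toDual u) +
        zs (pd (toDual u)) • ((-pre Q f) (toDual u) ∘ₗ (-dHom s P Q))) = 0 := by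
  refine pHom_hom_ext fun d φ hφ x a p hp => ?_
  have h1 : hv (cmp 1 (pre Q f) (pre Q f) (toDual u) φ) x p = cop x fun o m =>
      zs (pd u * (par d + pd x) + 1) •
        hv φ o (cmp 1 (nrm f.1) (nrm f.1) (pair m u) p) := by
    rw [cmp_apply, toDual, cop_toDual, hv_cop, cop_apply]
    calc _ = cop u fun u₁ u₂ => cop x fun y n => cop y fun o n₁ =>
          zs (pd u₂ * (par d + pd x) + pd u₁ * (par d + pd o + pd n₁) + pd u₁ + 1 + pd n₁) •
            hv φ o (nrm f.1 (pair n₁ u₁) (nrm f.1 (pair n u₂) p)) := by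
          refine cop_congr fun u₁ u₂ _ => ?_
          change hv (zs (pd u₁ * pd u₂) • zs (1 * pd u₂) • pre Q f (toDual u₂) (pre Q f (toDual u₁) φ)) x p = _
          rw [hv_zs_smul, hv_zs_smul, LinearMap.smul_apply, LinearMap.smul_apply,
            hv_pre f u₂ (hasDeg_pre Q f (toDual u₁) d φ hφ) hp, zs_smul_cop, zs_smul_cop]
          refine cop_congr fun y n _ => ?_
          rw [hv_pre f u₁ hφ (f.2.2.nrm_pair _ _ hp), zs_smul_cop, zs_smul_cop, zs_smul_cop]
          refine cop_congr fun o n₁ hy => ?_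
          rw [zs_smul_zs_smul, zs_smul_zs_smul, zs_smul_zs_smul, par_degree, map_one, pd_toDual]
          congr 2
          grind
      _ = cop x fun y n => cop y fun o n₁ => cop u fun u₁ u₂ =>
          zs (pd u₂ * (par d + pd x) + pd u₁ * (par d + pd o + pd n₁) + pd u₁ + 1 + pd n₁) •
            hv φ o (nrm f.1 (pair n₁ u₁) (nrm f.1 (pair n u₂) p)) := by
          rw [cop_comm]
          exact cop_congr fun o n _ => cop_comm _ _ _
      _ = _ := by
          rw [cop_assoc x fun o n₁ n => cop u fun u₁ u₂ =>
          zs (pd u₂ * (par d + pd x) + pd u₁ * (par d + pd o + pd n₁) + pd u₁ + 1 + pd n₁) •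
            hv φ o (nrm f.1 (pair n₁ u₁) (nrm f.1 (pair n u₂) p))]
          refine cop_congr fun o m hx => ?_
          rw [cmp_apply, cop_pair, map_cop, zs_smul_cop]
          refine cop_congr fun n₁ n hm => ?_
          rw [map_cop, zs_smul_cop]
          refine cop_congr fun u₁ u₂ hu => ?_
          rw [zs_smul_zs_smul, map_zs_smul, zs_smul_zs_smul, pd_pair]
          congr 2
          grind
  have h2 : hv (wordDiff (toDual u) (pre Q f) φ) x p = cop x fun o m =>
      zs (pd u * (par d + pd x) + pd m) •
        hv φ o (wordDiff u (fun u' => nrm f.1 (pair m u') p)) := by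
    rw [wordDiff_apply, hv_wordDiff, wordDiff_apply]
    change (wordDiff u fun u' => hv (pre Q f (toDual u') φ) x p) = _
    simp only [hv_pre f _ hφ hp]
    rw [wordDiff_cop_comm]
    refine cop_congr fun o m hx => ?_
    rw [map_wordDiff, zs_smul_wordDiff]
    refine wordDiff_congr fun u' hu' => ?_
    rw [hu', map_one]
    congr 2
    grind
  have h3 : hv (dHom s P Q (pre Q f (toDual u) φ)) x p = cop x fun o m =>
      zs (pd u * (par d + pd x) + pd o) •
        (wordDiff o fun o' => hv φ o' (nrm f.1 (pair m u) p)) +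
      zs (pd u * (par d + pd x) + 1) •
        hv φ o (wordDiff m fun m' => nrm f.1 (pair m' u) p) := by
    rw [hv_dHom (hasDeg_pre Q f (toDual u) d φ hφ), LinearMap.smul_apply, wordDiff_apply]
    rw [wordDiff_congr (G := fun x' => cop x' fun o n =>
      zs (pd u * (par d + pd x + 1) + (par d + pd o)) • hv φ o (nrm f.1 (pair n u) p))
      fun x' hx' => by rw [hv_pre f u hφ hp, hx', map_one]; simp only [one_mul, add_assoc]]
    rw [wordDiff_cop, zs_smul_cop, par_degree]
    refine cop_congr fun o m _ => ?_
    simp only [smul_add, zs_smul_wordDiff, zs_smul_zs_smul, map_one, par_deg, map_wordDiff,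
      pd_toDual]
    refine congrArg₂ (· + ·) ?_ ?_
    · refine wordDiff_congr fun o' ho => ?_
      rw [ho]
      congr 2
      grind
    · refine wordDiff_congr fun n' _ => ?_
      congr 2
      grind
  have h4 : zs (pd u) • hv (pre Q f (toDual u) (dHom s P Q φ)) x p = cop x fun o m =>
      zs (pd u * (par d + pd x) + pd o + 1) •
        wordDiff o fun o' => hv φ o' (nrm f.1 (pair m u) p) := by
    rw [hv_pre f u (dHom_mem hφ) hp, zs_smul_cop]
    refine cop_congr fun o m _ => ?_
    rw [hv_dHom hφ, LinearMap.smul_apply, wordDiff_apply,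
      zs_smul_zs_smul, zs_smul_zs_smul, map_add, map_one]
    congr 2
    grind
  have hw : wordDiff (toDual u) (-pre Q f) = -wordDiff (toDual u) (pre Q f) := wordDiff_neg _ _
  rw [cmp_neg_left, cmp_neg_right, neg_neg, hw]
  simp only [LinearMap.add_apply, LinearMap.smul_apply, LinearMap.comp_apply, LinearMap.zero_apply,
    LinearMap.neg_apply, Pi.neg_apply, map_neg, hv_add, hv_neg, hv_zero, hv_zs_smul, neg_neg]
  rw [h1, h2, h3, pd_toDual, h4, ← cop_neg, ← cop_add, ← cop_add, ← cop_add]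
  refine (cop_congr fun o m _ => ?_).trans (cop_zero x)
  have h5 := LinearMap.congr_fun (hf (pair m u)) p
  rw [LinearMap.add_apply, wordDiff_apply, wordDiff_pair] at h5
  have h6 := congrArg (fun z => zs (pd u * (par d + pd x)) • hv φ o z) h5
  simp only [smul_add, zs_smul_zs_smul, LinearMap.zero_apply, smul_zero, map_add, map_zs_smul,
    map_zero] at h6
  simp only [zs_add_one_smul]
  rw [← neg_eq_zero]
  refine Eq.trans ?_ h6
  abel

theorem pre_post (f : homPiece (s.sum r₁) P P 1) (f' : homPiece (s.sum r₂) Q Q 1)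
    (u : Word r₁) (w : Word r₂) : (-pre Q f) (toDual u) ∘ₗ post P f' w +
      zs (pd u + pd u * pd w + pd w) • (post P f' w ∘ₗ (-pre Q f) (toDual u)) = 0 := by
  refine pHom_hom_ext fun d φ hφ x a p hp => ?_
  have h1 : hv (pre Q f (toDual u) (post P f' w φ)) x p = cop x fun o z => cop z fun m n =>
      zs (pd u * (par d + pd w + 1 + pd x) + par d + pd w + 1 + pd o + pd m +
        pd o * (pd w + par d)) •
        nrm f'.1 (pair o w) (hv φ m (nrm f.1 (pair n u) p)) := by
    rw [← cop_assoc x fun o m n =>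
      zs (pd u * (par d + pd w + 1 + pd x) + par d + pd w + 1 + pd o + pd m +
        pd o * (pd w + par d)) •
        nrm f'.1 (pair o w) (hv φ m (nrm f.1 (pair n u) p)),
      hv_pre f u (hasDeg_post P f' w d φ hφ) hp]
    refine cop_congr fun y n _ => ?_
    rw [hv_post f' w hφ (f.2.2.nrm_pair _ _ hp), zs_smul_cop]
    refine cop_congr fun o m h => ?_
    rw [zs_smul_zs_smul, ← h, par_degree, map_one]
    congr 2
    ring
  have h2 : hv (post P f' w (pre Q f (toDual u) φ)) x p = cop x fun o z => cop z fun m n =>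
      zs (pd o * (pd w + par d + pd u + 1) + (pd u * (par d + pd z) + par d + pd m)) •
        nrm f'.1 (pair o w) (hv φ m (nrm f.1 (pair n u) p)) := by
    rw [hv_post f' w (hasDeg_pre Q f (toDual u) d φ hφ) hp]
    refine cop_congr fun o z _ => ?_
    rw [hv_pre f u hφ hp, map_cop, zs_smul_cop]
    refine cop_congr fun m n h => ?_
    rw [map_zs_smul, zs_smul_zs_smul, par_degree, pd_toDual, map_one]
    congr 2
    ring
  simp only [LinearMap.add_apply, LinearMap.smul_apply, LinearMap.comp_apply, LinearMap.zero_apply,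
    LinearMap.neg_apply, Pi.neg_apply, map_neg, hv_add, hv_neg, hv_zero, hv_zs_smul, smul_neg]
  rw [h1, h2, zs_smul_cop, ← cop_neg, ← cop_neg, ← cop_add]
  refine (cop_congr fun o z hx => ?_).trans (cop_zero x)
  rw [zs_smul_cop, ← cop_neg, ← cop_neg, ← cop_add]
  refine (cop_congr fun m n hz => ?_).trans (cop_zero z)
  rw [zs_smul_zs_smul, ← zs_add_one_smul, ← eq_neg_iff_add_eq_zero, neg_neg]
  congr 2
  grind

theorem nrm_hom_sum (f : homPiece (s.sum r₁) P P 1) (f' : homPiece (s.sum r₂) Q Q 1) :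
    nrm (homPost r₁ P f' - homPre r₂ Q f - homD s (r₁.dual.sum r₂) P Q).1 =
      extL r₂ (-pre Q f) + extR r₁.dual (post P f') + extE (r₁.dual.sum r₂) (-dHom s P Q) := by
  have h1 : extL r₂ (-pre Q f) = -extL r₂ (pre Q f) := by
    funext w
    by_cases hw : sndW w = emptyWord r₂ <;> simp [extL, hw]
  have h2 : extE (r₁.dual.sum r₂) (-dHom s P Q) = -extE (r₁.dual.sum r₂) (dHom s P Q) := by
    funext w
    by_cases hw : w = emptyWord (r₁.dual.sum r₂) <;> simp [extE, hw]
  rw [Submodule.coe_sub, Submodule.coe_sub, nrm_sub, nrm_sub, nrm_homPost, nrm_homPre, homD_val,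
    nrm_extE, h1, h2]
  abel

/-- The equation `d² = 0` for the internal Hom. -/
theorem hom_nRel {f : homPiece (s.sum r₁) P P 1} (hf : NRel (nrm f.1))
    {f' : homPiece (s.sum r₂) Q Q 1} (hf' : NRel (nrm f'.1)) :
    NRel (nrm (homPost r₁ P f' - homPre r₂ Q f - homD s (r₁.dual.sum r₂) P Q).1) := by
  rw [nrm_hom_sum]
  refine nRel_ext (fun v => pre_rel f hf (ofDual v)) (post_rel f' hf')
    (fun v => pre_post f f' (ofDual v)) ?_
  rw [LinearMap.neg_comp, LinearMap.comp_neg, neg_neg, dHom_dHom]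

end hom_relation

/-! ### Units, and the polymodules obtained by gluing -/

section units

variable {s t r₁ r₂ : LSet K ι} {M P P' Q Q' R : GrMod K ι} {k : ι}

theorem len_eq_zero {w : Word s} : len w = 0 ↔ w = emptyWord s := by
  simp [len, Finset.sum_eq_zero_iff, funext_iff, emptyWord]

theorem len_pair (v : Word s) (w : Word t) : len (pair v w) = len v + len w :=
  Fintype.sum_sum_type (α₁ := s.I) (α₂ := t.I) _

theorem len_push (i : LSet.Hom s t) (w : Word s) : len (push i w) = len w := by
  unfold len
  rw [sum_push i]
  · refine Finset.sum_congr rfl fun x _ => ?_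
    rw [push_apply, length_castL]
  · intro y hy
    rw [push_of_notMem _ _ _ hy]; rfl

/-- The unit of `κ x`, as a letter. -/
def unitLetter (s : LSet K ι) (x : s.I) : Letter (s.κ x).toGrMod := ⟨0, (s.κ x).one⟩

theorem one_le_len {w : Word s} {x : s.I} (h : unitLetter s x ∈ w x) : 1 ≤ len w :=
  (List.length_pos_of_mem h).trans_le
    (Finset.single_le_sum (f := fun y => (w y).length) (fun _ _ => Nat.zero_le _)
      (Finset.mem_univ x))

theorem eq_single {w : Word s} {x : s.I} (h : unitLetter s x ∈ w x) (hw : len w = 1) :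
    w = single x [unitLetter s x] := by
  have h0 := List.length_pos_of_mem h
  have h1 : (w x).length + ∑ y ∈ Finset.univ.erase x, (w y).length = 1 := by
    rw [Finset.add_sum_erase Finset.univ (fun y => (w y).length) (Finset.mem_univ x)]
    exact hw
  have h2 : (w x).length = 1 := by omega
  have h3 : ∑ y ∈ Finset.univ.erase x, (w y).length = 0 := by omega
  obtain ⟨a, ha⟩ := List.length_eq_one_iff.1 h2
  funext y
  by_cases hy : y = x
  · subst hy
    rw [ha, List.mem_singleton] at h
    rw [single, upd_self, ha, h]
  · rw [single, upd_of_ne hy]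
    exact List.eq_nil_of_length_eq_zero
      (Finset.sum_eq_zero_iff.1 h3 y (Finset.mem_erase.2 ⟨hy, Finset.mem_univ y⟩))

theorem len_single (x : s.I) : len (single x [unitLetter s x]) = 1 := by
  unfold len
  rw [Finset.sum_eq_single_of_mem x (Finset.mem_univ x)]
  · rw [single, upd_self]; rfl
  · intro y _ hy
    rw [single, upd_of_ne hy]; rfl

theorem pw_unit (s : LSet K ι) (x : s.I) : pw [unitLetter s x] = 1 := by
  simp [pw, wt, unitLetter]

theorem pw_single (x y : s.I) :
    pw (single x [unitLetter s x] y) = if y = x then 1 else 0 := by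
  by_cases hy : y = x
  · subst hy
    rw [single, upd_self, pw_unit, if_pos rfl]
  · rw [single, upd_of_ne hy, if_neg hy]
    exact pw_nil

theorem pd_single (x : s.I) : pd (single x [unitLetter s x]) = 1 := by
  rw [pd_eq]
  simp [pw_single]

theorem pR_single (x : s.I) :
    pR (single x [unitLetter s x]) = if s.side x then 0 else 1 := by
  rw [pR_eq]
  rw [Finset.sum_eq_single_of_mem x (Finset.mem_univ x)]
  · rw [pw_single, if_pos rfl]
  · intro y _ hy
    rw [pw_single, if_neg hy, ite_self]

theorem ninv_single (x : s.I) : ninv (single x [unitLetter s x]) = 0 := by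
  unfold ninv
  refine Finset.sum_eq_zero fun y _ => Finset.sum_eq_zero fun z _ => ?_
  split_ifs with h
  · rw [pw_single, pw_single]
    split_ifs with h1 h2
    · exact absurd (h1.trans h2.symm) (ne_of_lt' h.1)
    all_goals simp
  · rfl

theorem ro_single (i : LSet.Hom s t) (x : s.I) : ro i (single x [unitLetter s x]) = 0 := by
  unfold ro
  refine Finset.sum_eq_zero fun y _ => Finset.sum_eq_zero fun z _ => ?_
  split_ifs with h
  · rw [pw_single, pw_single]
    split_ifs with h1 h2
    · exact absurd (h1.trans h2.symm) (ne_of_lt' h.1)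
    all_goals simp
  · rfl

/-- The units act strictly, for a normalized map. -/
def NUnit (f : Word s → P →ₗ[K] P) : Prop :=
  ∀ w x, unitLetter s x ∈ w x →
    f w = if len w = 1 then zs (if s.side x then 0 else 1) • LinearMap.id else 0

theorem isPolymodule_iff (M : PreMod s) :
    IsPolymodule M ↔ NRel (nrm (P := M.toGrMod) (Q := M.toGrMod) M.μ) ∧
      NUnit (nrm (P := M.toGrMod) (Q := M.toGrMod) M.μ) := by
  have key : ∀ x, ∀ f : Word s → M.toGrMod →ₗ[K] M.toGrMod,
      (nrm f (single x [unitLetter s x]) = zs (if s.side x then 0 else 1) • LinearMap.id ↔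
        f (single x [unitLetter s x]) =
          if s.side x then LinearMap.id else -M.toGrMod.twist 1) := by
    intro x f
    have h1 : nrm (fun _ : Word s => if s.side x then LinearMap.id else -M.toGrMod.twist 1)
        (single x [unitLetter s x]) = zs (if s.side x then 0 else 1) • LinearMap.id := by
      refine GrMod.hom_ext fun i p hp => ?_
      rw [nrm_apply _ _ hp, ninv_single, pR_single]
      split_ifs
      · simp [zs_zero_smul]
      · rw [LinearMap.neg_apply, M.toGrMod.twist_zs 1 hp, neg_eq_zs_smul, zs_smul_zs_smul,
          zs_smul_zs_smul, LinearMap.smul_apply, map_one]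
        congr 2
        grind
    rw [← h1]
    exact ⟨fun h => nrm_injective h, fun h => by rw [nrm, h, nrm]⟩
  constructor
  · intro h
    refine ⟨(rel_iff_nRel M.μ_mem).1 h.rel, fun w x hx => ?_⟩
    by_cases hw : len w = 1
    · rw [if_pos hw, eq_single hx hw, key x M.μ]
      by_cases hs : s.side x = true
      · rw [if_pos hs]
        exact h.unit_left x hs
      · rw [if_neg hs]
        exact h.unit_right x (by simpa using hs)
    · rw [if_neg hw]
      exact nrm_zero_of (h.unit_zero w x hx hw)
  · rintro ⟨h, h'⟩
    have hu : ∀ x, M.μ (single x [unitLetter s x]) =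
        if s.side x then LinearMap.id else -M.toGrMod.twist 1 := fun x => by
      rw [← key x M.μ]
      have h2 := h' (single x [unitLetter s x]) x (by rw [single, upd_self]; exact .head _)
      rw [if_pos (len_single x)] at h2
      exact h2
    refine ⟨(rel_iff_nRel M.μ_mem).2 h, fun x hx => ?_, fun x hx => ?_, fun w x hx hw => ?_⟩
    · exact (hu x).trans (if_pos hx)
    · exact (hu x).trans (if_neg (by simp [hx]))
    · have h2 := h' w x hx
      rw [if_neg hw, nrm_eq_zero] at h2
      exact h2

theorem unitLetter_push (i : LSet.Hom s t) {w : Word s} {x : s.I} (h : unitLetter s x ∈ w x) :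
    unitLetter t (i.f x) ∈ push i w (i.f x) := by
  rw [push_apply]
  unfold unitLetter at *
  generalize i.κ_eq x = e
  revert e
  generalize t.κ (i.f x) = B
  rintro rfl
  exact h

theorem NUnit.npull {f : Word t → P →ₗ[K] P} (hf : NUnit f) (i : LSet.Hom s t) :
    NUnit (npull i f) := by
  intro w x hx
  rw [PolyMod.npull, hf (push i w) (i.f x) (unitLetter_push i hx), len_push, i.side_eq]
  split_ifs with hw
  all_goals first
    | rw [eq_single hx hw, ro_single, zs_zero_smul]
    | rw [smul_zero]

theorem nUnit_ext {A : Word r₁ → M →ₗ[K] M} {B : Word r₂ → M →ₗ[K] M} {D : M →ₗ[K] M}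
    (hA : NUnit A) (hB : NUnit B) : NUnit (extL r₂ A + extR r₁ B + extE (r₁.sum r₂) D) := by
  intro x y hy
  rw [← pair_fst_snd x] at hy ⊢
  generalize fstW x = v at hy
  generalize sndW x = w at hy
  have hne : pair v w ≠ emptyWord _ := fun h => by
    rw [h] at hy
    exact List.not_mem_nil hy
  rw [Pi.add_apply, Pi.add_apply, extL_pair, extR_pair, extE, if_neg hne, add_zero, len_pair]
  rcases y with y | y
  · change unitLetter r₁ y ∈ v y at hy
    have hv : v ≠ emptyWord r₁ := fun h => by rw [h] at hy; exact List.not_mem_nil hy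
    have hl := one_le_len hy
    rw [if_neg hv, add_zero, hA v y hy]
    by_cases hw : w = emptyWord r₂
    · rw [if_pos hw, len_eq_zero.2 hw, add_zero]; rfl
    · rw [if_neg hw, if_neg]
      have := mt len_eq_zero.1 hw
      omega
  · change unitLetter r₂ y ∈ w y at hy
    have hw : w ≠ emptyWord r₂ := fun h => by rw [h] at hy; exact List.not_mem_nil hy
    have hl := one_le_len hy
    rw [if_neg hw, zero_add, hB w y hy]
    by_cases hv : v = emptyWord r₁
    · rw [if_pos hv, len_eq_zero.2 hv, zero_add]; rfl
    · rw [if_neg hv, if_neg]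
      have := mt len_eq_zero.1 hv
      omega

theorem NUnit.pair {f : Word (s.sum t) → P →ₗ[K] P} (hf : NUnit f) (v : Word s) {w : Word t}
    {x : t.I} (h : unitLetter t x ∈ w x) :
    f (pair v w) = if v = emptyWord s ∧ len w = 1 then
      zs (if t.side x then 0 else 1) • LinearMap.id else 0 := by
  rw [hf (PolyMod.pair v w) (Sum.inr x) h, len_pair]
  have := one_le_len h
  have e := len_eq_zero (w := v)
  refine if_congr ⟨fun h' => ⟨e.1 (by omega), by omega⟩, fun h' => ?_⟩ rfl rfl
  rw [e.2 h'.1, h'.2]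

theorem NUnit.neg_dual {f : Word s.dual → P →ₗ[K] P} (hf : ∀ (w : Word s) x,
    unitLetter s x ∈ w x → f (toDual w) =
      if len w = 1 then zs (if s.side x then 0 else 1) • LinearMap.id else 0) : NUnit (-f) := by
  intro (w : Word s) (x : s.I) hx
  have h := hf w x hx
  change -f (toDual w) = if len w = 1 then
    zs (if (!s.side x) = true then 0 else 1) • LinearMap.id else 0
  rw [h]
  by_cases hw : len w = 1
  · rw [if_pos hw, if_pos hw, ← zs_add_one_smul]
    cases s.side x
    · simp [CharTwo.add_self_eq_zero]
    · simp
  · rw [if_neg hw, if_neg hw, neg_zero]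

theorem nUnit_actL {f : homPiece (s.dual.sum r₁) P P 1} (hf : NUnit (nrm f.1)) :
    NUnit (actL Q f) := by
  intro v x hx
  refine tens_hom_ext fun a b p hp g q hq => ?_
  rw [actL_tm f v hp hq]
  have h : ∀ o : Word s, nrm f.1 (pair (toDual o) v) = _ := fun o => hf.pair (toDual o) hx
  rw [cop_eq_left]
  · rw [h, pd_emptyWord, zero_mul, zs_zero_smul]
    by_cases hv : len v = 1
    · rw [if_pos ⟨rfl, hv⟩, if_pos hv, LinearMap.smul_apply, LinearMap.smul_apply, tm_smul_left]
      rfl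
    · rw [if_neg fun h => hv h.2, if_neg hv, LinearMap.zero_apply, LinearMap.zero_apply,
        tm_zero_left]
  · intro o n ho
    rw [h, if_neg fun h => ho h.1, LinearMap.zero_apply, tm_zero_left, smul_zero]

theorem nUnit_actR {f : homPiece (s.sum r₂) Q Q 1} (hf : NUnit (nrm f.1)) :
    NUnit (actR P f) := by
  intro v x hx
  refine tens_hom_ext fun a b p hp g q hq => ?_
  rw [actR_tm f v hp hq]
  have h : ∀ o : Word s, nrm f.1 (pair o v) = _ := fun o => hf.pair o hx
  rw [cop_eq_right]
  · rw [h]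
    by_cases hv : len v = 1
    · rw [if_pos ⟨rfl, hv⟩, if_pos hv, LinearMap.smul_apply, LinearMap.smul_apply, tm_smul_right,
        eq_single hx hv, pd_single, pd_emptyWord, map_one, CharTwo.add_self_eq_zero, zero_mul,
        zero_mul, add_zero, zs_zero_smul]
      rfl
    · rw [if_neg fun h => hv h.2, if_neg hv, LinearMap.zero_apply, LinearMap.zero_apply,
        tm_zero_right, smul_zero]
  · intro o n ho
    rw [h, if_neg fun h => ho h.1, LinearMap.zero_apply, tm_zero_right, smul_zero]

theorem nUnit_post {f : homPiece (s.sum r₂) Q Q 1} (hf : NUnit (nrm f.1)) :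
    NUnit (post P f) := by
  intro v x hx
  refine pHom_hom_ext fun d φ hφ z a p hp => ?_
  rw [hv_post f v hφ hp]
  have h : ∀ o : Word s, nrm f.1 (pair o v) = _ := fun o => hf.pair o hx
  rw [cop_eq_left]
  · rw [h, pd_emptyWord, zero_mul, zs_zero_smul]
    by_cases hv : len v = 1
    · rw [if_pos ⟨rfl, hv⟩, if_pos hv, LinearMap.smul_apply, LinearMap.smul_apply, hv_zs_smul]
      rfl
    · rw [if_neg fun h => hv h.2, if_neg hv, LinearMap.zero_apply, LinearMap.zero_apply,
        hv_zero, LinearMap.zero_apply]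
  · intro o n ho
    rw [h, if_neg fun h => ho h.1, LinearMap.zero_apply, smul_zero]

theorem nUnit_pre {f : homPiece (s.sum r₁) P P 1} (hf : NUnit (nrm f.1)) :
    NUnit (-pre Q f) := by
  refine NUnit.neg_dual fun v x hx => ?_
  refine pHom_hom_ext fun d φ hφ z a p hp => ?_
  have e := hv_pre f v hφ hp z
  refine Eq.trans e ?_
  have h : ∀ o : Word s, nrm f.1 (pair o v) = _ := fun o => hf.pair o hx
  rw [cop_eq_right]
  · rw [h]
    by_cases hv : len v = 1
    · rw [if_pos ⟨rfl, hv⟩, if_pos hv, LinearMap.smul_apply, LinearMap.smul_apply, hv_zs_smul,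
        eq_single hx hv, pd_single, map_one, CharTwo.add_self_eq_zero, zs_zero_smul, map_zs_smul]
      rfl
    · rw [if_neg fun h => hv h.2, if_neg hv, LinearMap.zero_apply, LinearMap.zero_apply,
        hv_zero, LinearMap.zero_apply, map_zero, smul_zero]
  · intro o n ho
    rw [h, if_neg fun h => ho h.1, LinearMap.zero_apply, map_zero, smul_zero]

theorem IsPolymodule.pull {M : PreMod t} (hM : IsPolymodule M) (i : LSet.Hom s t) :
    IsPolymodule (M.pull i) := by
  have h := (isPolymodule_iff M).1 hM
  have e : nrm (P := M.toGrMod) (Q := M.toGrMod) (M.pull i).μ =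
      npull i (nrm (P := M.toGrMod) (Q := M.toGrMod) M.μ) := funext (nrm_pull i _)
  exact (isPolymodule_iff _).2 ⟨e ▸ h.1.npull i, e ▸ h.2.npull i⟩

end units

section gluing_polymodules

variable {s₀ s₁ s₂ : LSet K ι}

/-- The tensor product of polymodules is a polymodule. -/
theorem IsPolymodule.tensor (i₁ : LSet.Hom s₀ s₁.dual) (i₂ : LSet.Hom s₀ s₂) {P₁ : PreMod s₁}
    {P₂ : PreMod s₂} (h₁ : IsPolymodule P₁) (h₂ : IsPolymodule P₂) :
    IsPolymodule (tensor i₁ i₂ P₁ P₂) := by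
  have h₁' := (isPolymodule_iff _).1 (h₁.pull (splitDual i₁))
  have h₂' := (isPolymodule_iff _).1 (h₂.pull (split i₂))
  rw [isPolymodule_iff]
  refine ⟨tens_nRel (f := pullHom (splitDual i₁) ⟨P₁.μ, P₁.μ_mem⟩) h₁'.1
    (f' := pullHom (split i₂) ⟨P₂.μ, P₂.μ_mem⟩) h₂'.1, ?_⟩
  have e := nrm_tens_sum (pullHom (splitDual i₁) ⟨P₁.μ, P₁.μ_mem⟩)
    (pullHom (split i₂) ⟨P₂.μ, P₂.μ_mem⟩)
  exact Eq.mpr (congrArg NUnit e) (nUnit_ext (nUnit_actL h₁'.2) (nUnit_actR h₂'.2))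

/-- The internal Hom of polymodules is a polymodule. -/
theorem IsPolymodule.ihom (i₁ : LSet.Hom s₀ s₁) (i₂ : LSet.Hom s₀ s₂) {P₁ : PreMod s₁}
    {P₂ : PreMod s₂} (h₁ : IsPolymodule P₁) (h₂ : IsPolymodule P₂) :
    IsPolymodule (ihom i₁ i₂ P₁ P₂) := by
  have h₁' := (isPolymodule_iff _).1 (h₁.pull (split i₁))
  have h₂' := (isPolymodule_iff _).1 (h₂.pull (split i₂))
  rw [isPolymodule_iff]
  refine ⟨hom_nRel (f := pullHom (split i₁) ⟨P₁.μ, P₁.μ_mem⟩) h₁'.1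
    (f' := pullHom (split i₂) ⟨P₂.μ, P₂.μ_mem⟩) h₂'.1, ?_⟩
  have e := nrm_hom_sum (pullHom (split i₁) ⟨P₁.μ, P₁.μ_mem⟩)
    (pullHom (split i₂) ⟨P₂.μ, P₂.μ_mem⟩)
  exact Eq.mpr (congrArg NUnit e) (nUnit_ext (nUnit_pre h₁'.2) (nUnit_post h₂'.2))

end gluing_polymodules

/-! ### Graded subspaces and lattice filtrations -/

section graded_subspaces

variable {s t r₁ r₂ : LSet K ι} {P P' Q Q' R : GrMod K ι} {k : ι}

/-- The projection to the component of degree `i`. -/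
def GrMod.proj (P : GrMod K ι) (i : ι) : P →ₗ[K] P :=
  (P.piece i).subtype ∘ₗ DirectSum.component K ι (fun i => P.piece i) i ∘ₗ
    (P.decomp : P →ₗ[K] DirectSum ι fun i => P.piece i)

theorem GrMod.proj_mem (P : GrMod K ι) (i : ι) (p : P) : P.proj i p ∈ P.piece i :=
  (DirectSum.component K ι (fun i => P.piece i) i (P.decomp p)).2

theorem GrMod.proj_of_mem (P : GrMod K ι) {i : ι} {p : P} (hp : p ∈ P.piece i) (j : ι) :
    P.proj j p = if i = j then p else 0 := by
  change ((DirectSum.component K ι (fun i => P.piece i) j (P.decomp p) : P.piece j) : P) = _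
  rw [P.decomp_of_mem hp]
  split_ifs with h
  · subst h
    rw [DirectSum.component.lof_self]
  · rw [DirectSum.component.of, dif_neg h]; rfl

theorem GrMod.mem_of_proj (P : GrMod K ι) {p : P} {N : Submodule K P} (h : ∀ i, P.proj i p ∈ N) :
    p ∈ N := by
  have h1 : P.decomp.symm (P.decomp p) = p := P.decomp.symm_apply_apply p
  rw [← h1, ← DirectSum.sum_support_of (P.decomp p), map_sum]
  refine Submodule.sum_mem _ fun i _ => ?_
  have h2 : P.decomp.symm (DirectSum.of (fun i => P.piece i) i (P.decomp p i)) = P.proj i p :=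
    DirectSum.coeLinearMap_lof P.piece i _
  rw [h2]
  exact h i

/-- A graded subspace. -/
def IsGraded (U : Submodule K P) : Prop := U = ⨆ i, U ⊓ P.piece i

theorem IsGraded.map_mem {U : Submodule K P} (hU : IsGraded U) {M : Type*} [AddCommGroup M]
    [Module K M] {L : P →ₗ[K] M} {N : Submodule K M}
    (h : ∀ i, ∀ p ∈ P.piece i, p ∈ U → L p ∈ N) {p : P} (hp : p ∈ U) : L p ∈ N := by
  have h1 : U ≤ N.comap L := by
    rw [hU]
    exact iSup_le fun i p hp => h i p hp.2 hp.1
  exact h1 hp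

theorem IsGraded.proj_mem {U : Submodule K P} (hU : IsGraded U) (i : ι) {p : P} (hp : p ∈ U) :
    P.proj i p ∈ U := by
  refine hU.map_mem (fun j p hp hp' => ?_) hp
  rw [P.proj_of_mem hp]
  split_ifs
  · exact hp'
  · exact U.zero_mem

theorem isGraded_of_proj {U : Submodule K P} (h : ∀ i, ∀ p ∈ U, P.proj i p ∈ U) : IsGraded U := by
  refine le_antisymm (fun p hp => P.mem_of_proj fun i => ?_) (iSup_le fun i => inf_le_left)
  exact Submodule.mem_iSup_of_mem i ⟨h i p hp, P.proj_mem i p⟩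

theorem isGraded_top : IsGraded (⊤ : Submodule K P) :=
  isGraded_of_proj fun _ _ _ => Submodule.mem_top

theorem isGraded_bot : IsGraded (⊥ : Submodule K P) :=
  isGraded_of_proj fun i p hp => by
    rw [(Submodule.mem_bot K).1 hp, map_zero]
    exact Submodule.zero_mem _

/-- A map sends `U` to `V` if and only if its normalized form does. -/
theorem IsGraded.nrm_mem_iff {U : Submodule K P} (hU : IsGraded U) {V : Submodule K Q}
    {f : Word s → P →ₗ[K] Q} {w : Word s} :
    (∀ p ∈ U, nrm f w p ∈ V) ↔ ∀ p ∈ U, f w p ∈ V := by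
  constructor
  · intro h p hp
    refine hU.map_mem (fun i p hp hp' => ?_) hp
    have := h p hp'
    rwa [nrm_apply _ _ hp, zs_smul_mem_iff] at this
  · intro h p hp
    refine hU.map_mem (fun i p hp hp' => ?_) hp
    rw [nrm_apply _ _ hp, zs_smul_mem_iff]
    exact h p hp'

theorem mem_homFilt_iff {U : Submodule K P} (hU : IsGraded U) {V : Submodule K Q} {β : s.I → ℤ}
    {φ : PHom s P Q} : φ ∈ homFilt s U V β ↔
      ∀ a : Word s, (∀ x, ((a x).length : ℤ) ≤ -β x) → ∀ p ∈ U, hv φ a p ∈ V :=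
  forall_congr' fun _ => forall_congr' fun _ => hU.nrm_mem_iff.symm

theorem mem_homFilt_of_pieces {U : Submodule K P} (hU : IsGraded U) {V : Submodule K Q}
    {β : s.I → ℤ} {φ : PHom s P Q} (h : ∀ a : Word s, (∀ x, ((a x).length : ℤ) ≤ -β x) →
      ∀ i, ∀ p ∈ P.piece i, p ∈ U → hv φ a p ∈ V) : φ ∈ homFilt s U V β :=
  (mem_homFilt_iff hU).2 fun a ha _ hp => hU.map_mem (h a ha) hp

theorem hv_proj (d : ι) (φ : PHom s P Q) (a : Word s) {i : ι} {p : P} (hp : p ∈ P.piece i) :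
    hv ((PHom s P Q).proj d φ) a p = Q.proj (i + deg a + d) (hv φ a p) := by
  have h : ((LinearMap.applyₗ p : (P →ₗ[K] Q) →ₗ[K] Q) ∘ₗ hvL a) ∘ₗ (PHom s P Q).proj d =
      (Q.proj (i + deg a + d) ∘ₗ (LinearMap.applyₗ p : (P →ₗ[K] Q) →ₗ[K] Q)) ∘ₗ hvL a := by
    refine GrMod.hom_ext fun e φ hφ => ?_
    change hv ((PHom s P Q).proj d φ) a p = Q.proj (i + deg a + d) (hv φ a p)
    rw [(PHom s P Q).proj_of_mem hφ, Q.proj_of_mem (hv_mem hφ a hp)]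
    by_cases hd : e = d
    · rw [if_pos hd, if_pos (by rw [hd])]
    · rw [if_neg hd, if_neg fun h => hd (add_left_cancel h), hv_zero, LinearMap.zero_apply]
  exact LinearMap.congr_fun h φ

theorem isGraded_homFilt {U : Submodule K P} (hU : IsGraded U) {V : Submodule K Q}
    (hV : IsGraded V) (β : s.I → ℤ) : IsGraded (homFilt s U V β) := by
  refine isGraded_of_proj fun d φ hφ => mem_homFilt_of_pieces hU fun a ha i p hp hp' => ?_
  rw [hv_proj d φ a hp]
  exact hV.proj_mem _ ((mem_homFilt_iff hU).1 hφ a ha p hp')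

theorem homFilt_mono {U U' : Submodule K P} {V V' : Submodule K Q} {β β' : s.I → ℤ} (hU : U' ≤ U)
    (hV : V ≤ V') (hβ : β ≤ β') : homFilt s U V β ≤ homFilt s U' V' β' :=
  fun _ h a ha p hp => hV (h a (fun x => (ha x).trans (neg_le_neg (hβ x))) p (hU hp))

theorem tm_mem_tensFilt {γ : s.I → ℤ} {g : Word s} (hg : ∀ x, ((g x).length : ℤ) ≤ γ x) (p : P)
    (q : Q) : tm p g q ∈ tensFilt s P Q γ :=
  zs_smul_mem _ _ (Submodule.subset_span ⟨p, g, q, hg, rfl⟩)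

theorem tensFilt_le {γ : s.I → ℤ} {N : Submodule K (tens s P Q)}
    (h : ∀ a b, ∀ p ∈ P.piece a, ∀ g : Word s, (∀ x, ((g x).length : ℤ) ≤ γ x) →
      ∀ q ∈ Q.piece b, tm p g q ∈ N) : tensFilt s P Q γ ≤ N := by
  refine Submodule.span_le.2 ?_
  rintro _ ⟨p, g, q, hg, rfl⟩
  rw [tmk_eq_tm]
  refine zs_smul_mem _ _ ?_
  rw [← tmB_apply]
  refine Q.le_of_pieces (tmB g p) N (fun b q hq => ?_) q
  refine P.le_of_pieces ((tmB g).flip q) N (fun a p hp => ?_) p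
  rw [LinearMap.flip_apply, tmB_apply]
  exact h a b p hp g hg q hq

theorem isGraded_tensFilt (γ : s.I → ℤ) : IsGraded (tensFilt s P Q γ) := by
  refine le_antisymm (tensFilt_le fun a b p hp g hg q hq => ?_) (iSup_le fun i => inf_le_left)
  exact Submodule.mem_iSup_of_mem _ ⟨tm_mem_tensFilt hg p q, tm_mem hp hq⟩

theorem tensFilt_mono {γ γ' : s.I → ℤ} (h : γ ≤ γ') : tensFilt s P Q γ ≤ tensFilt s P Q γ' :=
  tensFilt_le fun _ _ _ _ _ hg _ _ => tm_mem_tensFilt (fun x => (hg x).trans (h x)) _ _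

theorem IsCut.length_le {o n w : Word s} (h : IsCut o n w) {γ : s.I → ℤ}
    (hw : ∀ x, ((w x).length : ℤ) ≤ γ x) :
    (∀ x, ((o x).length : ℤ) ≤ γ x) ∧ ∀ x, ((n x).length : ℤ) ≤ γ x :=
  ⟨fun x => by have := h.length_add x; have := hw x; omega,
    fun x => by have := h.length_add x; have := hw x; omega⟩

theorem actL_mem_tensFilt (f : homPiece (s.dual.sum r₁) P P' k) (v : Word r₁) (γ : s.I → ℤ) :
    tensFilt s P Q γ ≤ (tensFilt s P' Q γ).comap (actL Q f v) :=
  tensFilt_le fun a b p hp g hg q hq => by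
    rw [Submodule.mem_comap, actL_tm f v hp hq]
    exact cop_mem fun o n h => zs_smul_mem _ _ (tm_mem_tensFilt (h.length_le hg).2 _ _)

theorem actR_mem_tensFilt (f : homPiece (s.sum r₂) Q Q' k) (v : Word r₂) (γ : s.I → ℤ) :
    tensFilt s P Q γ ≤ (tensFilt s P Q' γ).comap (actR P f v) :=
  tensFilt_le fun a b p hp g hg q hq => by
    rw [Submodule.mem_comap, actR_tm f v hp hq]
    exact cop_mem fun o n h => zs_smul_mem _ _ (tm_mem_tensFilt (h.length_le hg).1 _ _)

theorem dTens_mem_tensFilt (γ : s.I → ℤ) :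
    tensFilt s P Q γ ≤ (tensFilt s P Q γ).comap (dTens s P Q) :=
  tensFilt_le fun a b p hp g hg q hq => by
    rw [Submodule.mem_comap, dTens_tm hp]
    refine zs_smul_mem _ _ (wordDiff_mem fun g' hg' => tm_mem_tensFilt (fun x => ?_) _ _)
    have := hg' x
    have := hg x
    omega

theorem post_mem_homFilt {U : Submodule K P} (hU : IsGraded U) {V : Submodule K Q}
    (hV : IsGraded V) (f : homPiece (s.sum r₂) Q Q k) (hf : ∀ w, ∀ q ∈ V, nrm f.1 w q ∈ V)
    (v : Word r₂) (β : s.I → ℤ) {φ : PHom s P Q} (hφ : φ ∈ homFilt s U V β) :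
    post P f v φ ∈ homFilt s U V β := by
  refine (isGraded_homFilt hU hV β).map_mem (fun d φ hφ hφ' => ?_) hφ
  refine mem_homFilt_of_pieces hU fun a ha i p hp hp' => ?_
  rw [hv_post f v hφ hp]
  exact cop_mem fun o n h => zs_smul_mem _ _ (hf _ _ ((mem_homFilt_iff hU).1 hφ' n
    (h.length_le ha).2 p hp'))

theorem pre_mem_homFilt {U : Submodule K P} (hU : IsGraded U) {V : Submodule K Q}
    (hV : IsGraded V) (f : homPiece (s.sum r₁) P P k) (hf : ∀ w, ∀ p ∈ U, nrm f.1 w p ∈ U)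
    (v : Word r₁.dual) (β : s.I → ℤ) {φ : PHom s P Q} (hφ : φ ∈ homFilt s U V β) :
    pre Q f v φ ∈ homFilt s U V β := by
  refine (isGraded_homFilt hU hV β).map_mem (fun d φ hφ hφ' => ?_) hφ
  refine mem_homFilt_of_pieces hU fun a ha i p hp hp' => ?_
  have e := hv_pre f (ofDual v) hφ hp a
  refine (congrArg (· ∈ V) e).mpr ?_
  exact cop_mem fun o n h => zs_smul_mem _ _ ((mem_homFilt_iff hU).1 hφ' o
    (h.length_le ha).1 _ (hf _ p hp'))

theorem dHom_mem_homFilt {U : Submodule K P} (hU : IsGraded U) {V : Submodule K Q}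
    (hV : IsGraded V) (β : s.I → ℤ) {φ : PHom s P Q} (hφ : φ ∈ homFilt s U V β) :
    dHom s P Q φ ∈ homFilt s U V β := by
  refine (isGraded_homFilt hU hV β).map_mem (fun d φ hφ hφ' => ?_) hφ
  refine mem_homFilt_of_pieces hU fun a ha i p hp hp' => ?_
  rw [hv_dHom hφ, LinearMap.smul_apply, wordDiff_apply]
  refine zs_smul_mem _ _ (wordDiff_mem fun a' ha' => (mem_homFilt_iff hU).1 hφ' a'
    (fun x => ?_) p hp')
  have := ha' x
  have := ha x
  omega

theorem ext_mem {A : Word r₁ → P →ₗ[K] P} {B : Word r₂ → P →ₗ[K] P} {D : P →ₗ[K] P}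
    {U : Submodule K P} (hA : ∀ v, ∀ p ∈ U, A v p ∈ U) (hB : ∀ v, ∀ p ∈ U, B v p ∈ U)
    (hD : ∀ p ∈ U, D p ∈ U) (w : Word (r₁.sum r₂)) (p : P) (hp : p ∈ U) :
    (extL r₂ A + extR r₁ B + extE (r₁.sum r₂) D) w p ∈ U := by
  refine U.add_mem (U.add_mem ?_ ?_) ?_
  · unfold extL; split_ifs
    exacts [hA _ p hp, U.zero_mem]
  · unfold extR; split_ifs
    exacts [hB _ p hp, U.zero_mem]
  · unfold extE; split_ifs
    exacts [hD p hp, U.zero_mem]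

end graded_subspaces

section filtered_gluing

variable {s t s₀ s₁ s₂ : LSet K ι} {L : Type}

theorem IsLatticeFiltration.pull {M : PreMod t} {F : (L → ℤ) → Submodule K M.toGrMod}
    (h : IsLatticeFiltration M F) (i : LSet.Hom s t) : IsLatticeFiltration (M.pull i) F :=
  ⟨h.mono, h.graded, fun γ w p hp => sgn_smul_mem _ _ (h.stable γ (push i w) p hp)⟩

theorem pull_stable {P : GrMod K ι} {U : Submodule K P} {f : Word t → P →ₗ[K] P}
    (h : ∀ w, ∀ p ∈ U, f w p ∈ U) (hU : IsGraded U) (i : LSet.Hom s t) (w : Word s) :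
    ∀ p ∈ U, nrm (pull i f) w p ∈ U :=
  hU.nrm_mem_iff.2 fun p hp => sgn_smul_mem _ _ (h (push i w) p hp)

theorem isLatticeFiltration_tensor (i₁ : LSet.Hom s₀ s₁.dual) (i₂ : LSet.Hom s₀ s₂)
    (P₁ : PreMod s₁) (P₂ : PreMod s₂) : IsLatticeFiltration (tensor i₁ i₂ P₁ P₂)
      (tensFilt s₀ P₁.toGrMod P₂.toGrMod) := by
  refine ⟨fun _ _ => tensFilt_mono, isGraded_tensFilt, fun γ w => ?_⟩
  refine (isGraded_tensFilt γ).nrm_mem_iff.1 fun p hp => ?_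
  have e := nrm_tens_sum (pullHom (splitDual i₁) ⟨P₁.μ, P₁.μ_mem⟩)
    (pullHom (split i₂) ⟨P₂.μ, P₂.μ_mem⟩)
  refine (congrArg (· ∈ tensFilt s₀ P₁.toGrMod P₂.toGrMod γ)
    (LinearMap.congr_fun (congrFun e w) p)).mpr ?_
  exact ext_mem (fun v => actL_mem_tensFilt _ v γ) (fun v => actR_mem_tensFilt _ v γ)
    (dTens_mem_tensFilt γ) w p hp

theorem isLatticeFiltration_ihom (i₁ : LSet.Hom s₀ s₁) (i₂ : LSet.Hom s₀ s₂) (P₁ : PreMod s₁)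
    (P₂ : PreMod s₂) {U : (L → ℤ) → Submodule K P₁.toGrMod}
    {V : (L → ℤ) → Submodule K P₂.toGrMod} {β : (L → ℤ) → s₀.I → ℤ} (hU : Antitone U)
    (hU' : ∀ γ, IsGraded (U γ)) (hU'' : ∀ γ w, ∀ p ∈ U γ, P₁.μ w p ∈ U γ) (hV : Monotone V)
    (hV' : ∀ γ, IsGraded (V γ)) (hV'' : ∀ γ w, ∀ p ∈ V γ, P₂.μ w p ∈ V γ) (hβ : Monotone β) :
    IsLatticeFiltration (ihom i₁ i₂ P₁ P₂) fun γ => homFilt s₀ (U γ) (V γ) (β γ) := by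
  refine ⟨fun _ _ h => homFilt_mono (hU h) (hV h) (hβ h),
    fun γ => isGraded_homFilt (hU' γ) (hV' γ) (β γ), fun γ w => ?_⟩
  refine (isGraded_homFilt (hU' γ) (hV' γ) (β γ)).nrm_mem_iff.1 fun p hp => ?_
  have e := nrm_hom_sum (pullHom (split i₁) ⟨P₁.μ, P₁.μ_mem⟩)
    (pullHom (split i₂) ⟨P₂.μ, P₂.μ_mem⟩)
  refine (congrArg (· ∈ homFilt s₀ (U γ) (V γ) (β γ))
    (LinearMap.congr_fun (congrFun e w) p)).mpr ?_
  refine ext_mem (fun v φ hφ => ?_) (fun v φ hφ => ?_) (fun φ hφ => ?_) w p hp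
  · exact Submodule.neg_mem _ (pre_mem_homFilt (hU' γ) (hV' γ) _
      (pull_stable (hU'' γ) (hU' γ) (split i₁)) v _ hφ)
  · exact post_mem_homFilt (hU' γ) (hV' γ) _ (pull_stable (hV'' γ) (hV' γ) (split i₂)) v _ hφ
  · exact Submodule.neg_mem _ (dHom_mem_homFilt (hU' γ) (hV' γ) _ hφ)

theorem isLatticeFiltration_ihom_top_bot (i₁ : LSet.Hom s₀ s₁) (i₂ : LSet.Hom s₀ s₂)
    (P₁ : PreMod s₁) (P₂ : PreMod s₂) : IsLatticeFiltration (ihom i₁ i₂ P₁ P₂)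
      (homFilt s₀ (P := P₁.toGrMod) (Q := P₂.toGrMod) ⊤ ⊥) :=
  isLatticeFiltration_ihom i₁ i₂ P₁ P₂ (U := fun _ => ⊤) (V := fun _ => ⊥) (β := id)
    antitone_const (fun _ => isGraded_top) (fun _ _ _ _ => Submodule.mem_top) monotone_const
    (fun _ => isGraded_bot) (fun _ w p hp => by
      rw [(Submodule.mem_bot K).1 hp, map_zero]; exact Submodule.zero_mem _) monotone_id

end filtered_gluing

section gluing_cycles

variable (r : GluingCycle K ι)

theorem IsLatticeFiltration.isGraded {s : LSet K ι} {M : PreMod s} {L : Type}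
    {F : (L → ℤ) → Submodule K M.toGrMod} (h : IsLatticeFiltration M F) (γ : L → ℤ) :
    IsGraded (F γ) := h.graded γ

theorem isPolymodule_tensor₁₂ {P₁ : PreMod r.s₁} {P₂ : PreMod r.s₂} (h₁ : IsPolymodule P₁)
    (h₂ : IsPolymodule P₂) : IsPolymodule (r.tensor₁₂ P₁ P₂) := .tensor _ _ h₁ h₂

theorem isPolymodule_hom₂₃ {P₂ : PreMod r.s₂} {P₃ : PreMod r.s₃} (h₂ : IsPolymodule P₂)
    (h₃ : IsPolymodule P₃) : IsPolymodule (r.hom₂₃ P₂ P₃) := .ihom _ _ h₂ h₃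

theorem isPolymodule_hom₁₃ {P₁ : PreMod r.s₁} {P₃ : PreMod r.s₃} (h₁ : IsPolymodule P₁)
    (h₃ : IsPolymodule P₃) : IsPolymodule (r.hom₁₃ P₁ P₃) := .ihom _ _ h₁ h₃

theorem isPolymodule_lhs {P₁ : PreMod r.s₁} {P₂ : PreMod r.s₂} {P₃ : PreMod r.s₃}
    (h₁ : IsPolymodule P₁) (h₂ : IsPolymodule P₂) (h₃ : IsPolymodule P₃) :
    IsPolymodule (r.lhs P₁ P₂ P₃) :=
  (IsPolymodule.ihom _ _ (isPolymodule_tensor₁₂ r h₁ h₂) h₃).pull _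

theorem isPolymodule_rhs {P₁ : PreMod r.s₁} {P₂ : PreMod r.s₂} {P₃ : PreMod r.s₃}
    (h₁ : IsPolymodule P₁) (h₂ : IsPolymodule P₂) (h₃ : IsPolymodule P₃) :
    IsPolymodule (r.rhs P₁ P₂ P₃) :=
  (IsPolymodule.ihom _ _ h₁ (isPolymodule_hom₂₃ r h₂ h₃)).pull _

theorem isPolymodule_rhs' {P₁ : PreMod r.s₁} {P₂ : PreMod r.s₂} {P₃ : PreMod r.s₃}
    (h₁ : IsPolymodule P₁) (h₂ : IsPolymodule P₂) (h₃ : IsPolymodule P₃) :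
    IsPolymodule (r.rhs' P₁ P₂ P₃) :=
  (IsPolymodule.ihom _ _ h₂ (isPolymodule_hom₁₃ r h₁ h₃)).pull _

theorem isLatticeFiltration_tensor₁₂ (P₁ : PreMod r.s₁) (P₂ : PreMod r.s₂) :
    IsLatticeFiltration (r.tensor₁₂ P₁ P₂) (tensFilt r.s₁₂ P₁.toGrMod P₂.toGrMod) :=
  isLatticeFiltration_tensor _ _ _ _

theorem isLatticeFiltration_hom₂₃ (P₂ : PreMod r.s₂) (P₃ : PreMod r.s₃) :
    IsLatticeFiltration (r.hom₂₃ P₂ P₃)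
      (homFilt r.s₂₃ (P := P₂.toGrMod) (Q := P₃.toGrMod) ⊤ ⊥) :=
  isLatticeFiltration_ihom_top_bot _ _ _ _

theorem isLatticeFiltration_hom₁₃ (P₁ : PreMod r.s₁) (P₃ : PreMod r.s₃) :
    IsLatticeFiltration (r.hom₁₃ P₁ P₃)
      (homFilt r.s₃₁.dual (P := P₁.toGrMod) (Q := P₃.toGrMod) ⊤ ⊥) :=
  isLatticeFiltration_ihom_top_bot _ _ _ _

theorem isLatticeFiltration_lhs (P₁ : PreMod r.s₁) (P₂ : PreMod r.s₂) (P₃ : PreMod r.s₃) :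
    IsLatticeFiltration (r.lhs P₁ P₂ P₃)
      (r.lhsFilt P₁.toGrMod P₂.toGrMod P₃.toGrMod) := by
  have h := isLatticeFiltration_tensor₁₂ r P₁ P₂
  refine IsLatticeFiltration.pull (isLatticeFiltration_ihom r.h₁₂ r.h₃ (r.tensor₁₂ P₁ P₂) P₃
    (U := fun γ => tensFilt r.s₁₂ P₁.toGrMod P₂.toGrMod fun x => -γ (Sum.inl (Sum.inl x)))
    (V := fun _ => ⊥)
    (β := fun γ => Sum.elim (fun x => γ (Sum.inr x)) fun x => γ (Sum.inl (Sum.inr x)))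
    (fun γ γ' hγ => tensFilt_mono fun x => neg_le_neg (hγ _)) (fun γ => isGraded_tensFilt _)
    (fun γ => h.stable _) (fun _ _ _ => le_rfl) (fun _ => isGraded_bot) ?_ ?_) _
  · rintro γ w p hp
    rw [(Submodule.mem_bot K).1 hp, map_zero]
    exact Submodule.zero_mem _
  · rintro γ γ' hγ (x | x)
    exacts [hγ _, hγ _]

theorem isLatticeFiltration_rhs (P₁ : PreMod r.s₁) (P₂ : PreMod r.s₂) (P₃ : PreMod r.s₃) :
    IsLatticeFiltration (r.rhs P₁ P₂ P₃)
      (r.rhsFilt P₁.toGrMod P₂.toGrMod P₃.toGrMod) := by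
  have h := isLatticeFiltration_hom₂₃ r P₂ P₃
  refine IsLatticeFiltration.pull (isLatticeFiltration_ihom r.k₁ r.k₂₃ P₁ (r.hom₂₃ P₂ P₃)
    (U := fun _ => ⊤)
    (V := fun γ => homFilt r.s₂₃ (P := P₂.toGrMod) (Q := P₃.toGrMod) ⊤ ⊥
      fun x => γ (Sum.inl (Sum.inr x)))
    (β := fun γ => Sum.elim (fun x => γ (Sum.inr x)) fun x => γ (Sum.inl (Sum.inl x)))
    (fun _ _ _ => le_rfl) (fun _ => isGraded_top) (fun _ _ _ _ => Submodule.mem_top)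
    (fun γ γ' hγ => h.mono fun x => hγ _) (fun γ => h.isGraded _) (fun γ => h.stable _) ?_) _
  rintro γ γ' hγ (x | x)
  exacts [hγ _, hγ _]

theorem isLatticeFiltration_rhs' (P₁ : PreMod r.s₁) (P₂ : PreMod r.s₂) (P₃ : PreMod r.s₃) :
    IsLatticeFiltration (r.rhs' P₁ P₂ P₃)
      (r.rhsFilt' P₁.toGrMod P₂.toGrMod P₃.toGrMod) := by
  have h := isLatticeFiltration_hom₁₃ r P₁ P₃
  refine IsLatticeFiltration.pull (isLatticeFiltration_ihom r.l₂ r.l₁₃ P₂ (r.hom₁₃ P₁ P₃)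
    (U := fun _ => ⊤)
    (V := fun γ => homFilt r.s₃₁.dual (P := P₁.toGrMod) (Q := P₃.toGrMod) ⊤ ⊥
      fun x => γ (Sum.inr x))
    (β := fun γ => Sum.elim (fun x => γ (Sum.inl (Sum.inl x))) fun x => γ (Sum.inl (Sum.inr x)))
    (fun _ _ _ => le_rfl) (fun _ => isGraded_top) (fun _ _ _ _ => Submodule.mem_top)
    (fun γ γ' hγ => h.mono fun x => hγ _) (fun γ => h.isGraded _) (fun γ => h.stable _) ?_) _
  rintro γ γ' hγ (x | x)
  exacts [hγ _, hγ _]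

end gluing_cycles

section currying

variable {s t u a b c : LSet K ι} {V P P₁ P₂ P₃ Q R : GrMod K ι} {k : ι}

theorem SameDeg.pd {w w' : Word s} (h : SameDeg w w') : pd w = pd w' := by
  rw [← par_deg, ← par_deg, h.deg]

theorem multilin_zs {M : Type*} [AddCommGroup M] [Module K M] {f : Word s → M}
    (hf : Multilin (K := K) f) (e : Word s → ZMod 2)
    (he : ∀ w w', SameDeg w w' → e w = e w') : Multilin (K := K) fun w => zs (e w) • f w := by
  refine Multilin.diag (fun c w => zs (e c) • f w) (fun c => ?_) fun c c' h => by rw [he c c' h]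
  rcases Int.units_eq_one_or (zs (e c)) with h | h <;> rw [h]
  · simpa using hf
  · simpa using hf.map (-LinearMap.id)

theorem Multilin.of_pair {M : Type*} [AddCommGroup M] [Module K M] {f : Word s → Word t → M}
    (h₁ : ∀ w, Multilin (K := K) fun v => f v w) (h₂ : ∀ v, Multilin (K := K) (f v)) :
    Multilin (K := K) fun w : Word (s.sum t) => f (fstW w) (sndW w) := by
  refine multilin_of_line fun x i W hW => ?_
  rcases isLine_sum hW with ⟨h, c, hc⟩ | ⟨h, c, hc⟩
  · simp only [hc]; exact (h₁ c).line h
  · simp only [hc]; exact (h₂ c).line h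

theorem nrm_nrm (f : Word s → P →ₗ[K] Q) : nrm (nrm f) = f := by
  funext w
  refine GrMod.hom_ext fun i p hp => ?_
  rw [nrm_apply _ _ hp, nrm_apply _ _ hp, zs_smul_self]

theorem nrm_mem_homPiece {f : Word s → P →ₗ[K] Q} (hf : f ∈ homPiece s P Q k) :
    nrm f ∈ homPiece s P Q k := ⟨hf.1.nrm, hf.2.nrm⟩

/-- `hv` as a linear map. -/
def hvMap : PHom s P Q →ₗ[K] (Word s → P →ₗ[K] Q) := LinearMap.pi hvL

theorem hvMap_apply (φ : PHom s P Q) (w : Word s) : hvMap φ w = hv φ w := rfl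

theorem hvMap_injective : Function.Injective (hvMap : PHom s P Q →ₗ[K] _) := fun _ _ h =>
  hv_ext fun w _ p _ => LinearMap.congr_fun (congrFun h w) p

theorem hv_mem_homPiece {d : ι} {φ : PHom s P Q} (hφ : φ ∈ (PHom s P Q).piece d) :
    hv φ ∈ homPiece s P Q d := nrm_mem_homPiece (PHom.val_mem hφ)

/-- The homogeneous element of `PHom s P Q` with given normalized values. -/
def mkHom (F : Word s → P →ₗ[K] Q) (hF : F ∈ homPiece s P Q k) : PHom s P Q :=
  ⟨nrm F, le_iSup (homPiece s P Q) k (nrm_mem_homPiece hF)⟩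

theorem hv_mkHom {F : Word s → P →ₗ[K] Q} (hF : F ∈ homPiece s P Q k) : hv (mkHom F hF) = F :=
  nrm_nrm F

theorem mkHom_mem {F : Word s → P →ₗ[K] Q} (hF : F ∈ homPiece s P Q k) :
    mkHom F hF ∈ (PHom s P Q).piece k := nrm_mem_homPiece hF

theorem mem_range_hvMap_of_mem {F : Word s → P →ₗ[K] Q} (hF : F ∈ homPiece s P Q k) :
    F ∈ LinearMap.range (hvMap : PHom s P Q →ₗ[K] _) :=
  ⟨mkHom F hF, hv_mkHom hF⟩

theorem mem_piece_of_hv {F : PHom s P Q} (h : hv F ∈ homPiece s P Q k) :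
    F ∈ (PHom s P Q).piece k := by
  rw [show F = mkHom _ h from hvMap_injective (hv_mkHom h).symm]
  exact mkHom_mem h

/-- A linear map with values in maps of words that can be lifted to `PHom`. -/
def liftHv {V : Type*} [AddCommGroup V] [Module K V] (L : V →ₗ[K] (Word s → P →ₗ[K] Q))
    (h : ∀ v, L v ∈ LinearMap.range (hvMap : PHom s P Q →ₗ[K] _)) : V →ₗ[K] PHom s P Q :=
  (LinearEquiv.ofInjective hvMap hvMap_injective).symm.toLinearMap ∘ₗ L.codRestrict _ h

theorem hv_liftHv {V : Type*} [AddCommGroup V] [Module K V]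
    (L : V →ₗ[K] (Word s → P →ₗ[K] Q))
    (h : ∀ v, L v ∈ LinearMap.range (hvMap : PHom s P Q →ₗ[K] _)) (v : V) :
    hv (liftHv L h v) = L v :=
  congrArg Subtype.val
    ((LinearEquiv.ofInjective hvMap hvMap_injective).apply_symm_apply (L.codRestrict _ h v))

/-- A family of trilinear maps which is suitable to define a map into a twofold internal Hom. -/
structure Curryable (C : Word s → Word t → V →ₗ[K] P →ₗ[K] Q →ₗ[K] R) : Prop where
  left : ∀ y d, ∀ φ ∈ V.piece d, Multilin (K := K) fun w => C w y φ
  right : ∀ w d, ∀ φ ∈ V.piece d, Multilin (K := K) fun y => C w y φ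
  mem : ∀ w y d, ∀ φ ∈ V.piece d, ∀ i, ∀ p ∈ P.piece i, ∀ j, ∀ q ∈ Q.piece j,
    C w y φ p q ∈ R.piece (j + deg y + (i + deg w + d))

namespace Curryable

variable {C : Word s → Word t → V →ₗ[K] P →ₗ[K] Q →ₗ[K] R} (hC : Curryable C)

theorem inner_mem (hC : Curryable C) {w : Word s} {d : ι} {φ : V} (hφ : φ ∈ V.piece d) {i : ι}
    {p : P} (hp : p ∈ P.piece i) : (fun y => C w y φ p) ∈ homPiece t Q R (i + deg w + d) :=
  ⟨(hC.right w d φ hφ).map (LinearMap.applyₗ p), fun y j q hq => hC.mem w y d φ hφ i p hp j q hq⟩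

/-- The inner maps of a curried family. -/
def inner (hC : Curryable C) (w : Word s) (φ : V) : P →ₗ[K] PHom t Q R :=
  liftHv (LinearMap.pi fun y => C w y φ) fun p => by
    refine P.le_of_pieces (LinearMap.pi fun y => C w y φ) _ (fun i p hp => ?_) p
    refine V.le_of_pieces (LinearMap.pi fun y => (C w y).flip p) _ (fun d φ hφ => ?_) φ
    exact mem_range_hvMap_of_mem (hC.inner_mem hφ hp)

theorem hv_inner (w : Word s) (φ : V) (p : P) (y : Word t) :
    hv (hC.inner w φ p) y = C w y φ p := congrFun (hv_liftHv _ _ p) y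

theorem outer_mem {d : ι} {φ : V} (hφ : φ ∈ V.piece d) :
    (fun w => hC.inner w φ) ∈ homPiece s P (PHom t Q R) d := by
  refine ⟨multilin_lin fun p => Multilin.of_injective hvMap hvMap_injective ?_, ?_⟩
  · refine multilin_pi fun y => ?_
    have e : (fun w => hvMap (hC.inner w φ p) y) = fun w => C w y φ p :=
      funext fun w => hC.hv_inner w φ p y
    rw [e]
    exact (hC.left y d φ hφ).map (LinearMap.applyₗ p)
  · intro w i p hp
    refine mem_piece_of_hv ?_
    have e : hv (hC.inner w φ p) = fun y => C w y φ p := funext fun y => hC.hv_inner w φ p y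
    rw [e]
    exact hC.inner_mem hφ hp

/-- The map into a twofold internal Hom given by a family of trilinear maps. -/
def curry : V →ₗ[K] PHom s P (PHom t Q R) :=
  liftHv (V := V)
    { toFun := fun φ w => hC.inner w φ
      map_add' := fun φ ψ => funext fun w => LinearMap.ext fun p => hvMap_injective <|
        funext fun y => by
          change _ = hvMap (hC.inner w φ p + hC.inner w ψ p) y
          rw [map_add hvMap, Pi.add_apply]
          simp only [hvMap_apply, hv_inner, map_add, LinearMap.add_apply]
      map_smul' := fun r φ => funext fun w => LinearMap.ext fun p => hvMap_injective <|
        funext fun y => by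
          change _ = hvMap (r • hC.inner w φ p) y
          rw [map_smul hvMap, Pi.smul_apply]
          simp only [hvMap_apply, hv_inner, map_smul, LinearMap.smul_apply] }
    fun φ => V.le_of_pieces (LinearMap.mk _ _) _
      (fun d φ hφ => mem_range_hvMap_of_mem (hC.outer_mem hφ)) φ

theorem hv_curry (φ : V) (w : Word s) (p : P) (y : Word t) :
    hv (hv (hC.curry φ) w p) y = C w y φ p :=
  (congrArg (fun f => hv f y) (LinearMap.congr_fun (congrFun (hv_liftHv _ _ φ) w) p)).trans
    (hC.hv_inner w φ p y)

theorem curry_mem {d : ι} {φ : V} (hφ : φ ∈ V.piece d) :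
    hC.curry φ ∈ (PHom s P (PHom t Q R)).piece d :=
  mem_piece_of_hv (by
    have e : hv (hC.curry φ) = fun w => hC.inner w φ := hv_liftHv _ _ φ
    rw [e]
    exact hC.outer_mem hφ)

end Curryable

theorem exists_hv_tm (D : Word t → Word s → P →ₗ[K] Q →ₗ[K] R)
    (hD : ∀ v, Multilin (K := K) (D v)) (hD' : ∀ g, Multilin (K := K) fun v => D v g)
    (hdeg : ∀ v g i j, ∀ p ∈ P.piece i, ∀ q ∈ Q.piece j,
      D v g p q ∈ R.piece (i + deg g + j + deg v + k)) :
    ∃ φ ∈ (PHom t (tens s P Q) R).piece k, ∀ v p g q, hv φ v (tm p g q) = D v g p q := by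
  have h1 : ∀ v, Multilin (K := K) fun g => zs (ninv g) • D v g := fun v =>
    multilin_zs (hD v) _ fun w w' h => h.ninv
  have h2 : (fun v => tensLift (fun g => zs (ninv g) • D v g) (h1 v)) ∈
      homPiece t (tens s P Q) R k := by
    refine tensLift_mem (fun v g => zs (ninv g) • D v g) h1 (fun g => ?_) fun v g i j p hp q hq => ?_
    · exact multilin_zs (hD' g) (fun _ => ninv g) fun _ _ _ => rfl
    · rw [LinearMap.smul_apply, LinearMap.smul_apply]
      exact zs_smul_mem _ _ (hdeg v g i j p hp q hq)
  refine ⟨mkHom _ h2, mkHom_mem h2, fun v p g q => ?_⟩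
  rw [hv_mkHom, tm, map_zs_smul, tensLift_tmk, LinearMap.smul_apply, LinearMap.smul_apply,
    zs_smul_self]

end currying

section hom_tensor

variable {a b c : LSet K ι} {P P₁ P₂ P₃ Q : GrMod K ι} {k : ι}

/-- A bilinear map with its arguments exchanged, with the Koszul sign. -/
def braid {M : Type*} [AddCommGroup M] [Module K M] (B : P →ₗ[K] Q →ₗ[K] M) : Q →ₗ[K] P →ₗ[K] M :=
  Q.elim fun j => LinearMap.lcomp K M (P.twist j) ∘ₗ B.flip

theorem braid_apply {M : Type*} [AddCommGroup M] [Module K M] (B : P →ₗ[K] Q →ₗ[K] M) {i j : ι}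
    {p : P} {q : Q} (hp : p ∈ P.piece i) (hq : q ∈ Q.piece j) :
    braid B q p = zs (par i * par j) • B p q := by
  rw [braid, Q.elim_of_mem _ hq, LinearMap.comp_apply, LinearMap.lcomp_apply, LinearMap.flip_apply,
    P.twist_zs _ hp, map_zs_smul, LinearMap.smul_apply, mul_comm]

theorem multilin_hv' {s : LSet K ι} {d : ι} {φ : PHom s P Q} (hφ : φ ∈ (PHom s P Q).piece d) :
    Multilin (K := K) (hv φ) := (hv_mem_homPiece hφ).1

/-- The normalized values of the image of `φ` in `Hom(P₁, Hom(P₂, P₃))`. -/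
def phiFam (a b c : LSet K ι) (P₁ P₂ P₃ : GrMod K ι) (w : Word (a.sum c.dual)) (y : Word b) :
    PHom (a.sum b) (tens c P₁ P₂) P₃ →ₗ[K] P₁ →ₗ[K] P₂ →ₗ[K] P₃ :=
  zs (pd y * pd (sndW w)) • ((LinearMap.llcomp K P₂ (tens c P₁ P₂) P₃).compl₂
    (tmB (ofDual (sndW w)) ∘ₗ P₁.twist (deg y + deg (sndW w)))) ∘ₗ hvL (pair (fstW w) y)

theorem phiFam_apply (w : Word (a.sum c.dual)) (y : Word b)
    (φ : PHom (a.sum b) (tens c P₁ P₂) P₃) {i : ι} {p : P₁} (hp : p ∈ P₁.piece i) (q : P₂) :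
    phiFam a b c P₁ P₂ P₃ w y φ p q = zs (pd y * (par i + pd (sndW w)) + pd (sndW w) * par i) •
      hv φ (pair (fstW w) y) (tm p (ofDual (sndW w)) q) := by
  change zs (pd y * pd (sndW w)) • hv φ (pair (fstW w) y)
    (tmB (ofDual (sndW w)) (P₁.twist (deg y + deg (sndW w)) p) q) = _
  rw [P₁.twist_zs _ hp, map_zs_smul, LinearMap.smul_apply, tmB_apply, map_zs_smul,
    zs_smul_zs_smul, map_add, par_deg, par_deg]
  congr 2
  ring

theorem curryable_phiFam : Curryable (phiFam a b c P₁ P₂ P₃) where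
  left y d φ hφ := by
    refine multilin_of_pieces fun i p hp => multilin_lin fun q => ?_
    simp only [phiFam_apply _ _ _ hp]
    refine multilin_zs (Multilin.of_pair (s := a) (t := c.dual)
      (f := fun x g => hv φ (pair x y) (tm p (ofDual g) q)) (fun g => ?_) fun x => ?_) _
      fun w w' h => ?_
    · exact ((multilin_hv' hφ).pair_left y).map (LinearMap.applyₗ (tm p (ofDual g) q))
    · exact (multilin_tm (s := c) p q).map (hv φ (pair x y))
    · have : pd (sndW w) = pd (sndW w') := SameDeg.pd fun x => h (Sum.inr x)
      rw [this]
  right w d φ hφ := by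
    refine multilin_of_pieces fun i p hp => multilin_lin fun q => ?_
    simp only [phiFam_apply _ _ _ hp]
    refine multilin_zs (((multilin_hv' hφ).pair_right (fstW w)).map
      (LinearMap.applyₗ (tm p (ofDual (sndW w)) q))) _ fun y y' h => ?_
    rw [h.pd]
  mem w y d φ hφ i p hp j q hq := by
    rw [phiFam_apply _ _ _ hp]
    refine zs_smul_mem _ _ ?_
    have := hv_mem hφ (pair (fstW w) y) (tm_mem hp hq (g := ofDual (sndW w)))
    rw [deg_pair] at this
    rw [deg_eq w]
    convert this using 2
    change _ = i + deg (sndW w) + j + (deg (fstW w) + deg y) + d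
    ring

/-- The map `Hom(P₁ ⊗ P₂, P₃) → Hom(P₁, Hom(P₂, P₃))`. -/
def phi (a b c : LSet K ι) (P₁ P₂ P₃ : GrMod K ι) : PHom (a.sum b) (tens c P₁ P₂) P₃ →ₗ[K]
    PHom (a.sum c.dual) P₁ (PHom b P₂ P₃) := (curryable_phiFam (a := a) (b := b) (c := c)).curry

theorem hv_phi (φ : PHom (a.sum b) (tens c P₁ P₂) P₃) (x : Word a) (g : Word c) (y : Word b)
    {i : ι} {p : P₁} (hp : p ∈ P₁.piece i) (q : P₂) :
    hv (hv (phi a b c P₁ P₂ P₃ φ) (pair x (toDual g)) p) y q =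
      zs (pd y * (par i + pd g) + pd g * par i) • hv φ (pair x y) (tm p g q) :=
  (LinearMap.congr_fun (curryable_phiFam.hv_curry φ (pair x (toDual g)) p y) q).trans
    (phiFam_apply _ _ _ hp q)

theorem phi_mem {d : ι} {φ : PHom (a.sum b) (tens c P₁ P₂) P₃} (hφ : φ ∈ (PHom _ _ _).piece d) :
    phi a b c P₁ P₂ P₃ φ ∈ (PHom (a.sum c.dual) P₁ (PHom b P₂ P₃)).piece d :=
  curryable_phiFam.curry_mem hφ

/-- The normalized values of the image of `φ` in `Hom(P₂, Hom(P₁, P₃))`. -/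
def psiFam (a b c : LSet K ι) (P₁ P₂ P₃ : GrMod K ι) (w : Word (c.sum b)) (x : Word a) :
    PHom (a.sum b) (tens c P₁ P₂) P₃ →ₗ[K] P₂ →ₗ[K] P₁ →ₗ[K] P₃ :=
  zs (pd x * (pd (fstW w) + pd (sndW w)) + pd (fstW w) * pd (sndW w)) •
    ((LinearMap.llcomp K P₁ (tens c P₁ P₂) P₃).compl₂ (LinearMap.lcomp K _ (P₁.twist (deg (fstW w)))
      ∘ₗ braid (tmB (fstW w)) ∘ₗ P₂.twist (deg x))) ∘ₗ hvL (pair x (sndW w))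

theorem psiFam_apply (w : Word (c.sum b)) (x : Word a)
    (φ : PHom (a.sum b) (tens c P₁ P₂) P₃) {i j : ι} {p : P₁} (hp : p ∈ P₁.piece i) {q : P₂}
    (hq : q ∈ P₂.piece j) :
    psiFam a b c P₁ P₂ P₃ w x φ q p = zs (pd x * (pd (fstW w) + pd (sndW w) + par j) +
      pd (fstW w) * pd (sndW w) + par i * (pd (fstW w) + par j)) •
      hv φ (pair x (sndW w)) (tm p (fstW w) q) := by
  change zs (pd x * (pd (fstW w) + pd (sndW w)) + pd (fstW w) * pd (sndW w)) •
    hv φ (pair x (sndW w)) (braid (tmB (fstW w)) (P₂.twist (deg x) q)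
      (P₁.twist (deg (fstW w)) p)) = _
  rw [P₁.twist_zs _ hp, P₂.twist_zs _ hq, map_zs_smul (braid (tmB (fstW w))),
    LinearMap.smul_apply, map_zs_smul (braid (tmB (fstW w)) q),
    braid_apply _ hp hq, tmB_apply, map_zs_smul, map_zs_smul, map_zs_smul, zs_smul_zs_smul,
    zs_smul_zs_smul, zs_smul_zs_smul, par_deg, par_deg]
  congr 2
  ring

theorem curryable_psiFam : Curryable (psiFam a b c P₁ P₂ P₃) where
  left x d φ hφ := by
    refine multilin_of_pieces fun j q hq => multilin_of_pieces fun i p hp => ?_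
    simp only [psiFam_apply _ _ _ hp hq]
    refine multilin_zs (Multilin.of_pair (s := c) (t := b)
      (f := fun g y => hv φ (pair x y) (tm p g q)) (fun y => ?_) fun g => ?_) _
      fun w w' h => ?_
    · exact (multilin_tm (s := c) p q).map (hv φ (pair x y))
    · exact ((multilin_hv' hφ).pair_right x).map (LinearMap.applyₗ (tm p g q))
    · have h1 : pd (sndW w) = pd (sndW w') := SameDeg.pd fun x => h (Sum.inr x)
      have h2 : pd (fstW w) = pd (fstW w') := SameDeg.pd fun x => h (Sum.inl x)
      rw [h1, h2]
  right w d φ hφ := by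
    refine multilin_of_pieces fun j q hq => multilin_of_pieces fun i p hp => ?_
    simp only [psiFam_apply _ _ _ hp hq]
    refine multilin_zs (((multilin_hv' hφ).pair_left (sndW w)).map
      (LinearMap.applyₗ (tm p (fstW w) q))) _ fun y y' h => ?_
    rw [h.pd]
  mem w x d φ hφ j q hq i p hp := by
    rw [psiFam_apply _ _ _ hp hq]
    refine zs_smul_mem _ _ ?_
    have := hv_mem hφ (pair x (sndW w)) (tm_mem hp hq (g := fstW w))
    rw [deg_pair] at this
    rw [deg_eq w]
    convert this using 2
    ring

/-- The map `Hom(P₁ ⊗ P₂, P₃) → Hom(P₂, Hom(P₁, P₃))`. -/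
def psi (a b c : LSet K ι) (P₁ P₂ P₃ : GrMod K ι) : PHom (a.sum b) (tens c P₁ P₂) P₃ →ₗ[K]
    PHom (c.sum b) P₂ (PHom a P₁ P₃) := (curryable_psiFam (a := a) (b := b) (c := c)).curry

theorem hv_psi (φ : PHom (a.sum b) (tens c P₁ P₂) P₃) (x : Word a) (g : Word c) (y : Word b)
    {i j : ι} {p : P₁} (hp : p ∈ P₁.piece i) {q : P₂} (hq : q ∈ P₂.piece j) :
    hv (hv (psi a b c P₁ P₂ P₃ φ) (pair g y) q) x p =
      zs (pd x * (pd g + pd y + par j) + pd g * pd y + par i * (pd g + par j)) •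
        hv φ (pair x y) (tm p g q) :=
  (LinearMap.congr_fun (curryable_psiFam.hv_curry φ (pair g y) q x) p).trans
    (psiFam_apply _ _ _ hp hq)

theorem psi_mem {d : ι} {φ : PHom (a.sum b) (tens c P₁ P₂) P₃} (hφ : φ ∈ (PHom _ _ _).piece d) :
    psi a b c P₁ P₂ P₃ φ ∈ (PHom (c.sum b) P₂ (PHom a P₁ P₃)).piece d :=
  curryable_psiFam.curry_mem hφ

theorem pHom_tens_ext {s : LSet K ι} {φ ψ : PHom s (tens c P₁ P₂) P₃}
    (h : ∀ v i j, ∀ p ∈ P₁.piece i, ∀ q ∈ P₂.piece j, ∀ g,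
      hv φ v (tm p g q) = hv ψ v (tm p g q)) : φ = ψ :=
  hvMap_injective <| funext fun v => tens_hom_ext fun i j p hp g q hq => h v i j p hp q hq g

theorem phi_injective : Function.Injective (phi a b c P₁ P₂ P₃) := fun φ ψ h =>
  pHom_tens_ext fun v i j p hp q hq g => by
    have := congrArg (fun χ => hv (hv χ (pair (fstW v) (toDual g)) p) (sndW v) q) h
    beta_reduce at this
    rw [hv_phi _ _ _ _ hp, hv_phi _ _ _ _ hp, pair_fst_snd] at this
    exact zs_smul_injective _ this

theorem psi_injective : Function.Injective (psi a b c P₁ P₂ P₃) := fun φ ψ h =>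
  pHom_tens_ext fun v i j p hp q hq g => by
    have := congrArg (fun χ => hv (hv χ (pair g (sndW v)) q) (fstW v) p) h
    beta_reduce at this
    rw [hv_psi _ _ _ _ hp hq, hv_psi _ _ _ _ hp hq, pair_fst_snd] at this
    exact zs_smul_injective _ this

theorem exists_phi_eq {d : ι} {χ : PHom (a.sum c.dual) P₁ (PHom b P₂ P₃)}
    (hχ : χ ∈ (PHom _ _ _).piece d) :
    ∃ φ ∈ (PHom (a.sum b) (tens c P₁ P₂) P₃).piece d, phi a b c P₁ P₂ P₃ φ = χ := by
  let D : Word (a.sum b) → Word c → P₁ →ₗ[K] P₂ →ₗ[K] P₃ := fun v g =>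
    zs (pd (sndW v) * pd g) • (hvL (sndW v) ∘ₗ hv χ (pair (fstW v) (toDual g)) ∘ₗ
      P₁.twist (deg (sndW v) + deg g))
  have hD : ∀ v g i, ∀ p ∈ P₁.piece i, ∀ q, D v g p q =
      zs (pd (sndW v) * (par i + pd g) + pd g * par i) •
        hv (hv χ (pair (fstW v) (toDual g)) p) (sndW v) q := by
    intro v g i p hp q
    change zs (pd (sndW v) * pd g) • hv (hv χ (pair (fstW v) (toDual g))
      (P₁.twist (deg (sndW v) + deg g) p)) (sndW v) q = _
    rw [P₁.twist_zs _ hp, map_zs_smul, hv_zs_smul, LinearMap.smul_apply, zs_smul_zs_smul, map_add,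
      par_deg, par_deg]
    congr 2
    ring
  have h₁ : ∀ v, Multilin (K := K) (D v) := fun v => by
    refine multilin_of_pieces fun i p hp => multilin_lin fun q => ?_
    simp only [hD _ _ _ _ hp]
    refine multilin_zs (Multilin.map (f := fun g => hv χ (pair (fstW v) (toDual g)) p)
      ?_ (LinearMap.applyₗ q ∘ₗ hvL (sndW v))) _ fun g g' h => by rw [h.pd]
    exact Multilin.toDual (s := c) (f := fun g => hv χ (pair (fstW v) g) p)
      (((multilin_hv' hχ).pair_right (fstW v)).map (LinearMap.applyₗ p))
  have h₂ : ∀ g, Multilin (K := K) fun v => D v g := fun g => by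
    refine multilin_of_pieces fun i p hp => multilin_of_pieces fun j q hq => ?_
    simp only [hD _ _ _ _ hp]
    refine multilin_zs (Multilin.of_pair (s := a) (t := b)
      (f := fun x y => hv (hv χ (pair x (toDual g)) p) y q) (fun y => ?_) fun x => ?_) _
      fun w w' h => ?_
    · exact (((multilin_hv' hχ).pair_left (toDual g)).map (LinearMap.applyₗ p)).map
        (LinearMap.applyₗ q ∘ₗ hvL y)
    · exact (multilin_hv' (hv_mem hχ (pair x (toDual g)) hp)).map (LinearMap.applyₗ q)
    · have : pd (sndW w) = pd (sndW w') := SameDeg.pd fun x => h (Sum.inr x)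
      rw [this]
  have h₃ : ∀ v g i j, ∀ p ∈ P₁.piece i, ∀ q ∈ P₂.piece j,
      D v g p q ∈ P₃.piece (i + deg g + j + deg v + d) := by
    intro v g i j p hp q hq
    rw [hD _ _ _ _ hp]
    refine zs_smul_mem _ _ ?_
    have := hv_mem (hv_mem hχ (pair (fstW v) (toDual g)) hp) (sndW v) hq
    rw [deg_pair, deg_toDual] at this
    rw [deg_eq v]
    convert this using 2
    ring
  obtain ⟨φ, hφ, h⟩ := exists_hv_tm D h₁ h₂ h₃
  refine ⟨φ, hφ, hv_ext fun w i p hp => hv_ext fun y j q hq => ?_⟩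
  obtain ⟨x, g, rfl⟩ : ∃ x g, w = pair x (toDual g) := ⟨fstW w, ofDual (sndW w),
    (pair_fst_snd w).symm⟩
  rw [hv_phi _ _ _ _ hp, h, hD _ _ _ _ hp]
  change zs _ • zs (pd y * (par i + pd g) + pd g * par i) • _ = _
  rw [zs_smul_self]
  rfl

theorem exists_psi_eq {d : ι} {χ : PHom (c.sum b) P₂ (PHom a P₁ P₃)}
    (hχ : χ ∈ (PHom _ _ _).piece d) :
    ∃ φ ∈ (PHom (a.sum b) (tens c P₁ P₂) P₃).piece d, psi a b c P₁ P₂ P₃ φ = χ := by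
  let D : Word (a.sum b) → Word c → P₁ →ₗ[K] P₂ →ₗ[K] P₃ := fun v g =>
    zs (pd (fstW v) * (pd g + pd (sndW v)) + pd g * pd (sndW v)) •
      (braid (hvL (fstW v) ∘ₗ hv χ (pair g (sndW v)) ∘ₗ P₂.twist (deg (fstW v))) ∘ₗ
        P₁.twist (deg g))
  have hD : ∀ v g i j, ∀ p ∈ P₁.piece i, ∀ q ∈ P₂.piece j, D v g p q =
      zs (pd (fstW v) * (pd g + pd (sndW v) + par j) + pd g * pd (sndW v) +
        par i * (pd g + par j)) • hv (hv χ (pair g (sndW v)) q) (fstW v) p := by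
    intro v g i j p hp q hq
    change zs (pd (fstW v) * (pd g + pd (sndW v)) + pd g * pd (sndW v)) •
      braid (hvL (fstW v) ∘ₗ hv χ (pair g (sndW v)) ∘ₗ P₂.twist (deg (fstW v)))
        (P₁.twist (deg g) p) q = _
    rw [P₁.twist_zs _ hp, map_zs_smul, LinearMap.smul_apply, braid_apply _ hq hp,
      LinearMap.comp_apply, LinearMap.comp_apply, P₂.twist_zs _ hq, map_zs_smul, map_zs_smul,
      LinearMap.smul_apply, hvL_apply, zs_smul_zs_smul, zs_smul_zs_smul, zs_smul_zs_smul, par_deg,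
      par_deg]
    congr 2
    ring
  have h₁ : ∀ v, Multilin (K := K) (D v) := fun v => by
    refine multilin_of_pieces fun i p hp => multilin_of_pieces fun j q hq => ?_
    simp only [hD _ _ _ _ _ hp _ hq]
    refine multilin_zs (Multilin.map (f := fun g => hv χ (pair g (sndW v)) q)
      ?_ (LinearMap.applyₗ p ∘ₗ hvL (fstW v))) _ fun g g' h => by rw [h.pd]
    exact ((multilin_hv' hχ).pair_left (sndW v)).map (LinearMap.applyₗ q)
  have h₂ : ∀ g, Multilin (K := K) fun v => D v g := fun g => by
    refine multilin_of_pieces fun i p hp => multilin_of_pieces fun j q hq => ?_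
    simp only [hD _ _ _ _ _ hp _ hq]
    refine multilin_zs (Multilin.of_pair (s := a) (t := b)
      (f := fun x y => hv (hv χ (pair g y) q) x p) (fun y => ?_) fun x => ?_) _
      fun w w' h => ?_
    · exact (multilin_hv' (hv_mem hχ (pair g y) hq)).map (LinearMap.applyₗ p)
    · exact (((multilin_hv' hχ).pair_right g).map (LinearMap.applyₗ q)).map
        (LinearMap.applyₗ p ∘ₗ hvL x)
    · have h1 : pd (sndW w) = pd (sndW w') := SameDeg.pd fun x => h (Sum.inr x)
      have h2 : pd (fstW w) = pd (fstW w') := SameDeg.pd fun x => h (Sum.inl x)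
      rw [h1, h2]
  have h₃ : ∀ v g i j, ∀ p ∈ P₁.piece i, ∀ q ∈ P₂.piece j,
      D v g p q ∈ P₃.piece (i + deg g + j + deg v + d) := by
    intro v g i j p hp q hq
    rw [hD _ _ _ _ _ hp _ hq]
    refine zs_smul_mem _ _ ?_
    have := hv_mem (hv_mem hχ (pair g (sndW v)) hq) (fstW v) hp
    rw [deg_pair] at this
    rw [deg_eq v]
    convert this using 2
    ring
  obtain ⟨φ, hφ, h⟩ := exists_hv_tm D h₁ h₂ h₃
  refine ⟨φ, hφ, hv_ext fun w j q hq => hv_ext fun x i p hp => ?_⟩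
  obtain ⟨g, y, rfl⟩ : ∃ g y, w = pair g y := ⟨fstW w, sndW w, (pair_fst_snd w).symm⟩
  rw [hv_psi _ _ _ _ hp hq, h, hD _ _ _ _ _ hp _ hq]
  change zs _ • zs (pd x * (pd g + pd y + par j) + pd g * pd y + par i * (pd g + par j)) • _ = _
  rw [zs_smul_self]
  rfl

end hom_tensor

section filtered_hom_tensor

variable {a b c : LSet K ι} {P₁ P₂ P₃ : GrMod K ι}

theorem phi_mem_homFilt_iff {α : a.I → ℤ} {β : b.I → ℤ} {γ : c.I → ℤ}
    {φ : PHom (a.sum b) (tens c P₁ P₂) P₃} :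
    phi a b c P₁ P₂ P₃ φ ∈
        homFilt (a.sum c.dual) ⊤ (homFilt b (P := P₂) (Q := P₃) ⊤ ⊥ β) (Sum.elim α γ) ↔
      φ ∈ homFilt (a.sum b) (tensFilt c P₁ P₂ fun x => -γ x) ⊥ (Sum.elim α β) := by
  constructor
  · intro h
    refine (mem_homFilt_iff (isGraded_tensFilt _)).2 fun v hv' => ?_
    refine tensFilt_le (N := (⊥ : Submodule K P₃).comap (hv φ v)) fun i j p hp g hg q hq => ?_
    have h1 := (mem_homFilt_iff isGraded_top).1 h (pair (fstW v) (toDual g)) ?_ p Submodule.mem_top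
    · have h2 := (mem_homFilt_iff isGraded_top).1 h1 (sndW v) (fun x => hv' (Sum.inr x)) q
        Submodule.mem_top
      rw [hv_phi _ _ _ _ hp, pair_fst_snd] at h2
      exact (zs_smul_mem_iff (⊥ : Submodule K P₃) _).1 h2
    · rintro (x | x)
      exacts [hv' (Sum.inl x), hg x]
  · intro h
    refine mem_homFilt_of_pieces isGraded_top fun w hw i p hp _ =>
      mem_homFilt_of_pieces isGraded_top fun y hy j q hq _ => ?_
    obtain ⟨x, g, rfl⟩ : ∃ x g, w = pair x (toDual g) := ⟨fstW w, ofDual (sndW w),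
      (pair_fst_snd w).symm⟩
    rw [hv_phi _ _ _ _ hp]
    refine zs_smul_mem _ _ ((mem_homFilt_iff (isGraded_tensFilt _)).1 h (pair x y) ?_ _
      (tm_mem_tensFilt (s := c) (g := g) (fun z => hw (Sum.inr z)) p q))
    rintro (z | z)
    exacts [hw (Sum.inl z), hy z]

theorem psi_mem_homFilt_iff {α : a.I → ℤ} {β : b.I → ℤ} {γ : c.I → ℤ}
    {φ : PHom (a.sum b) (tens c P₁ P₂) P₃} :
    psi a b c P₁ P₂ P₃ φ ∈
        homFilt (c.sum b) ⊤ (homFilt a (P := P₁) (Q := P₃) ⊤ ⊥ α) (Sum.elim γ β) ↔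
      φ ∈ homFilt (a.sum b) (tensFilt c P₁ P₂ fun x => -γ x) ⊥ (Sum.elim α β) := by
  constructor
  · intro h
    refine (mem_homFilt_iff (isGraded_tensFilt _)).2 fun v hv' => ?_
    refine tensFilt_le (N := (⊥ : Submodule K P₃).comap (hv φ v)) fun i j p hp g hg q hq => ?_
    have h1 := (mem_homFilt_iff isGraded_top).1 h (pair g (sndW v)) ?_ q Submodule.mem_top
    · have h2 := (mem_homFilt_iff isGraded_top).1 h1 (fstW v) (fun x => hv' (Sum.inl x)) p
        Submodule.mem_top
      rw [hv_psi _ _ _ _ hp hq, pair_fst_snd] at h2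
      exact (zs_smul_mem_iff (⊥ : Submodule K P₃) _).1 h2
    · rintro (x | x)
      exacts [hg x, hv' (Sum.inr x)]
  · intro h
    refine mem_homFilt_of_pieces isGraded_top fun w hw j q hq _ =>
      mem_homFilt_of_pieces isGraded_top fun x hx i p hp _ => ?_
    obtain ⟨g, y, rfl⟩ : ∃ g y, w = pair g y := ⟨fstW w, sndW w, (pair_fst_snd w).symm⟩
    rw [hv_psi _ _ _ _ hp hq]
    refine zs_smul_mem _ _ ((mem_homFilt_iff (isGraded_tensFilt _)).1 h (pair x y) ?_ _
      (tm_mem_tensFilt (fun z => hw (Sum.inl z)) p q))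
    rintro (z | z)
    exacts [hx z, hw (Sum.inr z)]

end filtered_hom_tensor

section strict_morphisms

variable {s : LSet K ι} {M N P Q R : GrMod K ι} {k : ι}

theorem surjective_of_pieces {F : P →ₗ[K] Q} (h : ∀ d, ∀ q ∈ Q.piece d, ∃ p ∈ P.piece d, F p = q) :
    Function.Surjective F := fun q =>
  Q.le_of_pieces LinearMap.id (LinearMap.range F)
    (fun d q hq => let ⟨p, _, hp⟩ := h d q hq; ⟨p, hp⟩) q

/-- A map of degree `0` as a strict morphism. -/
def strictHom (s : LSet K ι) (F : P →ₗ[K] Q) (hF : ∀ i, ∀ p ∈ P.piece i, F p ∈ Q.piece i) :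
    homPiece s P Q 0 :=
  ⟨extE s F, extE_mem fun i p hp => by rw [add_zero]; exact hF i p hp⟩

theorem extE_emptyWord (F : P →ₗ[K] Q) : extE s F (emptyWord s) = F := if_pos rfl

theorem isStrict_extE (F : P →ₗ[K] Q) : IsStrict (extE s F) := fun _ hw => if_neg hw

theorem comp_extE_right {X : Word s → Q →ₗ[K] R} {F : P →ₗ[K] Q}
    (hF : ∀ i, ∀ p ∈ P.piece i, F p ∈ Q.piece i) (w : Word s) :
    nrm (comp 0 X (extE s F)) w = nrm X w ∘ₗ F := by
  have h : HasDeg 0 (extE s F) := (strictHom s F hF).2.2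
  rw [nrm_comp _ h, map_zero, nrm_extE, cmp_extE_right, zero_mul, zs_zero_smul]

theorem comp_extE_left {X : Word s → P →ₗ[K] Q} (hX : HasDeg k X) (F : Q →ₗ[K] R) (w : Word s) :
    nrm (comp k (extE s F) X) w = F ∘ₗ nrm X w := by
  rw [nrm_comp _ hX, nrm_extE, cmp_extE_left]

theorem comp_eq_comp {M' N' : GrMod K ι} {X : Word s → M →ₗ[K] M'} {Y : Word s → N →ₗ[K] N'}
    (hX : HasDeg k X) {F : M →ₗ[K] N} (hF : ∀ i, ∀ p ∈ M.piece i, F p ∈ N.piece i)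
    {F' : M' →ₗ[K] N'} (h : ∀ w, F' ∘ₗ nrm X w = nrm Y w ∘ₗ F) :
    comp k (extE s F') X = comp 0 Y (extE s F) := funext fun w => nrm_injective <| by
  rw [comp_extE_left hX, comp_extE_right hF, h]

theorem preD_extE (F : P →ₗ[K] Q) (w : Word s) : preD (extE s F) w = 0 := nrm_eq_zero.1 <| by
  rw [nrm_preD, nrm_extE, wordDiff_extE]

theorem dMor_extE {M N : PreMod s} {F : M.toGrMod →ₗ[K] N.toGrMod}
    (hF : ∀ i, ∀ p ∈ M.piece i, F p ∈ N.piece i)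
    (h : ∀ w, F ∘ₗ nrm (P := M.toGrMod) (Q := M.toGrMod) M.μ w =
      nrm (P := N.toGrMod) (Q := N.toGrMod) N.μ w ∘ₗ F) (w : Word s) :
    dMor 0 (extE s F) w = 0 := by
  rw [dMor, preD_extE, add_zero, comp_eq_comp M.μ_mem.2 hF h, sgn_eq, map_zero, zs_zero_smul,
    sub_self]

theorem comp_extE_extE {F : P →ₗ[K] Q} (hF : ∀ i, ∀ p ∈ P.piece i, F p ∈ Q.piece i)
    {G : Q →ₗ[K] P} (h : G ∘ₗ F = LinearMap.id) : comp 0 (extE s G) (extE s F) = idMor s P :=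
  funext fun w => nrm_injective <| by
    rw [comp_extE_right hF, nrm_extE]
    change _ = nrm (extE s LinearMap.id) w
    rw [nrm_extE, extE, extE]
    by_cases hw : w = emptyWord s
    · rw [if_pos hw, if_pos hw, h]
    · rw [if_neg hw, if_neg hw, LinearMap.zero_comp]

/-- A bijective map of degree `0` that commutes with the structure maps and identifies the
filtrations is an isomorphism of lattice filtered polymodules. -/
theorem isFilteredIso_strictHom {M N : PreMod s} {L : Type}
    {F : (L → ℤ) → Submodule K M.toGrMod} {G : (L → ℤ) → Submodule K N.toGrMod}
    {f : M.toGrMod →ₗ[K] N.toGrMod} (hf : ∀ i, ∀ p ∈ M.piece i, f p ∈ N.piece i)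
    (hinj : Function.Injective f) (hsurj : ∀ d, ∀ q ∈ N.piece d, ∃ p ∈ M.piece d, f p = q)
    (hμ : ∀ w, f ∘ₗ nrm (P := M.toGrMod) (Q := M.toGrMod) M.μ w =
      nrm (P := N.toGrMod) (Q := N.toGrMod) N.μ w ∘ₗ f)
    (hFG : ∀ γ p, f p ∈ G γ ↔ p ∈ F γ) : IsFilteredIso F G (strictHom s f hf) := by
  have hsurj' := surjective_of_pieces hsurj
  let e := LinearEquiv.ofBijective f ⟨hinj, hsurj'⟩
  have he : ∀ i, ∀ q ∈ N.piece i, (e.symm : N.toGrMod →ₗ[K] M.toGrMod) q ∈ M.piece i := by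
    intro i q hq
    obtain ⟨p, hp, rfl⟩ := hsurj i q hq
    have : (e.symm : N.toGrMod →ₗ[K] M.toGrMod) (f p) = p := e.symm_apply_apply p
    rwa [this]
  have h1 : (e.symm : N.toGrMod →ₗ[K] M.toGrMod) ∘ₗ f = LinearMap.id :=
    LinearMap.ext e.symm_apply_apply
  have h2 : f ∘ₗ (e.symm : N.toGrMod →ₗ[K] M.toGrMod) = LinearMap.id :=
    LinearMap.ext e.apply_symm_apply
  refine ⟨isStrict_extE _, dMor_extE hf hμ,
    ⟨strictHom s e.symm.toLinearMap he, isStrict_extE _, dMor_extE he fun w => ?_,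
      comp_extE_extE hf h1, comp_extE_extE he h2⟩, fun γ => ?_⟩
  · refine LinearMap.ext fun q => hinj ?_
    have h3 := LinearMap.congr_fun (hμ w) (e.symm q)
    have h4 : ∀ q, f (e.symm q) = q := e.apply_symm_apply
    rw [LinearMap.comp_apply, LinearMap.comp_apply, h4] at h3
    exact (h4 _).trans h3.symm
  · change (F γ).map (extE s f (emptyWord s)) = _
    rw [extE_emptyWord]
    refine le_antisymm (Submodule.map_le_iff_le_comap.2 fun p hp => (hFG γ p).2 hp) fun q hq => ?_
    obtain ⟨p, rfl⟩ := hsurj' q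
    exact ⟨p, (hFG γ p).1 hq, rfl⟩

end strict_morphisms

section hom_tensor_naturality

variable {a b c r r' q q' : LSet K ι} {P P' P₁ P₁' P₂ P₂' P₃ P₃' Q Q' : GrMod K ι} {k : ι}

theorem cop_pair_dual_right {M : Type*} [AddCommGroup M] {s t : LSet K ι} (v : Word s) (w : Word t)
    (F : Word (s.sum t.dual) → Word (s.sum t.dual) → M) :
    cop (pair v (toDual w)) F = cop v fun o n => cop w fun o' n' =>
      zs (pd o' * pd n' + pd n * pd n') • F (pair o (toDual n')) (pair n (toDual o')) := by
  rw [cop_pair]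
  refine cop_congr fun o n _ => ?_
  rw [toDual, cop_toDual]
  refine cop_congr fun o' n' _ => ?_
  rw [zs_smul_zs_smul]
  rfl

theorem hv_cop_apply {t s : LSet K ι} (w : Word t) (F : Word t → Word t → PHom s P Q) (x : Word s)
    (p : P) : hv (cop w F) x p = cop w fun o n => hv (F o n) x p := by
  rw [hv_cop, cop_apply]

theorem hv_wordDiff_apply {t s : LSet K ι} (w : Word t) (F : Word t → PHom s P Q) (x : Word s)
    (p : P) : hv (wordDiff w F) x p = wordDiff w fun w' => hv (F w') x p := by
  rw [hv_wordDiff, wordDiff_apply]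

theorem hv_zs_smul_apply {s : LSet K ι} (e : ZMod 2) (φ : PHom s P Q) (x : Word s) (p : P) :
    hv (zs e • φ) x p = zs e • hv φ x p := by
  rw [hv_zs_smul, LinearMap.smul_apply]

theorem pre_eq_zero {s : LSet K ι} {f : homPiece (s.sum r) P' P k} {u : Word r}
    (h : ∀ n, nrm f.1 (pair n u) = 0) : pre Q f (toDual u) = 0 :=
  pHom_hom_ext fun d φ hφ x i p hp => by
    rw [hv_pre f u hφ hp, LinearMap.zero_apply, hv_zero, LinearMap.zero_apply]
    refine (cop_congr fun o n _ => ?_).trans (cop_zero x)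
    rw [h, LinearMap.zero_apply, map_zero, smul_zero]

theorem post_eq_zero {s : LSet K ι} {f : homPiece (s.sum r) Q Q' k} {v : Word r}
    (h : ∀ n, nrm f.1 (pair n v) = 0) : post P f v = 0 :=
  pHom_hom_ext fun d φ hφ x i p hp => by
    rw [hv_post f v hφ hp, LinearMap.zero_apply, hv_zero, LinearMap.zero_apply]
    refine (cop_congr fun o n _ => ?_).trans (cop_zero x)
    rw [h, LinearMap.zero_apply, smul_zero]

theorem phi_pre_actL {F : homPiece ((a.sum b).sum r) (tens c P₁' P₂) (tens c P₁ P₂) k}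
    {f : homPiece (c.dual.sum q) P₁' P₁ k} {f' : homPiece ((a.sum c.dual).sum r') P₁' P₁ k}
    {U : Word r} {v : Word a → Word q} {u : Word r'}
    (hF : ∀ x y, nrm F.1 (pair (pair x y) U) =
      if y = emptyWord b then actL P₂ f (v x) else 0)
    (hf : ∀ x g, nrm f'.1 (pair (pair x (toDual g)) u) =
      zs (pd x * pd g) • nrm f.1 (pair (toDual g) (v x)))
    (hU : pd U = pd u) (hv' : ∀ x, pd (v x) = pd x + pd u) :
    phi a b c P₁' P₂ P₃ ∘ₗ pre P₃ F (toDual U) =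
      pre (PHom b P₂ P₃) f' (toDual u) ∘ₗ phi a b c P₁ P₂ P₃ := by
  refine pHom_hom_ext fun d φ hφ w i p hp => hv_ext fun y j q hq => ?_
  obtain ⟨x, g, rfl⟩ : ∃ x g, w = pair x (toDual g) := ⟨fstW w, ofDual (sndW w),
    (pair_fst_snd w).symm⟩
  rw [LinearMap.comp_apply, LinearMap.comp_apply, hv_phi _ _ _ _ hp, hv_pre F U hφ (tm_mem hp hq),
    cop_pair, hv_pre f' u (phi_mem hφ) hp, hv_cop_apply, cop_pair_dual_right, zs_smul_cop]
  refine cop_congr fun o n hx => ?_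
  rw [cop_eq_right (w := y) fun o' n' h => by
    rw [hF, if_neg h, LinearMap.zero_apply, map_zero, smul_zero, smul_zero], hF, if_pos rfl,
    actL_tm f _ hp hq, map_cop, zs_smul_zs_smul, zs_smul_zs_smul, zs_smul_cop]
  refine cop_congr fun o' n' hg => ?_
  rw [hv_zs_smul_apply, hf, LinearMap.smul_apply, map_zs_smul, map_zs_smul,
    hv_zs_smul_apply, hv_phi _ _ _ _ (f.2.2.nrm_pair _ _ hp)]
  simp only [zs_smul_zs_smul]
  congr 2
  simp only [pd_pair, pd_toDual, hv', hU, par_degree, map_add, par_deg]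
  rw [← hx, ← hg]
  grind

theorem phi_pre_actR {F : homPiece ((a.sum b).sum r) (tens c P₁ P₂') (tens c P₁ P₂) k}
    {f : homPiece (c.sum q) P₂' P₂ k} {f' : homPiece (b.sum q') P₂' P₂ k}
    {G : homPiece ((a.sum c.dual).sum r') (PHom b P₂ P₃) (PHom b P₂' P₃) k}
    {U : Word r} {v : Word b → Word q} {v' : Word c → Word q'} {u : Word r'}
    (hF : ∀ x y, nrm F.1 (pair (pair x y) U) =
      if x = emptyWord a then actR P₁ f (v y) else 0)
    (hG : ∀ x g, nrm G.1 (pair (pair x (toDual g)) u) =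
      if x = emptyWord a then pre P₃ f' (toDual (v' g)) else 0)
    (hf : ∀ y g, nrm f'.1 (pair y (v' g)) = zs (pd y * pd g) • nrm f.1 (pair g (v y)))
    (hU : pd U = pd u) (hv₁ : ∀ y, pd (v y) = pd y + pd u) (hv₂ : ∀ g, pd (v' g) = pd g + pd u) :
    phi a b c P₁ P₂' P₃ ∘ₗ pre P₃ F (toDual U) = post P₁ G u ∘ₗ phi a b c P₁ P₂ P₃ := by
  refine pHom_hom_ext fun d φ hφ w i p hp => hv_ext fun y j q hq => ?_
  obtain ⟨x, g, rfl⟩ : ∃ x g, w = pair x (toDual g) := ⟨fstW w, ofDual (sndW w),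
    (pair_fst_snd w).symm⟩
  rw [LinearMap.comp_apply, LinearMap.comp_apply, hv_phi _ _ _ _ hp, hv_pre F U hφ (tm_mem hp hq),
    cop_pair, cop_eq_right (w := x) fun o n h => by
      refine (cop_congr fun o' n' _ => ?_).trans (cop_zero y)
      rw [hF, if_neg h, LinearMap.zero_apply, map_zero, smul_zero, smul_zero],
    hv_post G u (phi_mem hφ) hp, hv_cop_apply, cop_pair_dual_right,
    cop_eq_left (w := x) fun o n h => by
      refine (cop_congr fun o' n' _ => ?_).trans (cop_zero g)
      rw [hG, if_neg h, LinearMap.zero_apply, smul_zero, hv_zero, LinearMap.zero_apply, smul_zero]]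
  simp only [hF, hG, if_pos]
  rw [zs_smul_cop]
  refine Eq.trans (cop_congr (G := fun o' n' => cop g fun o n =>
    zs (pd y * (par i + pd g) + pd g * par i + (pd u * (par d + (pd x + pd y)) +
      par k * (par d + (pd x + pd o'))) + ((par k + (pd n' + pd u)) * (par i + pd o) +
        pd n * (pd n' + pd u))) • hv φ (pair x o') (tm p o (nrm f.1 (pair n (v n')) q)))
      fun o' n' hy => ?_) ?_
  · rw [actR_tm f _ hp hq, map_cop]
    simp only [zs_smul_cop]
    refine cop_congr fun o n hg => ?_
    rw [map_zs_smul]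
    simp only [zs_smul_zs_smul]
    congr 2
    simp only [pd_pair, pd_emptyWord, hv₁, hU]
    grind
  rw [cop_comm]
  refine cop_congr fun o n hg => ?_
  rw [hv_zs_smul_apply, hv_pre f' (v' n) (hv_mem (phi_mem hφ) _ hp) hq, zs_smul_cop, zs_smul_cop]
  refine cop_congr fun o' n' hy => ?_
  rw [hf, LinearMap.smul_apply, map_zs_smul, hv_phi _ _ _ _ hp]
  simp only [zs_smul_zs_smul]
  congr 2
  simp only [pd_pair, pd_toDual, hv₂, par_degree, pd_emptyWord]
  rw [← hy, ← hg]
  grind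

theorem phi_post {f : homPiece ((a.sum b).sum r) P₃ P₃' k} {f' : homPiece (b.sum q) P₃ P₃' k}
    {G : homPiece ((a.sum c.dual).sum r') (PHom b P₂ P₃) (PHom b P₂ P₃') k}
    {U : Word r} {v : Word a → Word q} {u : Word r'}
    (hG : ∀ x g, nrm G.1 (pair (pair x (toDual g)) u) =
      if g = emptyWord c then post P₂ f' (v x) else 0)
    (hf : ∀ x y, nrm f'.1 (pair y (v x)) = zs (pd x * pd y) • nrm f.1 (pair (pair x y) U))
    (hU : pd U = pd u) (hv' : ∀ x, pd (v x) = pd x + pd u) :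
    phi a b c P₁ P₂ P₃' ∘ₗ post (tens c P₁ P₂) f U = post P₁ G u ∘ₗ phi a b c P₁ P₂ P₃ := by
  refine pHom_hom_ext fun d φ hφ w i p hp => hv_ext fun y j q hq => ?_
  obtain ⟨x, g, rfl⟩ : ∃ x g, w = pair x (toDual g) := ⟨fstW w, ofDual (sndW w),
    (pair_fst_snd w).symm⟩
  rw [LinearMap.comp_apply, LinearMap.comp_apply, hv_phi _ _ _ _ hp, hv_post f U hφ (tm_mem hp hq),
    cop_pair, hv_post G u (phi_mem hφ) hp, hv_cop_apply, cop_pair_dual_right, zs_smul_cop]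
  refine cop_congr fun o n hx => ?_
  rw [cop_eq_right (w := g) fun o' n' h => by
    rw [hG, if_neg h, LinearMap.zero_apply, smul_zero, hv_zero, LinearMap.zero_apply, smul_zero],
    hG, if_pos rfl, hv_zs_smul_apply, hv_post f' (v o) (hv_mem (phi_mem hφ) _ hp) hq]
  simp only [zs_smul_cop]
  refine cop_congr fun o' n' hy => ?_
  rw [hf, LinearMap.smul_apply, hv_phi _ _ _ _ hp, map_zs_smul]
  simp only [zs_smul_zs_smul]
  congr 2
  simp only [pd_pair, pd_toDual, hv', par_degree, pd_emptyWord, hU]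
  rw [← hy]
  grind

theorem phi_differential {F : homPiece ((a.sum b).sum r) (tens c P₁ P₂) (tens c P₁ P₂) 1}
    {G : homPiece ((a.sum c.dual).sum r') (PHom b P₂ P₃) (PHom b P₂ P₃) 1}
    {U : Word r} {u : Word r'}
    (hF : ∀ v, nrm F.1 (pair v U) = if v = emptyWord _ then dTens c P₁ P₂ else 0)
    (hG : ∀ w, nrm G.1 (pair w u) = if w = emptyWord _ then dHom b P₂ P₃ else 0)
    (hU : pd U = 0) (hu : pd u = 0) :
    phi a b c P₁ P₂ P₃ ∘ₗ (pre P₃ F (toDual U) + dHom (a.sum b) (tens c P₁ P₂) P₃) =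
      (post P₁ G u + dHom (a.sum c.dual) P₁ (PHom b P₂ P₃)) ∘ₗ phi a b c P₁ P₂ P₃ := by
  refine pHom_hom_ext fun d φ hφ w i p hp => hv_ext fun y j q hq => ?_
  obtain ⟨x, g, rfl⟩ : ∃ x g, w = pair x (toDual g) := ⟨fstW w, ofDual (sndW w),
    (pair_fst_snd w).symm⟩
  rw [LinearMap.comp_apply, LinearMap.comp_apply, LinearMap.add_apply, LinearMap.add_apply,
    hv_add (P := P₁), LinearMap.add_apply, hv_add (P := P₂), LinearMap.add_apply, hv_phi _ _ _ _ hp,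
    hv_add, LinearMap.add_apply, hv_pre F U hφ (tm_mem hp hq),
    cop_eq_right (w := pair x y) fun o n h => by
      rw [hF, if_neg h, LinearMap.zero_apply, map_zero, smul_zero],
    hv_post G u (phi_mem hφ) hp,
    cop_eq_left (w := pair x (toDual g)) fun o n h => by
      rw [hG, if_neg h, LinearMap.zero_apply, smul_zero],
    hF, if_pos rfl, hG, if_pos rfl, dTens_tm hp, hv_dHom hφ, hv_dHom (phi_mem hφ),
    hv_zs_smul_apply, hv_dHom (hv_mem (phi_mem hφ) _ hp), wordDiff_pair]
  simp only [LinearMap.smul_apply, LinearMap.add_apply, wordDiff_pair, wordDiff_apply, map_zs_smul,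
    map_wordDiff, hv_zs_smul_apply, hv_add, hv_wordDiff_apply, smul_add, zs_smul_wordDiff,
    zs_smul_zs_smul]
  rw [add_comm, add_comm (wordDiff x _) (wordDiff y _), add_assoc]
  refine congrArg₂ (· + ·) ?_ (congrArg₂ (· + ·) ?_
    (Eq.trans ?_ (wordDiff_toDual g _).symm)) <;> refine wordDiff_congr fun w' hw => ?_
  · rw [hv_phi _ _ _ _ hp, zs_smul_zs_smul]
    congr 2
    simp only [pd_pair, pd_toDual, par_degree, pd_emptyWord, hU, hu, map_one]
    grind
  · rw [hv_phi _ _ _ _ hp, zs_smul_zs_smul]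
    congr 2
    ring
  · change _ = zs _ • hv (hv (phi a b c P₁ P₂ P₃ φ) (pair x (toDual w')) p) y q
    rw [hv_phi _ _ _ _ hp, zs_smul_zs_smul]
    congr 2
    simp only [pd_pair, pd_toDual, par_degree, pd_emptyWord, hU, hu, map_one]
    grind

end hom_tensor_naturality

section hom_tensor_naturality_left

variable {a b c r r' q q' : LSet K ι} {P₁ P₁' P₂ P₂' P₃ P₃' : GrMod K ι} {k : ι}

theorem psi_pre_actL {F : homPiece ((a.sum b).sum r) (tens c P₁' P₂) (tens c P₁ P₂) k}
    {f : homPiece (c.dual.sum q) P₁' P₁ k} {f' : homPiece (a.sum q') P₁' P₁ k}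
    {G : homPiece ((c.sum b).sum r') (PHom a P₁ P₃) (PHom a P₁' P₃) k}
    {U : Word r} {v : Word a → Word q} {v' : Word c → Word q'} {u : Word r'}
    (hF : ∀ x y, nrm F.1 (pair (pair x y) U) =
      if y = emptyWord b then actL P₂ f (v x) else 0)
    (hG : ∀ g y, nrm G.1 (pair (pair g y) u) =
      if y = emptyWord b then pre P₃ f' (toDual (v' g)) else 0)
    (hf : ∀ x g, nrm f'.1 (pair x (v' g)) =
      zs (pd x * pd g) • nrm f.1 (pair (toDual g) (v x)))
    (hU : pd U = pd u) (hv₁ : ∀ x, pd (v x) = pd x + pd u) (hv₂ : ∀ g, pd (v' g) = pd g + pd u) :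
    psi a b c P₁' P₂ P₃ ∘ₗ pre P₃ F (toDual U) = post P₂ G u ∘ₗ psi a b c P₁ P₂ P₃ := by
  refine pHom_hom_ext fun d φ hφ w j q hq => hv_ext fun x i p hp => ?_
  obtain ⟨g, y, rfl⟩ : ∃ g y, w = pair g y := ⟨fstW w, sndW w, (pair_fst_snd w).symm⟩
  rw [LinearMap.comp_apply, LinearMap.comp_apply, hv_psi _ _ _ _ hp hq,
    hv_pre F U hφ (tm_mem hp hq), cop_pair, hv_post G u (psi_mem hφ) hq, hv_cop_apply, cop_pair,
    zs_smul_cop]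
  refine Eq.trans (cop_congr (G := fun o n => cop g fun o' n' =>
    zs (pd x * (pd g + pd y + par j) + pd g * pd y + par i * (pd g + par j) + pd n * pd y +
      (pd u * (par d + (pd x + pd y)) + par k * (par d + (pd o + pd y))) +
      pd o' * (pd n + pd u + par i)) •
      hv φ (pair o y) (tm (nrm f.1 (pair (toDual o') (v n)) p) n' q)) fun o n hx => ?_) ?_
  · rw [cop_eq_right (w := y) fun o' n' h => by
      rw [hF, if_neg h, LinearMap.zero_apply, map_zero, smul_zero, smul_zero], hF, if_pos rfl,
      actL_tm f _ hp hq, map_cop]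
    simp only [zs_smul_cop]
    refine cop_congr fun o' n' hg => ?_
    rw [map_zs_smul]
    simp only [zs_smul_zs_smul]
    congr 2
    simp only [pd_pair, hv₁, hU]
    ring
  rw [cop_comm]
  refine cop_congr fun o' n' hg => ?_
  rw [cop_eq_left (w := y) fun o n h => by
      rw [hG, if_neg h, LinearMap.zero_apply, smul_zero, hv_zero, LinearMap.zero_apply, smul_zero],
    hG, if_pos rfl, hv_zs_smul_apply, hv_pre f' (v' o') (hv_mem (psi_mem hφ) _ hq) hp]
  simp only [zs_smul_cop]
  refine cop_congr fun o n hx => ?_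
  rw [hf, LinearMap.smul_apply, map_zs_smul, hv_psi _ _ _ _ (f.2.2.nrm_pair _ _ hp) hq]
  simp only [zs_smul_zs_smul]
  congr 2
  simp only [pd_pair, pd_toDual, hv₁, hv₂, par_degree, pd_emptyWord, map_add, par_deg]
  rw [← hx, ← hg]
  grind

theorem psi_pre_actR {F : homPiece ((a.sum b).sum r) (tens c P₁ P₂') (tens c P₁ P₂) k}
    {f : homPiece (c.sum q) P₂' P₂ k} {f' : homPiece ((c.sum b).sum r') P₂' P₂ k}
    {U : Word r} {v : Word b → Word q} {u : Word r'}
    (hF : ∀ x y, nrm F.1 (pair (pair x y) U) =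
      if x = emptyWord a then actR P₁ f (v y) else 0)
    (hf : ∀ y g, nrm f'.1 (pair (pair g y) u) = nrm f.1 (pair g (v y)))
    (hU : pd U = pd u) (hv' : ∀ y, pd (v y) = pd y + pd u) :
    psi a b c P₁ P₂' P₃ ∘ₗ pre P₃ F (toDual U) =
      pre (PHom a P₁ P₃) f' (toDual u) ∘ₗ psi a b c P₁ P₂ P₃ := by
  refine pHom_hom_ext fun d φ hφ w j q hq => hv_ext fun x i p hp => ?_
  obtain ⟨g, y, rfl⟩ : ∃ g y, w = pair g y := ⟨fstW w, sndW w, (pair_fst_snd w).symm⟩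
  rw [LinearMap.comp_apply, LinearMap.comp_apply, hv_psi _ _ _ _ hp hq,
    hv_pre F U hφ (tm_mem hp hq), cop_pair, cop_eq_right (w := x) fun o n h => by
      refine (cop_congr fun o' n' _ => ?_).trans (cop_zero y)
      rw [hF, if_neg h, LinearMap.zero_apply, map_zero, smul_zero, smul_zero],
    hv_pre f' u (psi_mem hφ) hq, hv_cop_apply, cop_pair, cop_comm, zs_smul_cop]
  refine cop_congr fun o' n' hy => ?_
  rw [hF, if_pos rfl, actR_tm f _ hp hq, map_cop]
  simp only [zs_smul_cop]
  refine cop_congr fun o n hg => ?_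
  rw [hf, hv_zs_smul_apply, hv_psi _ _ _ _ hp (f.2.2.nrm_pair _ _ hq), map_zs_smul]
  simp only [zs_smul_zs_smul]
  congr 2
  simp only [pd_pair, hv', hU, par_degree, map_add, par_deg, pd_emptyWord]
  rw [← hy, ← hg]
  grind

theorem psi_post {f : homPiece ((a.sum b).sum r) P₃ P₃' k} {f' : homPiece (a.sum q) P₃ P₃' k}
    {G : homPiece ((c.sum b).sum r') (PHom a P₁ P₃) (PHom a P₁ P₃') k}
    {U : Word r} {v : Word b → Word q} {u : Word r'}
    (hG : ∀ g y, nrm G.1 (pair (pair g y) u) =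
      if g = emptyWord c then post P₁ f' (v y) else 0)
    (hf : ∀ x y, nrm f'.1 (pair x (v y)) = nrm f.1 (pair (pair x y) U))
    (hU : pd U = pd u) (hv' : ∀ y, pd (v y) = pd y + pd u) :
    psi a b c P₁ P₂ P₃' ∘ₗ post (tens c P₁ P₂) f U = post P₂ G u ∘ₗ psi a b c P₁ P₂ P₃ := by
  refine pHom_hom_ext fun d φ hφ w j q hq => hv_ext fun x i p hp => ?_
  obtain ⟨g, y, rfl⟩ : ∃ g y, w = pair g y := ⟨fstW w, sndW w, (pair_fst_snd w).symm⟩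
  rw [LinearMap.comp_apply, LinearMap.comp_apply, hv_psi _ _ _ _ hp hq,
    hv_post f U hφ (tm_mem hp hq), cop_pair, hv_post G u (psi_mem hφ) hq, hv_cop_apply, cop_pair,
    cop_eq_left (w := g) fun o n h => by
      refine (cop_congr fun o' n' _ => ?_).trans (cop_zero y)
      rw [hG, if_neg h, LinearMap.zero_apply, smul_zero, hv_zero, LinearMap.zero_apply, smul_zero],
    cop_comm, zs_smul_cop]
  refine cop_congr fun o' n' hy => ?_
  rw [hG, if_pos rfl, hv_zs_smul_apply, hv_post f' (v o') (hv_mem (psi_mem hφ) _ hq) hp]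
  simp only [zs_smul_cop]
  refine cop_congr fun o n hx => ?_
  rw [hf, hv_psi _ _ _ _ hp hq, map_zs_smul]
  simp only [zs_smul_zs_smul]
  congr 2
  simp only [pd_pair, hv', par_degree, pd_emptyWord, hU]
  rw [← hx, ← hy]
  grind

theorem psi_differential {F : homPiece ((a.sum b).sum r) (tens c P₁ P₂) (tens c P₁ P₂) 1}
    {G : homPiece ((c.sum b).sum r') (PHom a P₁ P₃) (PHom a P₁ P₃) 1}
    {U : Word r} {u : Word r'}
    (hF : ∀ v, nrm F.1 (pair v U) = if v = emptyWord _ then dTens c P₁ P₂ else 0)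
    (hG : ∀ w, nrm G.1 (pair w u) = if w = emptyWord _ then dHom a P₁ P₃ else 0)
    (hU : pd U = 0) (hu : pd u = 0) :
    psi a b c P₁ P₂ P₃ ∘ₗ (pre P₃ F (toDual U) + dHom (a.sum b) (tens c P₁ P₂) P₃) =
      (post P₂ G u + dHom (c.sum b) P₂ (PHom a P₁ P₃)) ∘ₗ psi a b c P₁ P₂ P₃ := by
  refine pHom_hom_ext fun d φ hφ w j q hq => hv_ext fun x i p hp => ?_
  obtain ⟨g, y, rfl⟩ : ∃ g y, w = pair g y := ⟨fstW w, sndW w, (pair_fst_snd w).symm⟩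
  rw [LinearMap.comp_apply, LinearMap.comp_apply, LinearMap.add_apply, LinearMap.add_apply,
    hv_add (P := P₂), LinearMap.add_apply, hv_add (P := P₁), LinearMap.add_apply,
    hv_psi _ _ _ _ hp hq, hv_add, LinearMap.add_apply, hv_pre F U hφ (tm_mem hp hq),
    cop_eq_right (w := pair x y) fun o n h => by
      rw [hF, if_neg h, LinearMap.zero_apply, map_zero, smul_zero],
    hv_post G u (psi_mem hφ) hq,
    cop_eq_left (w := pair g y) fun o n h => by
      rw [hG, if_neg h, LinearMap.zero_apply, smul_zero],
    hF, if_pos rfl, hG, if_pos rfl, dTens_tm hp, hv_dHom hφ, hv_dHom (psi_mem hφ),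
    hv_zs_smul_apply, hv_dHom (hv_mem (psi_mem hφ) _ hq)]
  simp only [LinearMap.smul_apply, LinearMap.add_apply, wordDiff_pair, wordDiff_apply, map_zs_smul,
    map_wordDiff, hv_zs_smul_apply, hv_add, hv_wordDiff_apply, smul_add, zs_smul_wordDiff,
    zs_smul_zs_smul]
  rw [add_left_comm]
  refine congrArg₂ (· + ·) ?_ (congrArg₂ (· + ·) ?_ ?_) <;>
    refine wordDiff_congr fun w' hw => ?_
  · rw [hv_psi _ _ _ _ hp hq, zs_smul_zs_smul]
    congr 2
    simp only [pd_pair, par_degree, pd_emptyWord, hU, hu, map_one]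
    grind
  · rw [hv_psi _ _ _ _ hp hq, zs_smul_zs_smul]
    congr 2
    simp only [pd_pair, par_degree, pd_emptyWord, hU, hu, map_one]
    grind
  · rw [hv_psi _ _ _ _ hp hq, zs_smul_zs_smul]
    congr 2
    grind

end hom_tensor_naturality_left

section label_maps

variable {s s' t t' u a b c p q : LSet K ι} {P P' Q Q' R : GrMod K ι} {k : ι}

theorem LSet.Hom.ext {i j : LSet.Hom s t} (h : ∀ x, i.f x = j.f x) : i = j := by
  cases i
  cases j
  congr
  exact funext h

/-- The composition of morphisms of labelled sets. -/
def LSet.Hom.comp (j : LSet.Hom t u) (i : LSet.Hom s t) : LSet.Hom s u where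
  f x := j.f (i.f x)
  inj := j.inj.comp i.inj
  side_eq x := (j.side_eq _).trans (i.side_eq x)
  κ_eq x := (j.κ_eq _).trans (i.κ_eq x)

/-- The identity morphism. -/
def LSet.Hom.id (s : LSet K ι) : LSet.Hom s s := ⟨fun x => x, fun _ _ h => h, fun _ => rfl, fun _ => rfl⟩

theorem castL_castL {A B C : AInfAlg K ι} (h : A = B) (h' : B = C)
    (l : List (Letter A.toGrMod)) : castL h' (castL h l) = castL (h.trans h') l := by
  subst h h'; rfl

theorem castL_nil {A B : AInfAlg K ι} (h : A = B) : castL h ([] : List (Letter A.toGrMod)) = [] := by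
  subst h; rfl

theorem push_eq {i : LSet.Hom s t} {w : Word s} {w' : Word t}
    (h : ∀ x, w' (i.f x) = castL (i.κ_eq x).symm (w x))
    (h' : ∀ y, (¬ ∃ x, i.f x = y) → w' y = []) : push i w = w' := by
  funext y
  by_cases hy : ∃ x, i.f x = y
  · obtain ⟨x, rfl⟩ := hy
    rw [push_apply, h]
  · rw [push_of_notMem _ _ _ hy, h' y hy]

theorem push_comp (j : LSet.Hom t u) (i : LSet.Hom s t) (w : Word s) :
    push (j.comp i) w = push j (push i w) := by
  refine push_eq (fun x => ?_) fun z hz => ?_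
  · refine (push_apply j (push i w) (i.f x)).trans ?_
    rw [push_apply i w x, castL_castL]
    rfl
  · by_cases hy : ∃ y, j.f y = z
    · obtain ⟨y, rfl⟩ := hy
      rw [push_apply, push_of_notMem i w y (fun ⟨x, hx⟩ => hz ⟨x, congrArg j.f hx⟩), castL_nil]
    · exact push_of_notMem _ _ _ hy

theorem ro_comp (j : LSet.Hom t u) (i : LSet.Hom s t) (w : Word s) :
    ro (j.comp i) w = ro i w + ro j (push i w) := by
  have h : ro j (push i w) = ∑ x, ∑ y,
      if t.lt (i.f x) (i.f y) ∧ u.lt (j.f (i.f y)) (j.f (i.f x)) then pw (w x) * pw (w y) else 0 := by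
    rw [ro, sum_push i _ fun y hy => Finset.sum_eq_zero fun z _ => by
      rw [push_of_notMem i w y hy]; simp [pw_nil]]
    refine Finset.sum_congr rfl fun x _ => ?_
    rw [sum_push i _ fun y hy => by rw [push_of_notMem i w y hy]; simp [pw_nil]]
    refine Finset.sum_congr rfl fun y _ => ?_
    rw [pw_push, pw_push]
  rw [h, ro, ro]
  simp only [LSet.Hom.comp]
  rw [sum_sum_lt s, sum_sum_lt s (fun x y => if s.lt x y ∧ t.lt (i.f y) (i.f x) then _ else _),
    sum_sum_lt s (fun x y => if t.lt (i.f x) (i.f y) ∧ _ then _ else _)]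
  have h0 : ∀ x : s.I, ¬ s.lt x x := irrefl_of s.lt
  have h1 : ∀ x : t.I, ¬ t.lt x x := irrefl_of t.lt
  simp only [h0, h1, false_and, if_false, Finset.sum_const_zero, add_zero]
  rw [← Finset.sum_add_distrib]
  refine Finset.sum_congr rfl fun x _ => ?_
  rw [← Finset.sum_add_distrib]
  refine Finset.sum_congr rfl fun y _ => ?_
  by_cases hxy : s.lt x y
  · have hne : x ≠ y := ne_of_lt' hxy
    have e1 : ¬ s.lt y x := lt_asymm' hxy
    have e2 : i.f x ≠ i.f y := fun h => hne (i.inj h)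
    have e3 : j.f (i.f x) ≠ j.f (i.f y) := fun h => e2 (j.inj h)
    rcases trichotomous_of t.lt (i.f x) (i.f y) with h2 | h2 | h2
    · have h2' := lt_asymm' h2
      rcases trichotomous_of u.lt (j.f (i.f x)) (j.f (i.f y)) with h3 | h3 | h3
      · simp [hxy, e1, h2, h2', h3, lt_asymm' h3]
      · exact absurd h3 e3
      · simp [hxy, e1, h2, h2', h3, lt_asymm' h3]
    · exact absurd h2 e2
    · have h2' := lt_asymm' h2
      rcases trichotomous_of u.lt (j.f (i.f x)) (j.f (i.f y)) with h3 | h3 | h3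
      · simp only [hxy, e1, h2, h2', h3, lt_asymm' h3, true_and, and_true, and_false, false_and,
          if_true, if_false]
        grind
      · exact absurd h3 e3
      · simp [hxy, e1, h2, h2', h3, lt_asymm' h3]
  · simp [hxy]

theorem npull_npull (j : LSet.Hom t u) (i : LSet.Hom s t) (f : Word u → P →ₗ[K] Q) :
    npull i (npull j f) = npull (j.comp i) f := by
  funext w
  rw [npull, npull, npull, zs_smul_zs_smul, ro_comp, push_comp]

theorem pull_pull (j : LSet.Hom t u) (i : LSet.Hom s t) (f : Word u → P →ₗ[K] Q) :
    pull i (pull j f) = pull (j.comp i) f := funext fun w => nrm_injective <| by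
  rw [nrm_pull, nrm_pull, ← npull_npull]
  exact congrArg (fun g => npull i g w) (funext (nrm_pull j f))

theorem pullHom_pullHom (j : LSet.Hom t u) (i : LSet.Hom s t) (f : homPiece u P Q k) :
    pullHom i (pullHom j f) = pullHom (j.comp i) f := Subtype.ext (pull_pull j i f.1)

theorem push_sum (i : LSet.Hom s t) (j : LSet.Hom s' t') (v : Word s) (w : Word s') :
    push (i.sum j) (pair v w) = pair (push i v) (push j w) := by
  refine push_eq ?_ ?_
  · rintro (x | x)
    exacts [push_apply i v x, push_apply j w x]
  · rintro (y | y) hy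
    · exact push_of_notMem i v y fun ⟨x, hx⟩ => hy ⟨Sum.inl x, congrArg Sum.inl hx⟩
    · exact push_of_notMem j w y fun ⟨x, hx⟩ => hy ⟨Sum.inr x, congrArg Sum.inr hx⟩

theorem push_id (w : Word s) : push (LSet.Hom.id s) w = w :=
  push_eq (fun _ => rfl) fun _ hy => absurd ⟨_, rfl⟩ hy

theorem ro_id (w : Word s) : ro (LSet.Hom.id s) w = 0 :=
  Finset.sum_eq_zero fun _ _ => Finset.sum_eq_zero fun _ _ => if_neg fun h => lt_asymm' h.1 h.2

theorem push_dual (i : LSet.Hom s t) (w : Word s) : push i.dual (toDual w) = toDual (push i w) :=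
  push_eq (fun x => push_apply i w x) fun y hy => push_of_notMem i w y hy

theorem ro_dual (i : LSet.Hom s t) (w : Word s) : ro i.dual (toDual w) = ro i w := rfl

theorem push_emptyWord_iff (i : LSet.Hom s t) (w : Word s) :
    push i w = emptyWord t ↔ w = emptyWord s := by
  rw [← len_eq_zero, len_push, len_eq_zero]

theorem pair_emptyWord_iff (v : Word s) (w : Word t) :
    pair v w = emptyWord (s.sum t) ↔ v = emptyWord s ∧ w = emptyWord t := by
  constructor
  · intro h
    exact ⟨funext fun x => congrFun h (Sum.inl x), funext fun x => congrFun h (Sum.inr x)⟩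
  · rintro ⟨rfl, rfl⟩
    funext x
    rcases x with x | x <;> rfl

theorem sum_sum_pair (s t : LSet K ι) (g : s.I ⊕ t.I → s.I ⊕ t.I → ZMod 2) :
    (∑ x : (s.sum t).I, ∑ y : (s.sum t).I, g x y) =
      (∑ x, ∑ y, g (Sum.inl x) (Sum.inl y)) + (∑ x, ∑ y, g (Sum.inl x) (Sum.inr y)) +
        ((∑ x, ∑ y, g (Sum.inr x) (Sum.inl y)) + ∑ x, ∑ y, g (Sum.inr x) (Sum.inr y)) := by
  rw [← Finset.sum_add_distrib, ← Finset.sum_add_distrib]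
  refine (Fintype.sum_sum_type (α₁ := s.I) (α₂ := t.I) _).trans
    (congrArg₂ (· + ·) ?_ ?_) <;> refine Finset.sum_congr rfl fun x _ => ?_ <;>
    exact Fintype.sum_sum_type (α₁ := s.I) (α₂ := t.I) _

/-- The cross terms of the sign of a reordering of a disjoint union. -/
theorem ro_pair (i : LSet.Hom (s.sum t) u) (v : Word s) (w : Word t) :
    ro i (pair v w) =
      (∑ x, ∑ y, if s.lt x y ∧ u.lt (i.f (Sum.inl y)) (i.f (Sum.inl x)) then
        pw (v x) * pw (v y) else 0) +
      (∑ x, ∑ y, if t.lt x y ∧ u.lt (i.f (Sum.inr y)) (i.f (Sum.inr x)) then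
        pw (w x) * pw (w y) else 0) +
      ∑ x, ∑ y, if u.lt (i.f (Sum.inr y)) (i.f (Sum.inl x)) then pw (v x) * pw (w y) else 0 := by
  rw [ro, sum_sum_pair s t]
  simp [pair]
  ring

theorem ro_sum (i : LSet.Hom s t) (j : LSet.Hom s' t') (v : Word s) (w : Word s') :
    ro (i.sum j) (pair v w) = ro i v + ro j w := by
  rw [ro_pair]
  simp [LSet.Hom.sum, LSet.Hom.desc, LSet.Hom.toL, LSet.Hom.toR, ro]

end label_maps

section reorderings

variable (a b c u v : LSet K ι)

/-- `(a ⊔ b) ⊔ (u ⊔ v) → (a ⊔ u) ⊔ (b ⊔ v)`. -/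
def interchange : LSet.Hom ((a.sum b).sum (u.sum v)) ((a.sum u).sum (b.sum v)) where
  f := Sum.elim (Sum.elim (fun x => Sum.inl (Sum.inl x)) fun x => Sum.inr (Sum.inl x))
    (Sum.elim (fun x => Sum.inl (Sum.inr x)) fun x => Sum.inr (Sum.inr x))
  inj := by rintro ((x | x) | (x | x)) ((y | y) | (y | y)) <;> simp
  side_eq := by rintro ((x | x) | (x | x)) <;> rfl
  κ_eq := by rintro ((x | x) | (x | x)) <;> rfl

/-- `(a ⊔ c*) ⊔ (u* ⊔ v) → (c ⊔ u)* ⊔ (a ⊔ v)`. -/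
def interchangeSwap :
    LSet.Hom ((a.sum c.dual).sum (u.dual.sum v)) ((c.sum u).dual.sum (a.sum v)) where
  f := Sum.elim (Sum.elim (fun x => Sum.inr (Sum.inl x)) fun x => Sum.inl (Sum.inl x))
    (Sum.elim (fun x => Sum.inl (Sum.inr x)) fun x => Sum.inr (Sum.inr x))
  inj := by rintro ((x | x) | (x | x)) ((y | y) | (y | y)) <;> simp
  side_eq := by rintro ((x | x) | (x | x)) <;> rfl
  κ_eq := by rintro ((x | x) | (x | x)) <;> rfl

/-- `(c ⊔ b) ⊔ (u* ⊔ v) → (c* ⊔ u)* ⊔ (b ⊔ v)`. -/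
def interchangeDual :
    LSet.Hom ((c.sum b).sum (u.dual.sum v)) ((c.dual.sum u).dual.sum (b.sum v)) where
  f := Sum.elim (Sum.elim (fun x => Sum.inl (Sum.inl x)) fun x => Sum.inr (Sum.inl x))
    (Sum.elim (fun x => Sum.inl (Sum.inr x)) fun x => Sum.inr (Sum.inr x))
  inj := by rintro ((x | x) | (x | x)) ((y | y) | (y | y)) <;> simp
  side_eq := by rintro ((x | x) | (x | x)) <;> simp
  κ_eq := by rintro ((x | x) | (x | x)) <;> rfl

/-- `(a ⊔ b) ⊔ u → b ⊔ (a ⊔ u)`. -/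
def rotate : LSet.Hom ((a.sum b).sum u) (b.sum (a.sum u)) where
  f := Sum.elim (Sum.elim (fun x => Sum.inr (Sum.inl x)) fun x => Sum.inl x)
    fun x => Sum.inr (Sum.inr x)
  inj := by rintro ((x | x) | x) ((y | y) | y) <;> simp
  side_eq := by rintro ((x | x) | x) <;> rfl
  κ_eq := by rintro ((x | x) | x) <;> rfl

/-- `b ⊔ (a ⊔ u) → (a ⊔ b) ⊔ u`. -/
def unrotate : LSet.Hom (b.sum (a.sum u)) ((a.sum b).sum u) where
  f := Sum.elim (fun x => Sum.inl (Sum.inr x))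
    (Sum.elim (fun x => Sum.inl (Sum.inl x)) fun x => Sum.inr x)
  inj := by rintro (x | (x | x)) (y | (y | y)) <;> simp
  side_eq := by rintro (x | (x | x)) <;> rfl
  κ_eq := by rintro (x | (x | x)) <;> rfl

/-- `a ⊔ (b ⊔ u) → b ⊔ (a ⊔ u)`. -/
def exchange : LSet.Hom (a.sum (b.sum u)) (b.sum (a.sum u)) where
  f := Sum.elim (fun x => Sum.inr (Sum.inl x))
    (Sum.elim (fun x => Sum.inl x) fun x => Sum.inr (Sum.inr x))
  inj := by rintro (x | (x | x)) (y | (y | y)) <;> simp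
  side_eq := by rintro (x | (x | x)) <;> rfl
  κ_eq := by rintro (x | (x | x)) <;> rfl

/-- `(a ⊔ b) ⊔ u → a ⊔ (b ⊔ u)`. -/
def assocR : LSet.Hom ((a.sum b).sum u) (a.sum (b.sum u)) where
  f := Sum.elim (Sum.elim (fun x => Sum.inl x) fun x => Sum.inr (Sum.inl x))
    fun x => Sum.inr (Sum.inr x)
  inj := by rintro ((x | x) | x) ((y | y) | y) <;> simp
  side_eq := by rintro ((x | x) | x) <;> rfl
  κ_eq := by rintro ((x | x) | x) <;> rfl

/-- `a ⊔ (b ⊔ u) → (a ⊔ b) ⊔ u`. -/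
def assocL : LSet.Hom (a.sum (b.sum u)) ((a.sum b).sum u) where
  f := Sum.elim (fun x => Sum.inl (Sum.inl x))
    (Sum.elim (fun x => Sum.inl (Sum.inr x)) fun x => Sum.inr x)
  inj := by rintro (x | (x | x)) (y | (y | y)) <;> simp
  side_eq := by rintro (x | (x | x)) <;> rfl
  κ_eq := by rintro (x | (x | x)) <;> rfl

/-- `(u ⊔ v)* ⊔ a → u* ⊔ (v* ⊔ a)`. -/
def assocDual : LSet.Hom ((u.sum v).dual.sum a) (u.dual.sum (v.dual.sum a)) where
  f := Sum.elim (Sum.elim (fun x => Sum.inl x) fun x => Sum.inr (Sum.inl x))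
    fun x => Sum.inr (Sum.inr x)
  inj := by rintro ((x | x) | x) ((y | y) | y) <;> simp
  side_eq := by rintro ((x | x) | x) <;> rfl
  κ_eq := by rintro ((x | x) | x) <;> rfl

/-- `(u ⊔ v)* ⊔ a → v* ⊔ (u* ⊔ a)`. -/
def rotateDual : LSet.Hom ((u.sum v).dual.sum a) (v.dual.sum (u.dual.sum a)) where
  f := Sum.elim (Sum.elim (fun x => Sum.inr (Sum.inl x)) fun x => Sum.inl x)
    fun x => Sum.inr (Sum.inr x)
  inj := by rintro ((x | x) | x) ((y | y) | y) <;> simp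
  side_eq := by rintro ((x | x) | x) <;> rfl
  κ_eq := by rintro ((x | x) | x) <;> rfl

variable {a b c u v} (x : Word a) (y : Word b) (z : Word c) (m : Word u) (n : Word v)

theorem lt_and_lt (s : LSet K ι) (i j : s.I) : (s.lt i j ∧ s.lt j i) ↔ False :=
  ⟨fun h => lt_asymm' h.1 h.2, False.elim⟩

theorem push_interchange : push (interchange a b u v) (pair (pair x y) (pair m n)) =
    pair (pair x m) (pair y n) := by
  refine push_eq (by rintro ((i | i) | (i | i)) <;> rfl) ?_
  rintro ((i | i) | (i | i)) hi
  exacts [absurd ⟨.inl (.inl i), rfl⟩ hi, absurd ⟨.inr (.inl i), rfl⟩ hi, absurd ⟨.inl (.inr i), rfl⟩ hi, absurd ⟨.inr (.inr i), rfl⟩ hi]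

theorem ro_interchange : ro (interchange a b u v) (pair (pair x y) (pair m n)) =
    pd y * pd m := by
  rw [ro_pair]
  simp [interchange, pair, pd_eq, Finset.sum_mul_sum, lt_and_lt,
    Finset.sum_add_distrib]

theorem push_interchangeSwap : push (interchangeSwap a c u v) (pair (pair x (toDual z)) (pair (toDual m) n)) =
    pair (toDual (pair z m)) (pair x n) := by
  refine push_eq (by rintro ((i | i) | (i | i)) <;> rfl) ?_
  rintro ((i | i) | (i | i)) hi
  exacts [absurd ⟨.inl (.inr i), rfl⟩ hi, absurd ⟨.inr (.inl i), rfl⟩ hi, absurd ⟨.inl (.inl i), rfl⟩ hi, absurd ⟨.inr (.inr i), rfl⟩ hi]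

theorem ro_interchangeSwap : ro (interchangeSwap a c u v) (pair (pair x (toDual z)) (pair (toDual m) n)) =
    pd x * pd z + pd x * pd m := by
  rw [ro_pair]
  simp [interchangeSwap, pair, pd_eq, Finset.sum_mul_sum, lt_and_lt,
    Finset.sum_add_distrib]
  rfl

theorem push_interchangeDual : push (interchangeDual b c u v) (pair (pair z y) (pair (toDual m) n)) =
    pair (toDual (pair (toDual z) m)) (pair y n) := by
  refine push_eq (by rintro ((i | i) | (i | i)) <;> rfl) ?_
  rintro ((i | i) | (i | i)) hi
  exacts [absurd ⟨.inl (.inl i), rfl⟩ hi, absurd ⟨.inr (.inl i), rfl⟩ hi, absurd ⟨.inl (.inr i), rfl⟩ hi, absurd ⟨.inr (.inr i), rfl⟩ hi]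

theorem ro_interchangeDual : ro (interchangeDual b c u v) (pair (pair z y) (pair (toDual m) n)) =
    pd y * pd m := by
  rw [ro_pair]
  simp [interchangeDual, pair, pd_eq, Finset.sum_mul_sum, lt_and_lt,
    Finset.sum_add_distrib]
  rfl

theorem push_rotate : push (rotate a b u) (pair (pair x y) m) =
    pair y (pair x m) := by
  refine push_eq (by rintro ((i | i) | i) <;> rfl) ?_
  rintro (i | (i | i)) hi
  exacts [absurd ⟨.inl (.inr i), rfl⟩ hi, absurd ⟨.inl (.inl i), rfl⟩ hi, absurd ⟨.inr i, rfl⟩ hi]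

theorem ro_rotate : ro (rotate a b u) (pair (pair x y) m) =
    pd x * pd y := by
  rw [ro_pair]
  simp [rotate, pair, pd_eq, Finset.sum_mul_sum, lt_and_lt,
    Finset.sum_add_distrib]

theorem push_unrotate : push (unrotate a b u) (pair y (pair x m)) =
    pair (pair x y) m := by
  refine push_eq (by rintro (i | (i | i)) <;> rfl) ?_
  rintro ((i | i) | i) hi
  exacts [absurd ⟨.inr (.inl i), rfl⟩ hi, absurd ⟨.inl i, rfl⟩ hi, absurd ⟨.inr (.inr i), rfl⟩ hi]

theorem ro_unrotate : ro (unrotate a b u) (pair y (pair x m)) =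
    pd y * pd x := by
  rw [ro_pair]
  simp [unrotate, pair, pd_eq, Finset.sum_mul_sum, lt_and_lt,
    Finset.sum_add_distrib]

theorem push_exchange : push (exchange a b u) (pair x (pair y m)) =
    pair y (pair x m) := by
  refine push_eq (by rintro (i | (i | i)) <;> rfl) ?_
  rintro (i | (i | i)) hi
  exacts [absurd ⟨.inr (.inl i), rfl⟩ hi, absurd ⟨.inl i, rfl⟩ hi, absurd ⟨.inr (.inr i), rfl⟩ hi]

theorem ro_exchange : ro (exchange a b u) (pair x (pair y m)) =
    pd x * pd y := by
  rw [ro_pair]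
  simp [exchange, pair, pd_eq, Finset.sum_mul_sum, lt_and_lt,
    Finset.sum_add_distrib]

theorem push_assocR : push (assocR a b u) (pair (pair x y) m) =
    pair x (pair y m) := by
  refine push_eq (by rintro ((i | i) | i) <;> rfl) ?_
  rintro (i | (i | i)) hi
  exacts [absurd ⟨.inl (.inl i), rfl⟩ hi, absurd ⟨.inl (.inr i), rfl⟩ hi, absurd ⟨.inr i, rfl⟩ hi]

theorem ro_assocR : ro (assocR a b u) (pair (pair x y) m) =
    0 := by
  rw [ro_pair]
  simp [assocR, pair, pd_eq, Finset.sum_mul_sum, lt_and_lt,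
    Finset.sum_add_distrib]

theorem push_assocL : push (assocL a b u) (pair x (pair y m)) =
    pair (pair x y) m := by
  refine push_eq (by rintro (i | (i | i)) <;> rfl) ?_
  rintro ((i | i) | i) hi
  exacts [absurd ⟨.inl i, rfl⟩ hi, absurd ⟨.inr (.inl i), rfl⟩ hi, absurd ⟨.inr (.inr i), rfl⟩ hi]

theorem ro_assocL : ro (assocL a b u) (pair x (pair y m)) =
    0 := by
  rw [ro_pair]
  simp [assocL, pair, pd_eq, Finset.sum_mul_sum, lt_and_lt,
    Finset.sum_add_distrib]

theorem push_assocDual : push (assocDual a u v) (pair (toDual (pair m n)) x) =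
    pair (toDual m) (pair (toDual n) x) := by
  refine push_eq (by rintro ((i | i) | i) <;> rfl) ?_
  rintro (i | (i | i)) hi
  exacts [absurd ⟨.inl (.inl i), rfl⟩ hi, absurd ⟨.inl (.inr i), rfl⟩ hi, absurd ⟨.inr i, rfl⟩ hi]

theorem ro_assocDual : ro (assocDual a u v) (pair (toDual (pair m n)) x) =
    0 := by
  rw [ro_pair]
  simp [assocDual, pair, pd_eq, Finset.sum_mul_sum, lt_and_lt,
    Finset.sum_add_distrib]

theorem push_rotateDual : push (rotateDual a u v) (pair (toDual (pair m n)) x) =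
    pair (toDual n) (pair (toDual m) x) := by
  refine push_eq (by rintro ((i | i) | i) <;> rfl) ?_
  rintro (i | (i | i)) hi
  exacts [absurd ⟨.inl (.inr i), rfl⟩ hi, absurd ⟨.inl (.inl i), rfl⟩ hi, absurd ⟨.inr i, rfl⟩ hi]

theorem ro_rotateDual : ro (rotateDual a u v) (pair (toDual (pair m n)) x) =
    pd m * pd n := by
  rw [ro_pair]
  simp [rotateDual, pair, pd_eq, Finset.sum_mul_sum, lt_and_lt,
    Finset.sum_add_distrib]
  rfl

end reorderings

section relabelling

variable {a r r' q q' s t t' : LSet K ι} {P P' Q Q' : GrMod K ι} {k : ι}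

theorem homPiece_ext {f g : homPiece s P Q k} (h : ∀ w, nrm f.1 w = nrm g.1 w) : f = g :=
  Subtype.ext (funext fun w => nrm_injective (h w))

theorem nrm_pullHom (i : LSet.Hom s t) (f : homPiece t P Q k) :
    nrm (pullHom i f).1 = npull i (nrm f.1) := funext (nrm_pull i f.1)

theorem ro_emptyWord (i : LSet.Hom s t) : ro i (emptyWord s) = 0 := by
  simp [ro, emptyWord, pw_nil]

theorem npull_extL (α : LSet.Hom r r') (β : LSet.Hom q q') (h : Word r' → P →ₗ[K] Q) :
    npull (α.sum β) (extL q' h) = extL q (npull α h) := funext fun w => by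
  rw [← pair_fst_snd w]
  generalize fstW w = u
  generalize sndW w = v
  rw [npull, push_sum, extL_pair, extL_pair, ro_sum]
  simp only [push_emptyWord_iff]
  split_ifs with hv
  · rw [hv, ro_emptyWord, add_zero, npull]
  · exact smul_zero _

theorem npull_extR (α : LSet.Hom r r') (β : LSet.Hom q q') (h : Word q' → P →ₗ[K] Q) :
    npull (α.sum β) (extR r' h) = extR r (npull β h) := funext fun w => by
  rw [← pair_fst_snd w]
  generalize fstW w = u
  generalize sndW w = v
  rw [npull, push_sum, extR_pair, extR_pair, ro_sum]
  simp only [push_emptyWord_iff]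
  split_ifs with hv
  · rw [hv, ro_emptyWord, zero_add, npull]
  · exact smul_zero _

theorem npull_extE (i : LSet.Hom s t) (h : P →ₗ[K] Q) : npull i (extE t h) = extE s h :=
  funext fun w => by
  rw [npull]
  unfold extE
  simp only [push_emptyWord_iff]
  split_ifs with hw
  · rw [hw, ro_emptyWord, zs_zero_smul]
  · exact smul_zero _

theorem nrm_pullHom_sum (α : LSet.Hom r r') (f : homPiece (a.sum r') P Q k) (n : Word a)
    (u : Word r) : nrm (pullHom ((LSet.Hom.id a).sum α) f).1 (pair n u) =
      zs (ro α u) • nrm f.1 (pair n (push α u)) := by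
  rw [nrm_pullHom, npull, push_sum, push_id, ro_sum, ro_id, zero_add]

theorem npull_pre (α : LSet.Hom r r') (f : homPiece (a.sum r') P' P k) :
    npull α.dual (pre Q f) = pre Q (pullHom ((LSet.Hom.id a).sum α) f) := funext fun u => by
  refine GrMod.hom_ext fun d φ hφ => hv_ext fun w i p hp => ?_
  change hv (npull α.dual (pre Q f) (toDual (ofDual u)) φ) w p = hv (pre Q _ (toDual (ofDual u)) φ) w p
  generalize ofDual u = u
  rw [npull, push_dual, LinearMap.smul_apply, hv_zs_smul_apply, hv_pre _ _ hφ hp, hv_pre _ _ hφ hp,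
    ro_dual, zs_smul_cop]
  refine cop_congr fun o n _ => ?_
  rw [nrm_pullHom_sum, pd_push, LinearMap.smul_apply, map_zs_smul, zs_smul_zs_smul, zs_smul_zs_smul,
    add_comm]

theorem npull_post (β : LSet.Hom q q') (f : homPiece (a.sum q') Q Q' k) :
    npull β (post P f) = post P (pullHom ((LSet.Hom.id a).sum β) f) := funext fun u => by
  refine GrMod.hom_ext fun d φ hφ => hv_ext fun w i p hp => ?_
  rw [npull, LinearMap.smul_apply, hv_zs_smul_apply, hv_post _ _ hφ hp, hv_post _ _ hφ hp,
    zs_smul_cop]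
  refine cop_congr fun o n _ => ?_
  rw [nrm_pullHom_sum, pd_push, LinearMap.smul_apply, zs_smul_zs_smul, zs_smul_zs_smul, add_comm]

theorem npull_actL (α : LSet.Hom r r') (f : homPiece (a.dual.sum r') P P' k) :
    npull α (actL Q f) = actL Q (pullHom ((LSet.Hom.id a.dual).sum α) f) := funext fun u => by
  refine tens_hom_ext fun i j p hp g q hq => ?_
  rw [npull, LinearMap.smul_apply, actL_tm _ _ hp hq, actL_tm _ _ hp hq, zs_smul_cop]
  refine cop_congr fun o n _ => ?_
  rw [nrm_pullHom_sum, pd_push, LinearMap.smul_apply, tm_smul_left, zs_smul_zs_smul, zs_smul_zs_smul,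
    add_comm]

theorem npull_actR (β : LSet.Hom q q') (f : homPiece (a.sum q') Q Q' k) :
    npull β (actR P f) = actR P (pullHom ((LSet.Hom.id a).sum β) f) := funext fun u => by
  refine tens_hom_ext fun i j p hp g q hq => ?_
  rw [npull, LinearMap.smul_apply, actR_tm _ _ hp hq, actR_tm _ _ hp hq, zs_smul_cop]
  refine cop_congr fun o n _ => ?_
  rw [nrm_pullHom_sum, pd_push, LinearMap.smul_apply, tm_smul_right, zs_smul_zs_smul, zs_smul_zs_smul,
    add_comm]

theorem pullHom_homPre (α : LSet.Hom r r') (β : LSet.Hom q q') (f : homPiece (a.sum r') P' P k) :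
    pullHom (α.dual.sum β) (homPre q' Q f) = homPre q Q (pullHom ((LSet.Hom.id a).sum α) f) :=
  homPiece_ext fun w => by
  rw [nrm_pullHom, nrm_homPre, nrm_homPre, npull_extL, npull_pre]

theorem pullHom_homPost (α : LSet.Hom r r') (β : LSet.Hom q q') (f : homPiece (a.sum q') Q Q' k) :
    pullHom (α.dual.sum β) (homPost r' P f) = homPost r P (pullHom ((LSet.Hom.id a).sum β) f) :=
  homPiece_ext fun w => by
  rw [nrm_pullHom, nrm_homPost, nrm_homPost, npull_extR, npull_post]

theorem pullHom_tensL (α : LSet.Hom r r') (β : LSet.Hom q q')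
    (f : homPiece (a.dual.sum r') P P' k) :
    pullHom (α.sum β) (tensL q' Q f) = tensL q Q (pullHom ((LSet.Hom.id a.dual).sum α) f) :=
  homPiece_ext fun w => by
  rw [nrm_pullHom, nrm_tensL, nrm_tensL, npull_extL, npull_actL]

theorem pullHom_tensR (α : LSet.Hom r r') (β : LSet.Hom q q') (f : homPiece (a.sum q') Q Q' k) :
    pullHom (α.sum β) (tensR r' P f) = tensR r P (pullHom ((LSet.Hom.id a).sum β) f) :=
  homPiece_ext fun w => by
  rw [nrm_pullHom, nrm_tensR, nrm_tensR, npull_extR, npull_actR]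

theorem pullHom_tensD (i : LSet.Hom t t') :
    pullHom i (tensD a t' P Q) = tensD a t P Q := homPiece_ext fun w => by
  rw [nrm_pullHom, tensD_val, tensD_val, nrm_extE, nrm_extE, npull_extE]

theorem pullHom_homD (i : LSet.Hom t t') :
    pullHom i (homD a t' P Q) = homD a t P Q := homPiece_ext fun w => by
  rw [nrm_pullHom, homD_val, homD_val, nrm_extE, nrm_extE, npull_extE]

theorem pullHom_add (i : LSet.Hom s t) (f g : homPiece t P Q k) :
    pullHom i (f + g) = pullHom i f + pullHom i g :=
  Subtype.ext (funext fun _ => smul_add _ _ _)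

theorem pullHom_sub (i : LSet.Hom s t) (f g : homPiece t P Q k) :
    pullHom i (f - g) = pullHom i f - pullHom i g :=
  Subtype.ext (funext fun _ => smul_sub _ _ _)

theorem pre_add (f g : homPiece (a.sum r) P' P k) (u : Word r) :
    pre Q (f + g) (toDual u) = pre Q f (toDual u) + pre Q g (toDual u) := by
  refine GrMod.hom_ext fun d φ hφ => hv_ext fun w i p hp => ?_
  rw [LinearMap.add_apply, hv_add, LinearMap.add_apply, hv_pre _ _ hφ hp,
    hv_pre _ _ hφ hp, hv_pre _ _ hφ hp, ← cop_add]
  refine cop_congr fun o n _ => ?_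
  rw [Submodule.coe_add, nrm_add, Pi.add_apply, LinearMap.add_apply, map_add, smul_add]

theorem post_add (f g : homPiece (a.sum r) Q Q' k) (u : Word r) :
    post P (f + g) u = post P f u + post P g u := by
  refine GrMod.hom_ext fun d φ hφ => hv_ext fun w i p hp => ?_
  rw [LinearMap.add_apply, hv_add, LinearMap.add_apply, hv_post _ _ hφ hp,
    hv_post _ _ hφ hp, hv_post _ _ hφ hp, ← cop_add]
  refine cop_congr fun o n _ => ?_
  rw [Submodule.coe_add, nrm_add, Pi.add_apply, LinearMap.add_apply, smul_add]

theorem homPre_add (f g : homPiece (a.sum r) P' P k) :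
    homPre q Q (f + g) = homPre q Q f + homPre q Q g := homPiece_ext fun w => by
  rw [Submodule.coe_add, nrm_add, nrm_homPre, Pi.add_apply, nrm_homPre, nrm_homPre]
  unfold extL
  split_ifs
  exacts [pre_add f g (ofDual (fstW w)), (add_zero _).symm]

theorem homPost_add (f g : homPiece (a.sum r) Q Q' k) :
    homPost q P (f + g) = homPost q P f + homPost q P g := homPiece_ext fun w => by
  rw [Submodule.coe_add, nrm_add, nrm_homPost, Pi.add_apply, nrm_homPost, nrm_homPost]
  unfold extR
  split_ifs
  exacts [post_add f g (sndW w), (add_zero _).symm]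

theorem homPost_sub (f g : homPiece (a.sum r) Q Q' k) :
    homPost q P (f - g) = homPost q P f - homPost q P g := by
  rw [eq_sub_iff_add_eq, ← homPost_add, sub_add_cancel]

end relabelling

section internal_hom_of_tensor

variable {a b c t u v : LSet K ι} {P P' P₁ P₁' P₂ P₂' P₃ P₃' Q Q' : GrMod K ι} {k : ι}

theorem toDual_emptyWord_iff (w : Word u) : toDual w = emptyWord u.dual ↔ w = emptyWord u := Iff.rfl

theorem word_sum_dual_induction {C : Word ((u.sum v).dual.sum t) → Prop}
    (h : ∀ m n l, C (pair (toDual (pair m n)) l)) (w : Word ((u.sum v).dual.sum t)) : C w := by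
  rw [← pair_fst_snd w]
  have := h (fstW (s := u) (t := v) (ofDual (fstW w))) (sndW (s := u) (t := v) (ofDual (fstW w)))
    (sndW w)
  rwa [pair_fst_snd] at this

theorem nrm_pull_interchange_tensL (f : homPiece (c.dual.sum (a.sum u)) P P' k) (x : Word a)
    (y : Word b) (m : Word u) (n : Word v) :
    nrm (pullHom (interchange a b u v) (tensL (b.sum v) Q f)).1 (pair (pair x y) (pair m n)) =
      if y = emptyWord b ∧ n = emptyWord v then actL Q f (pair x m) else 0 := by
  rw [nrm_pullHom, npull, push_interchange, ro_interchange, nrm_tensL, extL_pair]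
  simp only [pair_emptyWord_iff]
  split_ifs with h
  · rw [h.1, pd_emptyWord, zero_mul, zs_zero_smul]
  · exact smul_zero _

theorem nrm_pull_interchange_tensR (f : homPiece (c.sum (b.sum v)) Q Q' k) (x : Word a)
    (y : Word b) (m : Word u) (n : Word v) :
    nrm (pullHom (interchange a b u v) (tensR (a.sum u) P f)).1 (pair (pair x y) (pair m n)) =
      if x = emptyWord a ∧ m = emptyWord u then actR P f (pair y n) else 0 := by
  rw [nrm_pullHom, npull, push_interchange, ro_interchange, nrm_tensR, extR_pair]
  simp only [pair_emptyWord_iff]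
  split_ifs with h
  · rw [h.2, pd_emptyWord, mul_zero, zs_zero_smul]
  · exact smul_zero _

theorem nrm_pull_interchangeSwap_homPre (f : homPiece (b.sum (c.sum v)) P' P k) (x : Word a)
    (g : Word c) (n : Word v) (l : Word t) :
    nrm (pullHom (interchangeSwap a c v t) (homPre (a.sum t) Q f)).1
        (pair (pair x (toDual g)) (pair (toDual n) l)) =
      if x = emptyWord a ∧ l = emptyWord t then pre Q f (toDual (pair g n)) else 0 := by
  rw [nrm_pullHom, npull, push_interchangeSwap, ro_interchangeSwap, nrm_homPre, extL_pair]
  simp only [pair_emptyWord_iff]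
  split_ifs with h
  · rw [h.1, pd_emptyWord, zero_mul, zero_mul, add_zero, zs_zero_smul]
  · exact smul_zero _

theorem nrm_pull_interchangeSwap_homPost (f : homPiece (b.sum (a.sum t)) Q Q' k) (x : Word a)
    (g : Word c) (n : Word v) (l : Word t) :
    nrm (pullHom (interchangeSwap a c v t) (homPost (c.sum v) P f)).1
        (pair (pair x (toDual g)) (pair (toDual n) l)) =
      if g = emptyWord c ∧ n = emptyWord v then post P f (pair x l) else 0 := by
  rw [nrm_pullHom, npull, push_interchangeSwap, ro_interchangeSwap, nrm_homPost, extR_pair]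
  simp only [toDual_emptyWord_iff, pair_emptyWord_iff]
  split_ifs with h
  · rw [h.1, h.2, pd_emptyWord, pd_emptyWord, mul_zero, add_zero, zs_zero_smul]
  · exact smul_zero _

theorem nrm_pull_interchangeDual_homPre (f : homPiece (a.sum (c.dual.sum u)) P' P k) (g : Word c)
    (y : Word b) (m : Word u) (l : Word t) :
    nrm (pullHom (interchangeDual b c u t) (homPre (b.sum t) Q f)).1
        (pair (pair g y) (pair (toDual m) l)) =
      if y = emptyWord b ∧ l = emptyWord t then pre Q f (toDual (pair (toDual g) m)) else 0 := by
  rw [nrm_pullHom, npull, push_interchangeDual, ro_interchangeDual, nrm_homPre, extL_pair]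
  simp only [pair_emptyWord_iff]
  split_ifs with h
  · rw [h.1, pd_emptyWord, zero_mul, zs_zero_smul]
  · exact smul_zero _

theorem nrm_pull_interchangeDual_homPost (f : homPiece (a.sum (b.sum t)) Q Q' k) (g : Word c)
    (y : Word b) (m : Word u) (l : Word t) :
    nrm (pullHom (interchangeDual b c u t) (homPost (c.dual.sum u) P f)).1
        (pair (pair g y) (pair (toDual m) l)) =
      if g = emptyWord c ∧ m = emptyWord u then post P f (pair y l) else 0 := by
  rw [nrm_pullHom, npull, push_interchangeDual, ro_interchangeDual, nrm_homPost, extR_pair]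
  simp only [toDual_emptyWord_iff, pair_emptyWord_iff]
  split_ifs with h
  · rw [h.2, pd_emptyWord, mul_zero, zs_zero_smul]
  · exact smul_zero _

theorem nrm_homPre_pair (f : homPiece (a.sum u) P' P k) (m : Word u) (l : Word t) :
    nrm (homPre t Q f).1 (pair (toDual m) l) =
      if l = emptyWord t then pre Q f (toDual m) else 0 := by
  rw [nrm_homPre, extL_pair]

theorem nrm_homPost_pair (f : homPiece (a.sum t) Q Q' k) (m : Word u) (l : Word t) :
    nrm (homPost u P f).1 (pair (toDual m) l) =
      if m = emptyWord u then post P f l else 0 := by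
  rw [nrm_homPost, extR_pair]
  rfl

theorem nrm_pull_assocDual_homPre (f : homPiece (a.sum u) P' P k) (m : Word u) (n : Word v)
    (l : Word t) :
    nrm (pullHom (assocDual t u v) (homPre (v.dual.sum t) Q f)).1 (pair (toDual (pair m n)) l) =
      if n = emptyWord v ∧ l = emptyWord t then pre Q f (toDual m) else 0 := by
  rw [nrm_pullHom, npull, push_assocDual, ro_assocDual, zs_zero_smul, nrm_homPre_pair]
  simp only [toDual_emptyWord_iff, pair_emptyWord_iff]

theorem nrm_pull_assocDual_homPost (f : homPiece (a.sum (v.dual.sum t)) Q Q' k) (m : Word u)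
    (n : Word v) (l : Word t) :
    nrm (pullHom (assocDual t u v) (homPost u P f)).1 (pair (toDual (pair m n)) l) =
      if m = emptyWord u then post P f (pair (toDual n) l) else 0 := by
  rw [nrm_pullHom, npull, push_assocDual, ro_assocDual, zs_zero_smul, nrm_homPost_pair]

theorem nrm_pull_rotateDual_homPre (f : homPiece (a.sum v) P' P k) (m : Word u) (n : Word v)
    (l : Word t) :
    nrm (pullHom (rotateDual t u v) (homPre (u.dual.sum t) Q f)).1 (pair (toDual (pair m n)) l) =
      if m = emptyWord u ∧ l = emptyWord t then pre Q f (toDual n) else 0 := by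
  rw [nrm_pullHom, npull, push_rotateDual, ro_rotateDual, nrm_homPre_pair]
  simp only [toDual_emptyWord_iff, pair_emptyWord_iff]
  split_ifs with h
  · rw [h.1, pd_emptyWord, zero_mul, zs_zero_smul]
  · exact smul_zero _

theorem nrm_pull_rotateDual_homPost (f : homPiece (a.sum (u.dual.sum t)) Q Q' k) (m : Word u)
    (n : Word v) (l : Word t) :
    nrm (pullHom (rotateDual t u v) (homPost v P f)).1 (pair (toDual (pair m n)) l) =
      if n = emptyWord v then post P f (pair (toDual m) l) else 0 := by
  rw [nrm_pullHom, npull, push_rotateDual, ro_rotateDual, nrm_homPost_pair]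
  split_ifs with h
  · rw [h, pd_emptyWord, mul_zero, zs_zero_smul]
  · exact smul_zero _

theorem pre_pull_interchange_tensL {f : homPiece (c.dual.sum (a.sum u)) P P' k} {m : Word u}
    {n : Word v} (hn : n ≠ emptyWord v) :
    pre P₃ (pullHom (interchange a b u v) (tensL (b.sum v) Q f)) (toDual (pair m n)) = 0 :=
  pre_eq_zero fun w => by
    rw [← pair_fst_snd w, nrm_pull_interchange_tensL, if_neg fun h => hn h.2]

theorem pre_pull_interchange_tensR {f : homPiece (c.sum (b.sum v)) Q Q' k} {m : Word u}
    {n : Word v} (hm : m ≠ emptyWord u) :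
    pre P₃ (pullHom (interchange a b u v) (tensR (a.sum u) P f)) (toDual (pair m n)) = 0 :=
  pre_eq_zero fun w => by
    rw [← pair_fst_snd w, nrm_pull_interchange_tensR, if_neg fun h => hm h.2]

theorem phi_comp_tensL (f : homPiece (c.dual.sum (a.sum u)) P₁' P₁ k)
    (w : Word ((u.sum v).dual.sum t)) :
    phi a b c P₁' P₂ P₃ ∘ₗ
        nrm (homPre t P₃ (pullHom (interchange a b u v) (tensL (b.sum v) P₂ f))).1 w =
      nrm (pullHom (assocDual t u v) (homPre (v.dual.sum t) (PHom b P₂ P₃)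
        (pullHom (rotate a c.dual u) f))).1 w ∘ₗ phi a b c P₁ P₂ P₃ := by
  induction w using word_sum_dual_induction with | h m n l => ?_
  rw [nrm_homPre_pair, nrm_pull_assocDual_homPre]
  by_cases hn : n = emptyWord v
  · by_cases hl : l = emptyWord t
    · rw [if_pos hl, if_pos ⟨hn, hl⟩]
      refine phi_pre_actL (f := f) (v := fun x => pair x m) (fun x y => ?_) (fun x g => ?_) ?_
        fun x => pd_pair _ _
      · rw [nrm_pull_interchange_tensL]
        simp only [hn, and_true]
      · rw [nrm_pullHom, npull, push_rotate, ro_rotate, pd_toDual]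
      · rw [pd_pair, hn, pd_emptyWord, add_zero]
    · rw [if_neg hl, if_neg fun h => hl h.2, LinearMap.comp_zero, LinearMap.zero_comp]
  · rw [pre_pull_interchange_tensL hn, ite_self, if_neg fun h => hn h.1, LinearMap.comp_zero,
      LinearMap.zero_comp]

theorem phi_comp_tensR (f : homPiece (c.sum (b.sum v)) P₂' P₂ k)
    (w : Word ((u.sum v).dual.sum t)) :
    phi a b c P₁ P₂' P₃ ∘ₗ
        nrm (homPre t P₃ (pullHom (interchange a b u v) (tensR (a.sum u) P₁ f))).1 w =
      nrm (pullHom (assocDual t u v) (homPost u P₁ (pullHom (interchangeSwap a c v t)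
        (homPre (a.sum t) P₃ (pullHom (exchange b c v) f))))).1 w ∘ₗ phi a b c P₁ P₂ P₃ := by
  induction w using word_sum_dual_induction with | h m n l => ?_
  rw [nrm_homPre_pair, nrm_pull_assocDual_homPost]
  by_cases hm : m = emptyWord u
  · rw [if_pos hm]
    by_cases hl : l = emptyWord t
    · rw [if_pos hl]
      refine phi_pre_actR (f := f) (f' := pullHom (exchange b c v) f) (v := fun y => pair y n)
        (v' := fun g => pair g n) (fun x y => ?_) (fun x g => ?_) (fun y g => ?_) ?_
        (fun y => ?_) fun g => ?_
      · rw [nrm_pull_interchange_tensR]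
        simp only [hm, and_true]
      · rw [nrm_pull_interchangeSwap_homPre]
        simp only [hl, and_true]
      · rw [nrm_pullHom, npull, push_exchange, ro_exchange]
      all_goals simp only [pd_pair, pd_toDual, hm, hl, pd_emptyWord, add_zero, zero_add]
    · rw [if_neg hl, post_eq_zero, LinearMap.comp_zero, LinearMap.zero_comp]
      intro w
      rw [← pair_fst_snd w]
      exact (nrm_pull_interchangeSwap_homPre _ _ (ofDual (sndW w)) _ _).trans
        (if_neg fun h => hl h.2)
  · rw [if_neg hm, pre_pull_interchange_tensR hm, ite_self, LinearMap.comp_zero,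
      LinearMap.zero_comp]

theorem phi_comp_homPost (f : homPiece ((a.sum b).sum t) P₃ P₃' k)
    (w : Word ((u.sum v).dual.sum t)) :
    phi a b c P₁ P₂ P₃' ∘ₗ nrm (homPost (u.sum v) (tens c P₁ P₂) f).1 w =
      nrm (pullHom (assocDual t u v) (homPost u P₁ (pullHom (interchangeSwap a c v t)
        (homPost (c.sum v) P₂ (pullHom (unrotate a b t) f))))).1 w ∘ₗ phi a b c P₁ P₂ P₃ := by
  induction w using word_sum_dual_induction with | h m n l => ?_
  rw [nrm_homPost_pair, nrm_pull_assocDual_homPost]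
  simp only [pair_emptyWord_iff]
  by_cases hm : m = emptyWord u
  · rw [if_pos hm]
    by_cases hn : n = emptyWord v
    · rw [if_pos ⟨hm, hn⟩]
      refine phi_post (f := f) (f' := pullHom (unrotate a b t) f) (v := fun x => pair x l)
        (fun x g => ?_) (fun x y => ?_) ?_ fun x => ?_
      · rw [nrm_pull_interchangeSwap_homPost]
        simp only [hn, and_true]
      · rw [nrm_pullHom, npull, push_unrotate, ro_unrotate, mul_comm]
      all_goals simp only [pd_pair, pd_toDual, hn, pd_emptyWord, add_zero, zero_add]
    · rw [if_neg fun h => hn h.2, post_eq_zero, LinearMap.comp_zero, LinearMap.zero_comp]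
      intro w
      rw [← pair_fst_snd w]
      exact (nrm_pull_interchangeSwap_homPost _ _ (ofDual (sndW w)) _ _).trans
        (if_neg fun h => hn h.2)
  · rw [if_neg hm, if_neg fun h => hm h.1, LinearMap.comp_zero, LinearMap.zero_comp]

theorem psi_comp_tensL (f : homPiece (c.dual.sum (a.sum u)) P₁' P₁ k)
    (w : Word ((u.sum v).dual.sum t)) :
    psi a b c P₁' P₂ P₃ ∘ₗ
        nrm (homPre t P₃ (pullHom (interchange a b u v) (tensL (b.sum v) P₂ f))).1 w =
      nrm (pullHom (rotateDual t u v) (homPost v P₂ (pullHom (interchangeDual b c u t)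
        (homPre (b.sum t) P₃ (pullHom (exchange a c.dual u) f))))).1 w ∘ₗ
        psi a b c P₁ P₂ P₃ := by
  induction w using word_sum_dual_induction with | h m n l => ?_
  rw [nrm_homPre_pair, nrm_pull_rotateDual_homPost]
  by_cases hn : n = emptyWord v
  · rw [if_pos hn]
    by_cases hl : l = emptyWord t
    · rw [if_pos hl]
      refine psi_pre_actL (f := f) (f' := pullHom (exchange a c.dual u) f)
        (v := fun x => pair x m) (v' := fun g => pair (toDual g) m) (fun x y => ?_)
        (fun g y => ?_) (fun x g => ?_) ?_ (fun x => ?_) fun g => ?_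
      · rw [nrm_pull_interchange_tensL]
        simp only [hn, and_true]
      · rw [nrm_pull_interchangeDual_homPre]
        simp only [hl, and_true]
      · rw [nrm_pullHom, npull, push_exchange, ro_exchange, pd_toDual]
      all_goals simp only [pd_pair, pd_toDual, hn, hl, pd_emptyWord, add_zero]
    · rw [if_neg hl, post_eq_zero, LinearMap.comp_zero, LinearMap.zero_comp]
      intro w
      rw [← pair_fst_snd w, nrm_pull_interchangeDual_homPre, if_neg fun h => hl h.2]
  · rw [if_neg hn, pre_pull_interchange_tensL hn, ite_self, LinearMap.comp_zero,
      LinearMap.zero_comp]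

theorem psi_comp_tensR (f : homPiece (c.sum (b.sum v)) P₂' P₂ k)
    (w : Word ((u.sum v).dual.sum t)) :
    psi a b c P₁ P₂' P₃ ∘ₗ
        nrm (homPre t P₃ (pullHom (interchange a b u v) (tensR (a.sum u) P₁ f))).1 w =
      nrm (pullHom (rotateDual t u v) (homPre (u.dual.sum t) (PHom a P₁ P₃)
        (pullHom (assocR c b v) f))).1 w ∘ₗ psi a b c P₁ P₂ P₃ := by
  induction w using word_sum_dual_induction with | h m n l => ?_
  rw [nrm_homPre_pair, nrm_pull_rotateDual_homPre]
  by_cases hm : m = emptyWord u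
  · by_cases hl : l = emptyWord t
    · rw [if_pos hl, if_pos ⟨hm, hl⟩]
      refine psi_pre_actR (f := f) (v := fun y => pair y n) (fun x y => ?_) (fun y g => ?_) ?_
        fun y => pd_pair _ _
      · rw [nrm_pull_interchange_tensR]
        simp only [hm, and_true]
      · rw [nrm_pullHom, npull, push_assocR, ro_assocR, zs_zero_smul]
      · rw [pd_pair, hm, pd_emptyWord, zero_add]
    · rw [if_neg hl, if_neg fun h => hl h.2, LinearMap.comp_zero, LinearMap.zero_comp]
  · rw [pre_pull_interchange_tensR hm, ite_self, if_neg fun h => hm h.1, LinearMap.comp_zero,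
      LinearMap.zero_comp]

theorem psi_comp_homPost (f : homPiece ((a.sum b).sum t) P₃ P₃' k)
    (w : Word ((u.sum v).dual.sum t)) :
    psi a b c P₁ P₂ P₃' ∘ₗ nrm (homPost (u.sum v) (tens c P₁ P₂) f).1 w =
      nrm (pullHom (rotateDual t u v) (homPost v P₂ (pullHom (interchangeDual b c u t)
        (homPost (c.dual.sum u) P₁ (pullHom (assocL a b t) f))))).1 w ∘ₗ psi a b c P₁ P₂ P₃ := by
  induction w using word_sum_dual_induction with | h m n l => ?_
  rw [nrm_homPost_pair, nrm_pull_rotateDual_homPost]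
  simp only [pair_emptyWord_iff]
  by_cases hn : n = emptyWord v
  · rw [if_pos hn]
    by_cases hm : m = emptyWord u
    · rw [if_pos ⟨hm, hn⟩]
      refine psi_post (f := f) (f' := pullHom (assocL a b t) f) (v := fun y => pair y l)
        (fun g y => ?_) (fun x y => ?_) ?_ fun y => ?_
      · rw [nrm_pull_interchangeDual_homPost]
        simp only [hm, and_true]
      · rw [nrm_pullHom, npull, push_assocL, ro_assocL, zs_zero_smul]
      all_goals simp only [pd_pair, pd_toDual, hm, pd_emptyWord, add_zero, zero_add]
    · rw [if_neg fun h => hm h.1, post_eq_zero, LinearMap.comp_zero, LinearMap.zero_comp]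
      intro w
      rw [← pair_fst_snd w, nrm_pull_interchangeDual_homPost, if_neg fun h => hm h.2]
  · rw [if_neg hn, if_neg fun h => hn h.2, LinearMap.comp_zero, LinearMap.zero_comp]

theorem nrm_tensD (s t : LSet K ι) (P Q : GrMod K ι) :
    nrm (tensD s t P Q).1 = extE t (dTens s P Q) := by
  rw [tensD_val, nrm_extE]

theorem nrm_homD (s t : LSet K ι) (P Q : GrMod K ι) :
    nrm (homD s t P Q).1 = extE t (dHom s P Q) := by
  rw [homD_val, nrm_extE]

theorem phi_comp_differential (w : Word ((u.sum v).dual.sum t)) :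
    phi a b c P₁ P₂ P₃ ∘ₗ
        (nrm (homPre t P₃ (tensD c ((a.sum b).sum (u.sum v)) P₁ P₂)).1 w +
          nrm (homD (a.sum b) _ (tens c P₁ P₂) P₃).1 w) =
      (nrm (pullHom (assocDual t u v) (homPost u P₁
          (homD b ((a.sum c.dual).sum (v.dual.sum t)) P₂ P₃))).1 w +
        nrm (homD (a.sum c.dual) _ P₁ (PHom b P₂ P₃)).1 w) ∘ₗ phi a b c P₁ P₂ P₃ := by
  induction w using word_sum_dual_induction with | h m n l => ?_
  rw [nrm_homPre_pair, nrm_pull_assocDual_homPost, nrm_homD, nrm_homD]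
  unfold extE
  simp only [pair_emptyWord_iff, toDual_emptyWord_iff]
  by_cases h : (m = emptyWord u ∧ n = emptyWord v) ∧ l = emptyWord t
  · obtain ⟨⟨hm, hn⟩, hl⟩ := h
    simp only [hm, hn, hl, if_true, and_self]
    refine phi_differential (fun x => ?_) (fun x => ?_) ?_ ?_
    · rw [nrm_tensD]
      unfold extE
      simp only [pair_emptyWord_iff, and_true, and_self]
    · rw [nrm_homD]
      unfold extE
      simp only [pair_emptyWord_iff, toDual_emptyWord_iff, and_true, and_self]
    all_goals simp only [pd_pair, pd_toDual, pd_emptyWord, add_zero]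
  · have h₁ : (if l = emptyWord t then
        pre P₃ (tensD c ((a.sum b).sum (u.sum v)) P₁ P₂) (toDual (pair m n)) else 0) = 0 := by
      split_ifs with hl
      · refine pre_eq_zero fun x => ?_
        rw [nrm_tensD]
        refine if_neg fun hx => h ⟨?_, hl⟩
        rw [pair_emptyWord_iff, pair_emptyWord_iff] at hx
        exact hx.2
      · rfl
    have h₂ : (if m = emptyWord u then post P₁ (homD b ((a.sum c.dual).sum (v.dual.sum t)) P₂ P₃)
        (pair (toDual n) l) else 0) = 0 := by
      split_ifs with hm
      · refine post_eq_zero fun x => ?_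
        rw [nrm_homD]
        refine if_neg fun hx => h ?_
        rw [pair_emptyWord_iff, pair_emptyWord_iff] at hx
        exact ⟨⟨hm, hx.2.1⟩, hx.2.2⟩
      · rfl
    rw [h₁, h₂, if_neg h, if_neg h, add_zero, add_zero, LinearMap.comp_zero, LinearMap.zero_comp]

theorem psi_comp_differential (w : Word ((u.sum v).dual.sum t)) :
    psi a b c P₁ P₂ P₃ ∘ₗ
        (nrm (homPre t P₃ (tensD c ((a.sum b).sum (u.sum v)) P₁ P₂)).1 w +
          nrm (homD (a.sum b) _ (tens c P₁ P₂) P₃).1 w) =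
      (nrm (pullHom (rotateDual t u v) (homPost v P₂
          (homD a ((c.sum b).sum (u.dual.sum t)) P₁ P₃))).1 w +
        nrm (homD (c.sum b) _ P₂ (PHom a P₁ P₃)).1 w) ∘ₗ psi a b c P₁ P₂ P₃ := by
  induction w using word_sum_dual_induction with | h m n l => ?_
  rw [nrm_homPre_pair, nrm_pull_rotateDual_homPost, nrm_homD, nrm_homD]
  unfold extE
  simp only [pair_emptyWord_iff, toDual_emptyWord_iff]
  by_cases h : (m = emptyWord u ∧ n = emptyWord v) ∧ l = emptyWord t
  · obtain ⟨⟨hm, hn⟩, hl⟩ := h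
    simp only [hm, hn, hl, if_true, and_self]
    refine psi_differential (fun x => ?_) (fun x => ?_) ?_ ?_
    · rw [nrm_tensD]
      unfold extE
      simp only [pair_emptyWord_iff, and_true, and_self]
    · rw [nrm_homD]
      unfold extE
      simp only [pair_emptyWord_iff, toDual_emptyWord_iff, and_true, and_self]
    all_goals simp only [pd_pair, pd_toDual, pd_emptyWord, add_zero]
  · have h₁ : (if l = emptyWord t then
        pre P₃ (tensD c ((a.sum b).sum (u.sum v)) P₁ P₂) (toDual (pair m n)) else 0) = 0 := by
      split_ifs with hl
      · refine pre_eq_zero fun x => ?_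
        rw [nrm_tensD]
        refine if_neg fun hx => h ⟨?_, hl⟩
        rw [pair_emptyWord_iff, pair_emptyWord_iff] at hx
        exact hx.2
      · rfl
    have h₂ : (if n = emptyWord v then post P₂ (homD a ((c.sum b).sum (u.dual.sum t)) P₁ P₃)
        (pair (toDual m) l) else 0) = 0 := by
      split_ifs with hn
      · refine post_eq_zero fun x => ?_
        rw [nrm_homD]
        refine if_neg fun hx => h ?_
        rw [pair_emptyWord_iff, pair_emptyWord_iff] at hx
        exact ⟨⟨hx.2.1, hn⟩, hx.2.2⟩
      · rfl
    rw [h₁, h₂, if_neg h, if_neg h, add_zero, add_zero, LinearMap.comp_zero, LinearMap.zero_comp]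

end internal_hom_of_tensor

section complements

variable {s t : LSet K ι}

/-- The inclusion of a smaller complement. -/
def LSet.Hom.inclMinus {A B : Set t.I} (h : ∀ x : (t.minus B).I, x.1 ∉ A) :
    LSet.Hom (t.minus B) (t.minus A) where
  f x := ⟨x.1, h x⟩
  inj _ _ e := Subtype.ext (Subtype.mk.inj e)
  side_eq _ := rfl
  κ_eq _ := rfl

/-- The complement of `A` contains the image of a morphism and the complement of a larger set. -/
def LSet.Hom.avoidSum (i : LSet.Hom s t) {A B : Set t.I} (h : Disjoint A (Set.range i.f))
    (hA : ∀ x : (t.minus B).I, x.1 ∉ A) (hi : ∀ x : (t.minus B).I, x.1 ∉ Set.range i.f) :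
    LSet.Hom (s.sum (t.minus B)) (t.minus A) :=
  (i.avoid A h).desc (LSet.Hom.inclMinus hA) <| by
    rw [Set.disjoint_left]
    rintro _ ⟨x, rfl⟩ ⟨y, e⟩
    exact hi y ⟨x, (congrArg Subtype.val e).symm⟩

end complements

namespace GluingCycle

variable (r : GluingCycle K ι)

/-- `q₁ ⊔ q₂` as labels of `P₁ ⊗ P₂`. -/
def free₁₂ : LSet.Hom (r.q₁.sum r.q₂) ((glue r.i₁₂ r.i₁₂').minus (Set.range r.h₁₂.f)) where
  f := Sum.elim
    (fun x => ⟨Sum.inl ⟨x.1, fun h => x.2 (Or.inl h)⟩, r.notMem_h₁₂_left x _⟩)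
    (fun x => ⟨Sum.inr ⟨x.1, fun h => x.2 (Or.inl h)⟩, r.notMem_h₁₂_right x _⟩)
  inj := by rintro (⟨x, _⟩ | ⟨x, _⟩) (⟨y, _⟩ | ⟨y, _⟩) <;> simp
  side_eq := by rintro (x | x) <;> rfl
  κ_eq := by rintro (x | x) <;> rfl

/-- `q₂* ⊔ q₃` as labels of `Hom(P₂, P₃)`. -/
def free₂₃ :
    LSet.Hom (r.q₂.dual.sum r.q₃) ((glueHom r.i₂₃ r.i₂₃').minus (Set.range r.k₂₃.f)) where
  f := Sum.elim
    (fun x => ⟨Sum.inl ⟨x.1, fun h => x.2 (Or.inr h)⟩, r.notMem_k₂₃_left x _⟩)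
    (fun x => ⟨Sum.inr ⟨x.1, fun h => x.2 (Or.inr h)⟩, r.notMem_k₂₃_right x _⟩)
  inj := by rintro (⟨x, _⟩ | ⟨x, _⟩) (⟨y, _⟩ | ⟨y, _⟩) <;> simp
  side_eq := by rintro (x | x) <;> rfl
  κ_eq := by rintro (x | x) <;> rfl

/-- `q₁* ⊔ q₃` as labels of `Hom(P₁, P₃)`. -/
def free₁₃ : LSet.Hom (r.q₁.dual.sum r.q₃)
    ((glueHom r.i₃₁'.flip r.i₃₁.flip).minus (Set.range r.l₁₃.f)) where
  f := Sum.elim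
    (fun x => ⟨Sum.inl ⟨x.1, fun h => x.2 (Or.inr h)⟩, r.notMem_l₁₃_left x _⟩)
    (fun x => ⟨Sum.inr ⟨x.1, fun h => x.2 (Or.inl h)⟩, r.notMem_l₁₃_right x _⟩)
  inj := by rintro (⟨x, _⟩ | ⟨x, _⟩) (⟨y, _⟩ | ⟨y, _⟩) <;> simp
  side_eq := by rintro (x | x) <;> rfl
  κ_eq := by rintro (x | x) <;> rfl

/-- `s₃₁* ⊔ q₁ → s₁ - s₁₂`. -/
def rest₁ : LSet.Hom (r.s₃₁.dual.sum r.q₁) (r.s₁.minus (Set.range r.i₁₂.f)) :=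
  r.i₃₁'.flip.avoidSum r.disj₁ (fun x h => x.2 (Or.inl h)) fun x h => x.2 (Or.inr h)

/-- `s₁₂* ⊔ q₁ → s₁ - s₃₁`. -/
def rest₁' : LSet.Hom (r.s₁₂.dual.sum r.q₁) (r.s₁.minus (Set.range r.i₃₁'.flip.f)) :=
  r.i₁₂.flip.avoidSum r.disj₁.symm (fun x h => x.2 (Or.inr h)) fun x h => x.2 (Or.inl h)

/-- `s₂₃ ⊔ q₂ → s₂ - s₁₂`. -/
def rest₂ : LSet.Hom (r.s₂₃.sum r.q₂) (r.s₂.minus (Set.range r.i₁₂'.f)) :=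
  r.i₂₃.avoidSum r.disj₂ (fun x h => x.2 (Or.inl h)) fun x h => x.2 (Or.inr h)

/-- `s₁₂ ⊔ q₂ → s₂ - s₂₃`. -/
def rest₂' : LSet.Hom (r.s₁₂.sum r.q₂) (r.s₂.minus (Set.range r.i₂₃.f)) :=
  r.i₁₂'.avoidSum r.disj₂.symm (fun x h => x.2 (Or.inr h)) fun x h => x.2 (Or.inl h)

/-- `s₃₁* ⊔ q₃ → s₃ - s₂₃`. -/
def rest₃ : LSet.Hom (r.s₃₁.dual.sum r.q₃) (r.s₃.minus (Set.range r.i₂₃'.f)) :=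
  r.i₃₁.flip.avoidSum r.disj₃.symm (fun x h => x.2 (Or.inr h)) fun x h => x.2 (Or.inl h)

/-- `s₂₃ ⊔ q₃ → s₃ - s₃₁`. -/
def rest₃' : LSet.Hom (r.s₂₃.sum r.q₃) (r.s₃.minus (Set.range r.i₃₁.flip.f)) :=
  r.i₂₃'.avoidSum r.disj₃ (fun x h => x.2 (Or.inl h)) fun x h => x.2 (Or.inr h)

/-- `s₁` as a disjoint union. -/
def incl₁ : LSet.Hom (r.s₁₂.dual.sum (r.s₃₁.dual.sum r.q₁)) r.s₁ :=
  (splitDual r.i₁₂).comp ((LSet.Hom.id _).sum r.rest₁)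

/-- `s₂` as a disjoint union. -/
def incl₂ : LSet.Hom (r.s₁₂.sum (r.s₂₃.sum r.q₂)) r.s₂ :=
  (split r.i₁₂').comp ((LSet.Hom.id _).sum r.rest₂)

/-- `s₃` as a disjoint union. -/
def incl₃ : LSet.Hom ((r.s₃₁.dual.sum r.s₂₃).sum r.q₃) r.s₃ :=
  (split r.h₃).comp ((LSet.Hom.id _).sum (LSet.Hom.inclMinus r.notMem_h₃))

theorem eL_eq : r.eL = r.free₁₂.dual.sum (LSet.Hom.inclMinus r.notMem_h₃) :=
  LSet.Hom.ext <| by rintro ((x | x) | x) <;> rfl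

theorem eR_eq : r.eR = ((LSet.Hom.inclMinus r.notMem_k₁).dual.sum r.free₂₃).comp
    (assocDual r.q₃ r.q₁ r.q₂) :=
  LSet.Hom.ext <| by rintro ((x | x) | x) <;> rfl

theorem eR'_eq : r.eR' = ((LSet.Hom.inclMinus r.notMem_l₂).dual.sum r.free₁₃).comp
    (rotateDual r.q₃ r.q₁ r.q₂) :=
  LSet.Hom.ext <| by rintro ((x | x) | x) <;> rfl

theorem split_h₁₂ : (split r.h₁₂).comp ((LSet.Hom.id _).sum r.free₁₂) =
    (r.rest₁.sum r.rest₂).comp (interchange r.s₃₁.dual r.s₂₃ r.q₁ r.q₂) :=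
  LSet.Hom.ext <| by rintro ((x | x) | (x | x)) <;> rfl

theorem split_k₂₃ : (split r.k₂₃).comp ((LSet.Hom.id _).sum r.free₂₃) =
    (r.rest₂'.dual.sum r.rest₃).comp (interchangeSwap r.s₃₁.dual r.s₁₂ r.q₂ r.q₃) :=
  LSet.Hom.ext <| by rintro ((x | x) | (x | x)) <;> rfl

theorem split_l₁₃ : (split r.l₁₃).comp ((LSet.Hom.id _).sum r.free₁₃) =
    (r.rest₁'.dual.sum r.rest₃').comp (interchangeDual r.s₂₃ r.s₁₂ r.q₁ r.q₃) :=
  LSet.Hom.ext <| by rintro ((x | x) | (x | x)) <;> rfl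

theorem split_k₁ :
    (split r.k₁).comp ((LSet.Hom.id _).sum (LSet.Hom.inclMinus r.notMem_k₁)) =
      r.incl₁.comp (rotate r.s₃₁.dual r.s₁₂.dual r.q₁) :=
  LSet.Hom.ext <| by rintro ((x | x) | x) <;> rfl

theorem split_i₃₁' : (split r.i₃₁'.flip).comp ((LSet.Hom.id _).sum r.rest₁') =
    r.incl₁.comp (exchange r.s₃₁.dual r.s₁₂.dual r.q₁) :=
  LSet.Hom.ext <| by rintro (x | (x | x)) <;> rfl

theorem split_i₂₃ : (split r.i₂₃).comp ((LSet.Hom.id _).sum r.rest₂') =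
    r.incl₂.comp (exchange r.s₂₃ r.s₁₂ r.q₂) :=
  LSet.Hom.ext <| by rintro (x | (x | x)) <;> rfl

theorem split_l₂ :
    (split r.l₂).comp ((LSet.Hom.id _).sum (LSet.Hom.inclMinus r.notMem_l₂)) =
      r.incl₂.comp (assocR r.s₁₂ r.s₂₃ r.q₂) :=
  LSet.Hom.ext <| by rintro ((x | x) | x) <;> rfl

theorem split_i₂₃' : (split r.i₂₃').comp ((LSet.Hom.id _).sum r.rest₃) =
    r.incl₃.comp (unrotate r.s₃₁.dual r.s₂₃ r.q₃) :=
  LSet.Hom.ext <| by rintro (x | (x | x)) <;> rfl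

theorem split_i₃₁ : (split r.i₃₁.flip).comp ((LSet.Hom.id _).sum r.rest₃') =
    r.incl₃.comp (assocL r.s₃₁.dual r.s₂₃ r.q₃) :=
  LSet.Hom.ext <| by rintro (x | (x | x)) <;> rfl

variable {P₁ P₁' P₂ P₂' P₃ P₃' : GrMod K ι} {k : ι}

theorem lhsMap₁_eq (f : homPiece r.s₁ P₁' P₁ k) : r.lhsMap₁ P₂ P₃ f =
    homPre r.q₃ P₃ (pullHom (interchange r.s₃₁.dual r.s₂₃ r.q₁ r.q₂)
      (tensL (r.s₂₃.sum r.q₂) P₂ (pullHom r.incl₁ f))) := by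
  rw [lhsMap₁, ihomPre, tensorMapL, eL_eq, pullHom_homPre, pullHom_pullHom, split_h₁₂,
    ← pullHom_pullHom, pullHom_tensL, pullHom_pullHom, incl₁]

theorem lhsMap₂_eq (f : homPiece r.s₂ P₂' P₂ k) : r.lhsMap₂ P₁ P₃ f =
    homPre r.q₃ P₃ (pullHom (interchange r.s₃₁.dual r.s₂₃ r.q₁ r.q₂)
      (tensR (r.s₃₁.dual.sum r.q₁) P₁ (pullHom r.incl₂ f))) := by
  rw [lhsMap₂, ihomPre, tensorMapR, eL_eq, pullHom_homPre, pullHom_pullHom, split_h₁₂,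
    ← pullHom_pullHom, pullHom_tensR, pullHom_pullHom, incl₂]

theorem lhsMap₃_eq (f : homPiece r.s₃ P₃ P₃' k) : r.lhsMap₃ P₁ P₂ f =
    homPost (r.q₁.sum r.q₂) (tens r.s₁₂ P₁ P₂) (pullHom r.incl₃ f) := by
  rw [lhsMap₃, ihomPost, eL_eq, pullHom_homPost, pullHom_pullHom, incl₃]

theorem rhsMap₁_eq (f : homPiece r.s₁ P₁' P₁ k) : r.rhsMap₁ P₂ P₃ f =
    pullHom (assocDual r.q₃ r.q₁ r.q₂) (homPre (r.q₂.dual.sum r.q₃) (PHom r.s₂₃ P₂ P₃)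
      (pullHom (rotate r.s₃₁.dual r.s₁₂.dual r.q₁) (pullHom r.incl₁ f))) := by
  rw [rhsMap₁, ihomPre, eR_eq, ← pullHom_pullHom, pullHom_homPre, pullHom_pullHom, split_k₁,
    ← pullHom_pullHom]

theorem rhsMap₂_eq (f : homPiece r.s₂ P₂' P₂ k) : r.rhsMap₂ P₁ P₃ f =
    pullHom (assocDual r.q₃ r.q₁ r.q₂) (homPost r.q₁ P₁
      (pullHom (interchangeSwap r.s₃₁.dual r.s₁₂ r.q₂ r.q₃) (homPre (r.s₃₁.dual.sum r.q₃) P₃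
        (pullHom (exchange r.s₂₃ r.s₁₂ r.q₂) (pullHom r.incl₂ f))))) := by
  rw [rhsMap₂, ihomPost, ihomPre, eR_eq, ← pullHom_pullHom, pullHom_homPost, pullHom_pullHom,
    split_k₂₃, ← pullHom_pullHom, pullHom_homPre, pullHom_pullHom, split_i₂₃, ← pullHom_pullHom]

theorem rhsMap₃_eq (f : homPiece r.s₃ P₃ P₃' k) : r.rhsMap₃ P₁ P₂ f =
    pullHom (assocDual r.q₃ r.q₁ r.q₂) (homPost r.q₁ P₁
      (pullHom (interchangeSwap r.s₃₁.dual r.s₁₂ r.q₂ r.q₃) (homPost (r.s₁₂.sum r.q₂) P₂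
        (pullHom (unrotate r.s₃₁.dual r.s₂₃ r.q₃) (pullHom r.incl₃ f))))) := by
  rw [rhsMap₃, ihomPost, ihomPost, eR_eq, ← pullHom_pullHom, pullHom_homPost, pullHom_pullHom,
    split_k₂₃, ← pullHom_pullHom, pullHom_homPost, pullHom_pullHom, split_i₂₃', ← pullHom_pullHom]

theorem rhsMap₁'_eq (f : homPiece r.s₁ P₁' P₁ k) : r.rhsMap₁' P₂ P₃ f =
    pullHom (rotateDual r.q₃ r.q₁ r.q₂) (homPost r.q₂ P₂
      (pullHom (interchangeDual r.s₂₃ r.s₁₂ r.q₁ r.q₃) (homPre (r.s₂₃.sum r.q₃) P₃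
        (pullHom (exchange r.s₃₁.dual r.s₁₂.dual r.q₁) (pullHom r.incl₁ f))))) := by
  rw [rhsMap₁', ihomPost, ihomPre, eR'_eq, ← pullHom_pullHom, pullHom_homPost, pullHom_pullHom,
    split_l₁₃, ← pullHom_pullHom, pullHom_homPre, pullHom_pullHom, split_i₃₁', ← pullHom_pullHom]

theorem rhsMap₂'_eq (f : homPiece r.s₂ P₂' P₂ k) : r.rhsMap₂' P₁ P₃ f =
    pullHom (rotateDual r.q₃ r.q₁ r.q₂) (homPre (r.q₁.dual.sum r.q₃) (PHom r.s₃₁.dual P₁ P₃)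
      (pullHom (assocR r.s₁₂ r.s₂₃ r.q₂) (pullHom r.incl₂ f))) := by
  rw [rhsMap₂', ihomPre, eR'_eq, ← pullHom_pullHom, pullHom_homPre, pullHom_pullHom, split_l₂,
    ← pullHom_pullHom]

theorem rhsMap₃'_eq (f : homPiece r.s₃ P₃ P₃' k) : r.rhsMap₃' P₁ P₂ f =
    pullHom (rotateDual r.q₃ r.q₁ r.q₂) (homPost r.q₂ P₂
      (pullHom (interchangeDual r.s₂₃ r.s₁₂ r.q₁ r.q₃) (homPost (r.s₁₂.dual.sum r.q₁) P₁
        (pullHom (assocL r.s₃₁.dual r.s₂₃ r.q₃) (pullHom r.incl₃ f))))) := by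
  rw [rhsMap₃', ihomPost, ihomPost, eR'_eq, ← pullHom_pullHom, pullHom_homPost, pullHom_pullHom,
    split_l₁₃, ← pullHom_pullHom, pullHom_homPost, pullHom_pullHom, split_i₃₁, ← pullHom_pullHom]

end GluingCycle

section additivity

variable {s₀ s₁ s₂ : LSet K ι} {P P' Q Q' : GrMod K ι} {k : ι}

theorem ihomPre_add (i₁ : LSet.Hom s₀ s₁) (i₂ : LSet.Hom s₀ s₂) (f g : homPiece s₁ P' P k) :
    ihomPre i₁ i₂ Q (f + g) = ihomPre i₁ i₂ Q f + ihomPre i₁ i₂ Q g := by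
  rw [ihomPre, pullHom_add, homPre_add, ihomPre, ihomPre]

theorem ihomPost_sub (i₁ : LSet.Hom s₀ s₁) (i₂ : LSet.Hom s₀ s₂) (f g : homPiece s₂ Q Q' k) :
    ihomPost i₁ i₂ P (f - g) = ihomPost i₁ i₂ P f - ihomPost i₁ i₂ P g := by
  rw [ihomPost, pullHom_sub, homPost_sub, ihomPost, ihomPost]

end additivity

section premod

variable {s t s₀ s₁ s₂ : LSet K ι} {P Q : GrMod K ι}

/-- A graded vector space with a candidate for a structure map. -/
def PreMod.of (m : homPiece s P P 1) : PreMod s := ⟨P, m.1, m.2⟩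

theorem of_self (M : PreMod s) : PreMod.of ⟨M.μ, M.μ_mem⟩ = M := rfl

theorem heq_μ_of_eq {M : PreMod s} {m : homPiece s P P 1} (h : M = .of m) : HEq M.μ m.1 := by
  subst h
  rfl

theorem pull_of (i : LSet.Hom s t) (m : homPiece t P P 1) :
    (PreMod.of m).pull i = .of (pullHom i m) := rfl

theorem tensor_of (i₁ : LSet.Hom s₀ s₁.dual) (i₂ : LSet.Hom s₀ s₂) (m : homPiece s₁ P P 1)
    (n : homPiece s₂ Q Q 1) : tensor i₁ i₂ (.of m) (.of n) =
      .of (tensorMapL i₁ i₂ Q m + tensorMapR i₁ i₂ P n + tensD s₀ (glue i₁ i₂) P Q) := rfl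

theorem ihom_of (i₁ : LSet.Hom s₀ s₁) (i₂ : LSet.Hom s₀ s₂) (m : homPiece s₁ P P 1)
    (n : homPiece s₂ Q Q 1) : ihom i₁ i₂ (.of m) (.of n) =
      .of (ihomPost i₁ i₂ P n - ihomPre i₁ i₂ Q m - homD s₀ (glueHom i₁ i₂) P Q) := rfl

end premod

namespace GluingCycle

variable (r : GluingCycle K ι)

section structure_maps

variable {P₁ P₂ P₃ : GrMod K ι} (m₁ : homPiece r.s₁ P₁ P₁ 1) (m₂ : homPiece r.s₂ P₂ P₂ 1)
  (m₃ : homPiece r.s₃ P₃ P₃ 1)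

/-- The structure map of `Hom(P₁ ⊗ P₂, P₃)`. -/
def lhsStr : homPiece r.sr (r.lhsGr P₁ P₂ P₃) (r.lhsGr P₁ P₂ P₃) 1 :=
  pullHom r.eL (ihomPost r.h₁₂ r.h₃ (tens r.s₁₂ P₁ P₂) m₃ -
    ihomPre r.h₁₂ r.h₃ P₃ (tensorMapL r.i₁₂ r.i₁₂' P₂ m₁ + tensorMapR r.i₁₂ r.i₁₂' P₁ m₂ +
      tensD r.s₁₂ (glue r.i₁₂ r.i₁₂') P₁ P₂) -
    homD (r.s₃₁.dual.sum r.s₂₃) (glueHom r.h₁₂ r.h₃) (tens r.s₁₂ P₁ P₂) P₃)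

/-- The structure map of `Hom(P₁, Hom(P₂, P₃))`. -/
def rhsStr : homPiece r.sr (r.rhsGr P₁ P₂ P₃) (r.rhsGr P₁ P₂ P₃) 1 :=
  pullHom r.eR (ihomPost r.k₁ r.k₂₃ P₁ (ihomPost r.i₂₃ r.i₂₃' P₂ m₃ - ihomPre r.i₂₃ r.i₂₃' P₃ m₂ -
      homD r.s₂₃ (glueHom r.i₂₃ r.i₂₃') P₂ P₃) -
    ihomPre r.k₁ r.k₂₃ (PHom r.s₂₃ P₂ P₃) m₁ -
    homD (r.s₃₁.dual.sum r.s₁₂.dual) (glueHom r.k₁ r.k₂₃) P₁ (PHom r.s₂₃ P₂ P₃))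

/-- The structure map of `Hom(P₂, Hom(P₁, P₃))`. -/
def rhsStr' : homPiece r.sr (r.rhsGr' P₁ P₂ P₃) (r.rhsGr' P₁ P₂ P₃) 1 :=
  pullHom r.eR' (ihomPost r.l₂ r.l₁₃ P₂ (ihomPost r.i₃₁'.flip r.i₃₁.flip P₁ m₃ -
      ihomPre r.i₃₁'.flip r.i₃₁.flip P₃ m₁ -
      homD r.s₃₁.dual (glueHom r.i₃₁'.flip r.i₃₁.flip) P₁ P₃) -
    ihomPre r.l₂ r.l₁₃ (PHom r.s₃₁.dual P₁ P₃) m₂ -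
    homD (r.s₁₂.sum r.s₂₃) (glueHom r.l₂ r.l₁₃) P₂ (PHom r.s₃₁.dual P₁ P₃))

theorem lhsStr_eq : r.lhsStr m₁ m₂ m₃ = r.lhsMap₃ P₁ P₂ m₃ -
    (r.lhsMap₁ P₂ P₃ m₁ + r.lhsMap₂ P₁ P₃ m₂ +
      homPre r.q₃ P₃ (tensD r.s₁₂ ((r.s₃₁.dual.sum r.s₂₃).sum (r.q₁.sum r.q₂)) P₁ P₂)) -
    homD (r.s₃₁.dual.sum r.s₂₃) r.sr (tens r.s₁₂ P₁ P₂) P₃ := by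
  have h : pullHom r.eL (ihomPre r.h₁₂ r.h₃ P₃ (tensD r.s₁₂ (glue r.i₁₂ r.i₁₂') P₁ P₂)) =
      homPre r.q₃ P₃ (tensD r.s₁₂ ((r.s₃₁.dual.sum r.s₂₃).sum (r.q₁.sum r.q₂)) P₁ P₂) := by
    rw [eL_eq, ihomPre, pullHom_homPre, pullHom_tensD, pullHom_tensD]
  rw [lhsStr, pullHom_sub, pullHom_sub, pullHom_homD, ihomPre_add, ihomPre_add, pullHom_add,
    pullHom_add, h, lhsMap₁, lhsMap₂, lhsMap₃]

theorem rhsStr_eq : r.rhsStr m₁ m₂ m₃ = r.rhsMap₃ P₁ P₂ m₃ - r.rhsMap₂ P₁ P₃ m₂ -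
    pullHom (assocDual r.q₃ r.q₁ r.q₂) (homPost r.q₁ P₁ (homD r.s₂₃
      ((r.s₃₁.dual.sum r.s₁₂.dual).sum (r.q₂.dual.sum r.q₃)) P₂ P₃)) - r.rhsMap₁ P₂ P₃ m₁ -
    homD (r.s₃₁.dual.sum r.s₁₂.dual) r.sr P₁ (PHom r.s₂₃ P₂ P₃) := by
  have h : pullHom r.eR (ihomPost r.k₁ r.k₂₃ P₁ (homD r.s₂₃ (glueHom r.i₂₃ r.i₂₃') P₂ P₃)) =
      pullHom (assocDual r.q₃ r.q₁ r.q₂) (homPost r.q₁ P₁ (homD r.s₂₃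
        ((r.s₃₁.dual.sum r.s₁₂.dual).sum (r.q₂.dual.sum r.q₃)) P₂ P₃)) := by
    rw [eR_eq, ← pullHom_pullHom, ihomPost, pullHom_homPost, pullHom_homD, pullHom_homD]
  rw [rhsStr, pullHom_sub, pullHom_sub, pullHom_homD, ihomPost_sub, ihomPost_sub, pullHom_sub,
    pullHom_sub, h, rhsMap₁, rhsMap₂, rhsMap₃]

theorem rhsStr'_eq : r.rhsStr' m₁ m₂ m₃ = r.rhsMap₃' P₁ P₂ m₃ - r.rhsMap₁' P₂ P₃ m₁ -
    pullHom (rotateDual r.q₃ r.q₁ r.q₂) (homPost r.q₂ P₂ (homD r.s₃₁.dual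
      ((r.s₁₂.sum r.s₂₃).sum (r.q₁.dual.sum r.q₃)) P₁ P₃)) - r.rhsMap₂' P₁ P₃ m₂ -
    homD (r.s₁₂.sum r.s₂₃) r.sr P₂ (PHom r.s₃₁.dual P₁ P₃) := by
  have h : pullHom r.eR' (ihomPost r.l₂ r.l₁₃ P₂
      (homD r.s₃₁.dual (glueHom r.i₃₁'.flip r.i₃₁.flip) P₁ P₃)) =
      pullHom (rotateDual r.q₃ r.q₁ r.q₂) (homPost r.q₂ P₂ (homD r.s₃₁.dual
        ((r.s₁₂.sum r.s₂₃).sum (r.q₁.dual.sum r.q₃)) P₁ P₃)) := by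
    rw [eR'_eq, ← pullHom_pullHom, ihomPost, pullHom_homPost, pullHom_homD, pullHom_homD]
  rw [rhsStr', pullHom_sub, pullHom_sub, pullHom_homD, ihomPost_sub, ihomPost_sub, pullHom_sub,
    pullHom_sub, h, rhsMap₁', rhsMap₂', rhsMap₃']

end structure_maps

section adjunction

variable {P₁ P₁' P₂ P₂' P₃ P₃' : GrMod K ι} {k : ι}

/-- The currying map `Hom(P₁ ⊗ P₂, P₃) → Hom(P₁, Hom(P₂, P₃))`. -/
def curryMap (P₁ P₂ P₃ : GrMod K ι) : r.lhsGr P₁ P₂ P₃ →ₗ[K] r.rhsGr P₁ P₂ P₃ :=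
  phi r.s₃₁.dual r.s₂₃ r.s₁₂ P₁ P₂ P₃

/-- The currying map `Hom(P₁ ⊗ P₂, P₃) → Hom(P₂, Hom(P₁, P₃))`. -/
def curryMap' (P₁ P₂ P₃ : GrMod K ι) : r.lhsGr P₁ P₂ P₃ →ₗ[K] r.rhsGr' P₁ P₂ P₃ :=
  psi r.s₃₁.dual r.s₂₃ r.s₁₂ P₁ P₂ P₃

theorem curryMap_mem (i : ι) : ∀ φ ∈ (r.lhsGr P₁ P₂ P₃).piece i,
    r.curryMap P₁ P₂ P₃ φ ∈ (r.rhsGr P₁ P₂ P₃).piece i := fun _ => phi_mem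

theorem curryMap'_mem (i : ι) : ∀ φ ∈ (r.lhsGr P₁ P₂ P₃).piece i,
    r.curryMap' P₁ P₂ P₃ φ ∈ (r.rhsGr' P₁ P₂ P₃).piece i := fun _ => psi_mem

theorem curryMap_lhsMap₁ (f : homPiece r.s₁ P₁' P₁ k) (w : Word r.sr) :
    r.curryMap P₁' P₂ P₃ ∘ₗ nrm (r.lhsMap₁ P₂ P₃ f).1 w =
      nrm (r.rhsMap₁ P₂ P₃ f).1 w ∘ₗ r.curryMap P₁ P₂ P₃ := by
  rw [lhsMap₁_eq, rhsMap₁_eq]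
  exact phi_comp_tensL _ w

theorem curryMap_lhsMap₂ (f : homPiece r.s₂ P₂' P₂ k) (w : Word r.sr) :
    r.curryMap P₁ P₂' P₃ ∘ₗ nrm (r.lhsMap₂ P₁ P₃ f).1 w =
      nrm (r.rhsMap₂ P₁ P₃ f).1 w ∘ₗ r.curryMap P₁ P₂ P₃ := by
  rw [lhsMap₂_eq, rhsMap₂_eq]
  exact phi_comp_tensR _ w

theorem curryMap_lhsMap₃ (f : homPiece r.s₃ P₃ P₃' k) (w : Word r.sr) :
    r.curryMap P₁ P₂ P₃' ∘ₗ nrm (r.lhsMap₃ P₁ P₂ f).1 w =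
      nrm (r.rhsMap₃ P₁ P₂ f).1 w ∘ₗ r.curryMap P₁ P₂ P₃ := by
  rw [lhsMap₃_eq, rhsMap₃_eq]
  exact phi_comp_homPost _ w

theorem curryMap'_lhsMap₁ (f : homPiece r.s₁ P₁' P₁ k) (w : Word r.sr) :
    r.curryMap' P₁' P₂ P₃ ∘ₗ nrm (r.lhsMap₁ P₂ P₃ f).1 w =
      nrm (r.rhsMap₁' P₂ P₃ f).1 w ∘ₗ r.curryMap' P₁ P₂ P₃ := by
  rw [lhsMap₁_eq, rhsMap₁'_eq]
  exact psi_comp_tensL _ w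

theorem curryMap'_lhsMap₂ (f : homPiece r.s₂ P₂' P₂ k) (w : Word r.sr) :
    r.curryMap' P₁ P₂' P₃ ∘ₗ nrm (r.lhsMap₂ P₁ P₃ f).1 w =
      nrm (r.rhsMap₂' P₁ P₃ f).1 w ∘ₗ r.curryMap' P₁ P₂ P₃ := by
  rw [lhsMap₂_eq, rhsMap₂'_eq]
  exact psi_comp_tensR _ w

theorem curryMap'_lhsMap₃ (f : homPiece r.s₃ P₃ P₃' k) (w : Word r.sr) :
    r.curryMap' P₁ P₂ P₃' ∘ₗ nrm (r.lhsMap₃ P₁ P₂ f).1 w =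
      nrm (r.rhsMap₃' P₁ P₂ f).1 w ∘ₗ r.curryMap' P₁ P₂ P₃ := by
  rw [lhsMap₃_eq, rhsMap₃'_eq]
  exact psi_comp_homPost _ w

/-- Currying, as a strict morphism. -/
def curryHom (P₁ P₂ P₃ : GrMod K ι) : homPiece r.sr (r.lhsGr P₁ P₂ P₃) (r.rhsGr P₁ P₂ P₃) 0 :=
  strictHom r.sr (r.curryMap P₁ P₂ P₃) r.curryMap_mem

/-- Currying, as a strict morphism. -/
def curryHom' (P₁ P₂ P₃ : GrMod K ι) : homPiece r.sr (r.lhsGr P₁ P₂ P₃) (r.rhsGr' P₁ P₂ P₃) 0 :=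
  strictHom r.sr (r.curryMap' P₁ P₂ P₃) r.curryMap'_mem

theorem curryHom_comp_lhsMap₁ (f : homPiece r.s₁ P₁' P₁ k) :
    comp k (r.curryHom P₁' P₂ P₃).1 (r.lhsMap₁ P₂ P₃ f).1 =
      comp 0 (r.rhsMap₁ P₂ P₃ f).1 (r.curryHom P₁ P₂ P₃).1 :=
  comp_eq_comp (r.lhsMap₁ P₂ P₃ f).2.2 r.curryMap_mem (r.curryMap_lhsMap₁ f)

theorem curryHom_comp_lhsMap₂ (f : homPiece r.s₂ P₂' P₂ k) :
    comp k (r.curryHom P₁ P₂' P₃).1 (r.lhsMap₂ P₁ P₃ f).1 =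
      comp 0 (r.rhsMap₂ P₁ P₃ f).1 (r.curryHom P₁ P₂ P₃).1 :=
  comp_eq_comp (r.lhsMap₂ P₁ P₃ f).2.2 r.curryMap_mem (r.curryMap_lhsMap₂ f)

theorem curryHom_comp_lhsMap₃ (f : homPiece r.s₃ P₃ P₃' k) :
    comp k (r.curryHom P₁ P₂ P₃').1 (r.lhsMap₃ P₁ P₂ f).1 =
      comp 0 (r.rhsMap₃ P₁ P₂ f).1 (r.curryHom P₁ P₂ P₃).1 :=
  comp_eq_comp (r.lhsMap₃ P₁ P₂ f).2.2 r.curryMap_mem (r.curryMap_lhsMap₃ f)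

theorem curryHom'_comp_lhsMap₁ (f : homPiece r.s₁ P₁' P₁ k) :
    comp k (r.curryHom' P₁' P₂ P₃).1 (r.lhsMap₁ P₂ P₃ f).1 =
      comp 0 (r.rhsMap₁' P₂ P₃ f).1 (r.curryHom' P₁ P₂ P₃).1 :=
  comp_eq_comp (r.lhsMap₁ P₂ P₃ f).2.2 r.curryMap'_mem (r.curryMap'_lhsMap₁ f)

theorem curryHom'_comp_lhsMap₂ (f : homPiece r.s₂ P₂' P₂ k) :
    comp k (r.curryHom' P₁ P₂' P₃).1 (r.lhsMap₂ P₁ P₃ f).1 =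
      comp 0 (r.rhsMap₂' P₁ P₃ f).1 (r.curryHom' P₁ P₂ P₃).1 :=
  comp_eq_comp (r.lhsMap₂ P₁ P₃ f).2.2 r.curryMap'_mem (r.curryMap'_lhsMap₂ f)

theorem curryHom'_comp_lhsMap₃ (f : homPiece r.s₃ P₃ P₃' k) :
    comp k (r.curryHom' P₁ P₂ P₃').1 (r.lhsMap₃ P₁ P₂ f).1 =
      comp 0 (r.rhsMap₃' P₁ P₂ f).1 (r.curryHom' P₁ P₂ P₃).1 :=
  comp_eq_comp (r.lhsMap₃ P₁ P₂ f).2.2 r.curryMap'_mem (r.curryMap'_lhsMap₃ f)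

end adjunction

section closed

variable {P₁ P₂ P₃ : GrMod K ι} (m₁ : homPiece r.s₁ P₁ P₁ 1) (m₂ : homPiece r.s₂ P₂ P₂ 1)
  (m₃ : homPiece r.s₃ P₃ P₃ 1)

theorem curryMap_lhsStr (w : Word r.sr) :
    r.curryMap P₁ P₂ P₃ ∘ₗ nrm (r.lhsStr m₁ m₂ m₃).1 w =
      nrm (r.rhsStr m₁ m₂ m₃).1 w ∘ₗ r.curryMap P₁ P₂ P₃ := by
  have h := phi_comp_differential (a := r.s₃₁.dual) (b := r.s₂₃) (c := r.s₁₂) (P₁ := P₁)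
    (P₂ := P₂) (P₃ := P₃) w
  change r.curryMap _ _ _ ∘ₗ _ = _ ∘ₗ r.curryMap _ _ _ at h
  rw [lhsStr_eq, rhsStr_eq]
  simp only [Submodule.coe_sub, Submodule.coe_add, nrm_sub, nrm_add, Pi.sub_apply, Pi.add_apply,
    LinearMap.comp_sub, LinearMap.sub_comp, LinearMap.comp_add, LinearMap.add_comp,
    curryMap_lhsMap₁, curryMap_lhsMap₂, curryMap_lhsMap₃] at h ⊢
  rw [sub_sub, add_assoc, h]
  abel

theorem curryMap'_lhsStr (w : Word r.sr) :
    r.curryMap' P₁ P₂ P₃ ∘ₗ nrm (r.lhsStr m₁ m₂ m₃).1 w =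
      nrm (r.rhsStr' m₁ m₂ m₃).1 w ∘ₗ r.curryMap' P₁ P₂ P₃ := by
  have h := psi_comp_differential (a := r.s₃₁.dual) (b := r.s₂₃) (c := r.s₁₂) (P₁ := P₁)
    (P₂ := P₂) (P₃ := P₃) w
  change r.curryMap' _ _ _ ∘ₗ _ = _ ∘ₗ r.curryMap' _ _ _ at h
  rw [lhsStr_eq, rhsStr'_eq]
  simp only [Submodule.coe_sub, Submodule.coe_add, nrm_sub, nrm_add, Pi.sub_apply, Pi.add_apply,
    LinearMap.comp_sub, LinearMap.sub_comp, LinearMap.comp_add, LinearMap.add_comp,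
    curryMap'_lhsMap₁, curryMap'_lhsMap₂, curryMap'_lhsMap₃] at h ⊢
  rw [sub_sub, add_assoc, h]
  abel

end closed

section free_structure_maps

variable {P₁ P₂ P₃ : GrMod K ι} (m₁ : homPiece r.s₁ P₁ P₁ 1) (m₂ : homPiece r.s₂ P₂ P₂ 1)
  (m₃ : homPiece r.s₃ P₃ P₃ 1)

theorem lhs_of : r.lhs (.of m₁) (.of m₂) (.of m₃) = .of (r.lhsStr m₁ m₂ m₃) := by
  rw [lhs, tensor₁₂, tensor_of, ihom_of, pull_of, lhsStr]

theorem rhs_of : r.rhs (.of m₁) (.of m₂) (.of m₃) = .of (r.rhsStr m₁ m₂ m₃) := by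
  rw [rhs, hom₂₃, ihom_of, ihom_of, pull_of, rhsStr]

theorem rhs'_of : r.rhs' (.of m₁) (.of m₂) (.of m₃) = .of (r.rhsStr' m₁ m₂ m₃) := by
  rw [rhs', hom₁₃, ihom_of, ihom_of, pull_of, rhsStr']


end free_structure_maps

section filtered_isomorphisms

variable (P₁ : PreMod r.s₁) (P₂ : PreMod r.s₂) (P₃ : PreMod r.s₃)

theorem lhs_μ : (r.lhs P₁ P₂ P₃).μ = (r.lhsStr ⟨P₁.μ, P₁.μ_mem⟩ ⟨P₂.μ, P₂.μ_mem⟩ ⟨P₃.μ, P₃.μ_mem⟩).1 := by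
  have h := heq_μ_of_eq (r.lhs_of ⟨P₁.μ, P₁.μ_mem⟩ ⟨P₂.μ, P₂.μ_mem⟩ ⟨P₃.μ, P₃.μ_mem⟩)
  rw [of_self, of_self, of_self] at h
  exact eq_of_heq h

theorem rhs_μ : (r.rhs P₁ P₂ P₃).μ = (r.rhsStr ⟨P₁.μ, P₁.μ_mem⟩ ⟨P₂.μ, P₂.μ_mem⟩ ⟨P₃.μ, P₃.μ_mem⟩).1 := by
  have h := heq_μ_of_eq (r.rhs_of ⟨P₁.μ, P₁.μ_mem⟩ ⟨P₂.μ, P₂.μ_mem⟩ ⟨P₃.μ, P₃.μ_mem⟩)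
  rw [of_self, of_self, of_self] at h
  exact eq_of_heq h

theorem rhs'_μ : (r.rhs' P₁ P₂ P₃).μ = (r.rhsStr' ⟨P₁.μ, P₁.μ_mem⟩ ⟨P₂.μ, P₂.μ_mem⟩ ⟨P₃.μ, P₃.μ_mem⟩).1 := by
  have h := heq_μ_of_eq (r.rhs'_of ⟨P₁.μ, P₁.μ_mem⟩ ⟨P₂.μ, P₂.μ_mem⟩ ⟨P₃.μ, P₃.μ_mem⟩)
  rw [of_self, of_self, of_self] at h
  exact eq_of_heq h

theorem isFilteredIso_curryHom :
    IsFilteredIso (M := r.lhs P₁ P₂ P₃) (N := r.rhs P₁ P₂ P₃) (r.lhsFilt P₁.toGrMod P₂.toGrMod P₃.toGrMod)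
      (r.rhsFilt P₁.toGrMod P₂.toGrMod P₃.toGrMod)
      (r.curryHom P₁.toGrMod P₂.toGrMod P₃.toGrMod) := by
  refine isFilteredIso_strictHom (M := r.lhs P₁ P₂ P₃) (N := r.rhs P₁ P₂ P₃) r.curryMap_mem
    phi_injective (fun _ _ => exists_phi_eq) (fun w => ?_) fun _ _ => phi_mem_homFilt_iff
  rw [lhs_μ, rhs_μ]
  exact r.curryMap_lhsStr _ _ _ w

theorem isFilteredIso_curryHom' :
    IsFilteredIso (M := r.lhs P₁ P₂ P₃) (N := r.rhs' P₁ P₂ P₃) (r.lhsFilt P₁.toGrMod P₂.toGrMod P₃.toGrMod)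
      (r.rhsFilt' P₁.toGrMod P₂.toGrMod P₃.toGrMod)
      (r.curryHom' P₁.toGrMod P₂.toGrMod P₃.toGrMod) := by
  refine isFilteredIso_strictHom (M := r.lhs P₁ P₂ P₃) (N := r.rhs' P₁ P₂ P₃) r.curryMap'_mem
    psi_injective (fun _ _ => exists_psi_eq) (fun w => ?_) fun _ _ => psi_mem_homFilt_iff
  rw [lhs_μ, rhs'_μ]
  exact r.curryMap'_lhsStr _ _ _ w

end filtered_isomorphisms

end GluingCycle

end

end PolyMod

theorem mainTheorem4 {K : Type u} [Field K] {ι : Type} [CommRing ι] [Module ι (Additive ℤˣ)]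
    (r : PolyMod.GluingCycle K ι) :
    -- the constructions yield lattice filtered polymodules
    (∀ (P₁ : PolyMod.Polymod r.s₁) (P₂ : PolyMod.Polymod r.s₂) (P₃ : PolyMod.Polymod r.s₃),
      PolyMod.IsPolymodule (r.tensor₁₂ P₁.toPreMod P₂.toPreMod) ∧
      PolyMod.IsPolymodule (r.hom₂₃ P₂.toPreMod P₃.toPreMod) ∧
      PolyMod.IsPolymodule (r.hom₁₃ P₁.toPreMod P₃.toPreMod) ∧
      PolyMod.IsPolymodule (r.lhs P₁.toPreMod P₂.toPreMod P₃.toPreMod) ∧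
      PolyMod.IsPolymodule (r.rhs P₁.toPreMod P₂.toPreMod P₃.toPreMod) ∧
      PolyMod.IsPolymodule (r.rhs' P₁.toPreMod P₂.toPreMod P₃.toPreMod) ∧
      PolyMod.IsLatticeFiltration (r.tensor₁₂ P₁.toPreMod P₂.toPreMod)
        (PolyMod.tensFilt r.s₁₂ P₁.toGrMod P₂.toGrMod) ∧
      PolyMod.IsLatticeFiltration (r.hom₂₃ P₂.toPreMod P₃.toPreMod)
        (PolyMod.homFilt r.s₂₃ (P := P₂.toGrMod) (Q := P₃.toGrMod) ⊤ ⊥) ∧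
      PolyMod.IsLatticeFiltration (r.hom₁₃ P₁.toPreMod P₃.toPreMod)
        (PolyMod.homFilt r.s₃₁.dual (P := P₁.toGrMod) (Q := P₃.toGrMod) ⊤ ⊥) ∧
      PolyMod.IsLatticeFiltration (r.lhs P₁.toPreMod P₂.toPreMod P₃.toPreMod)
        (r.lhsFilt P₁.toGrMod P₂.toGrMod P₃.toGrMod) ∧
      PolyMod.IsLatticeFiltration (r.rhs P₁.toPreMod P₂.toPreMod P₃.toPreMod)
        (r.rhsFilt P₁.toGrMod P₂.toGrMod P₃.toGrMod) ∧
      PolyMod.IsLatticeFiltration (r.rhs' P₁.toPreMod P₂.toPreMod P₃.toPreMod)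
        (r.rhsFilt' P₁.toGrMod P₂.toGrMod P₃.toGrMod)) ∧
    -- `Hom(P₁ ⊗ P₂, P₃) ≅ Hom(P₁, Hom(P₂, P₃))`, naturally
    (∃ Φ : ∀ (P₁ : PolyMod.Polymod r.s₁) (P₂ : PolyMod.Polymod r.s₂) (P₃ : PolyMod.Polymod r.s₃),
        PolyMod.homPiece r.sr (r.lhs P₁.toPreMod P₂.toPreMod P₃.toPreMod).toGrMod
          (r.rhs P₁.toPreMod P₂.toPreMod P₃.toPreMod).toGrMod 0,
      (∀ P₁ P₂ P₃, PolyMod.IsFilteredIso (r.lhsFilt P₁.toGrMod P₂.toGrMod P₃.toGrMod)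
        (r.rhsFilt P₁.toGrMod P₂.toGrMod P₃.toGrMod) (Φ P₁ P₂ P₃)) ∧
      (∀ P₁ P₁' P₂ P₃ (k : ι) (f : PolyMod.homPiece r.s₁ P₁'.toGrMod P₁.toGrMod k),
        PolyMod.comp k (Φ P₁' P₂ P₃).1 (r.lhsMap₁ P₂.toGrMod P₃.toGrMod f).1 =
          PolyMod.comp 0 (r.rhsMap₁ P₂.toGrMod P₃.toGrMod f).1 (Φ P₁ P₂ P₃).1) ∧
      (∀ P₁ P₂ P₂' P₃ (k : ι) (f : PolyMod.homPiece r.s₂ P₂'.toGrMod P₂.toGrMod k),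
        PolyMod.comp k (Φ P₁ P₂' P₃).1 (r.lhsMap₂ P₁.toGrMod P₃.toGrMod f).1 =
          PolyMod.comp 0 (r.rhsMap₂ P₁.toGrMod P₃.toGrMod f).1 (Φ P₁ P₂ P₃).1) ∧
      (∀ P₁ P₂ P₃ P₃' (k : ι) (f : PolyMod.homPiece r.s₃ P₃.toGrMod P₃'.toGrMod k),
        PolyMod.comp k (Φ P₁ P₂ P₃').1 (r.lhsMap₃ P₁.toGrMod P₂.toGrMod f).1 =
          PolyMod.comp 0 (r.rhsMap₃ P₁.toGrMod P₂.toGrMod f).1 (Φ P₁ P₂ P₃).1)) ∧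
    -- `Hom(P₁ ⊗ P₂, P₃) ≅ Hom(P₂, Hom(P₁, P₃))`, naturally
    (∃ Φ : ∀ (P₁ : PolyMod.Polymod r.s₁) (P₂ : PolyMod.Polymod r.s₂) (P₃ : PolyMod.Polymod r.s₃),
        PolyMod.homPiece r.sr (r.lhs P₁.toPreMod P₂.toPreMod P₃.toPreMod).toGrMod
          (r.rhs' P₁.toPreMod P₂.toPreMod P₃.toPreMod).toGrMod 0,
      (∀ P₁ P₂ P₃, PolyMod.IsFilteredIso (r.lhsFilt P₁.toGrMod P₂.toGrMod P₃.toGrMod)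
        (r.rhsFilt' P₁.toGrMod P₂.toGrMod P₃.toGrMod) (Φ P₁ P₂ P₃)) ∧
      (∀ P₁ P₁' P₂ P₃ (k : ι) (f : PolyMod.homPiece r.s₁ P₁'.toGrMod P₁.toGrMod k),
        PolyMod.comp k (Φ P₁' P₂ P₃).1 (r.lhsMap₁ P₂.toGrMod P₃.toGrMod f).1 =
          PolyMod.comp 0 (r.rhsMap₁' P₂.toGrMod P₃.toGrMod f).1 (Φ P₁ P₂ P₃).1) ∧
      (∀ P₁ P₂ P₂' P₃ (k : ι) (f : PolyMod.homPiece r.s₂ P₂'.toGrMod P₂.toGrMod k),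
        PolyMod.comp k (Φ P₁ P₂' P₃).1 (r.lhsMap₂ P₁.toGrMod P₃.toGrMod f).1 =
          PolyMod.comp 0 (r.rhsMap₂' P₁.toGrMod P₃.toGrMod f).1 (Φ P₁ P₂ P₃).1) ∧
      (∀ P₁ P₂ P₃ P₃' (k : ι) (f : PolyMod.homPiece r.s₃ P₃.toGrMod P₃'.toGrMod k),
        PolyMod.comp k (Φ P₁ P₂ P₃').1 (r.lhsMap₃ P₁.toGrMod P₂.toGrMod f).1 =
          PolyMod.comp 0 (r.rhsMap₃' P₁.toGrMod P₂.toGrMod f).1 (Φ P₁ P₂ P₃).1)) := by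
  refine ⟨fun P₁ P₂ P₃ => ?_,
    ⟨fun P₁ P₂ P₃ => r.curryHom P₁.toGrMod P₂.toGrMod P₃.toGrMod,
      fun _ _ _ => r.isFilteredIso_curryHom _ _ _, fun _ _ _ _ _ => r.curryHom_comp_lhsMap₁,
      fun _ _ _ _ _ => r.curryHom_comp_lhsMap₂, fun _ _ _ _ _ => r.curryHom_comp_lhsMap₃⟩,
    ⟨fun P₁ P₂ P₃ => r.curryHom' P₁.toGrMod P₂.toGrMod P₃.toGrMod,
      fun _ _ _ => r.isFilteredIso_curryHom' _ _ _, fun _ _ _ _ _ => r.curryHom'_comp_lhsMap₁,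
      fun _ _ _ _ _ => r.curryHom'_comp_lhsMap₂, fun _ _ _ _ _ => r.curryHom'_comp_lhsMap₃⟩⟩
  have h₁ := P₁.isPolymodule
  have h₂ := P₂.isPolymodule
  have h₃ := P₃.isPolymodule
  open PolyMod in
  exact ⟨isPolymodule_tensor₁₂ r h₁ h₂, isPolymodule_hom₂₃ r h₂ h₃, isPolymodule_hom₁₃ r h₁ h₃,
    isPolymodule_lhs r h₁ h₂ h₃, isPolymodule_rhs r h₁ h₂ h₃, isPolymodule_rhs' r h₁ h₂ h₃,
    isLatticeFiltration_tensor₁₂ r _ _, isLatticeFiltration_hom₂₃ r _ _,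
    isLatticeFiltration_hom₁₃ r _ _, isLatticeFiltration_lhs r _ _ _,
    isLatticeFiltration_rhs r _ _ _, isLatticeFiltration_rhs' r _ _ _⟩
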